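/- Let $\mathbb K$ be a field of characteristic zero. "Operad" means unital symmetric operad $\{\mathrm P(n)\}_{n\ge 0}$ in $\mathbb Z$-graded $\mathbb K$-vector spaces, and "dg operad" means such an operad with a square-zero derivation of degree $-1$. For an arity-$0$ generator $x$ of given degree, $[x]$ denotes the free operad on $x$, and $\vee$ is the coproduct of operads. **The operad $\mathrm{cL}_\infty$.** It is the free operad on generators $\ell_n$, $n\ge 0$, of arity $n$ and degree $-1$, with $\ell_n^\sigma=\ell_n$ for all $\sigma\in\mathbb S_n$, with the differential $$d\ell_n=-\sum_{p+q=n}\ \sum_{\sigma\in \mathrm{Sh}_{p,q}^{-1}}(\ell_{p+1}\circ_1\ell_q)^\sigma .$$ Let $(\mathrm{cL}_\infty\downarrow\operatorname{dg-Op})$ be the category of nonzero dg operads $\mathrm P$ (those with $\mathrm{id}\neq 0$) with a morphism $\mathrm{cL}_\infty\to\mathrm P$; the image of $\ell_k$ in $\mathrm P$ is again denoted $\ell_k$. **The category $\operatorname{Curv}^\Sigma$.** Its objects are the quadruples $(\mathrm Q,d,\kappa,\mathrm Q_0)$ with $(\mathrm Q,d)$ a dg operad, $\mathrm Q_0$ a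 sub-operad of the underlying graded operad, and $\kappa\in\mathrm Q\setminus\mathrm Q_0$ of arity $0$ and degree $-1$, such that 1. the natural morphism $\mathrm Q_0\vee[\kappa]\to\mathrm Q$ is an isomorphism; 2. for the resulting weight grading $\mathrm Q=\bigoplus_{w\ge0}\mathrm Q_w$ by the number of $\kappa$, one has $d=d_0+d_1$ with $d_i(\mathrm Q_w)\subset\mathrm Q_{w+i}$; 3. $d_1\kappa=0$. Its morphisms are the morphisms of dg operads that send $\kappa$ to $\kappa$ and $\mathrm Q_0$ into $\mathrm Q_0$. **Completed coproducts.** Let $\mathrm T$ be the dg operad freely generated by two arity-$0$ elements, $\alpha$ of degree $0$ and $\kappa$ of degree $-1$, with $d_{\mathrm T}\alpha=\kappa$ and $d_{\mathrm T}\kappa=0$. For an operad $\mathrm P$, let $(\mathrm P\vee\mathrm T)_{w,k}$ be the part of $\mathrm P\vee\mathrm T$ spanned by the expressions with $w$ occurrences of $\kappa$ and $k$ of $\alpha$. In each arity and degree put $$\mathrm P\,\hat\vee\,\mathrm T=\bigoplus_{w\ge 0}\ \prod_{k\ge0}(\mathrm P\vee\mathrm T)_{w,k},\qquad \mathrm P\,\hat\vee\,[\alpha]=\prod_{k\ge0}(\mathrm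 P\vee\mathrm T)_{0,k}.$$ If $\mathrm P$ is a dg operad, then $\mathrm P\,\hat\vee\,\mathrm T$ carries the differential $d_{\mathrm P}+d_{\mathrm T}$. **Theorem.** (a) For every object $(\mathrm Q,d,\kappa,\mathrm Q_0)$ of $\operatorname{Curv}^\Sigma$ there is a unique morphism of dg operads $\mathrm{cL}_\infty\to\mathrm Q$ with $\ell_0\mapsto\kappa$ and with $\ell_n$ sent into $\mathrm Q_0$ for all $n\ge1$. Hence $(\mathrm Q,d,\kappa,\mathrm Q_0)\mapsto(\mathrm{cL}_\infty\to\mathrm Q)$ defines a forgetful functor $$\mathcal L^\Sigma:\operatorname{Curv}^\Sigma\to(\mathrm{cL}_\infty\downarrow\operatorname{dg-Op}).$$ (b) The functor $\mathcal L^\Sigma$ has a right adjoint $\mathcal R^\Sigma$, given on objects by $$\mathrm P\ \mapsto\ \Bigl(\mathrm P\,\hat\vee\,\mathrm T,\ d_{\mathrm P}+d_{\mathrm T},\ \kappa+\sum_{k\ge0}\tfrac1{k!}\,\ell_k(\alpha,\dots,\alpha),\ \mathrm P\,\hat\vee\,[\alpha]\Bigr)$$ (in particular, these quadruples are objects of $\operatorname{Curv}^\Sigma$)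 and on morphisms by $f\mapsto f\vee 1_{\mathrm T}$. The counit $\mathcal L^\Sigma\mathcal R^\Sigma\to 1$ of the adjunction is, at $\mathrm P$, the morphism $1_{\mathrm P}\vee 0:\mathrm P\,\hat\vee\,\mathrm T\to\mathrm P$, which is the identity on $\mathrm P$ and sends $\alpha$ and $\kappa$ to $0$. -/

import Mathlib

open CategoryTheory

universe u

namespace CurvOp

/-! ### Graded symmetric operads -/

/-- A commutative monoid of degrees `D` together with the homological degree `D → ℤ`, which governs
the Koszul signs.  Besides `D = ℤ` we use `D = ℤ × ℕ` and `D = (ℤ × ℕ) × ℕ`, where the additional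
gradings are auxiliary and do not contribute to signs. -/
class HasDeg (D : Type) [AddCommMonoid D] where
  deg : D →+ ℤ

instance instHasDegInt : HasDeg ℤ := ⟨AddMonoidHom.id ℤ⟩

instance instHasDegProd {D M : Type} [AddCommMonoid D] [HasDeg D] [AddCommMonoid M] :
    HasDeg (D × M) := ⟨(HasDeg.deg (D := D)).comp (AddMonoidHom.fst D M)⟩

/-- The homological degree. -/
def deg {D : Type} [AddCommMonoid D] [HasDeg D] (g : D) : ℤ := HasDeg.deg g

theorem deg_add {D : Type} [AddCommMonoid D] [HasDeg D] (g g' : D) :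
    deg (g + g') = deg g + deg g' := map_add _ _ _

theorem deg_zero {D : Type} [AddCommMonoid D] [HasDeg D] : deg (0 : D) = 0 := map_zero _

/-- The sign `(-1)^n`, as an element of `K`. -/
def sg (K : Type u) [Field K] (n : ℤ) : K := ((n.negOnePow : ℤ) : K)

/-- The juxtaposition `e ⊕ f : {1..a+b} ≃ {1..a'+b'}` of two bijections. -/
def sumE {a b a' b' : ℕ} (e : Fin a ≃ Fin a') (f : Fin b ≃ Fin b') :
    Fin (a + b) ≃ Fin (a' + b') :=
  finSumFinEquiv.symm.trans ((Equiv.sumCongr e f).trans finSumFinEquiv)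

/-- The block permutation which exchanges the last two of three consecutive blocks
of sizes `a`, `b`, `c`. -/
def blk (a b c : ℕ) : Fin (a + b + c) ≃ Fin (a + c + b) :=
  (finSumFinEquiv.symm.trans (Equiv.sumCongr finSumFinEquiv.symm (Equiv.refl _))).trans
    (((Equiv.sumAssoc _ _ _).trans
      ((Equiv.sumCongr (Equiv.refl _) (Equiv.sumComm _ _)).trans (Equiv.sumAssoc _ _ _).symm)).trans
    ((Equiv.sumCongr finSumFinEquiv (Equiv.refl _)).trans finSumFinEquiv))

/-- A symmetric (unital) operad in `D`-graded vector spaces over `K`, in the partial-composition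
presentation.

* `obj n g` is the space of operations of arity `n` and degree `g`.
* `act` is the action of the symmetric groups, written as a functor on the groupoid with objects
  `n : ℕ` and morphisms the bijections `Fin m ≃ Fin n` (which exist only for `m = n`);
  `act e μ` is `μ` with its input labelled `x` relabelled as `e x`, i.e. `μ ^ (e⁻¹)` for
  the usual right action.
* `circ μ ν` is the partial composition which inserts `ν` into the *last* input of `μ`; the inputs of
  the result are the remaining inputs of `μ` followed by those of `ν`. The other partial
  compositions are obtained from it by means of `act`.
* `circ_act` is equivariance, `circ_assoc` and `circ_comm` are the sequential and
  parallel composition axioms (the latter with its Koszul sign), `one_circ` and `circ_one` are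
  the unit axioms.

Degrees of composites are tracked by equations, to avoid transports. -/
structure GOperad (K : Type u) [Field K] (D : Type) [AddCommMonoid D] [HasDeg D] where
  obj : ℕ → D → Type u
  [grp : ∀ n g, AddCommGroup (obj n g)]
  [mod : ∀ n g, Module K (obj n g)]
  act : ∀ {m n : ℕ} {g : D}, (Fin m ≃ Fin n) → obj m g →ₗ[K] obj n g
  one : obj 1 0
  circ : ∀ {a b : ℕ} {g g' g'' : D}, g + g' = g'' →
    obj (a + 1) g →ₗ[K] obj b g' →ₗ[K] obj (a + b) g''
  act_refl : ∀ {n : ℕ} {g : D} (x : obj n g), act (Equiv.refl _) x = x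
  act_trans : ∀ {l m n : ℕ} {g : D} (e : Fin l ≃ Fin m) (f : Fin m ≃ Fin n) (x : obj l g),
    act (e.trans f) x = act f (act e x)
  circ_act : ∀ {a a' b b' : ℕ} {g g' g'' : D} (h : g + g' = g'') (e : Fin a ≃ Fin a')
    (f : Fin b ≃ Fin b') (x : obj (a + 1) g) (y : obj b g'),
    circ h (act (sumE e (Equiv.refl (Fin 1))) x) (act f y) = act (sumE e f) (circ h x y)
  circ_assoc : ∀ {a b c : ℕ} {g₁ g₂ g₃ g₁₂ g₂₃ g : D} (h₁₂ : g₁ + g₂ = g₁₂) (h : g₁₂ + g₃ = g)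
    (h₂₃ : g₂ + g₃ = g₂₃) (h' : g₁ + g₂₃ = g)
    (x : obj (a + 1) g₁) (y : obj (b + 1) g₂) (z : obj c g₃),
    circ (a := a + b) h (circ h₁₂ x y) z =
      act (finCongr (Nat.add_assoc a b c).symm) (circ h' x (circ h₂₃ y z))
  circ_comm : ∀ {a b c : ℕ} {g₁ g₂ g₃ g₁₂ g₁₃ g : D} (h₁₂ : g₁ + g₂ = g₁₂) (h : g₁₂ + g₃ = g)
    (h₁₃ : g₁ + g₃ = g₁₃) (h' : g₁₃ + g₂ = g)
    (x : obj (a + 1 + 1) g₁) (y : obj b g₂) (z : obj c g₃),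
    circ h (act (blk a 1 b) (circ h₁₂ x y)) z =
      sg K (deg g₂ * deg g₃) •
        act (blk a c b) (circ h' (act (blk a 1 c) (circ h₁₃ (act (blk a 1 1) x) z)) y)
  one_circ : ∀ {b : ℕ} {g : D} (h : 0 + g = g) (y : obj b g),
    circ (a := 0) h one y = act (finCongr (Nat.zero_add b).symm) y
  circ_one : ∀ {a : ℕ} {g : D} (h : g + 0 = g) (x : obj (a + 1) g), circ h x one = x

attribute [instance] GOperad.grp GOperad.mod

section Basic

variable {K : Type u} [Field K] {D : Type} [AddCommMonoid D] [HasDeg D]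

/-- Morphisms of graded operads. -/
@[ext]
structure GHom (E F : GOperad K D) where
  map : ∀ {n : ℕ} {g : D}, E.obj n g →ₗ[K] F.obj n g
  map_act : ∀ {m n : ℕ} {g : D} (e : Fin m ≃ Fin n) (x : E.obj m g),
    map (E.act e x) = F.act e (map x)
  map_one : map E.one = F.one
  map_circ : ∀ {a b : ℕ} {g g' g'' : D} (h : g + g' = g'') (x : E.obj (a + 1) g) (y : E.obj b g'),
    map (E.circ h x y) = F.circ h (map x) (map y)

/-- Derivations of odd homological degree, of total degree `δ`, on a graded operad. -/
@[ext]
structure Der (E : GOperad K D) (δ : D) where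
  map : ∀ {n : ℕ} {g g' : D}, g + δ = g' → E.obj n g →ₗ[K] E.obj n g'
  map_act : ∀ {m n : ℕ} {g g' : D} (h : g + δ = g') (e : Fin m ≃ Fin n) (x : E.obj m g),
    map h (E.act e x) = E.act e (map h x)
  map_circ : ∀ {a b : ℕ} {g₁ g₂ g g₁' g₂' g' : D} (h : g₁ + g₂ = g) (h₁ : g₁ + δ = g₁')
    (h₂ : g₂ + δ = g₂') (hg : g + δ = g') (k₁ : g₁' + g₂ = g') (k₂ : g₁ + g₂' = g')
    (x : E.obj (a + 1) g₁) (y : E.obj b g₂),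
    map hg (E.circ h x y) = E.circ k₁ (map h₁ x) y + sg K (deg g₁) • E.circ k₂ x (map h₂ y)

/-- Sub-operads: families of subspaces containing the unit and stable under the symmetric group
actions and the compositions. -/
@[ext]
structure SubOperad (E : GOperad K D) where
  carrier : ∀ (n : ℕ) (g : D), Submodule K (E.obj n g)
  one_mem : E.one ∈ carrier 1 0
  act_mem : ∀ {m n : ℕ} {g : D} (e : Fin m ≃ Fin n) {x : E.obj m g},
    x ∈ carrier m g → E.act e x ∈ carrier n g
  circ_mem : ∀ {a b : ℕ} {g g' g'' : D} (h : g + g' = g'') {x : E.obj (a + 1) g} {y : E.obj b g'},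
    x ∈ carrier (a + 1) g → y ∈ carrier b g' → E.circ h x y ∈ carrier (a + b) g''

/-- A sub-operad, as an operad. -/
def SubOperad.toGOperad {E : GOperad K D} (S : SubOperad E) : GOperad K D where
  obj n g := S.carrier n g
  act e := (E.act e).restrict (fun _ hx => S.act_mem e hx)
  one := ⟨E.one, S.one_mem⟩
  circ {a b g g' g''} h := LinearMap.mk₂ K
    (fun x y => (⟨E.circ h x.1 y.1, S.circ_mem h x.2 y.2⟩ : S.carrier (a + b) g''))
    (fun x x' y => Subtype.ext (by simp)) (fun c x y => Subtype.ext (by simp))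
    (fun x y y' => Subtype.ext (by simp)) (fun c x y => Subtype.ext (by simp))
  act_refl x := Subtype.ext (E.act_refl x.1)
  act_trans e f x := Subtype.ext (E.act_trans e f x.1)
  circ_act h e f x y := Subtype.ext (E.circ_act h e f x.1 y.1)
  circ_assoc h₁₂ h h₂₃ h' x y z := Subtype.ext (E.circ_assoc h₁₂ h h₂₃ h' x.1 y.1 z.1)
  circ_comm h₁₂ h h₁₃ h' x y z := Subtype.ext (E.circ_comm h₁₂ h h₁₃ h' x.1 y.1 z.1)
  one_circ h y := Subtype.ext (E.one_circ h y.1)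
  circ_one h x := Subtype.ext (E.circ_one h x.1)

/-- The restriction of a derivation to a sub-operad which it preserves. -/
def Der.restrict {E : GOperad K D} {δ : D} (d : Der E δ) (S : SubOperad E)
    (hS : ∀ {n : ℕ} {g g' : D} (h : g + δ = g') {x : E.obj n g},
      x ∈ S.carrier n g → d.map h x ∈ S.carrier n g') : Der S.toGOperad δ where
  map h := (d.map h).restrict (fun _ hx => hS h hx)
  map_act h e x := Subtype.ext (d.map_act h e x.1)
  map_circ h h₁ h₂ hg k₁ k₂ x y := Subtype.ext (d.map_circ h h₁ h₂ hg k₁ k₂ x.1 y.1)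

/-- The sum of two derivations of the same degree. -/
def Der.add {E : GOperad K D} {δ : D} (d d' : Der E δ) : Der E δ where
  map h := d.map h + d'.map h
  map_act h e x := by simp [d.map_act, d'.map_act]
  map_circ h h₁ h₂ hg k₁ k₂ x y := by
    simp only [LinearMap.add_apply, d.map_circ h h₁ h₂ hg k₁ k₂, d'.map_circ h h₁ h₂ hg k₁ k₂,
      map_add, smul_add]
    abel

end Basic

/-! ### Operads presented by generators and relations -/

section Presentation

variable (K : Type u) [Field K] {D : Type} [AddCommMonoid D] [HasDeg D]

/-- Formal operadic expressions in the generators `G n g` (of arity `n` and degree `g`). -/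
inductive Pre (G : ℕ → D → Type u) : ℕ → D → Type u
  | gen {n : ℕ} {g : D} : G n g → Pre G n g
  | one : Pre G 1 0
  | zero {n : ℕ} {g : D} : Pre G n g
  | add {n : ℕ} {g : D} : Pre G n g → Pre G n g → Pre G n g
  | smul {n : ℕ} {g : D} : K → Pre G n g → Pre G n g
  | act {m n : ℕ} {g : D} : (Fin m ≃ Fin n) → Pre G m g → Pre G n g
  | circ {a b : ℕ} {g g' g'' : D} : g + g' = g'' → Pre G (a + 1) g → Pre G b g' → Pre G (a + b) g''

variable {K}

/-- The smallest congruence on formal operadic expressions which contains the relations `R` and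
makes the quotient an operad. -/
inductive Rel {G : ℕ → D → Type u} (R : ∀ ⦃n : ℕ⦄ ⦃g : D⦄, Pre K G n g → Pre K G n g → Prop) :
    ∀ {n : ℕ} {g : D}, Pre K G n g → Pre K G n g → Prop
  | of {n : ℕ} {g : D} {x y : Pre K G n g} : R x y → Rel R x y
  | refl {n : ℕ} {g : D} (x : Pre K G n g) : Rel R x x
  | symm {n : ℕ} {g : D} {x y : Pre K G n g} : Rel R x y → Rel R y x
  | trans {n : ℕ} {g : D} {x y z : Pre K G n g} : Rel R x y → Rel R y z → Rel R x z
  | add_congr {n : ℕ} {g : D} {x x' y y' : Pre K G n g} : Rel R x x' → Rel R y y' →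
      Rel R (x.add y) (x'.add y')
  | smul_congr {n : ℕ} {g : D} (c : K) {x x' : Pre K G n g} : Rel R x x' →
      Rel R (x.smul c) (x'.smul c)
  | act_congr {m n : ℕ} {g : D} (e : Fin m ≃ Fin n) {x x' : Pre K G m g} : Rel R x x' →
      Rel R (x.act e) (x'.act e)
  | circ_congr {a b : ℕ} {g g' g'' : D} (h : g + g' = g'') {x x' : Pre K G (a + 1) g}
      {y y' : Pre K G b g'} : Rel R x x' → Rel R y y' → Rel R (x.circ h y) (x'.circ h y')
  | add_comm {n : ℕ} {g : D} (x y : Pre K G n g) : Rel R (x.add y) (y.add x)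
  | add_assoc {n : ℕ} {g : D} (x y z : Pre K G n g) :
      Rel R ((x.add y).add z) (x.add (y.add z))
  | zero_add {n : ℕ} {g : D} (x : Pre K G n g) : Rel R (Pre.zero.add x) x
  | one_smul {n : ℕ} {g : D} (x : Pre K G n g) : Rel R (x.smul 1) x
  | zero_smul {n : ℕ} {g : D} (x : Pre K G n g) : Rel R (x.smul 0) Pre.zero
  | smul_zero {n : ℕ} {g : D} (c : K) : Rel R (Pre.smul c (Pre.zero : Pre K G n g)) Pre.zero
  | mul_smul {n : ℕ} {g : D} (c c' : K) (x : Pre K G n g) :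
      Rel R (x.smul (c * c')) ((x.smul c').smul c)
  | add_smul {n : ℕ} {g : D} (c c' : K) (x : Pre K G n g) :
      Rel R (x.smul (c + c')) ((x.smul c).add (x.smul c'))
  | smul_add {n : ℕ} {g : D} (c : K) (x y : Pre K G n g) :
      Rel R ((x.add y).smul c) ((x.smul c).add (y.smul c))
  | act_add {m n : ℕ} {g : D} (e : Fin m ≃ Fin n) (x y : Pre K G m g) :
      Rel R ((x.add y).act e) ((x.act e).add (y.act e))
  | act_smul {m n : ℕ} {g : D} (e : Fin m ≃ Fin n) (c : K) (x : Pre K G m g) :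
      Rel R ((x.smul c).act e) ((x.act e).smul c)
  | circ_add_left {a b : ℕ} {g g' g'' : D} (h : g + g' = g'') (x x' : Pre K G (a + 1) g)
      (y : Pre K G b g') : Rel R ((x.add x').circ h y) ((x.circ h y).add (x'.circ h y))
  | circ_smul_left {a b : ℕ} {g g' g'' : D} (h : g + g' = g'') (c : K) (x : Pre K G (a + 1) g)
      (y : Pre K G b g') : Rel R ((x.smul c).circ h y) ((x.circ h y).smul c)
  | circ_add_right {a b : ℕ} {g g' g'' : D} (h : g + g' = g'') (x : Pre K G (a + 1) g)
      (y y' : Pre K G b g') : Rel R (x.circ h (y.add y')) ((x.circ h y).add (x.circ h y'))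
  | circ_smul_right {a b : ℕ} {g g' g'' : D} (h : g + g' = g'') (c : K) (x : Pre K G (a + 1) g)
      (y : Pre K G b g') : Rel R (x.circ h (y.smul c)) ((x.circ h y).smul c)
  | act_refl {n : ℕ} {g : D} (x : Pre K G n g) : Rel R (x.act (Equiv.refl _)) x
  | act_trans {l m n : ℕ} {g : D} (e : Fin l ≃ Fin m) (f : Fin m ≃ Fin n) (x : Pre K G l g) :
      Rel R (x.act (e.trans f)) ((x.act e).act f)
  | circ_act {a a' b b' : ℕ} {g g' g'' : D} (h : g + g' = g'') (e : Fin a ≃ Fin a')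
      (f : Fin b ≃ Fin b') (x : Pre K G (a + 1) g) (y : Pre K G b g') :
      Rel R ((x.act (sumE e (Equiv.refl (Fin 1)))).circ h (y.act f)) ((x.circ h y).act (sumE e f))
  | circ_assoc {a b c : ℕ} {g₁ g₂ g₃ g₁₂ g₂₃ g : D} (h₁₂ : g₁ + g₂ = g₁₂) (h : g₁₂ + g₃ = g)
      (h₂₃ : g₂ + g₃ = g₂₃) (h' : g₁ + g₂₃ = g)
      (x : Pre K G (a + 1) g₁) (y : Pre K G (b + 1) g₂) (z : Pre K G c g₃) :
      Rel R (Pre.circ (a := a + b) h (Pre.circ (a := a) (b := b + 1) h₁₂ x y) z)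
        ((x.circ h' (y.circ h₂₃ z)).act (finCongr (Nat.add_assoc a b c).symm))
  | circ_comm {a b c : ℕ} {g₁ g₂ g₃ g₁₂ g₁₃ g : D} (h₁₂ : g₁ + g₂ = g₁₂) (h : g₁₂ + g₃ = g)
      (h₁₃ : g₁ + g₃ = g₁₃) (h' : g₁₃ + g₂ = g)
      (x : Pre K G (a + 1 + 1) g₁) (y : Pre K G b g₂) (z : Pre K G c g₃) :
      Rel R (((x.circ h₁₂ y).act (blk a 1 b)).circ h z)
        (((((((x.act (blk a 1 1)).circ h₁₃ z).act (blk a 1 c)).circ h' y).act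
          (blk a c b))).smul (sg K (deg g₂ * deg g₃)))
  | one_circ {b : ℕ} {g : D} (h : 0 + g = g) (y : Pre K G b g) :
      Rel R (Pre.circ (a := 0) h Pre.one y) (y.act (finCongr (Nat.zero_add b).symm))
  | circ_one {a : ℕ} {g : D} (h : g + 0 = g) (x : Pre K G (a + 1) g) :
      Rel R (x.circ h Pre.one) x

variable {G : ℕ → D → Type u} (R : ∀ ⦃n : ℕ⦄ ⦃g : D⦄, Pre K G n g → Pre K G n g → Prop)

/-- The space of expressions of arity `n` and degree `g`, modulo the relations. -/
def PresObj (n : ℕ) (g : D) : Type u := Quot (Rel R (n := n) (g := g))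

variable {R}

/-- The class of an expression. -/
def PresObj.mk {n : ℕ} {g : D} (x : Pre K G n g) : PresObj R n g := Quot.mk _ x

theorem PresObj.sound {n : ℕ} {g : D} {x y : Pre K G n g} (h : Rel R x y) :
    (PresObj.mk x : PresObj R n g) = PresObj.mk y := Quot.sound h

theorem PresObj.ind {n : ℕ} {g : D} {p : PresObj R n g → Prop} (h : ∀ x, p (PresObj.mk x))
    (x : PresObj R n g) : p x := Quot.ind h x

instance PresObj.instAdd (n : ℕ) (g : D) : Add (PresObj R n g) :=
  ⟨Quot.map₂ Pre.add (fun _ _ _ h => .add_congr (.refl _) h)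
    (fun _ _ _ h => .add_congr h (.refl _))⟩

instance PresObj.instZero (n : ℕ) (g : D) : Zero (PresObj R n g) := ⟨PresObj.mk Pre.zero⟩

instance PresObj.instNeg (n : ℕ) (g : D) : Neg (PresObj R n g) :=
  ⟨Quot.map (Pre.smul (-1)) (fun _ _ h => .smul_congr _ h)⟩

instance PresObj.instAddCommGroup (n : ℕ) (g : D) : AddCommGroup (PresObj R n g) where
  add_assoc x y z := by
    induction x using PresObj.ind; induction y using PresObj.ind; induction z using PresObj.ind
    exact PresObj.sound (.add_assoc _ _ _)
  zero_add x := by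
    induction x using PresObj.ind
    exact PresObj.sound (.zero_add _)
  add_zero x := by
    induction x using PresObj.ind
    exact PresObj.sound (.trans (.add_comm _ _) (.zero_add _))
  add_comm x y := by
    induction x using PresObj.ind; induction y using PresObj.ind
    exact PresObj.sound (.add_comm _ _)
  neg_add_cancel x := by
    induction x using PresObj.ind with | h x =>
    refine PresObj.sound (.trans (.add_congr (.refl _) (.symm (.one_smul x)))
      (.trans (.symm (.add_smul _ _ _)) ?_))
    rw [neg_add_cancel]
    exact .zero_smul _
  nsmul := nsmulRec
  zsmul := zsmulRec

instance PresObj.instModule (n : ℕ) (g : D) : Module K (PresObj R n g) where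
  smul c := Quot.map (Pre.smul c) (fun _ _ h => .smul_congr _ h)
  one_smul x := by
    induction x using PresObj.ind
    exact PresObj.sound (.one_smul _)
  mul_smul c c' x := by
    induction x using PresObj.ind
    exact PresObj.sound (.mul_smul _ _ _)
  smul_zero c := PresObj.sound (.smul_zero _)
  smul_add c x y := by
    induction x using PresObj.ind; induction y using PresObj.ind
    exact PresObj.sound (.smul_add _ _ _)
  add_smul c c' x := by
    induction x using PresObj.ind
    exact PresObj.sound (.add_smul _ _ _)
  zero_smul x := by
    induction x using PresObj.ind
    exact PresObj.sound (.zero_smul _)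

variable (R)

/-- The operad generated by `G` subject to the relations `R`. -/
def Pres : GOperad K D where
  obj n g := PresObj R n g
  act e :=
    { toFun := Quot.map (Pre.act e) (fun _ _ h => .act_congr _ h)
      map_add' := fun x y => by
        induction x using PresObj.ind; induction y using PresObj.ind
        exact PresObj.sound (.act_add _ _ _)
      map_smul' := fun c x => by
        induction x using PresObj.ind
        exact PresObj.sound (.act_smul _ _ _) }
  one := PresObj.mk Pre.one
  circ h := LinearMap.mk₂ K
    (Quot.map₂ (Pre.circ h) (fun _ _ _ k => .circ_congr _ (.refl _) k)
      (fun _ _ _ k => .circ_congr _ k (.refl _)))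
    (fun x x' y => by
      induction x using PresObj.ind; induction x' using PresObj.ind; induction y using PresObj.ind
      exact PresObj.sound (.circ_add_left _ _ _ _))
    (fun c x y => by
      induction x using PresObj.ind; induction y using PresObj.ind
      exact PresObj.sound (.circ_smul_left _ _ _ _))
    (fun x y y' => by
      induction x using PresObj.ind; induction y using PresObj.ind; induction y' using PresObj.ind
      exact PresObj.sound (.circ_add_right _ _ _ _))
    (fun c x y => by
      induction x using PresObj.ind; induction y using PresObj.ind
      exact PresObj.sound (.circ_smul_right _ _ _ _))
  act_refl x := by
    induction x using PresObj.ind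
    exact PresObj.sound (.act_refl _)
  act_trans e f x := by
    induction x using PresObj.ind
    exact PresObj.sound (.act_trans _ _ _)
  circ_act h e f x y := by
    induction x using PresObj.ind; induction y using PresObj.ind
    exact PresObj.sound (.circ_act _ _ _ _ _)
  circ_assoc h₁₂ h h₂₃ h' x y z := by
    induction x using PresObj.ind; induction y using PresObj.ind; induction z using PresObj.ind
    exact PresObj.sound (.circ_assoc _ _ h₂₃ h' _ _ _)
  circ_comm h₁₂ h h₁₃ h' x y z := by
    induction x using PresObj.ind; induction y using PresObj.ind; induction z using PresObj.ind
    exact PresObj.sound (.circ_comm _ _ h₁₃ h' _ _ _)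
  one_circ h y := by
    induction y using PresObj.ind
    exact PresObj.sound (.one_circ _ _)
  circ_one h x := by
    induction x using PresObj.ind
    exact PresObj.sound (.circ_one _ _)

/-- The class of an expression, as an element of the presented operad. -/
def Pres.mk {n : ℕ} {g : D} (x : Pre K G n g) : (Pres R).obj n g := PresObj.mk x

theorem Pres.sound {n : ℕ} {g : D} {x y : Pre K G n g} (h : Rel R x y) :
    Pres.mk R x = Pres.mk R y := PresObj.sound h

theorem Pres.ind {n : ℕ} {g : D} {p : (Pres R).obj n g → Prop} (h : ∀ x, p (Pres.mk R x))
    (x : (Pres R).obj n g) : p x := Quot.ind h x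

theorem Pres.mk_one : Pres.mk R .one = (Pres R).one := rfl

theorem Pres.mk_zero {n : ℕ} {g : D} : Pres.mk R (.zero : Pre K G n g) = 0 := rfl

theorem Pres.mk_add {n : ℕ} {g : D} (x y : Pre K G n g) :
    Pres.mk R (x.add y) = Pres.mk R x + Pres.mk R y := rfl

theorem Pres.mk_smul {n : ℕ} {g : D} (c : K) (x : Pre K G n g) :
    Pres.mk R (x.smul c) = c • Pres.mk R x := rfl

theorem Pres.mk_act {m n : ℕ} {g : D} (e : Fin m ≃ Fin n) (x : Pre K G m g) :
    Pres.mk R (x.act e) = (Pres R).act e (Pres.mk R x) := rfl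

theorem Pres.mk_circ {a b : ℕ} {g g' g'' : D} (h : g + g' = g'') (x : Pre K G (a + 1) g)
    (y : Pre K G b g') :
    Pres.mk R (x.circ h y) = (Pres R).circ h (Pres.mk R x) (Pres.mk R y) := rfl

/-- A generator, as an element of the presented operad. -/
def Pres.gen {n : ℕ} {g : D} (x : G n g) : (Pres R).obj n g := Pres.mk R (.gen x)

end Presentation

section Sign

variable (K : Type u) [Field K]

theorem sg_add (m n : ℤ) : sg K (m + n) = sg K m * sg K n := by
  simp [sg, Int.negOnePow_add]

theorem sg_mul_self (n : ℤ) : sg K n * sg K n = 1 := by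
  rw [← sg_add]
  simp [sg, Int.negOnePow_even _ (Even.add_self n)]

theorem sg_neg (n : ℤ) : sg K (-n) = sg K n := by
  simp [sg, Int.negOnePow_neg]

theorem sg_zero : sg K 0 = 1 := by simp [sg]

theorem sg_neg_one : sg K (-1) = -1 := by simp [sg, Int.negOnePow_neg]

end Sign

section Universal

variable {K : Type u} [Field K] {D D' : Type} [AddCommMonoid D] [HasDeg D] [AddCommMonoid D']
  [HasDeg D']

/-- Transport along an equality of degrees. -/
def GOperad.cast (X : GOperad K D) {n : ℕ} {g g' : D} (h : g = g') :
    X.obj n g →ₗ[K] X.obj n g' := h ▸ LinearMap.id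

theorem GOperad.cast_rfl (X : GOperad K D) {n : ℕ} {g : D} (h : g = g) (x : X.obj n g) :
    X.cast h x = x := rfl

theorem GOperad.cast_one_circ (X : GOperad K D) {b : ℕ} {z g : D} (h : 0 = z) (k : z + g = g)
    (y : X.obj b g) : X.circ (a := 0) k (X.cast h X.one) y =
      X.act (finCongr (Nat.zero_add b).symm) y := by
  subst h; exact X.one_circ k y

theorem GOperad.circ_cast_one (X : GOperad K D) {a : ℕ} {z g : D} (h : 0 = z) (k : g + z = g)
    (x : X.obj (a + 1) g) : X.circ k x (X.cast h X.one) = x := by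
  subst h; exact X.circ_one k x

theorem GOperad.cast_act (X : GOperad K D) {m n : ℕ} {g g' : D} (h : g = g') (e : Fin m ≃ Fin n)
    (x : X.obj m g) : X.cast h (X.act e x) = X.act e (X.cast h x) := by
  subst h; rfl

theorem GOperad.cast_circ (X : GOperad K D) {a b : ℕ} {g₁ g₂ g g₁' g₂' g' : D} (h₁ : g₁ = g₁')
    (h₂ : g₂ = g₂') (hg : g = g') (h : g₁ + g₂ = g) (h' : g₁' + g₂' = g')
    (x : X.obj (a + 1) g₁) (y : X.obj b g₂) :
    X.cast hg (X.circ h x y) = X.circ h' (X.cast h₁ x) (X.cast h₂ y) := by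
  subst h₁ h₂ hg; rfl

theorem Der.map_one {E : GOperad K D} {δ : D} (d : Der E δ) {g' : D} (h : 0 + δ = g') :
    d.map h E.one = 0 := by
  have k := d.map_circ (a := 0) (b := 1) (g₁ := 0) (g₂ := 0) (g := 0) (add_zero 0) h h h
    (add_zero _) (zero_add _) E.one E.one
  rw [deg_zero, sg_zero, one_smul, E.circ_one (a := 0)] at k
  have e₁ : E.circ (a := 0) (b := 1) (add_zero g') (d.map h E.one) E.one = d.map h E.one :=
    E.circ_one _ _
  have e₂ : E.circ (a := 0) (b := 1) (zero_add g') E.one (d.map h E.one) = d.map h E.one := by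
    rw [E.one_circ]
    exact E.act_refl _
  rw [e₁, e₂] at k
  simpa using k

variable {G : ℕ → D → Type u}

section Lift

variable (X : GOperad K D') (φ : D →+ D') (v : ∀ ⦃n : ℕ⦄ ⦃g : D⦄, G n g → X.obj n (φ g))

/-- The value of a formal expression in an operad, given values of the generators. -/
def evalPre : ∀ {n : ℕ} {g : D}, Pre K G n g → X.obj n (φ g)
  | _, _, .gen x => v x
  | _, _, .one => X.cast (map_zero φ).symm X.one
  | _, _, .zero => 0
  | _, _, .add x y => evalPre x + evalPre y
  | _, _, .smul c x => c • evalPre x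
  | _, _, .act e x => X.act e (evalPre x)
  | _, _, .circ h x y => X.circ (by rw [← h, map_add]) (evalPre x) (evalPre y)

variable {R : ∀ ⦃n : ℕ⦄ ⦃g : D⦄, Pre K G n g → Pre K G n g → Prop}
  (hφ : ∀ g, deg (φ g) = deg g)
  (hR : ∀ {n : ℕ} {g : D} {x y : Pre K G n g}, R x y → evalPre X φ v x = evalPre X φ v y)

theorem evalPre_rel (hφ : ∀ g, deg (φ g) = deg g)
    (hR : ∀ {n : ℕ} {g : D} {x y : Pre K G n g}, R x y → evalPre X φ v x = evalPre X φ v y)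
    {n : ℕ} {g : D} {x y : Pre K G n g} (h : Rel R x y) :
    evalPre X φ v x = evalPre X φ v y := by
  induction h with
  | of h => exact hR h
  | refl => rfl
  | symm _ ih => exact ih.symm
  | trans _ _ ih ih' => exact ih.trans ih'
  | add_congr _ _ ih ih' => simp only [evalPre, ih, ih']
  | smul_congr _ _ ih => simp only [evalPre, ih]
  | act_congr _ _ ih => simp only [evalPre, ih]
  | circ_congr _ _ _ ih ih' => simp only [evalPre, ih, ih']
  | add_comm => exact add_comm _ _
  | add_assoc => exact add_assoc _ _ _
  | zero_add => exact zero_add _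
  | one_smul => exact one_smul _ _
  | zero_smul => exact zero_smul _ _
  | smul_zero => exact smul_zero _
  | mul_smul => exact mul_smul _ _ _
  | add_smul => exact add_smul _ _ _
  | smul_add => exact smul_add _ _ _
  | act_add => simp only [evalPre, map_add]
  | act_smul => simp only [evalPre, map_smul]
  | circ_add_left => simp only [evalPre, map_add, LinearMap.add_apply]
  | circ_smul_left => simp only [evalPre, map_smul, LinearMap.smul_apply]
  | circ_add_right => simp only [evalPre, map_add]
  | circ_smul_right => simp only [evalPre, map_smul]
  | act_refl => exact X.act_refl _
  | act_trans => exact X.act_trans _ _ _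
  | circ_act => exact X.circ_act _ _ _ _ _
  | circ_assoc h₁₂ h h₂₃ h' => exact X.circ_assoc _ _ _ _ _ _ _
  | circ_comm h₁₂ h h₁₃ h' x y z =>
    simp only [evalPre, ← hφ]
    exact X.circ_comm _ _ _ _ _ _ _
  | one_circ => exact X.cast_one_circ _ _ _
  | circ_one => exact X.circ_cast_one _ _ _

/-- The morphism (along a map of degrees `φ`) out of a presented operad which is determined by
values of the generators that satisfy the relations. -/
def Pres.lift (hφ : ∀ g, deg (φ g) = deg g)
    (hR : ∀ {n : ℕ} {g : D} {x y : Pre K G n g}, R x y → evalPre X φ v x = evalPre X φ v y)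
    {n : ℕ} {g : D} : (Pres R).obj n g →ₗ[K] X.obj n (φ g) where
  toFun := Quot.lift (evalPre X φ v) (fun _ _ h => evalPre_rel X φ v hφ hR h)
  map_add' x y := by
    induction x using Pres.ind; induction y using Pres.ind
    rfl
  map_smul' c x := by
    induction x using Pres.ind
    rfl

theorem Pres.lift_mk {n : ℕ} {g : D} (x : Pre K G n g) :
    Pres.lift X φ v hφ hR (Pres.mk R x) = evalPre X φ v x := rfl

theorem Pres.lift_gen {n : ℕ} {g : D} (x : G n g) :
    Pres.lift X φ v hφ hR (Pres.gen R x) = v x := rfl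

theorem Pres.lift_act {m n : ℕ} {g : D} (e : Fin m ≃ Fin n) (x : (Pres R).obj m g) :
    Pres.lift X φ v hφ hR ((Pres R).act e x) = X.act e (Pres.lift X φ v hφ hR x) := by
  induction x using Pres.ind
  rfl

theorem Pres.lift_circ {a b : ℕ} {g g' g'' : D} (h : g + g' = g'') (k : φ g + φ g' = φ g'')
    (x : (Pres R).obj (a + 1) g) (y : (Pres R).obj b g') :
    Pres.lift X φ v hφ hR ((Pres R).circ h x y) =
      X.circ k (Pres.lift X φ v hφ hR x) (Pres.lift X φ v hφ hR y) := by
  induction x using Pres.ind; induction y using Pres.ind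
  rfl

theorem Pres.lift_one :
    Pres.lift X φ v hφ hR (Pres R).one = X.cast (map_zero φ).symm X.one := rfl

end Lift

/-- Induction principle for presented operads. -/
theorem Pres.induction {R : ∀ ⦃n : ℕ⦄ ⦃g : D⦄, Pre K G n g → Pre K G n g → Prop}
    {p : ∀ {n : ℕ} {g : D}, (Pres R).obj n g → Prop}
    (gen : ∀ {n : ℕ} {g : D} (x : G n g), p (Pres.gen R x)) (one : p (Pres R).one)
    (zero : ∀ {n : ℕ} {g : D}, p (0 : (Pres R).obj n g))
    (add : ∀ {n : ℕ} {g : D} (x y : (Pres R).obj n g), p x → p y → p (x + y))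
    (smul : ∀ {n : ℕ} {g : D} (c : K) (x : (Pres R).obj n g), p x → p (c • x))
    (act : ∀ {m n : ℕ} {g : D} (e : Fin m ≃ Fin n) (x : (Pres R).obj m g), p x →
      p ((Pres R).act e x))
    (circ : ∀ {a b : ℕ} {g g' g'' : D} (h : g + g' = g'') (x : (Pres R).obj (a + 1) g)
      (y : (Pres R).obj b g'), p x → p y → p ((Pres R).circ h x y))
    {n : ℕ} {g : D} (x : (Pres R).obj n g) : p x := by
  induction x using Pres.ind with | h x =>
  induction x with
  | gen x => exact gen x
  | one => exact one
  | zero => exact zero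
  | add x y ihx ihy => exact add _ _ ihx ihy
  | smul c x ih => exact smul c _ ih
  | act e x ih => exact act e _ ih
  | circ h x y ihx ihy => exact circ h _ _ ihx ihy

section LiftDer

variable (R : ∀ ⦃n : ℕ⦄ ⦃g : D⦄, Pre K G n g → Pre K G n g → Prop) (δ : D)
  (v : ∀ ⦃n : ℕ⦄ ⦃g g' : D⦄, g + δ = g' → G n g → (Pres R).obj n g')

/-- The Leibniz rule on formal expressions. -/
def derPre : ∀ {n : ℕ} {g g' : D}, g + δ = g' → Pre K G n g → (Pres R).obj n g'
  | _, _, _, h, .gen x => v h x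
  | _, _, _, _, .one => 0
  | _, _, _, _, .zero => 0
  | _, _, _, h, .add x y => derPre h x + derPre h y
  | _, _, _, h, .smul c x => c • derPre h x
  | _, _, _, h, .act e x => (Pres R).act e (derPre h x)
  | _, _, _, h, .circ (g := g) k x y =>
    (Pres R).circ (by rw [← h, ← k]; abel) (derPre rfl x) (Pres.mk R y) +
      sg K (deg g) • (Pres R).circ (by rw [← h, ← k]; abel) (Pres.mk R x) (derPre rfl y)

variable {R δ}

theorem derPre_rel (hδ : deg δ = -1)
    (hR : ∀ {n : ℕ} {g g' : D} (h : g + δ = g') {x y : Pre K G n g}, R x y →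
      derPre R δ v h x = derPre R δ v h y)
    {n : ℕ} {g g' : D} (h : g + δ = g') {x y : Pre K G n g} (r : Rel R x y) :
    derPre R δ v h x = derPre R δ v h y := by
  induction r generalizing g' with
  | of r => exact hR h r
  | refl => rfl
  | symm _ ih => exact (ih h).symm
  | trans _ _ ih ih' => exact (ih h).trans (ih' h)
  | add_congr _ _ ih ih' => simp only [derPre, ih, ih']
  | smul_congr _ _ ih => simp only [derPre, ih]
  | act_congr _ _ ih => simp only [derPre, ih]
  | circ_congr _ r r' ih ih' =>
    simp only [derPre, ih, ih', Pres.sound R r, Pres.sound R r']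
  | add_comm => exact add_comm _ _
  | add_assoc => exact add_assoc _ _ _
  | zero_add => exact zero_add _
  | one_smul => exact one_smul _ _
  | zero_smul => exact zero_smul _ _
  | smul_zero => exact smul_zero _
  | mul_smul => exact mul_smul _ _ _
  | add_smul => exact add_smul _ _ _
  | smul_add => exact smul_add _ _ _
  | act_add => simp only [derPre, map_add]
  | act_smul => simp only [derPre, map_smul]
  | circ_add_left _ x x' y =>
    simp only [derPre, Pres.mk_add, map_add, LinearMap.add_apply, smul_add]
    abel
  | circ_smul_left _ c x y =>
    simp only [derPre, Pres.mk_smul, map_smul, LinearMap.smul_apply, smul_add]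
    rw [smul_comm c]
  | circ_add_right _ x y y' =>
    simp only [derPre, Pres.mk_add, map_add, smul_add]
    abel
  | circ_smul_right _ c x y =>
    simp only [derPre, Pres.mk_smul, map_smul, smul_add]
    rw [smul_comm c]
  | act_refl => exact (Pres R).act_refl _
  | act_trans => exact (Pres R).act_trans _ _ _
  | circ_act k e f x y =>
    simp only [derPre, Pres.mk_act, map_add, map_smul, (Pres R).circ_act]
  | circ_assoc h₁₂ k h₂₃ k' x y z =>
    subst h₁₂ k h₂₃ h
    simp only [derPre, Pres.mk_circ, map_add, map_smul, LinearMap.add_apply, LinearMap.smul_apply,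
      deg_add, sg_add, smul_add, smul_smul, ← add_assoc]
    congr 1
    · congr 1
      · exact (Pres R).circ_assoc _ _ _ _ _ _ _
      · congr 1
        exact (Pres R).circ_assoc _ _ _ _ _ _ _
    · congr 1
      exact (Pres R).circ_assoc _ _ _ _ _ _ _
  | circ_comm h₁₂ k h₁₃ k' x y z =>
    rename_i g₁ g₂ g₃ _ _ _
    subst h₁₂ k h₁₃ h
    have d₂ : sg K (deg (g₂ + δ) * deg g₃) = sg K (deg g₂ * deg g₃) * sg K (deg g₃) := by
      rw [deg_add, hδ, add_mul, sg_add, neg_one_mul, sg_neg]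
    have d₃ : sg K (deg g₂ * deg (g₃ + δ)) = sg K (deg g₂ * deg g₃) * sg K (deg g₂) := by
      rw [deg_add, hδ, mul_add, sg_add, mul_neg_one, sg_neg]
    simp only [derPre, Pres.mk_circ, Pres.mk_act, map_add, map_smul, LinearMap.add_apply,
      LinearMap.smul_apply, deg_add, sg_add, smul_add, smul_smul]
    refine (add_right_comm _ _ _).trans ?_
    congr 1
    · congr 1
      · exact (Pres R).circ_comm _ _ _ _ _ _ _
      · rw [(Pres R).circ_comm (g₁₃ := g₁ + g₃ + δ) rfl _ (by abel) (by abel), smul_smul, d₃]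
        congr 1
        linear_combination (sg K (deg g₁) * sg K (deg g₂ * deg g₃)) * sg_mul_self K (deg g₂)
    · rw [(Pres R).circ_comm _ _ rfl (by abel), smul_smul, d₂]
      congr 1
      ring
  | one_circ k y =>
    simp only [derPre, map_zero, LinearMap.zero_apply, zero_add, Pres.mk_one, deg_zero, sg_zero,
      one_smul]
    subst h
    exact (Pres R).cast_one_circ rfl _ _
  | circ_one k x =>
    simp only [derPre, map_zero, smul_zero, add_zero, Pres.mk_one]
    subst h
    exact (Pres R).circ_one _ _

/-- The derivation of a presented operad which is determined by values of the generators that are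
compatible with the relations. -/
def Pres.der (hδ : deg δ = -1)
    (hR : ∀ {n : ℕ} {g g' : D} (h : g + δ = g') {x y : Pre K G n g}, R x y →
      derPre R δ v h x = derPre R δ v h y) : Der (Pres R) δ where
  map h :=
    { toFun := Quot.lift (derPre R δ v h) (fun _ _ r => derPre_rel v hδ hR h r)
      map_add' := fun x y => by
        induction x using Pres.ind; induction y using Pres.ind
        rfl
      map_smul' := fun c x => by
        induction x using Pres.ind
        rfl }
  map_act h e x := by
    induction x using Pres.ind
    rfl
  map_circ h h₁ h₂ hg k₁ k₂ x y := by
    induction x using Pres.ind; induction y using Pres.ind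
    subst h₁ h₂
    rfl

theorem Pres.der_gen (hδ : deg δ = -1)
    (hR : ∀ {n : ℕ} {g g' : D} (h : g + δ = g') {x y : Pre K G n g}, R x y →
      derPre R δ v h x = derPre R δ v h y) {n : ℕ} {g g' : D} (h : g + δ = g') (x : G n g) :
    (Pres.der v hδ hR).map h (Pres.gen R x) = v h x := rfl

/-- Two odd derivations of a presented operad anticommute if they do so on the generators. -/
theorem Pres.der_anticomm {δ' : D} (hδ : deg δ = -1) (hδ' : deg δ' = -1)
    (d : Der (Pres R) δ) (d' : Der (Pres R) δ')
    (H : ∀ {n : ℕ} {g g₁ g₂ g' : D} (h₁ : g + δ = g₁) (h₁' : g₁ + δ' = g')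
      (h₂ : g + δ' = g₂) (h₂' : g₂ + δ = g') (x : G n g),
      d'.map h₁' (d.map h₁ (Pres.gen R x)) + d.map h₂' (d'.map h₂ (Pres.gen R x)) = 0)
    {n : ℕ} {g g₁ g₂ g' : D} (h₁ : g + δ = g₁) (h₁' : g₁ + δ' = g')
    (h₂ : g + δ' = g₂) (h₂' : g₂ + δ = g') (x : (Pres R).obj n g) :
    d'.map h₁' (d.map h₁ x) + d.map h₂' (d'.map h₂ x) = 0 := by
  induction x using Pres.induction generalizing g₁ g₂ g' with
  | gen x => exact H h₁ h₁' h₂ h₂' x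
  | one => rw [d.map_one, d'.map_one, map_zero, map_zero, add_zero]
  | zero => simp only [map_zero, add_zero]
  | add x y hx hy =>
    have := congrArg₂ (· + ·) (hx h₁ h₁' h₂ h₂') (hy h₁ h₁' h₂ h₂')
    simp only [map_add, add_zero] at this ⊢
    rw [← this]; abel
  | smul c x hx =>
    simp only [map_smul, ← smul_add, hx h₁ h₁' h₂ h₂', smul_zero]
  | act e x hx =>
    simp only [d.map_act, d'.map_act, ← map_add, hx h₁ h₁' h₂ h₂', map_zero]
  | circ h x y hx hy =>
    rename_i a b p q r
    have hx' := hx (g₁ := p + δ) (g₂ := p + δ') (g' := p + δ + δ') rfl rfl rfl (by abel)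
    have hy' := hy (g₁ := q + δ) (g₂ := q + δ') (g' := q + δ + δ') rfl rfl rfl (by abel)
    subst h h₁ h₂ h₁'
    have s₁ : sg K (deg (p + δ)) = - sg K (deg p) := by
      rw [deg_add, hδ, sg_add, sg_neg_one]; ring
    have s₂ : sg K (deg (p + δ')) = - sg K (deg p) := by
      rw [deg_add, hδ', sg_add, sg_neg_one]; ring
    rw [d.map_circ rfl rfl rfl _ (by abel) (by abel), d'.map_circ rfl rfl rfl _ (by abel) (by abel)]
    simp only [map_add, map_smul]
    rw [d'.map_circ _ rfl rfl _ (by abel) (by abel), d'.map_circ _ rfl rfl _ (by abel) (by abel),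
      d.map_circ _ (g₁' := p + δ + δ') (by abel) rfl _ (by abel) (by abel),
      d.map_circ _ rfl (g₂' := q + δ + δ') (by abel) _ (by abel) (by abel)]
    have e₁ := congrArg (fun t => (Pres R).circ (show p + δ + δ' + q = p + q + δ + δ' by abel) t y)
      hx'
    have e₂ := congrArg (fun t => (Pres R).circ (show p + (q + δ + δ') = p + q + δ + δ' by abel) x t)
      hy'
    simp only [map_add, map_zero, LinearMap.add_apply, LinearMap.zero_apply] at e₁ e₂
    rw [s₁, s₂]
    linear_combination (norm := module) e₁ + (sg K (deg p) * sg K (deg p)) • e₂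

end LiftDer

end Universal

/-! ### Formal series -/

section Series

open Finset hiding antidiagonal mem_antidiagonal
open Finset.HasAntidiagonal

theorem sum_triple {M : Type*} [AddCommMonoid M] (N : ℕ) (F : ℕ → ℕ → ℕ → M) :
    ∑ s ∈ antidiagonal N, ∑ p ∈ antidiagonal s.1, F p.1 p.2 s.2 =
      ∑ s ∈ antidiagonal N, ∑ p ∈ antidiagonal s.2, F s.1 p.1 p.2 := by
  rw [sum_sigma', sum_sigma']
  refine sum_nbij' (fun t => ⟨(t.2.1, t.2.2 + t.1.2), (t.2.2, t.1.2)⟩)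
    (fun t => ⟨(t.1.1 + t.2.1, t.2.2), (t.1.1, t.2.1)⟩) ?_ ?_ ?_ ?_ ?_ <;>
  · rintro ⟨⟨s, r⟩, ⟨p, q⟩⟩ h
    simp only [mem_sigma, mem_antidiagonal] at h
    obtain ⟨h, k⟩ := h
    subst h k
    simp [add_assoc]

theorem sum_triple_comm {M : Type*} [AddCommMonoid M] (N : ℕ) (F : ℕ → ℕ → ℕ → M) :
    ∑ s ∈ antidiagonal N, ∑ p ∈ antidiagonal s.1, F p.1 p.2 s.2 =
      ∑ s ∈ antidiagonal N, ∑ p ∈ antidiagonal s.1, F p.1 s.2 p.2 := by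
  rw [sum_sigma', sum_sigma']
  refine sum_nbij' (fun t => ⟨(t.2.1 + t.1.2, t.2.2), (t.2.1, t.1.2)⟩)
    (fun t => ⟨(t.2.1 + t.1.2, t.2.2), (t.2.1, t.1.2)⟩) ?_ ?_ ?_ ?_ ?_ <;>
  · rintro ⟨⟨s, r⟩, ⟨p, q⟩⟩ h
    simp only [mem_sigma, mem_antidiagonal] at h
    obtain ⟨h, k⟩ := h
    subst h k
    simp [add_right_comm]

variable {K : Type u} [Field K] {D : Type} [AddCommMonoid D] [HasDeg D]

/-- The composition from parts of weight `p` and `q` to the part of weight `N`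
(zero unless `p + q = N`). -/
def GOperad.circN (E : GOperad K (D × ℕ)) {a b : ℕ} {g g' g'' : D} (h : g + g' = g'') (p q N : ℕ) :
    E.obj (a + 1) (g, p) →ₗ[K] E.obj b (g', q) →ₗ[K] E.obj (a + b) (g'', N) :=
  if k : p + q = N then E.circ (Prod.ext h k) else 0

theorem GOperad.circN_eq (E : GOperad K (D × ℕ)) {a b : ℕ} {g g' g'' : D} (h : g + g' = g'')
    {p q N : ℕ} (k : p + q = N) (x : E.obj (a + 1) (g, p)) (y : E.obj b (g', q)) :
    E.circN h p q N x y = E.circ (Prod.ext h k) x y := by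
  rw [GOperad.circN, dif_pos k]

/-- The formal series `∑ N, x N` with `x N` of weight `N`, for an operad with an additional weight
grading by `ℕ`. -/
abbrev SerObj (E : GOperad K (D × ℕ)) (n : ℕ) (g : D) : Type u := ∀ N : ℕ, E.obj n (g, N)

/-- The composition of formal series. -/
def serCirc (E : GOperad K (D × ℕ)) {a b : ℕ} {g g' g'' : D} (h : g + g' = g'') :
    SerObj E (a + 1) g →ₗ[K] SerObj E b g' →ₗ[K] SerObj E (a + b) g'' :=
  LinearMap.mk₂ K (fun x y N => ∑ p ∈ antidiagonal N, E.circN h p.1 p.2 N (x p.1) (y p.2))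
    (fun x x' y => by
      funext N; simp [sum_add_distrib])
    (fun c x y => by
      funext N; simp [smul_sum])
    (fun x x' y => by
      funext N; simp [sum_add_distrib])
    (fun c x y => by
      funext N; simp [smul_sum])

theorem serCirc_apply (E : GOperad K (D × ℕ)) {a b : ℕ} {g g' g'' : D} (h : g + g' = g'')
    (x : SerObj E (a + 1) g) (y : SerObj E b g') (N : ℕ) :
    serCirc E h x y N = ∑ p ∈ antidiagonal N, E.circN h p.1 p.2 N (x p.1) (y p.2) := rfl

/-- The action on formal series. -/
def serAct (E : GOperad K (D × ℕ)) {m n : ℕ} {g : D} (e : Fin m ≃ Fin n) :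
    SerObj E m g →ₗ[K] SerObj E n g where
  toFun x N := E.act e (x N)
  map_add' x y := by funext N; simp
  map_smul' c x := by funext N; simp

theorem serAct_apply (E : GOperad K (D × ℕ)) {m n : ℕ} {g : D} (e : Fin m ≃ Fin n)
    (x : SerObj E m g) (N : ℕ) : serAct E e x N = E.act e (x N) := rfl

/-- The unit, as a formal series. -/
def serOne (E : GOperad K (D × ℕ)) : SerObj E 1 0
  | 0 => E.one
  | _ + 1 => 0

/-- The operad of formal series (the product of the weight components) of an operad with an
additional weight grading by `ℕ`. -/
def Ser (E : GOperad K (D × ℕ)) : GOperad K D where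
  obj n g := SerObj E n g
  act e := serAct E e
  one := serOne E
  circ h := serCirc E h
  act_refl x := by
    funext N; exact E.act_refl _
  act_trans e f x := by
    funext N; exact E.act_trans _ _ _
  circ_act h e f x y := by
    funext N
    simp only [serCirc_apply, serAct_apply, map_sum]
    refine sum_congr rfl fun p hp => ?_
    rw [E.circN_eq h (mem_antidiagonal.1 hp), E.circN_eq h (mem_antidiagonal.1 hp), E.circ_act]
  circ_assoc {a b c g₁ g₂ g₃ g₁₂ g₂₃ g} h₁₂ h h₂₃ h' x y z := by
    funext N
    simp only [serCirc_apply, serAct_apply, map_sum, LinearMap.sum_apply]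
    refine Eq.trans ?_ ((sum_triple N (fun p q r => E.act (finCongr (Nat.add_assoc a b c).symm)
      (E.circN h' p (q + r) N (x p) (E.circN h₂₃ q r (q + r) (y q) (z r))))).trans ?_)
    · refine sum_congr rfl fun s hs => sum_congr rfl fun p hp => ?_
      obtain ⟨s, r⟩ := s
      obtain ⟨p, q⟩ := p
      simp only [mem_antidiagonal] at hs hp
      subst hp hs
      rw [E.circN_eq h rfl, E.circN_eq h₁₂ rfl, E.circN_eq h₂₃ rfl,
        E.circN_eq h' (add_assoc _ _ _).symm]
      exact E.circ_assoc _ _ _ _ _ _ _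
    · refine sum_congr rfl fun s hs => sum_congr rfl fun p hp => ?_
      rw [← mem_antidiagonal.1 hp]
  circ_comm {a b c g₁ g₂ g₃ g₁₂ g₁₃ g} h₁₂ h h₁₃ h' x y z := by
    funext N
    simp only [serCirc_apply, serAct_apply, map_sum, LinearMap.sum_apply, Pi.smul_apply, smul_sum]
    refine Eq.trans ?_ ((sum_triple_comm N (fun p q r => sg K (deg g₂ * deg g₃) • E.act (blk a c b)
      (E.circN h' (p + r) q N (E.act (blk a 1 c)
        (E.circN h₁₃ p r (p + r) (E.act (blk a 1 1) (x p)) (z r))) (y q)))).trans ?_)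
    · refine sum_congr rfl fun s hs => sum_congr rfl fun p hp => ?_
      obtain ⟨s, r⟩ := s
      obtain ⟨p, q⟩ := p
      simp only [mem_antidiagonal] at hs hp
      subst hp hs
      rw [E.circN_eq h rfl, E.circN_eq h₁₂ rfl, E.circN_eq h₁₃ rfl,
        E.circN_eq h' (add_right_comm _ _ _)]
      exact E.circ_comm _ _ _ _ _ _ _
    · refine sum_congr rfl fun s hs => sum_congr rfl fun p hp => ?_
      rw [← mem_antidiagonal.1 hp]
  one_circ {b g} h y := by
    funext N
    rw [serCirc_apply, sum_eq_single (0, N)]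
    · rw [E.circN_eq h (zero_add N)]
      exact E.one_circ _ _
    · rintro ⟨p, q⟩ hp hne
      cases p with
      | zero =>
        rw [mem_antidiagonal] at hp
        exact (hne (by simp only [zero_add] at hp; rw [hp])).elim
      | succ p => simp [serOne]
    · intro h
      exact (h (by simp)).elim
  circ_one {a g} h x := by
    funext N
    rw [serCirc_apply, sum_eq_single (N, 0)]
    · rw [E.circN_eq h (add_zero N)]
      exact E.circ_one _ _
    · rintro ⟨p, q⟩ hp hne
      cases q with
      | zero =>
        rw [mem_antidiagonal] at hp
        exact (hne (by simp only [add_zero] at hp; rw [hp])).elim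
      | succ p => simp [serOne]
    · intro h
      exact (h (by simp)).elim

/-- A derivation which preserves the weight acts on series componentwise. -/
def Der.ser₀ {E : GOperad K (D × ℕ)} {δ : D} (d : Der E (δ, 0)) : Der (Ser E) δ where
  map h :=
    { toFun := fun x N => d.map (Prod.ext h (add_zero N)) (x N)
      map_add' := fun x y => by funext N; exact map_add _ _ _
      map_smul' := fun c x => by funext N; exact map_smul _ _ _ }
  map_act h e x := by
    funext N; exact d.map_act _ _ _
  map_circ {a b g₁ g₂ g g₁' g₂' g'} h h₁ h₂ hg k₁ k₂ x y := by
    funext N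
    change d.map _ (∑ p ∈ antidiagonal N, E.circN h p.1 p.2 N (x p.1) (y p.2)) =
      ∑ p ∈ antidiagonal N, E.circN k₁ p.1 p.2 N (d.map _ (x p.1)) (y p.2) +
        sg K (deg g₁) • ∑ p ∈ antidiagonal N, E.circN k₂ p.1 p.2 N (x p.1) (d.map _ (y p.2))
    rw [map_sum, smul_sum, ← sum_add_distrib]
    refine sum_congr rfl fun p hp => ?_
    rw [mem_antidiagonal] at hp
    rw [E.circN_eq h hp, E.circN_eq k₁ hp, E.circN_eq k₂ hp]
    exact d.map_circ _ _ _ _ _ _ _ _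

/-- The underlying function of a derivation on series which raises the weight by one. -/
def serDer₁Fun {E : GOperad K (D × ℕ)} {δ : D} (d : Der E (δ, 1)) {n : ℕ} {g g' : D}
    (h : g + δ = g') (x : SerObj E n g) : SerObj E n g'
  | 0 => 0
  | N + 1 => d.map (g := (g, N)) (g' := (g', N + 1)) (Prod.ext h rfl) (x N)

/-- A derivation which raises the weight by one acts on series by a shift. -/
def Der.ser₁ {E : GOperad K (D × ℕ)} {δ : D} (d : Der E (δ, 1)) : Der (Ser E) δ where
  map h :=
    { toFun := fun x => serDer₁Fun d h x
      map_add' := fun x y => by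
        funext N
        cases N with
        | zero => exact (add_zero _).symm
        | succ N => exact map_add _ _ _
      map_smul' := fun c x => by
        funext N
        cases N with
        | zero => exact (smul_zero (A := E.obj _ (_, 0)) c).symm
        | succ N => exact map_smul _ _ _ }
  map_act h e x := by
    funext N
    cases N with
    | zero => exact (map_zero (E.act (g := (_, 0)) e)).symm
    | succ N => exact d.map_act _ _ _
  map_circ {a b g₁ g₂ g g₁' g₂' g'} h h₁ h₂ hg k₁ k₂ x y := by
    funext N
    change serDer₁Fun d hg (serCirc E h x y) N =
      ∑ p ∈ antidiagonal N, E.circN k₁ p.1 p.2 N (serDer₁Fun d h₁ x p.1) (y p.2) +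
        sg K (deg g₁) • ∑ p ∈ antidiagonal N, E.circN k₂ p.1 p.2 N (x p.1) (serDer₁Fun d h₂ y p.2)
    cases N with
    | zero => simp [serDer₁Fun]
    | succ N =>
      rw [Finset.Nat.sum_antidiagonal_succ, Finset.Nat.sum_antidiagonal_succ']
      simp only [serDer₁Fun, map_zero, LinearMap.zero_apply, zero_add]
      change d.map _ (∑ p ∈ antidiagonal N, E.circN h p.1 p.2 N (x p.1) (y p.2)) = _
      rw [map_sum, smul_sum, ← sum_add_distrib]
      refine sum_congr rfl fun p hp => ?_
      rw [mem_antidiagonal] at hp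
      rw [E.circN_eq h hp, E.circN_eq k₁ (by omega), E.circN_eq k₂ (by omega)]
      exact d.map_circ _ _ _ _ _ _ _ _

/-- A morphism acts on series componentwise. -/
def GHom.ser {E F : GOperad K (D × ℕ)} (f : GHom E F) : GHom (Ser E) (Ser F) where
  map :=
    { toFun := fun x N => f.map (x N)
      map_add' := fun x y => by funext N; exact map_add _ _ _
      map_smul' := fun c x => by funext N; exact map_smul _ _ _ }
  map_act e x := by
    funext N; exact f.map_act _ _
  map_one := by
    funext N
    cases N with
    | zero => exact f.map_one
    | succ N => exact map_zero (f.map (n := 1) (g := (0, N + 1)))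
  map_circ h x y := by
    funext N
    change f.map (∑ p ∈ antidiagonal N, E.circN h p.1 p.2 N (x p.1) (y p.2)) =
      ∑ p ∈ antidiagonal N, F.circN h p.1 p.2 N (f.map (x p.1)) (f.map (y p.2))
    rw [map_sum]
    refine sum_congr rfl fun p hp => ?_
    rw [mem_antidiagonal] at hp
    rw [E.circN_eq h hp, F.circN_eq h hp]
    exact f.map_circ _ _ _

/-- The sub-operad of the series with finitely many nonzero terms. -/
def serFin (E : GOperad K (D × ℕ)) : SubOperad (Ser E) where
  carrier n g :=
    { carrier := {x | ∃ W : ℕ, ∀ w : ℕ, W ≤ w → x w = 0}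
      add_mem' := by
        rintro x y ⟨W, hW⟩ ⟨W', hW'⟩
        refine ⟨max W W', fun w hw => ?_⟩
        change x w + y w = 0
        rw [hW w (le_trans (le_max_left _ _) hw), hW' w (le_trans (le_max_right _ _) hw), add_zero]
      zero_mem' := ⟨0, fun _ _ => rfl⟩
      smul_mem' := by
        rintro c x ⟨W, hW⟩
        refine ⟨W, fun w hw => ?_⟩
        change c • x w = 0
        rw [hW w hw, smul_zero] }
  one_mem := ⟨1, fun w hw => by
    cases w with
    | zero => omega
    | succ w => rfl⟩
  act_mem := by
    rintro m n g e x ⟨W, hW⟩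
    refine ⟨W, fun w hw => ?_⟩
    change E.act e (x w) = 0
    rw [hW w hw, map_zero]
  circ_mem := by
    rintro a b g g' g'' h x y ⟨W, hW⟩ ⟨W', hW'⟩
    refine ⟨W + W', fun w hw => ?_⟩
    change ∑ p ∈ antidiagonal w, E.circN h p.1 p.2 w (x p.1) (y p.2) = 0
    refine sum_eq_zero fun p hp => ?_
    rw [mem_antidiagonal] at hp
    rcases le_or_gt W p.1 with hle | hlt
    · rw [hW _ hle, map_zero, LinearMap.zero_apply]
    · rw [hW' _ (by omega), map_zero]

/-- The sub-operad of the series concentrated in weight `0`. -/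
def serZero (E : GOperad K (D × ℕ)) : SubOperad (Ser E) where
  carrier n g :=
    { carrier := {x | ∀ w : ℕ, x (w + 1) = 0}
      add_mem' := by
        intro x y hx hy w
        change x (w + 1) + y (w + 1) = 0
        rw [hx, hy, add_zero]
      zero_mem' := fun _ => rfl
      smul_mem' := by
        intro c x hx w
        change c • x (w + 1) = 0
        rw [hx, smul_zero] }
  one_mem := fun _ => rfl
  act_mem := by
    intro m n g e x hx w
    change E.act e (x (w + 1)) = 0
    rw [hx, map_zero]
  circ_mem := by
    intro a b g g' g'' h x y hx hy w
    change ∑ p ∈ antidiagonal (w + 1), E.circN h p.1 p.2 (w + 1) (x p.1) (y p.2) = 0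
    refine sum_eq_zero fun p hp => ?_
    obtain ⟨p, q⟩ := p
    rw [mem_antidiagonal] at hp
    cases p with
    | succ p => rw [hx, map_zero, LinearMap.zero_apply]
    | zero =>
      cases q with
      | succ q => rw [hy, map_zero]
      | zero => simp at hp

end Series

/-! ### Dg operads -/

section DG

variable (K : Type u) [Field K]

/-- A symmetric dg operad over `K` (homological conventions): a graded operad with a square-zero
derivation of degree `-1`. -/
structure DGOp extends GOperad K ℤ where
  d : Der toGOperad (-1)
  d_sq : ∀ {n : ℕ} {i j k : ℤ} (h : i + -1 = j) (h' : j + -1 = k) (x : obj n i),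
    d.map h' (d.map h x) = 0

variable {K}

/-- Morphisms of dg operads. -/
@[ext]
structure DGHom (P Q : DGOp K) extends GHom P.toGOperad Q.toGOperad where
  map_d : ∀ {n : ℕ} {i j : ℤ} (h : i + -1 = j) (x : P.obj n i),
    map (P.d.map h x) = Q.d.map h (map x)

/-- The category of symmetric dg operads. -/
instance DGOp.category : Category (DGOp K) where
  Hom P Q := DGHom P Q
  id P :=
    { map := LinearMap.id
      map_act := fun _ _ => rfl
      map_one := rfl
      map_circ := fun _ _ _ => rfl
      map_d := fun _ _ => rfl }
  comp f g :=
    { map := g.map.comp f.map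
      map_act := fun e x => by simp [f.map_act, g.map_act]
      map_one := by simp [f.map_one, g.map_one]
      map_circ := fun h x y => by simp [f.map_circ, g.map_circ]
      map_d := fun h x => by simp [f.map_d, g.map_d] }

/-- A morphism of dg operads, applied to an operation. -/
def app {P Q : DGOp K} (f : P ⟶ Q) {n : ℕ} {i : ℤ} : P.obj n i →ₗ[K] Q.obj n i :=
  (DGHom.toGHom f).map

theorem app_comp {P Q S : DGOp K} (f : P ⟶ Q) (g : Q ⟶ S) {n : ℕ} {i : ℤ} (x : P.obj n i) :
    app (f ≫ g) x = app g (app f x) := rfl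

end DG

/-! ### Freely adjoining operations of arity zero -/

section Adjoin

variable {K : Type u} [Field K] {D : Type} [AddCommMonoid D] [HasDeg D]

/-- The generators of `P ∨ [V]`: the operations of `P`, of degree `emb i`, and the elements of `V`,
which have arity zero and degrees `gr v`. -/
inductive AdjGen (P : GOperad K ℤ) (emb : ℤ →+ D) {V : Type} (gr : V → D) : ℕ → D → Type u
  | of {n : ℕ} {i : ℤ} {g : D} : emb i = g → P.obj n i → AdjGen P emb gr n g
  | var (v : V) {g : D} : gr v = g → AdjGen P emb gr 0 g

/-- The relations of `P ∨ [V]`: the inclusion of `P` is a morphism of operads. -/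
inductive AdjRel (P : GOperad K ℤ) (emb : ℤ →+ D) {V : Type} (gr : V → D) :
    ∀ ⦃n : ℕ⦄ ⦃g : D⦄, Pre K (AdjGen P emb gr) n g → Pre K (AdjGen P emb gr) n g → Prop
  | add {n : ℕ} {i : ℤ} {g : D} (h : emb i = g) (x y : P.obj n i) :
      AdjRel P emb gr (.gen (.of h (x + y))) (.add (.gen (.of h x)) (.gen (.of h y)))
  | smul {n : ℕ} {i : ℤ} {g : D} (h : emb i = g) (c : K) (x : P.obj n i) :
      AdjRel P emb gr (.gen (.of h (c • x))) (.smul c (.gen (.of h x)))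
  | act {m n : ℕ} {i : ℤ} {g : D} (h : emb i = g) (e : Fin m ≃ Fin n) (x : P.obj m i) :
      AdjRel P emb gr (.gen (.of h (P.act e x))) (.act e (.gen (.of h x)))
  | one (h : emb 0 = 0) : AdjRel P emb gr (.gen (.of h P.one)) .one
  | circ {a b : ℕ} {i j k : ℤ} {g g' g'' : D} (h₁ : emb i = g) (h₂ : emb j = g') (h₃ : emb k = g'')
      (h : i + j = k) (h' : g + g' = g'') (x : P.obj (a + 1) i) (y : P.obj b j) :
      AdjRel P emb gr (.gen (.of h₃ (P.circ h x y)))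
        (.circ h' (.gen (.of h₁ x)) (.gen (.of h₂ y)))

variable (P : GOperad K ℤ) (emb : ℤ →+ D) {V : Type} (gr : V → D)

/-- The coproduct `P ∨ [V]` of `P` and the free operad on the set `V` of generators of arity zero,
with its grading by `D`. -/
def Adj : GOperad K D := Pres (AdjRel P emb gr)

/-- The inclusion `P → P ∨ [V]`. -/
def Adj.of {n : ℕ} {i : ℤ} {g : D} (h : emb i = g) : P.obj n i →ₗ[K] (Adj P emb gr).obj n g where
  toFun x := Pres.gen (AdjRel P emb gr) (.of h x)
  map_add' x y := Pres.sound _ (.of (.add h x y))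
  map_smul' c x := Pres.sound _ (.of (.smul h c x))

/-- The adjoined generators. -/
def Adj.var (v : V) {g : D} (h : gr v = g) : (Adj P emb gr).obj 0 g :=
  Pres.gen (AdjRel P emb gr) (.var v h)

theorem Adj.of_act {m n : ℕ} {i : ℤ} {g : D} (h : emb i = g) (e : Fin m ≃ Fin n) (x : P.obj m i) :
    Adj.of P emb gr h (P.act e x) = (Adj P emb gr).act e (Adj.of P emb gr h x) :=
  Pres.sound _ (.of (.act h e x))

theorem Adj.of_one (h : emb 0 = 0) : Adj.of P emb gr h P.one = (Adj P emb gr).one :=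
  Pres.sound _ (.of (.one h))

theorem Adj.of_circ {a b : ℕ} {i j k : ℤ} {g g' g'' : D} (h₁ : emb i = g) (h₂ : emb j = g')
    (h₃ : emb k = g'') (h : i + j = k) (h' : g + g' = g'') (x : P.obj (a + 1) i) (y : P.obj b j) :
    Adj.of P emb gr h₃ (P.circ h x y) =
      (Adj P emb gr).circ h' (Adj.of P emb gr h₁ x) (Adj.of P emb gr h₂ y) :=
  Pres.sound _ (.of (.circ h₁ h₂ h₃ h h' x y))

/-- Induction principle for `P ∨ [V]`. -/
theorem Adj.induction {p : ∀ {n : ℕ} {g : D}, (Adj P emb gr).obj n g → Prop}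
    (of : ∀ {n : ℕ} {i : ℤ} {g : D} (h : emb i = g) (x : P.obj n i), p (Adj.of P emb gr h x))
    (var : ∀ (v : V) {g : D} (h : gr v = g), p (Adj.var P emb gr v h))
    (zero : ∀ {n : ℕ} {g : D}, p (0 : (Adj P emb gr).obj n g))
    (add : ∀ {n : ℕ} {g : D} (x y : (Adj P emb gr).obj n g), p x → p y → p (x + y))
    (smul : ∀ {n : ℕ} {g : D} (c : K) (x : (Adj P emb gr).obj n g), p x → p (c • x))
    (act : ∀ {m n : ℕ} {g : D} (e : Fin m ≃ Fin n) (x : (Adj P emb gr).obj m g), p x →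
      p ((Adj P emb gr).act e x))
    (circ : ∀ {a b : ℕ} {g g' g'' : D} (h : g + g' = g'') (x : (Adj P emb gr).obj (a + 1) g)
      (y : (Adj P emb gr).obj b g'), p x → p y → p ((Adj P emb gr).circ h x y))
    {n : ℕ} {g : D} (x : (Adj P emb gr).obj n g) : p x := by
  refine Pres.induction (R := AdjRel P emb gr) (p := p) ?_ ?_ zero add smul act circ x
  · rintro n g (⟨h, x⟩ | ⟨v, h⟩)
    · exact of h x
    · exact var v h
  · have := of (map_zero emb) P.one
    rwa [Adj.of_one] at this

section Lift

variable {D' : Type} [AddCommMonoid D'] [HasDeg D'] (X : GOperad K D') (φ : D →+ D')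
  (hφ : ∀ g, deg (φ g) = deg g)
  (f : ∀ ⦃n : ℕ⦄ ⦃i : ℤ⦄ ⦃g : D⦄, emb i = g → P.obj n i →ₗ[K] X.obj n (φ g))
  (y : ∀ (v : V) ⦃g : D⦄, gr v = g → X.obj 0 (φ g))

/-- Values of the generators of `P ∨ [V]`. -/
def adjVal : ∀ ⦃n : ℕ⦄ ⦃g : D⦄, AdjGen P emb gr n g → X.obj n (φ g)
  | _, _, .of h x => f h x
  | _, _, .var v h => y v h

/-- The morphism `P ∨ [V] → X` with given restrictions to `P` and `V`. -/
def Adj.lift (f_act : ∀ {m n : ℕ} {i : ℤ} {g : D} (h : emb i = g) (e : Fin m ≃ Fin n)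
      (x : P.obj m i), f h (P.act e x) = X.act e (f h x))
    (f_one : ∀ h, f (g := 0) h P.one = X.cast (map_zero φ).symm X.one)
    (f_circ : ∀ {a b : ℕ} {i j k : ℤ} {g g' g'' : D} (h₁ : emb i = g) (h₂ : emb j = g')
      (h₃ : emb k = g'') (h : i + j = k) (h' : φ g + φ g' = φ g'') (x : P.obj (a + 1) i)
      (y : P.obj b j), f h₃ (P.circ h x y) = X.circ h' (f h₁ x) (f h₂ y))
    {n : ℕ} {g : D} : (Adj P emb gr).obj n g →ₗ[K] X.obj n (φ g) :=
  Pres.lift X φ (adjVal P emb gr X φ f y) hφ (by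
    intro n g x x' r
    induction r with
    | add h x y => exact map_add (f h) x y
    | smul h c x => exact map_smul (f h) c x
    | act h e x => exact f_act h e x
    | one h => exact f_one h
    | circ h₁ h₂ h₃ h h' x y => exact f_circ h₁ h₂ h₃ h _ x y)

end Lift

section Der

variable (δ : D)
  (f : ∀ ⦃n : ℕ⦄ ⦃i : ℤ⦄ ⦃g g' : D⦄, g + δ = g' → emb i = g → P.obj n i →ₗ[K]
    (Adj P emb gr).obj n g')
  (y : ∀ (v : V) ⦃g g' : D⦄, g + δ = g' → gr v = g → (Adj P emb gr).obj 0 g')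

/-- Values of a derivation on the generators of `P ∨ [V]`. -/
def adjDerVal : ∀ ⦃n : ℕ⦄ ⦃g g' : D⦄, g + δ = g' → AdjGen P emb gr n g → (Adj P emb gr).obj n g'
  | _, _, _, k, .of h x => f k h x
  | _, _, _, k, .var v h => y v k h

/-- The derivation of `P ∨ [V]` with given values on `P` (where it has to satisfy the
Leibniz rule) and `V`. -/
def Adj.der (hδ : deg δ = -1)
    (f_act : ∀ {m n : ℕ} {i : ℤ} {g g' : D} (k : g + δ = g') (h : emb i = g) (e : Fin m ≃ Fin n)
      (x : P.obj m i), f k h (P.act e x) = (Adj P emb gr).act e (f k h x))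
    (f_one : ∀ {g' : D} (k : 0 + δ = g') (h : emb 0 = 0), f k h P.one = 0)
    (f_circ : ∀ {a b : ℕ} {i j l : ℤ} {g₁ g₂ g g₁' g₂' g' : D} (h₁ : emb i = g₁) (h₂ : emb j = g₂)
      (h₃ : emb l = g) (h : i + j = l) (k₁ : g₁ + δ = g₁') (k₂ : g₂ + δ = g₂') (k : g + δ = g')
      (h' : g₁' + g₂ = g') (h'' : g₁ + g₂' = g') (x : P.obj (a + 1) i) (y : P.obj b j),
      f k h₃ (P.circ h x y) =
        (Adj P emb gr).circ h' (f k₁ h₁ x) (Adj.of P emb gr h₂ y) +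
          sg K (deg g₁) • (Adj P emb gr).circ h'' (Adj.of P emb gr h₁ x) (f k₂ h₂ y)) :
    Der (Adj P emb gr) δ :=
  Pres.der (R := AdjRel P emb gr) (adjDerVal P emb gr δ f y) hδ (by
    intro n g g' k x x' r
    induction r with
    | add h x y => exact map_add (f k h) x y
    | smul h c x => exact map_smul (f k h) c x
    | act h e x => exact f_act k h e x
    | one h => exact f_one k h
    | circ h₁ h₂ h₃ h h' x y => exact f_circ h₁ h₂ h₃ h _ _ k _ _ x y)

end Der

end Adjoin

/-! ### The curved L-infinity operad -/

section LInf

open Finset hiding antidiagonal mem_antidiagonal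
open Finset.HasAntidiagonal

variable {K : Type u} [Field K]

/-- The shuffle of `{1..n}` which lists the elements of `A` in increasing order, followed by the
elements of the complement of `A` in increasing order.  For `|A| = p` and `p + q = n`
these are exactly the `(p, q)`-shuffles. -/
def shuf {n : ℕ} (A : Finset (Fin n)) : Fin (#A + #Aᶜ) ≃ Fin n :=
  finSumFinEquiv.symm.trans (finSumEquivOfFinset rfl rfl)

/-- The right hand side of the curved L-infinity relation,
`- ∑_{p+q=n} ∑_{(p, q)-shuffles σ} σ · (ℓ_{p+1} ∘ ℓ_q)`: the sum over the subsets
`A = {i₁ < ... < i_p}` of `{1..n}`, with complement `{j₁ < ... < j_q}`, of the operations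
`ℓ_{p+1}(x_{i₁}, ..., x_{i_p}, ℓ_q(x_{j₁}, ..., x_{j_q}))`.  (The operations `ℓ_{p+1}` to which
it is applied are symmetric, so the position of `ℓ_q` is immaterial.) -/
def lieSum (P : GOperad K ℤ) (ℓ : ∀ n, P.obj n (-1)) (n : ℕ) : P.obj n (-2) :=
  - ∑ A : Finset (Fin n),
    P.act (shuf A) (P.circ (g'' := -2) (by norm_num) (ℓ (#A + 1)) (ℓ #Aᶜ))

theorem sumE_refl (a b : ℕ) : sumE (Equiv.refl (Fin a)) (Equiv.refl (Fin b)) = Equiv.refl _ := by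
  ext x; simp [sumE]

/-- The sum of all relabellings of an operation. -/
def symm (P : GOperad K ℤ) (n : ℕ) {m : ℕ} {g : ℤ} : P.obj m g →ₗ[K] P.obj n g :=
  ∑ e : Fin m ≃ Fin n, P.act e

theorem symm_apply (P : GOperad K ℤ) (n : ℕ) {m : ℕ} {g : ℤ} (x : P.obj m g) :
    symm P n x = ∑ e : Fin m ≃ Fin n, P.act e x := by
  simp [symm]

theorem symm_act (P : GOperad K ℤ) (n : ℕ) {m l : ℕ} {g : ℤ} (f : Fin l ≃ Fin m) (x : P.obj l g) :
    symm P n (P.act f x) = symm P n x := by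
  rw [symm_apply, symm_apply]
  refine Fintype.sum_equiv (Equiv.equivCongr f.symm (Equiv.refl _)) _ _ fun e => ?_
  rw [← P.act_trans]
  congr 1

theorem act_symm (P : GOperad K ℤ) (n : ℕ) {m l : ℕ} {g : ℤ} (f : Fin n ≃ Fin l) (x : P.obj m g) :
    P.act f (symm P n x) = symm P l x := by
  rw [symm_apply, symm_apply, map_sum]
  refine Fintype.sum_equiv (Equiv.equivCongr (Equiv.refl _) f) _ _ fun e => ?_
  rw [← P.act_trans]
  congr 1

theorem der_symm (P : GOperad K ℤ) (d : Der P (-1)) (n : ℕ) {m : ℕ} {g g' : ℤ} (h : g + -1 = g')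
    (x : P.obj m g) : d.map h (symm P n x) = symm P n (d.map h x) := by
  simp only [symm_apply, map_sum, d.map_act]

section Sym

variable (P : GOperad K ℤ) (ℓ : ∀ n, P.obj n (-1))

/-- The composite `ℓ_{p+1} ∘ ℓ_q`. -/
def lieX (p q : ℕ) : P.obj (p + q) (-2) := P.circ (g'' := -2) (by norm_num) (ℓ (p + 1)) (ℓ q)

theorem lieX_act (hℓ : ∀ (n : ℕ) (e : Fin n ≃ Fin n), P.act e (ℓ n) = ℓ n) (p q : ℕ)
    (e : Fin p ≃ Fin p) (f : Fin q ≃ Fin q) : P.act (sumE e f) (lieX P ℓ p q) = lieX P ℓ p q := by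
  rw [lieX, ← P.circ_act, hℓ, hℓ]

/-- The image of the first block. -/
def blockImg {p q n : ℕ} (e : Fin (p + q) ≃ Fin n) : Finset (Fin n) :=
  univ.image fun i => e (Fin.castAdd q i)

theorem card_blockImg {p q n : ℕ} (e : Fin (p + q) ≃ Fin n) : #(blockImg e) = p := by
  rw [blockImg, card_image_of_injective _ (fun i j h => by simpa using h)]
  simp

theorem blockImg_shuf {n : ℕ} (A : Finset (Fin n)) : blockImg (shuf A) = A := by
  apply Finset.eq_of_subset_of_card_le
  · intro x hx
    simp only [blockImg, mem_image, mem_univ, true_and] at hx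
    obtain ⟨i, rfl⟩ := hx
    simp [shuf]
  · rw [card_blockImg]

theorem blockImg_sumE {p q n : ℕ} (e : Fin p ≃ Fin p) (f : Fin q ≃ Fin q)
    (s : Fin (p + q) ≃ Fin n) : blockImg ((sumE e f).trans s) = blockImg s := by
  ext x
  simp only [blockImg, mem_image, mem_univ, true_and]
  constructor
  · rintro ⟨i, rfl⟩
    exact ⟨e i, by simp [sumE]⟩
  · rintro ⟨i, rfl⟩
    exact ⟨e.symm i, by simp [sumE]⟩

theorem exists_sumE {p q n : ℕ} (s t : Fin (p + q) ≃ Fin n) (h : blockImg s = blockImg t) :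
    ∃ (e : Fin p ≃ Fin p) (f : Fin q ≃ Fin q), s = (sumE e f).trans t := by
  let σ : Equiv.Perm (Fin p ⊕ Fin q) :=
    finSumFinEquiv.trans ((s.trans t.symm).trans finSumFinEquiv.symm)
  have hσ : Set.MapsTo σ (Set.range Sum.inl) (Set.range Sum.inl) := by
    rintro _ ⟨i, rfl⟩
    have : s (Fin.castAdd q i) ∈ blockImg t := h ▸ mem_image_of_mem _ (mem_univ i)
    simp only [blockImg, mem_image, mem_univ, true_and] at this
    obtain ⟨j, hj⟩ := this
    refine ⟨j, ?_⟩
    simp [σ, ← hj]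
  obtain ⟨⟨e, f⟩, hef⟩ := Equiv.Perm.mem_sumCongrHom_range_of_perm_mapsTo_inl hσ
  refine ⟨e, f, ?_⟩
  have hef' : Equiv.sumCongr e f = σ := hef
  ext x
  simp [sumE, hef', σ]

theorem sum_fiber (hℓ : ∀ (n : ℕ) (e : Fin n ≃ Fin n), P.act e (ℓ n) = ℓ n) {n : ℕ}
    (A : Finset (Fin n)) :
    ∑ e : Fin (#A + #Aᶜ) ≃ Fin n with blockImg e = A, P.act e (lieX P ℓ #A #Aᶜ) =
      ((#A).factorial * (#Aᶜ).factorial) • P.act (shuf A) (lieX P ℓ #A #Aᶜ) := by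
  have : ∑ ef : Equiv.Perm (Fin #A) × Equiv.Perm (Fin #Aᶜ),
      P.act (shuf A) (lieX P ℓ #A #Aᶜ) =
      ∑ e : Fin (#A + #Aᶜ) ≃ Fin n with blockImg e = A, P.act e (lieX P ℓ #A #Aᶜ) := by
    refine sum_bij (fun ef _ => (sumE ef.1 ef.2).trans (shuf A)) ?_ ?_ ?_ ?_
    · intro ef _
      simp [blockImg_sumE, blockImg_shuf]
    · rintro ⟨e, f⟩ _ ⟨e', f'⟩ _ h
      have h' : sumE e f = sumE e' f' := by
        ext x
        have := congrArg (fun t => ((shuf A).symm (t x) : ℕ)) h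
        simpa using this
      have h'' : Equiv.Perm.sumCongrHom _ _ (e, f) = Equiv.Perm.sumCongrHom _ _ (e', f') := by
        ext x : 1
        have := congrArg (fun t => finSumFinEquiv.symm (t (finSumFinEquiv x))) h'
        simpa [sumE] using this
      exact Equiv.Perm.sumCongrHom_injective h''
    · intro t ht
      simp only [mem_filter, mem_univ, true_and] at ht
      obtain ⟨e, f, h⟩ := exists_sumE t (shuf A) (by rw [ht, blockImg_shuf])
      exact ⟨(e, f), mem_univ _, h.symm⟩
    · rintro ⟨e, f⟩ _
      rw [P.act_trans, lieX_act P ℓ hℓ]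
  rw [← this, sum_const, card_univ, Fintype.card_prod, Fintype.card_perm, Fintype.card_perm,
    Fintype.card_fin, Fintype.card_fin]

/-- The inverse factorial. -/
def ifac (K : Type u) [Field K] (n : ℕ) : K := ((n.factorial : K))⁻¹

theorem ifac_mul [CharZero K] (n : ℕ) : ifac K n * (n.factorial : K) = 1 :=
  inv_mul_cancel₀ (Nat.cast_ne_zero.2 n.factorial_ne_zero)

theorem ifac_succ [CharZero K] (n : ℕ) : ifac K (n + 1) * ((n : K) + 1) = ifac K n := by
  have h : ((n : K) + 1) ≠ 0 := by exact_mod_cast Nat.succ_ne_zero n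
  rw [ifac, ifac, Nat.factorial_succ, Nat.cast_mul, mul_inv, Nat.cast_succ]
  field_simp

theorem lieSum_eq [CharZero K] (hℓ : ∀ (n : ℕ) (e : Fin n ≃ Fin n), P.act e (ℓ n) = ℓ n) (n : ℕ) :
    lieSum P ℓ n =
      - ∑ p ∈ antidiagonal n, (ifac K p.1 * ifac K p.2) • symm P n (lieX P ℓ p.1 p.2) := by
  rw [lieSum]
  congr 1
  have key : ∀ p ∈ antidiagonal n, (ifac K p.1 * ifac K p.2) • symm P n (lieX P ℓ p.1 p.2) =
      ∑ A : Finset (Fin n), (ifac K p.1 * ifac K p.2) •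
        ∑ e : Fin (p.1 + p.2) ≃ Fin n with blockImg e = A, P.act e (lieX P ℓ p.1 p.2) := by
    intro p _
    rw [← smul_sum, symm_apply, sum_fiberwise]
  rw [sum_congr rfl key, sum_comm]
  refine sum_congr rfl fun A _ => ?_
  rw [sum_eq_single (#A, #Aᶜ)]
  · simp only
    rw [sum_fiber P ℓ hℓ, ← Nat.cast_smul_eq_nsmul K, smul_smul, Nat.cast_mul]
    have : ifac K #A * ifac K #Aᶜ * (((#A).factorial : K) * ((#Aᶜ).factorial : K)) = 1 := by
      rw [mul_mul_mul_comm, ifac_mul, ifac_mul, one_mul]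
    rw [this, one_smul, lieX]
  · rintro ⟨p, q⟩ hpq hne
    rw [mem_antidiagonal] at hpq
    rw [filter_false_of_mem, sum_empty, smul_zero]
    rintro e - rfl
    apply hne
    have h1 := card_blockImg e
    have h2 := card_compl (blockImg e)
    rw [Fintype.card_fin] at h2
    simp only at hpq
    rw [Prod.mk.injEq]
    omega
  · intro h
    exfalso
    apply h
    rw [mem_antidiagonal]
    simp [card_add_card_compl]

theorem act_lieSum [CharZero K] (hℓ : ∀ (n : ℕ) (e : Fin n ≃ Fin n), P.act e (ℓ n) = ℓ n) (n : ℕ)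
    (e : Fin n ≃ Fin n) : P.act e (lieSum P ℓ n) = lieSum P ℓ n := by
  rw [lieSum_eq P ℓ hℓ]
  simp only [map_neg, map_sum, map_smul, act_symm]

theorem symm_circ_symm (n q : ℕ) {a m : ℕ} {g g' g'' : ℤ} (h : g + g' = g'')
    (x : P.obj (a + 1) g) (y : P.obj m g') :
    symm P n (P.circ h x (symm P q y)) =
      Fintype.card (Fin m ≃ Fin q) • symm P n (P.circ h x y) := by
  rw [symm_apply P q, map_sum, map_sum]
  have : ∀ τ : Fin m ≃ Fin q, symm P n (P.circ h x (P.act τ y)) = symm P n (P.circ h x y) := by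
    intro τ
    conv_lhs => rw [← P.act_refl x, ← sumE_refl]
    rw [P.circ_act, symm_act]
  simp only [this, sum_const, card_univ]

theorem exists_eq_sumE {m p : ℕ} (τ : Fin (m + 1) ≃ Fin (p + 1))
    (h : τ (Fin.last m) = Fin.last p) : ∃ t : Fin m ≃ Fin p, τ = sumE t (Equiv.refl (Fin 1)) := by
  obtain rfl : m = p := by simpa using Fintype.card_congr τ
  let σ : Equiv.Perm (Fin m ⊕ Fin 1) := finSumFinEquiv.trans (τ.trans finSumFinEquiv.symm)
  have hσ : Set.MapsTo σ (Set.range Sum.inl) (Set.range Sum.inl) := by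
    rintro _ ⟨i, rfl⟩
    rcases hx : σ (Sum.inl i) with j | j
    · exact ⟨j, rfl⟩
    · exfalso
      obtain rfl : j = 0 := Subsingleton.elim _ _
      have h1 : τ (Fin.castAdd 1 i) = Fin.last m := by
        have := congrArg finSumFinEquiv hx
        simp only [σ, Equiv.trans_apply, Equiv.apply_symm_apply, finSumFinEquiv_apply_left,
          finSumFinEquiv_apply_right] at this
        rw [this]; rfl
      rw [← h] at h1
      have := congrArg Fin.val (τ.injective h1)
      simp at this
      omega
  obtain ⟨⟨e, f⟩, hef⟩ := Equiv.Perm.mem_sumCongrHom_range_of_perm_mapsTo_inl hσ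
  have hef' : Equiv.sumCongr e f = σ := hef
  obtain rfl : f = Equiv.refl _ := Subsingleton.elim _ _
  refine ⟨e, ?_⟩
  ext x
  simp [sumE, hef', σ]

theorem symm_circ_act_last (n : ℕ) {m p b : ℕ} {g g' g'' : ℤ} (h : g + g' = g'')
    (x : P.obj (m + 1) g) (y : P.obj b g') (τ : Fin (m + 1) ≃ Fin (p + 1))
    (hτ : τ (Fin.last m) = Fin.last p) :
    symm P n (P.circ h (P.act τ x) y) = symm P n (P.circ h x y) := by
  obtain ⟨t, rfl⟩ := exists_eq_sumE τ hτ
  conv_lhs => rw [← P.act_refl y]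
  rw [P.circ_act, symm_act]

theorem card_fix {M p : ℕ} (hM : M = p + 1) (x : Fin M) (y : Fin (p + 1)) :
    #{τ : Fin M ≃ Fin (p + 1) | τ x = y} = p.factorial := by
  subst hM
  have h1 : ∀ x', #{τ : Fin (p + 1) ≃ Fin (p + 1) | τ x' = y} =
      #{τ : Fin (p + 1) ≃ Fin (p + 1) | τ x = y} := by
    intro x'
    refine card_bij' (fun τ _ => (Equiv.swap x x').trans τ) (fun τ _ => (Equiv.swap x x').trans τ)
      ?_ ?_ ?_ ?_
    · intro τ hτ; simpa using hτ
    · intro τ hτ; simpa using hτ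
    · intro τ _; ext z; simp
    · intro τ _; ext z; simp
  have h2 : ∑ x', #{τ : Fin (p + 1) ≃ Fin (p + 1) | τ x' = y} = (p + 1).factorial := by
    have h3 : #(univ : Finset (Fin (p + 1) ≃ Fin (p + 1))) = (p + 1).factorial := by
      rw [card_univ, Fintype.card_perm, Fintype.card_fin]
    rw [← h3, card_eq_sum_card_fiberwise (f := fun τ => τ.symm y) (t := univ) (by simp)]
    refine sum_congr rfl fun x' _ => ?_
    congr 1
    ext τ
    simp only [mem_filter, mem_univ, true_and, Equiv.symm_apply_eq]
    exact eq_comm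
  simp only [h1, sum_const, card_univ, Fintype.card_fin, smul_eq_mul] at h2
  rw [Nat.factorial_succ] at h2
  exact Nat.eq_of_mul_eq_mul_left (Nat.succ_pos p) h2

/-- `ℓ_{a+1}(..., ℓ_{b+1}(..., ℓ_q(...)))` -/
def lieChain (n a b q : ℕ) : P.obj n (-3) :=
  symm P n (P.circ (a := a + b) (g'' := -3) (by norm_num) (lieX P ℓ a (b + 1)) (ℓ q))

/-- `ℓ_{a+2}(..., ℓ_b(...), ℓ_q(...))` -/
def liePar (n a b q : ℕ) : P.obj n (-3) :=
  symm P n (P.circ (g'' := -3) (by norm_num) (P.act (blk a 1 b) (lieX P ℓ (a + 1) b)) (ℓ q))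

theorem lieChain_eq (n a b q : ℕ) : lieChain P ℓ n a b q =
    symm P n (P.circ (g'' := -3) (by norm_num) (ℓ (a + 1)) (lieX P ℓ b q)) := by
  rw [lieChain, lieX, P.circ_assoc (g₂₃ := -2) _ _ (by norm_num) (by norm_num), symm_act]
  rfl

theorem liePar_swap (hℓ : ∀ (n : ℕ) (e : Fin n ≃ Fin n), P.act e (ℓ n) = ℓ n) (n a b q : ℕ) :
    liePar P ℓ n a b q = - liePar P ℓ n a q b := by
  have : sg K (deg (-1 : ℤ) * deg (-1 : ℤ)) = -1 := by
    have : deg (-1 : ℤ) * deg (-1 : ℤ) = 1 := rfl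
    rw [this]; simp [sg]
  rw [liePar, lieX, P.circ_comm (g₁₃ := -2) _ _ (by norm_num) (by norm_num), this, neg_one_smul,
    map_neg, symm_act, hℓ]
  rfl

theorem symm_circ_inr (hℓ : ∀ (n : ℕ) (e : Fin n ≃ Fin n), P.act e (ℓ n) = ℓ n) (n a b p q : ℕ)
    (j : Fin (b + 1)) (τ : Fin (a + (b + 1)) ≃ Fin (p + 1))
    (hτ : τ (Fin.natAdd a j) = Fin.last p) :
    symm P n (P.circ (g'' := -3) (by norm_num) (P.act τ (lieX P ℓ a (b + 1))) (ℓ q)) =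
      lieChain P ℓ n a b q := by
  rw [← lieX_act P ℓ hℓ a (b + 1) (Equiv.refl _) (Equiv.swap j (Fin.last b)), ← P.act_trans]
  refine symm_circ_act_last P n (m := a + b) _ (lieX P ℓ a (b + 1)) _ _ ?_
  have : (Fin.last (a + b) : Fin (a + b + 1)) = Fin.natAdd a (Fin.last b) := rfl
  rw [Equiv.trans_apply, this, ← hτ]
  congr 1
  have e : (Fin.natAdd a (Fin.last b) : Fin (a + (b + 1))) =
    finSumFinEquiv (Sum.inr (Fin.last b)) := rfl
  rw [e, sumE, Equiv.trans_apply, Equiv.symm_apply_apply, Equiv.trans_apply,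
    Equiv.sumCongr_apply, Sum.map_inr, Equiv.swap_apply_right, finSumFinEquiv_apply_right]

theorem symm_circ_inl (hℓ : ∀ (n : ℕ) (e : Fin n ≃ Fin n), P.act e (ℓ n) = ℓ n) (n a b p q : ℕ)
    (j : Fin (a + 1)) (τ : Fin (a + 1 + b) ≃ Fin (p + 1))
    (hτ : τ (Fin.castAdd b j) = Fin.last p) :
    symm P n (P.circ (g'' := -3) (by norm_num) (P.act τ (lieX P ℓ (a + 1) b)) (ℓ q)) =
      liePar P ℓ n a b q := by
  rw [← lieX_act P ℓ hℓ (a + 1) b (Equiv.swap j (Fin.last a)) (Equiv.refl _), ← P.act_trans]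
  have e : (sumE (Equiv.swap j (Fin.last a)) (Equiv.refl (Fin b))).trans τ = (blk a 1 b).trans
      ((blk a 1 b).symm.trans ((sumE (Equiv.swap j (Fin.last a)) (Equiv.refl (Fin b))).trans τ)) := by
    ext x; simp
  rw [e, P.act_trans]
  refine symm_circ_act_last P n _ _ _ _ ?_
  have h1 : (blk a 1 b).symm (Fin.last (a + b)) = Fin.castAdd b (Fin.last a) := by
    rw [Equiv.symm_apply_eq]
    have e1 : (Fin.castAdd b (Fin.last a) : Fin (a + 1 + b)) =
      finSumFinEquiv (Sum.inl (finSumFinEquiv (Sum.inr 0))) := rfl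
    rw [e1]
    simp [blk]
    rfl
  rw [Equiv.trans_apply, h1]
  simp [sumE, hτ]

theorem symm_circ_lieX (n p q a b : ℕ) :
    symm P n (P.circ (g'' := -3) (by norm_num) (symm P (p + 1) (lieX P ℓ a b)) (ℓ q)) =
      (∑ j : Fin a, ∑ τ : Fin (a + b) ≃ Fin (p + 1) with τ (Fin.castAdd b j) = Fin.last p,
        symm P n (P.circ (g'' := -3) (by norm_num) (P.act τ (lieX P ℓ a b)) (ℓ q))) +
      ∑ j : Fin b, ∑ τ : Fin (a + b) ≃ Fin (p + 1) with τ (Fin.natAdd a j) = Fin.last p,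
        symm P n (P.circ (g'' := -3) (by norm_num) (P.act τ (lieX P ℓ a b)) (ℓ q)) := by
  rw [symm_apply P (p + 1), map_sum, LinearMap.sum_apply, map_sum]
  rw [← sum_fiberwise (g := fun τ : Fin (a + b) ≃ Fin (p + 1) => τ.symm (Fin.last p)),
    Fin.sum_univ_add]
  have e : ∀ (x : Fin (a + b)) (τ : Fin (a + b) ≃ Fin (p + 1)),
      τ.symm (Fin.last p) = x ↔ τ x = Fin.last p := by
    intro x τ
    rw [Equiv.symm_apply_eq, eq_comm]
  simp only [e]

theorem der_lieSum [CharZero K] (hℓ : ∀ (n : ℕ) (e : Fin n ≃ Fin n), P.act e (ℓ n) = ℓ n)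
    (d : Der P (-1)) (hd : ∀ (n : ℕ) (h : (-1 : ℤ) + -1 = -2), d.map h (ℓ n) = lieSum P ℓ n) (n : ℕ)
    (h : (-2 : ℤ) + -1 = -3) : d.map h (lieSum P ℓ n) = 0 := by
  have hX : ∀ p q : ℕ, symm P n (d.map h (lieX P ℓ p q)) =
      symm P n (P.circ (g'' := -3) (by norm_num) (lieSum P ℓ (p + 1)) (ℓ q)) -
        symm P n (P.circ (g'' := -3) (by norm_num) (ℓ (p + 1)) (lieSum P ℓ q)) := by
    intro p q
    have : sg K (deg (-1 : ℤ)) = -1 := sg_neg_one K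
    rw [lieX, d.map_circ (g₁' := -2) (g₂' := -2) _ (by norm_num) (by norm_num) _ (by norm_num)
      (by norm_num), hd, hd, this, map_add, neg_one_smul, map_neg, sub_eq_add_neg]
  have hS : d.map h (lieSum P ℓ n) =
      ∑ p ∈ antidiagonal n, (ifac K p.1 * ifac K p.2) •
        symm P n (P.circ (g'' := -3) (by norm_num) (ℓ (p.1 + 1)) (lieSum P ℓ p.2)) -
      ∑ p ∈ antidiagonal n, (ifac K p.1 * ifac K p.2) •
        symm P n (P.circ (g'' := -3) (by norm_num) (lieSum P ℓ (p.1 + 1)) (ℓ p.2)) := by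
    rw [lieSum_eq P ℓ hℓ, map_neg, map_sum]
    simp only [map_smul, der_symm, hX, smul_sub, sum_sub_distrib, neg_sub]
  -- insertion into the inner operation
  have h2 : ∑ p ∈ antidiagonal n, (ifac K p.1 * ifac K p.2) •
      symm P n (P.circ (g'' := -3) (by norm_num) (ℓ (p.1 + 1)) (lieSum P ℓ p.2)) =
      - ∑ p ∈ antidiagonal n, ∑ r ∈ antidiagonal p.2, (ifac K p.1 * ifac K r.1 * ifac K r.2) •
        lieChain P ℓ n p.1 r.1 r.2 := by
    rw [← sum_neg_distrib]
    refine sum_congr rfl fun p _ => ?_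
    rw [lieSum_eq P ℓ hℓ p.2]
    simp only [map_neg, map_sum, map_smul, symm_circ_symm, smul_neg, smul_sum]
    congr 1
    refine sum_congr rfl fun r hr => ?_
    rw [mem_antidiagonal] at hr
    have hc : Fintype.card (Fin (r.1 + r.2) ≃ Fin p.2) = p.2.factorial := by
      rw [hr, Fintype.card_perm, Fintype.card_fin]
    rw [hc, ← Nat.cast_smul_eq_nsmul K, lieChain_eq, smul_smul,
      smul_smul]
    congr 1
    linear_combination (ifac K p.1 * ifac K r.1 * ifac K r.2) * ifac_mul (K := K) p.2
  -- insertion into the outer operation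
  have h1 : ∑ p ∈ antidiagonal n, (ifac K p.1 * ifac K p.2) •
      symm P n (P.circ (g'' := -3) (by norm_num) (lieSum P ℓ (p.1 + 1)) (ℓ p.2)) =
      - (∑ p ∈ antidiagonal n, ∑ r ∈ antidiagonal p.1, (ifac K r.1 * ifac K r.2 * ifac K p.2) •
        liePar P ℓ n r.1 r.2 p.2 +
        ∑ p ∈ antidiagonal n, ∑ r ∈ antidiagonal p.1, (ifac K r.1 * ifac K r.2 * ifac K p.2) •
        lieChain P ℓ n r.1 r.2 p.2) := by
    rw [← sum_add_distrib, ← sum_neg_distrib]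
    refine sum_congr rfl fun s _ => ?_
    obtain ⟨p, q⟩ := s
    simp only
    rw [lieSum_eq P ℓ hℓ (p + 1)]
    simp only [map_neg, map_sum, map_smul, LinearMap.neg_apply, LinearMap.sum_apply,
      LinearMap.smul_apply, smul_neg, symm_circ_lieX P ℓ, smul_add, sum_add_distrib]
    congr 2
    · rw [Finset.Nat.sum_antidiagonal_succ]
      simp only [univ_eq_empty, sum_empty, smul_zero, zero_add]
      rw [smul_sum]
      refine sum_congr rfl fun r hr => ?_
      rw [mem_antidiagonal] at hr
      rw [sum_congr rfl fun j _ => sum_congr rfl fun τ hτ =>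
        symm_circ_inl P ℓ hℓ n r.1 r.2 p q j τ (mem_filter.1 hτ).2]
      simp only [sum_const, card_fix (show r.1 + 1 + r.2 = p + 1 by omega), card_univ,
        Fintype.card_fin, ← Nat.cast_smul_eq_nsmul K, smul_smul]
      congr 1
      push_cast
      linear_combination (ifac K q * ifac K r.2) *
        (ifac K p * (p.factorial : K) * ifac_succ (K := K) r.1 + ifac K r.1 * ifac_mul (K := K) p)
    · rw [Finset.Nat.sum_antidiagonal_succ']
      simp only [univ_eq_empty, sum_empty, smul_zero, zero_add]
      rw [smul_sum]
      refine sum_congr rfl fun r hr => ?_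
      rw [mem_antidiagonal] at hr
      rw [sum_congr rfl fun j _ => sum_congr rfl fun τ hτ =>
        symm_circ_inr P ℓ hℓ n r.1 r.2 p q j τ (mem_filter.1 hτ).2]
      simp only [sum_const, card_fix (show r.1 + (r.2 + 1) = p + 1 by omega), card_univ,
        Fintype.card_fin, ← Nat.cast_smul_eq_nsmul K, smul_smul]
      congr 1
      push_cast
      linear_combination (ifac K q * ifac K r.1) *
        (ifac K p * (p.factorial : K) * ifac_succ (K := K) r.2 + ifac K r.2 * ifac_mul (K := K) p)
  have h3 : ∑ p ∈ antidiagonal n, ∑ r ∈ antidiagonal p.1,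
      (ifac K r.1 * ifac K r.2 * ifac K p.2) • liePar P ℓ n r.1 r.2 p.2 = 0 := by
    have e := sum_triple_comm n fun a b c =>
      (ifac K a * ifac K b * ifac K c) • liePar P ℓ n a b c
    have e' : ∑ p ∈ antidiagonal n, ∑ r ∈ antidiagonal p.1,
      (ifac K r.1 * ifac K p.2 * ifac K r.2) • liePar P ℓ n r.1 p.2 r.2 =
      - ∑ p ∈ antidiagonal n, ∑ r ∈ antidiagonal p.1,
      (ifac K r.1 * ifac K r.2 * ifac K p.2) • liePar P ℓ n r.1 r.2 p.2 := by
      rw [← sum_neg_distrib]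
      refine sum_congr rfl fun p _ => ?_
      rw [← sum_neg_distrib]
      refine sum_congr rfl fun r _ => ?_
      rw [liePar_swap P ℓ hℓ, smul_neg, mul_right_comm]
    rw [e'] at e
    have e2 : (2 : K) • ∑ p ∈ antidiagonal n, ∑ r ∈ antidiagonal p.1,
      (ifac K r.1 * ifac K r.2 * ifac K p.2) • liePar P ℓ n r.1 r.2 p.2 = 0 := by
      rw [two_smul]
      nth_rewrite 1 [e]
      rw [neg_add_cancel]
    exact (smul_eq_zero.1 e2).resolve_left two_ne_zero
  rw [hS, h1, h2, h3, zero_add, sum_triple n fun a b c =>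
      (ifac K a * ifac K b * ifac K c) • lieChain P ℓ n a b c]
  simp

end Sym

end LInf

section CLInf

variable (K : Type u) [Field K]

/-- The generators `ℓ_n`, `n ≥ 0`, of arity `n` and degree `-1`. -/
inductive LGen : ℕ → ℤ → Type u
  | ell (n : ℕ) : LGen n (-1)

/-- The generators are invariant under the symmetric groups. -/
inductive LRel : ∀ ⦃n : ℕ⦄ ⦃g : ℤ⦄, Pre K LGen.{u} n g → Pre K LGen.{u} n g → Prop
  | symm (n : ℕ) (e : Fin n ≃ Fin n) : LRel (.act e (.gen (.ell n))) (.gen (.ell n))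

/-- The free symmetric operad on the invariant generators `ℓ_n`. -/
def freeL : GOperad K ℤ := Pres (LRel K)

/-- The generator `ℓ_n`. -/
def ell (n : ℕ) : (freeL K).obj n (-1) := Pres.gen (LRel K) (.ell n)

theorem act_ell (n : ℕ) (e : Fin n ≃ Fin n) : (freeL K).act e (ell K n) = ell K n :=
  Pres.sound _ (.of (.symm n e))

/-- The values of the differential of `cL∞` on the generators. -/
def ellDer : ∀ ⦃n : ℕ⦄ ⦃g g' : ℤ⦄, g + -1 = g' → LGen.{u} n g → (freeL K).obj n g'
  | _, _, _, h, .ell n => (freeL K).cast (by omega) (lieSum (freeL K) (ell K) n)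

variable [CharZero K]

/-- The differential of `cL∞`. -/
def cLinfDer : Der (freeL K) (-1) :=
  Pres.der (R := LRel K) (ellDer K) rfl (by
    intro n g g' h x y r
    cases r with
    | symm e =>
      change (freeL K).act e ((freeL K).cast _ (lieSum (freeL K) (ell K) n)) =
        (freeL K).cast _ (lieSum (freeL K) (ell K) n)
      rw [← GOperad.cast_act, act_lieSum _ _ (act_ell K)])

theorem cLinfDer_ell (n : ℕ) (h : (-1 : ℤ) + -1 = -2) :
    (cLinfDer K).map h (ell K n) = lieSum (freeL K) (ell K) n := rfl

/-- The curved L-infinity operad `cL∞`: the free operad on the generators `ℓ_n`, `n ≥ 0`, with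
differential `d ℓ_n = - ∑_{p+q=n} ∑_σ σ · (ℓ_{p+1} ∘ ℓ_q)`. -/
def cLinf : DGOp K where
  toGOperad := freeL K
  d := cLinfDer K
  d_sq {n i j k} h h' x := by
    have key := Pres.der_anticomm (R := LRel K) (δ := -1) (δ' := -1) rfl rfl (cLinfDer K) (cLinfDer K) (by
      rintro n g g₁ g₂ g' h₁ h₁' h₂ h₂' ⟨n⟩
      obtain rfl : g₁ = -2 := by omega
      obtain rfl : g₂ = -2 := by omega
      obtain rfl : g' = -3 := by omega
      have : (cLinfDer K).map h₁' ((cLinfDer K).map h₁ (Pres.gen (LRel K) (.ell n))) = 0 :=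
        der_lieSum (freeL K) (ell K) (act_ell K) (cLinfDer K) (cLinfDer_ell K) n _
      exact (congrArg₂ (· + ·) this this).trans (add_zero _)) h h' h h' x
    rw [← two_smul K] at key
    exact (smul_eq_zero.1 key).resolve_left two_ne_zero

end CLInf

/-! ### The category `Curv^Σ` -/

section Curv

variable {K : Type u} [Field K]

/-- The weight-graded operad `Q₀ ∨ [κ]`, with `κ` of arity zero, degree `-1` and weight `1`. -/
abbrev adjKappa (Q₀ : GOperad K ℤ) : GOperad K (ℤ × ℕ) :=
  Adj Q₀ (AddMonoidHom.inl ℤ ℕ) (fun _ : Unit => ((-1 : ℤ), 1))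

/-- The natural morphism `Q₀ ∨ [κ] → Q` determined by a sub-operad `Q₀` of `Q` and an element `κ`
of `Q`, in arity `n`, degree `i` and weight `w`. -/
def kappaMap (Q : GOperad K ℤ) (κ : Q.obj 0 (-1)) (Q₀ : SubOperad Q) (n : ℕ) (i : ℤ) (w : ℕ) :
    (adjKappa Q₀.toGOperad).obj n (i, w) →ₗ[K] Q.obj n i :=
  Adj.lift Q₀.toGOperad (AddMonoidHom.inl ℤ ℕ) (fun _ : Unit => ((-1 : ℤ), 1)) Q
    (AddMonoidHom.fst ℤ ℕ) (fun _ => rfl)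
    (fun _ _ _ h => (Q.cast (by rw [← h]; rfl)).comp (Q₀.carrier _ _).subtype)
    (fun _ _ h => Q.cast (by rw [← h]; rfl) κ)
    (fun _ _ _ => Q.cast_act _ _ _) (fun _ => rfl)
    (fun _ _ _ _ _ _ _ => Q.cast_circ _ _ _ _ _ _ _) (g := (i, w))

/-- The subspace `Q_w` of elements of weight `w`: those given by expressions in elements of `Q₀`
and exactly `w` copies of `κ`. -/
def weightPart (Q : GOperad K ℤ) (κ : Q.obj 0 (-1)) (Q₀ : SubOperad Q) (w n : ℕ) (i : ℤ) :
    Submodule K (Q.obj n i) := LinearMap.range (kappaMap Q κ Q₀ n i w)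

/-- Quadruples `(Q, d, κ, Q₀)`. -/
structure CurvData (K : Type u) [Field K] where
  Q : DGOp K
  κ : Q.obj 0 (-1)
  Q₀ : SubOperad Q.toGOperad

/-- The conditions on the objects of `Curv^Σ`. -/
structure CurvData.IsCurv (C : CurvData K) : Prop where
  /-- `κ` is not in `Q₀`. -/
  kappa_notMem : C.κ ∉ C.Q₀.carrier 0 (-1)
  /-- The natural morphism `Q₀ ∨ [κ] → Q` is an isomorphism. -/
  free : ∀ (n : ℕ) (i : ℤ), Function.Bijective
    (DirectSum.toModule K ℕ (C.Q.obj n i) (kappaMap C.Q.toGOperad C.κ C.Q₀ n i))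
  /-- `d = d₀ + d₁` where `d_i` raises the weight by `i`. -/
  strict_mixed : ∀ (w n : ℕ) (i j : ℤ) (h : i + -1 = j) (x : C.Q.obj n i),
    x ∈ weightPart C.Q.toGOperad C.κ C.Q₀ w n i →
      C.Q.d.map h x ∈ weightPart C.Q.toGOperad C.κ C.Q₀ w n j ⊔
        weightPart C.Q.toGOperad C.κ C.Q₀ (w + 1) n j
  /-- `d₁ κ = 0`, i.e. `d κ` has weight `1`, like `κ`. -/
  d_kappa : C.Q.d.map (show (-1 : ℤ) + -1 = -2 by norm_num) C.κ ∈
    weightPart C.Q.toGOperad C.κ C.Q₀ 1 0 (-2)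

variable (K) in
/-- The objects of the category `Curv^Σ`. -/
structure Curv extends CurvData K where
  isCurv : toCurvData.IsCurv

/-- Morphisms of quadruples. -/
@[ext]
structure CurvHom (C C' : CurvData K) where
  hom : C.Q ⟶ C'.Q
  map_kappa : app hom C.κ = C'.κ
  map_mem : ∀ {n : ℕ} {i : ℤ} (x : C.Q.obj n i), x ∈ C.Q₀.carrier n i →
    app hom x ∈ C'.Q₀.carrier n i

/-- The category `Curv^Σ`. -/
instance Curv.category : Category (Curv K) where
  Hom C C' := CurvHom C.toCurvData C'.toCurvData
  id C := ⟨𝟙 C.Q, rfl, fun _ hx => hx⟩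
  comp f g := ⟨f.hom ≫ g.hom, by rw [app_comp, f.map_kappa, g.map_kappa],
    fun x hx => g.map_mem _ (f.map_mem x hx)⟩

/-- The underlying morphism of dg operads. -/
def Curv.homOp {C C' : Curv K} (f : C ⟶ C') : C.Q ⟶ C'.Q := CurvHom.hom f

/-- In an object of `Curv^Σ` the unit does not vanish. -/
theorem Curv.one_ne_zero (C : Curv K) : C.Q.one ≠ 0 := by
  intro h
  apply C.isCurv.kappa_notMem
  have : C.κ = 0 := by
    have e := C.Q.one_circ (zero_add _) C.κ
    rw [h, map_zero, LinearMap.zero_apply] at e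
    have e' : C.Q.act (finCongr (Nat.zero_add 0).symm) C.κ = C.κ := C.Q.act_refl _
    rw [← e', ← e]
  rw [this]
  exact Submodule.zero_mem _

variable [CharZero K]

/-- A morphism of dg operads `φ : cL∞ → Q` is a morphism of quadruples from
`(cL∞, d, ℓ₀, ⟨ℓ_i⟩_{i > 0})` if it sends `ℓ₀` to `κ` and `ℓ_i` to `Q₀` for `i > 0`. -/
def IsCurvStructure (C : Curv K) (φ : cLinf K ⟶ C.Q) : Prop :=
  app φ (ell K 0) = C.κ ∧ ∀ n : ℕ, app φ (ell K (n + 1)) ∈ C.Q₀.carrier (n + 1) (-1)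

variable (K) in
/-- The property of dg operads under `cL∞` of being nonzero. -/
def nonzeroUnder : ObjectProperty (Under (cLinf K)) := fun P => P.right.one ≠ 0

variable (K) in
/-- The category `cL∞ ↓ dg-Op` of (nonzero) dg operads under `cL∞`. -/
abbrev UnderCL := (nonzeroUnder K).FullSubcategory

/-- The forgetful functor `Curv^Σ → (cL∞ ↓ dg-Op)`, `(Q, d, κ, Q₀) ↦ (Q, d)`, which is well-defined
since there is a unique morphism of quadruples from `cL∞` to `(Q, d, κ, Q₀)`. -/
noncomputable def forgetL (h : ∀ C : Curv K, ∃! φ : cLinf K ⟶ C.Q, IsCurvStructure C φ) :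
    Curv K ⥤ UnderCL K where
  obj C := ⟨Under.mk (h C).choose, C.one_ne_zero⟩
  map {C C'} f := ObjectProperty.homMk (Under.homMk (Curv.homOp f) (by
    refine (h C').choose_spec.2 _ ⟨?_, fun n => ?_⟩
    · change app (Curv.homOp f) (app (h C).choose (ell K 0)) = _
      rw [(h C).choose_spec.1.1]
      exact CurvHom.map_kappa f
    · exact CurvHom.map_mem f _ ((h C).choose_spec.1.2 n)))
  map_id _ := rfl
  map_comp _ _ := rfl

end Curv

/-! ### The completed coproduct with `T` -/

section Twist

variable {K : Type u} [Field K]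

/-- The two generators of `T`. -/
inductive TGen : Type
  | alpha
  | kappa

/-- The degrees of the generators of `T`.  In `((i, w), N) : (ℤ × ℕ) × ℕ`, `i` is the homological
degree, `w` is the number of `κ`, and `N` is the total number of `α` and `κ`. -/
def TGen.gr : TGen → (ℤ × ℕ) × ℕ
  | .alpha => ((0, 0), 1)
  | .kappa => ((-1, 1), 1)

theorem TGen.gr_alpha : TGen.alpha.gr = ((0, 0), 1) := rfl

theorem TGen.gr_kappa : TGen.kappa.gr = ((-1, 1), 1) := rfl

/-- The inclusion of degrees `i ↦ ((i, 0), 0)`. -/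
def embT : ℤ →+ (ℤ × ℕ) × ℕ := (AddMonoidHom.inl (ℤ × ℕ) ℕ).comp (AddMonoidHom.inl ℤ ℕ)

theorem embT_apply (i : ℤ) : embT i = ((i, 0), 0) := rfl

/-- The coproduct `P ∨ T`, graded by the homological degree, the number of `κ` and the total number
of `α` and `κ`. -/
abbrev adjT (P : GOperad K ℤ) : GOperad K ((ℤ × ℕ) × ℕ) := Adj P embT TGen.gr

/-- The derivation `d_P` of `P ∨ T`, extending the differential of `P` by zero on `α`, `κ`. -/
def derP (P : DGOp K) : Der (adjT P.toGOperad) ((-1, 0), 0) :=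
  Adj.der P.toGOperad embT TGen.gr ((-1, 0), 0)
    (fun _ i _ _ k h => (Adj.of P.toGOperad embT TGen.gr (i := i + -1)
      (by rw [← k, ← h]; rfl)).comp (P.d.map rfl))
    (fun _ _ _ _ _ => 0) rfl
    (fun k h e x => by
      simp only [LinearMap.comp_apply]
      rw [P.d.map_act, Adj.of_act])
    (fun k h => by
      simp only [LinearMap.comp_apply]
      rw [P.d.map_one, map_zero])
    (fun h₁ h₂ h₃ h k₁ k₂ k h' h'' x y => by
      subst h₁
      simp only [LinearMap.comp_apply]
      rw [P.d.map_circ h rfl rfl rfl (by omega) (by omega), map_add, map_smul,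
        Adj.of_circ (h₁ := by rw [← k₁]; rfl) (h₂ := h₂) (h' := h'),
        Adj.of_circ (h₁ := rfl) (h₂ := by rw [← k₂, ← h₂]; rfl) (h' := h'')]
      rfl)

/-- The derivation `d_T` of `P ∨ T`: zero on `P`, and `α ↦ κ`, `κ ↦ 0`. -/
def derT (P : GOperad K ℤ) : Der (adjT P) ((-1, 1), 0) :=
  Adj.der P embT TGen.gr ((-1, 1), 0) (fun _ _ _ _ _ _ => 0)
    (fun v _ _ k h => match v, h with
      | .alpha, h => Adj.var P embT TGen.gr .kappa (by rw [← k, ← h]; rfl)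
      | .kappa, _ => 0)
    rfl (fun _ _ _ _ => by simp) (fun _ _ => rfl) (fun _ _ _ _ _ _ _ _ _ _ _ => by simp)

theorem derP_of (P : DGOp K) {n : ℕ} {i : ℤ} {g g' : (ℤ × ℕ) × ℕ} (k : g + ((-1, 0), 0) = g')
    (h : embT i = g) (h' : embT (i + -1) = g') (x : P.obj n i) :
    (derP P).map k (Adj.of P.toGOperad embT TGen.gr h x) =
      Adj.of P.toGOperad embT TGen.gr h' (P.d.map rfl x) := rfl

theorem derP_var (P : DGOp K) (v : TGen) {g g' : (ℤ × ℕ) × ℕ} (k : g + ((-1, 0), 0) = g')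
    (h : v.gr = g) : (derP P).map k (Adj.var P.toGOperad embT TGen.gr v h) = 0 := rfl

theorem derT_of (P : GOperad K ℤ) {n : ℕ} {i : ℤ} {g g' : (ℤ × ℕ) × ℕ}
    (k : g + ((-1, 1), 0) = g') (h : embT i = g) (x : P.obj n i) :
    (derT P).map k (Adj.of P embT TGen.gr h x) = 0 := rfl

theorem derT_alpha (P : GOperad K ℤ) {g g' : (ℤ × ℕ) × ℕ} (k : g + ((-1, 1), 0) = g')
    (h : TGen.alpha.gr = g) (h' : TGen.kappa.gr = g') :
    (derT P).map k (Adj.var P embT TGen.gr .alpha h) = Adj.var P embT TGen.gr .kappa h' := rfl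

theorem derT_kappa (P : GOperad K ℤ) {g g' : (ℤ × ℕ) × ℕ} (k : g + ((-1, 1), 0) = g')
    (h : TGen.kappa.gr = g) : (derT P).map k (Adj.var P embT TGen.gr .kappa h) = 0 := rfl

theorem derP_derP [CharZero K] (P : DGOp K) {n : ℕ} {g g₁ g₂ : (ℤ × ℕ) × ℕ}
    (h : g + ((-1, 0), 0) = g₁) (h' : g₁ + ((-1, 0), 0) = g₂) (x : (adjT P.toGOperad).obj n g) :
    (derP P).map h' ((derP P).map h x) = 0 := by
  have key := Pres.der_anticomm (R := AdjRel P.toGOperad embT TGen.gr) rfl rfl (derP P) (derP P) (by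
    rintro n g g₁ g₂ g' h₁ h₁' h₂ h₂' (⟨h, x⟩ | ⟨v, h⟩)
    · have : ∀ {g₁ : (ℤ × ℕ) × ℕ} (h₁ : g + ((-1, 0), 0) = g₁) (h₁' : g₁ + ((-1, 0), 0) = g'),
          (derP P).map h₁' ((derP P).map h₁ (Adj.of P.toGOperad embT TGen.gr h x)) = 0 := by
        intro g₁ h₁ h₁'
        rw [derP_of P h₁ h (by rw [← h₁, ← h]; rfl),
          derP_of P h₁' _ (by rw [← h₁', ← h₁, ← h]; rfl), P.d_sq, map_zero]
      exact (congrArg₂ (· + ·) (this h₁ h₁') (this h₂ h₂')).trans (add_zero _)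
    · have : ∀ {g₁ : (ℤ × ℕ) × ℕ} (h₁ : g + ((-1, 0), 0) = g₁) (h₁' : g₁ + ((-1, 0), 0) = g'),
          (derP P).map h₁' ((derP P).map h₁ (Adj.var P.toGOperad embT TGen.gr v h)) = 0 := by
        intro g₁ h₁ h₁'
        rw [derP_var, map_zero]
      exact (congrArg₂ (· + ·) (this h₁ h₁') (this h₂ h₂')).trans (add_zero _)) h h' h h' x
  rw [← two_smul K] at key
  exact (smul_eq_zero.1 key).resolve_left two_ne_zero

theorem derT_derT [CharZero K] (P : GOperad K ℤ) {n : ℕ} {g g₁ g₂ : (ℤ × ℕ) × ℕ}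
    (h : g + ((-1, 1), 0) = g₁) (h' : g₁ + ((-1, 1), 0) = g₂) (x : (adjT P).obj n g) :
    (derT P).map h' ((derT P).map h x) = 0 := by
  have key := Pres.der_anticomm (R := AdjRel P embT TGen.gr) rfl rfl (derT P) (derT P) (by
    rintro n g g₁ g₂ g' h₁ h₁' h₂ h₂' (⟨h, x⟩ | ⟨v, h⟩)
    · have : ∀ {g₁ : (ℤ × ℕ) × ℕ} (h₁ : g + ((-1, 1), 0) = g₁) (h₁' : g₁ + ((-1, 1), 0) = g'),
          (derT P).map h₁' ((derT P).map h₁ (Adj.of P embT TGen.gr h x)) = 0 := by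
        intro g₁ h₁ h₁'
        rw [derT_of, map_zero]
      exact (congrArg₂ (· + ·) (this h₁ h₁') (this h₂ h₂')).trans (add_zero _)
    · have : ∀ {g₁ : (ℤ × ℕ) × ℕ} (h₁ : g + ((-1, 1), 0) = g₁) (h₁' : g₁ + ((-1, 1), 0) = g'),
          (derT P).map h₁' ((derT P).map h₁ (Adj.var P embT TGen.gr v h)) = 0 := by
        intro g₁ h₁ h₁'
        cases v with
        | alpha => rw [derT_alpha P h₁ h (by rw [← h₁, ← h]; rfl), derT_kappa]
        | kappa => rw [derT_kappa, map_zero]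
      exact (congrArg₂ (· + ·) (this h₁ h₁') (this h₂ h₂')).trans (add_zero _)) h h' h h' x
  rw [← two_smul K] at key
  exact (smul_eq_zero.1 key).resolve_left two_ne_zero

theorem derP_derT (P : DGOp K) {n : ℕ} {g g₁ g₂ g' : (ℤ × ℕ) × ℕ}
    (h₁ : g + ((-1, 0), 0) = g₁) (h₁' : g₁ + ((-1, 1), 0) = g') (h₂ : g + ((-1, 1), 0) = g₂)
    (h₂' : g₂ + ((-1, 0), 0) = g') (x : (adjT P.toGOperad).obj n g) :
    (derT P.toGOperad).map h₁' ((derP P).map h₁ x) +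
      (derP P).map h₂' ((derT P.toGOperad).map h₂ x) = 0 := by
  refine Pres.der_anticomm (R := AdjRel P.toGOperad embT TGen.gr) rfl rfl (derP P)
    (derT P.toGOperad) ?_ h₁ h₁' h₂ h₂' x
  rintro n g g₁ g₂ g' h₁ h₁' h₂ h₂' (⟨h, x⟩ | ⟨v, h⟩)
  · have e₁ : (derT P.toGOperad).map h₁' ((derP P).map h₁ (Adj.of P.toGOperad embT TGen.gr h x)) =
        0 := by
      rw [derP_of P h₁ h (by rw [← h₁, ← h]; rfl), derT_of]
    have e₂ : (derP P).map h₂' ((derT P.toGOperad).map h₂ (Adj.of P.toGOperad embT TGen.gr h x)) =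
        0 := by
      rw [derT_of, map_zero]
    exact (congrArg₂ (· + ·) e₁ e₂).trans (add_zero _)
  · have e₁ : (derT P.toGOperad).map h₁' ((derP P).map h₁ (Adj.var P.toGOperad embT TGen.gr v h)) =
        0 := by
      rw [derP_var, map_zero]
    have e₂ : (derP P).map h₂' ((derT P.toGOperad).map h₂ (Adj.var P.toGOperad embT TGen.gr v h)) =
        0 := by
      cases v with
      | alpha => rw [derT_alpha _ h₂ h (by rw [← h₂, ← h]; rfl), derP_var]
      | kappa => rw [derT_kappa, map_zero]
    exact (congrArg₂ (· + ·) e₁ e₂).trans (add_zero _)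

/-- The completed coproduct `P ∨̂ T`, as a graded operad.

An element of arity `n` and degree `i` is a family `x w N` of elements of `P ∨ T` with
`w` occurrences of `κ` and `N` occurrences of `α` or `κ` (hence `N - w` occurrences of `α`), thought
of as the sum `∑_{w, N} x w N`, such that only finitely many `w` occur.
Thus for each fixed number of `κ` we complete with respect to the number of `α`, and
`P ∨̂ T` remains the direct sum of its parts of fixed `κ`-weight. -/
def hatT (P : GOperad K ℤ) : GOperad K ℤ := (serFin (Ser (adjT P))).toGOperad

/-- The component of an element of `P ∨̂ T` with `w` occurrences of `κ` and `N` occurrences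
of `α` or `κ`. -/
def hatT.coeff {P : GOperad K ℤ} {n : ℕ} {i : ℤ} (x : (hatT P).obj n i) (w N : ℕ) :
    (adjT P).obj n ((i, w), N) := x.1 w N

theorem hatT.ext {P : GOperad K ℤ} {n : ℕ} {i : ℤ} {x y : (hatT P).obj n i}
    (h : ∀ w N, hatT.coeff x w N = hatT.coeff y w N) : x = y :=
  Subtype.ext (funext fun w => funext fun N => h w N)

/-- The differential `d_P + d_T` on the operad of all series. -/
def serDer (P : DGOp K) : Der (Ser (Ser (adjT P.toGOperad))) (-1) :=
  Der.add (derP P).ser₀.ser₀ (derT P.toGOperad).ser₀.ser₁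

/-- The differential `d_P + d_T` of `P ∨̂ T`. -/
def hatDer (P : DGOp K) : Der (hatT P.toGOperad) (-1) :=
  (serDer P).restrict (serFin _) (by
    rintro n g g' h x ⟨W, hW⟩
    refine ⟨W + 1, fun w hw => ?_⟩
    obtain ⟨w, rfl⟩ : ∃ v, w = v + 1 := ⟨w - 1, by omega⟩
    change (derP P).ser₀.map (g := (g, w + 1)) (g' := (g', w + 1)) (Prod.ext h rfl) (x (w + 1)) +
      (derT P.toGOperad).ser₀.map (g := (g, w)) (g' := (g', w + 1)) (Prod.ext h rfl) (x w) = 0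
    rw [hW (w + 1) (by omega), hW w (by omega), map_zero, map_zero, add_zero])

theorem hatDer_coeff_zero (P : DGOp K) {n : ℕ} {i j : ℤ} (h : i + -1 = j)
    (x : (hatT P.toGOperad).obj n i) (N : ℕ) :
    hatT.coeff ((hatDer P).map h x) 0 N =
      (derP P).map (g := ((i, 0), N)) (g' := ((j, 0), N)) (Prod.ext (Prod.ext h rfl) rfl)
        (hatT.coeff x 0 N) :=
  add_zero _

theorem hatDer_coeff_succ (P : DGOp K) {n : ℕ} {i j : ℤ} (h : i + -1 = j)
    (x : (hatT P.toGOperad).obj n i) (w N : ℕ) :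
    hatT.coeff ((hatDer P).map h x) (w + 1) N =
      (derP P).map (g := ((i, w + 1), N)) (g' := ((j, w + 1), N)) (Prod.ext (Prod.ext h rfl) rfl)
          (hatT.coeff x (w + 1) N) +
        (derT P.toGOperad).map (g := ((i, w), N)) (g' := ((j, w + 1), N))
          (Prod.ext (Prod.ext h rfl) rfl) (hatT.coeff x w N) :=
  rfl

/-- The dg operad `(P ∨̂ T, d_P + d_T)`. -/
def hatTDG [CharZero K] (P : DGOp K) : DGOp K where
  toGOperad := hatT P.toGOperad
  d := hatDer P
  d_sq {n i j k} h h' x := by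
    refine hatT.ext fun w N => ?_
    change _ = 0
    cases w with
    | zero => rw [hatDer_coeff_zero, hatDer_coeff_zero, derP_derP]
    | succ w =>
      rw [hatDer_coeff_succ, hatDer_coeff_succ, map_add, derP_derP, zero_add]
      cases w with
      | zero =>
        rw [hatDer_coeff_zero]
        exact (add_comm _ _).trans (derP_derT P _ _ _ _ _)
      | succ w =>
        rw [hatDer_coeff_succ, map_add, derT_derT, add_zero]
        exact (add_comm _ _).trans (derP_derT P _ _ _ _ _)

/-- The morphism `f ∨ 1_T : P ∨ T → P' ∨ T` induced by `f : P → P'`. -/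
def adjTMap {P P' : GOperad K ℤ} (f : GHom P P') : GHom (adjT P) (adjT P') where
  map {n g} := Adj.lift P embT TGen.gr (adjT P') (AddMonoidHom.id _) (fun _ => rfl)
    (fun _ _ _ h => (Adj.of P' embT TGen.gr h).comp f.map)
    (fun v _ h => Adj.var P' embT TGen.gr v h)
    (fun h e x => by simp only [LinearMap.comp_apply, f.map_act, Adj.of_act])
    (fun h => by simp only [LinearMap.comp_apply, f.map_one]; exact Adj.of_one _ _ _ h)
    (fun h₁ h₂ h₃ h h' x y => by
      simp only [LinearMap.comp_apply, f.map_circ]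
      exact Adj.of_circ _ _ _ h₁ h₂ h₃ h h' _ _)
  map_act e x := by
    induction x using Pres.ind
    rfl
  map_one := rfl
  map_circ h x y := by
    induction x using Pres.ind; induction y using Pres.ind
    rfl

theorem adjTMap_of {P P' : GOperad K ℤ} (f : GHom P P') {n : ℕ} {i : ℤ} {g : (ℤ × ℕ) × ℕ}
    (h : embT i = g) (x : P.obj n i) : (adjTMap f).map (Adj.of P embT TGen.gr h x) =
      Adj.of P' embT TGen.gr h (f.map x) := rfl

theorem adjTMap_var {P P' : GOperad K ℤ} (f : GHom P P') (v : TGen) {g : (ℤ × ℕ) × ℕ}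
    (h : v.gr = g) : (adjTMap f).map (Adj.var P embT TGen.gr v h) =
      Adj.var P' embT TGen.gr v h := rfl

end Twist

section TwistFunctor

variable {K : Type u} [Field K]

theorem adjTMap_derP {P P' : DGOp K} (f : DGHom P P') {n : ℕ} {g g' : (ℤ × ℕ) × ℕ}
    (h : g + ((-1, 0), 0) = g') (x : (adjT P.toGOperad).obj n g) :
    (adjTMap f.toGHom).map ((derP P).map h x) = (derP P').map h ((adjTMap f.toGHom).map x) := by
  suffices H : ∀ {n : ℕ} {g : (ℤ × ℕ) × ℕ} (x : (adjT P.toGOperad).obj n g)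
      {g' : (ℤ × ℕ) × ℕ} (h : g + ((-1, 0), 0) = g'),
      (adjTMap f.toGHom).map ((derP P).map h x) = (derP P').map h ((adjTMap f.toGHom).map x) from
    H x h
  intro n g x
  refine Adj.induction P.toGOperad embT TGen.gr (p := fun {n g} x => ∀ {g' : (ℤ × ℕ) × ℕ}
    (h : g + ((-1, 0), 0) = g'), (adjTMap f.toGHom).map ((derP P).map h x) =
      (derP P').map h ((adjTMap f.toGHom).map x)) ?_ ?_ ?_ ?_ ?_ ?_ ?_ x
  · intro n i g h x g' k
    have h' : embT (i + -1) = g' := by rw [← k, ← h]; rfl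
    rw [derP_of P k h h', adjTMap_of, adjTMap_of, derP_of P' k h h', f.map_d]
  · intro v g h g' k
    rw [derP_var, adjTMap_var, derP_var, map_zero]
  · intro n g g' k
    simp only [map_zero]
  · intro n g x y hx hy g' k
    simp only [map_add, hx, hy]
  · intro n g c x hx g' k
    simp only [map_smul, hx]
  · intro m n g e x hx g' k
    rw [Der.map_act, GHom.map_act, GHom.map_act, Der.map_act, hx]
  · intro a b g₁ g₂ g h x y hx hy g' k
    have k₁ : g₁ + ((-1, 0), 0) + g₂ = g' := by rw [← k, ← h, add_right_comm]
    have k₂ : g₁ + (g₂ + ((-1, 0), 0)) = g' := by rw [← k, ← h, add_assoc]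
    rw [Der.map_circ _ h rfl rfl k k₁ k₂, GHom.map_circ, Der.map_circ _ h rfl rfl k k₁ k₂, map_add,
      map_smul, GHom.map_circ, GHom.map_circ, hx, hy]

theorem adjTMap_derT {P P' : GOperad K ℤ} (f : GHom P P') {n : ℕ} {g g' : (ℤ × ℕ) × ℕ}
    (h : g + ((-1, 1), 0) = g') (x : (adjT P).obj n g) :
    (adjTMap f).map ((derT P).map h x) = (derT P').map h ((adjTMap f).map x) := by
  suffices H : ∀ {n : ℕ} {g : (ℤ × ℕ) × ℕ} (x : (adjT P).obj n g)
      {g' : (ℤ × ℕ) × ℕ} (h : g + ((-1, 1), 0) = g'),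
      (adjTMap f).map ((derT P).map h x) = (derT P').map h ((adjTMap f).map x) from
    H x h
  intro n g x
  refine Adj.induction P embT TGen.gr (p := fun {n g} x => ∀ {g' : (ℤ × ℕ) × ℕ}
    (h : g + ((-1, 1), 0) = g'), (adjTMap f).map ((derT P).map h x) =
      (derT P').map h ((adjTMap f).map x)) ?_ ?_ ?_ ?_ ?_ ?_ ?_ x
  · intro n i g h x g' k
    rw [derT_of, adjTMap_of, derT_of, map_zero]
  · intro v g h g' k
    cases v with
    | alpha =>
      have h' : TGen.kappa.gr = g' := by rw [← k, ← h]; rfl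
      rw [derT_alpha P k h h', adjTMap_var, adjTMap_var, derT_alpha P' k h h']
    | kappa => rw [derT_kappa, adjTMap_var, derT_kappa, map_zero]
  · intro n g g' k
    simp only [map_zero]
  · intro n g x y hx hy g' k
    simp only [map_add, hx, hy]
  · intro n g c x hx g' k
    simp only [map_smul, hx]
  · intro m n g e x hx g' k
    rw [Der.map_act, GHom.map_act, GHom.map_act, Der.map_act, hx]
  · intro a b g₁ g₂ g h x y hx hy g' k
    have k₁ : g₁ + ((-1, 1), 0) + g₂ = g' := by rw [← k, ← h, add_right_comm]
    have k₂ : g₁ + (g₂ + ((-1, 1), 0)) = g' := by rw [← k, ← h, add_assoc]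
    rw [Der.map_circ _ h rfl rfl k k₁ k₂, GHom.map_circ, Der.map_circ _ h rfl rfl k k₁ k₂, map_add,
      map_smul, GHom.map_circ, GHom.map_circ, hx, hy]

/-- The morphism `P ∨̂ T → P' ∨̂ T` induced by `f`, on underlying graded operads. -/
def hatTGMap {P P' : GOperad K ℤ} (f : GHom P P') : GHom (hatT P) (hatT P') where
  map := (adjTMap f).ser.ser.map.restrict (by
    rintro x ⟨W, hW⟩
    refine ⟨W, fun w hw => ?_⟩
    change (adjTMap f).ser.map (x w) = 0
    rw [hW w hw, map_zero])
  map_act e x := Subtype.ext ((adjTMap f).ser.ser.map_act e x.1)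
  map_one := Subtype.ext (adjTMap f).ser.ser.map_one
  map_circ h x y := Subtype.ext ((adjTMap f).ser.ser.map_circ h x.1 y.1)

theorem hatTGMap_coeff {P P' : GOperad K ℤ} (f : GHom P P') {n : ℕ} {i : ℤ}
    (x : (hatT P).obj n i) (w N : ℕ) :
    hatT.coeff ((hatTGMap f).map x) w N = (adjTMap f).map (hatT.coeff x w N) := rfl

theorem hatTGMap_d {P P' : DGOp K} (f : DGHom P P') {n : ℕ} {i j : ℤ} (h : i + -1 = j)
    (x : (hatT P.toGOperad).obj n i) :
    (hatTGMap f.toGHom).map ((hatDer P).map h x) = (hatDer P').map h ((hatTGMap f.toGHom).map x) := by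
  refine hatT.ext fun w N => ?_
  rw [hatTGMap_coeff]
  cases w with
  | zero =>
    rw [hatDer_coeff_zero, hatDer_coeff_zero, hatTGMap_coeff]
    exact adjTMap_derP f _ _
  | succ w =>
    rw [hatDer_coeff_succ, hatDer_coeff_succ, hatTGMap_coeff, hatTGMap_coeff, map_add]
    exact congrArg₂ (· + ·) (adjTMap_derP f _ _) (adjTMap_derT f.toGHom _ _)

/-- The morphism of dg operads `f ∨ 1_T : P ∨̂ T → P' ∨̂ T` induced by `f : P → P'`. -/
def hatTMap [CharZero K] {P P' : DGOp K} (f : P ⟶ P') : hatTDG P ⟶ hatTDG P' :=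
  { hatTGMap (DGHom.toGHom f) with map_d := fun h x => hatTGMap_d f h x }

/-- `fillAlpha k μ = μ(α, …, α)` for `μ` of arity `k`: all inputs are filled with `α`. -/
def fillAlpha (P : GOperad K ℤ) {i : ℤ} : ∀ (k : ℕ) {N N' : ℕ}, N + k = N' →
    (adjT P).obj k ((i, 0), N) → (adjT P).obj 0 ((i, 0), N')
  | 0, _, _, h, x => (adjT P).cast (by rw [← h]; rfl) x
  | k + 1, N, _, h, x => fillAlpha P k (N := N + 1) (by omega)
      ((adjT P).circ (a := k) (b := 0) (g' := ((0, 0), 1)) (g'' := ((i, 0), N + 1))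
        (Prod.ext (Prod.ext (add_zero i) rfl) rfl) x
        (Adj.var P embT TGen.gr .alpha TGen.gr_alpha))

theorem adjTMap_fillAlpha {P P' : GOperad K ℤ} (f : GHom P P') {i : ℤ} (k : ℕ) :
    ∀ {N N' : ℕ} (h : N + k = N') (x : (adjT P).obj k ((i, 0), N)),
      (adjTMap f).map (fillAlpha P k h x) = fillAlpha P' k h ((adjTMap f).map x) := by
  induction k with
  | zero =>
    intro N N' h x
    subst h
    rfl
  | succ k ih =>
    intro N N' h x
    rw [fillAlpha, ih, fillAlpha]
    refine congrArg (fillAlpha P' k (by omega)) ?_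
    exact (adjTMap f).map_circ (a := k) (b := 0) (g := ((i, 0), N)) (g' := ((0, 0), 1)) _ x _

/-- The components of `κ + ∑_k (1/k!) ℓ_k(α, …, α)` for a family of operations `ℓ_k` of `P`. -/
def curvCoeff (P : GOperad K ℤ) (ℓ : ∀ k : ℕ, P.obj k (-1)) :
    ∀ w N : ℕ, (adjT P).obj 0 ((-1, w), N)
  | 0, N => (N.factorial : K)⁻¹ • fillAlpha P N (zero_add N) 
    (Adj.of P embT TGen.gr (embT_apply (-1)) (ℓ N))
  | 1, 1 => Adj.var P embT TGen.gr .kappa TGen.gr_kappa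
  | _, _ => 0

/-- The element `κ + ∑_k (1/k!) ℓ_k(α, …, α)` of `P ∨̂ T`. -/
def curvElt (P : GOperad K ℤ) (ℓ : ∀ k : ℕ, P.obj k (-1)) : (hatT P).obj 0 (-1) :=
  ⟨curvCoeff P ℓ, 2, fun w hw => by
    obtain ⟨w, rfl⟩ : ∃ v, w = v + 2 := ⟨w - 2, by omega⟩
    rfl⟩

theorem hatTGMap_curvElt {P P' : GOperad K ℤ} (f : GHom P P') (ℓ : ∀ k : ℕ, P.obj k (-1)) :
    (hatTGMap f).map (curvElt P ℓ) = curvElt P' (fun k => f.map (ℓ k)) := by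
  refine hatT.ext fun w N => ?_
  rw [hatTGMap_coeff]
  change (adjTMap f).map (curvCoeff P ℓ w N) = curvCoeff P' (fun k => f.map (ℓ k)) w N
  match w, N with
  | 0, N =>
    rw [curvCoeff, map_smul, adjTMap_fillAlpha, adjTMap_of, curvCoeff]
  | 1, 1 => rfl
  | 1, 0 => exact map_zero _
  | 1, N + 2 => exact map_zero _
  | w + 2, N => exact map_zero _

/-- The sub-operad `P ∨̂ [α]` of `P ∨̂ T`: the elements without `κ`. -/
def hatAlpha (P : GOperad K ℤ) : SubOperad (hatT P) where
  carrier n i := ((serZero (Ser (adjT P))).carrier n i).comap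
    ((serFin (Ser (adjT P))).carrier n i).subtype
  one_mem := (serZero (Ser (adjT P))).one_mem
  act_mem e _ hx := (serZero (Ser (adjT P))).act_mem e hx
  circ_mem h _ _ hx hy := (serZero (Ser (adjT P))).circ_mem h hx hy

theorem mem_hatAlpha {P : GOperad K ℤ} {n : ℕ} {i : ℤ} (x : (hatT P).obj n i) :
    x ∈ (hatAlpha P).carrier n i ↔ ∀ w N : ℕ, hatT.coeff x (w + 1) N = 0 :=
  ⟨fun h w N => congrFun (h w) N, fun h w => funext (h w)⟩

theorem adjTMap_id (P : GOperad K ℤ) (f : GHom P P) (hf : ∀ {n : ℕ} {i : ℤ} (x : P.obj n i),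
    f.map x = x) {n : ℕ} {g : (ℤ × ℕ) × ℕ} (x : (adjT P).obj n g) : (adjTMap f).map x = x := by
  refine Adj.induction P embT TGen.gr (p := fun {n g} x => (adjTMap f).map x = x)
    ?_ ?_ ?_ ?_ ?_ ?_ ?_ x
  · intro n i g h x
    rw [adjTMap_of, hf]
  · intro v g h
    rfl
  · intro n g
    exact map_zero _
  · intro n g x y hx hy
    rw [map_add, hx, hy]
  · intro n g c x hx
    rw [map_smul, hx]
  · intro m n g e x hx
    rw [GHom.map_act, hx]
  · intro a b g g' g'' h x y hx hy
    rw [GHom.map_circ, hx, hy]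

theorem adjTMap_comp {P P' P'' : GOperad K ℤ} (f : GHom P P') (f' : GHom P' P'') (f'' : GHom P P'')
    (hf : ∀ {n : ℕ} {i : ℤ} (x : P.obj n i), f''.map x = f'.map (f.map x))
    {n : ℕ} {g : (ℤ × ℕ) × ℕ} (x : (adjT P).obj n g) :
    (adjTMap f'').map x = (adjTMap f').map ((adjTMap f).map x) := by
  refine Adj.induction P embT TGen.gr (p := fun {n g} x =>
    (adjTMap f'').map x = (adjTMap f').map ((adjTMap f).map x)) ?_ ?_ ?_ ?_ ?_ ?_ ?_ x
  · intro n i g h x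
    rw [adjTMap_of, hf, adjTMap_of, adjTMap_of]
  · intro v g h
    rfl
  · intro n g
    simp only [map_zero]
  · intro n g x y hx hy
    simp only [map_add, hx, hy]
  · intro n g c x hx
    simp only [map_smul, hx]
  · intro m n g e x hx
    simp only [GHom.map_act, hx]
  · intro a b g g' g'' h x y hx hy
    simp only [GHom.map_circ, hx, hy]

theorem DGHom.ext_app {P Q : DGOp K} {f f' : P ⟶ Q}
    (h : ∀ {n : ℕ} {i : ℤ} (x : P.obj n i), app f x = app f' x) : f = f' :=
  DGHom.ext (by funext n i; exact LinearMap.ext fun x => h x)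

variable [CharZero K]

/-- The images of the generators `ℓ_k` in an operad under `cL∞`. -/
def ellOf (P : UnderCL K) (k : ℕ) : P.obj.right.obj k (-1) := app P.obj.hom (ell K k)

/-- The quadruple `(P ∨̂ T, d_P + d_T, κ + ∑_k (1/k!) ℓ_k(α, …, α), P ∨̂ [α])`. -/
def twData (P : UnderCL K) : CurvData K where
  Q := hatTDG P.obj.right
  κ := curvElt P.obj.right.toGOperad (ellOf P)
  Q₀ := hatAlpha P.obj.right.toGOperad

/-- The morphism of quadruples `f ∨ 1_T` induced by a morphism `f` of operads under `cL∞`. -/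
def twMap {P P' : UnderCL K} (f : P ⟶ P') : CurvHom (twData P) (twData P') where
  hom := hatTMap f.hom.right
  map_kappa := by
    refine (hatTGMap_curvElt (DGHom.toGHom f.hom.right) (ellOf P)).trans
      (congrArg (curvElt P'.obj.right.toGOperad) (funext fun k => ?_))
    exact congrArg (fun φ : cLinf K ⟶ P'.obj.right => app φ (ell K k)) (Under.w f.hom)
  map_mem x hx := by
    refine (mem_hatAlpha _).2 fun w N => ?_
    refine (hatTGMap_coeff (DGHom.toGHom f.hom.right) x (w + 1) N).trans ?_
    rw [(mem_hatAlpha _).1 hx, map_zero]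

/-- The functor `P ↦ (P ∨̂ T, d_P + d_T, κ + ∑_k (1/k!) ℓ_k(α, …, α), P ∨̂ [α])`, `f ↦ f ∨ 1_T`. -/
def twist (h : ∀ P : UnderCL K, (twData P).IsCurv) : UnderCL K ⥤ Curv K where
  obj P := ⟨twData P, h P⟩
  map f := twMap f
  map_id P := CurvHom.ext (DGHom.ext_app fun x => hatT.ext fun w N =>
    adjTMap_id P.obj.right.toGOperad _ (fun _ => rfl) (hatT.coeff x w N))
  map_comp _ _ := CurvHom.ext (DGHom.ext_app fun x => hatT.ext fun w N =>
    adjTMap_comp _ _ _ (fun _ => rfl) (hatT.coeff x w N))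

end TwistFunctor

section Counit

variable {K : Type u} [Field K]

/-- The morphism `1_P ∨ 0 : P ∨ T → P`. -/
def adjTCounit (P : GOperad K ℤ) {n : ℕ} {g : (ℤ × ℕ) × ℕ} : (adjT P).obj n g →ₗ[K] P.obj n g.1.1 :=
  Adj.lift P embT TGen.gr P ((AddMonoidHom.fst ℤ ℕ).comp (AddMonoidHom.fst (ℤ × ℕ) ℕ))
    (fun _ => rfl) (fun _ _ _ h => P.cast (by rw [← h]; rfl)) (fun _ _ _ => 0)
    (fun _ _ _ => P.cast_act _ _ _) (fun _ => rfl)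
    (fun _ _ _ _ _ _ _ => P.cast_circ _ _ _ _ _ _ _)

theorem adjTCounit_of (P : GOperad K ℤ) {n : ℕ} {i : ℤ} {g : (ℤ × ℕ) × ℕ} (h : embT i = g)
    (k : i = g.1.1) (x : P.obj n i) :
    adjTCounit P (Adj.of P embT TGen.gr h x) = P.cast k x := rfl

theorem adjTCounit_var (P : GOperad K ℤ) (v : TGen) {g : (ℤ × ℕ) × ℕ} (h : v.gr = g) :
    adjTCounit P (Adj.var P embT TGen.gr v h) = 0 := rfl

theorem adjTCounit_act (P : GOperad K ℤ) {m n : ℕ} {g : (ℤ × ℕ) × ℕ} (e : Fin m ≃ Fin n)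
    (x : (adjT P).obj m g) :
    adjTCounit P ((adjT P).act e x) = P.act e (adjTCounit P x) := by
  induction x using Pres.ind
  rfl

theorem adjTCounit_circ (P : GOperad K ℤ) {a b : ℕ} {g g' g'' : (ℤ × ℕ) × ℕ} (h : g + g' = g'')
    (k : g.1.1 + g'.1.1 = g''.1.1) (x : (adjT P).obj (a + 1) g) (y : (adjT P).obj b g') :
    adjTCounit P ((adjT P).circ h x y) = P.circ k (adjTCounit P x) (adjTCounit P y) := by
  induction x using Pres.ind; induction y using Pres.ind
  rfl

theorem adjTCounit_derP (P : DGOp K) {n : ℕ} {g g' : (ℤ × ℕ) × ℕ}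
    (h : g + ((-1, 0), 0) = g') (h' : g.1.1 + -1 = g'.1.1) (x : (adjT P.toGOperad).obj n g) :
    adjTCounit P.toGOperad ((derP P).map h x) = P.d.map h' (adjTCounit P.toGOperad x) := by
  refine Adj.induction P.toGOperad embT TGen.gr (p := fun {n g} x => ∀ {g' : (ℤ × ℕ) × ℕ}
    (h : g + ((-1, 0), 0) = g') (h' : g.1.1 + -1 = g'.1.1),
    adjTCounit P.toGOperad ((derP P).map h x) = P.d.map h' (adjTCounit P.toGOperad x))
    ?_ ?_ ?_ ?_ ?_ ?_ ?_ x h h'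
  · intro n i g h x g' k k'
    subst h k
    rfl
  · intro v g h g' k k'
    rw [derP_var, adjTCounit_var, map_zero, map_zero]
  · intro n g g' k k'
    simp only [map_zero]
  · intro n g x y hx hy g' k k'
    simp only [map_add, hx _ k', hy _ k']
  · intro n g c x hx g' k k'
    simp only [map_smul, hx _ k']
  · intro m n g e x hx g' k k'
    rw [Der.map_act, adjTCounit_act, adjTCounit_act, Der.map_act, hx]
  · intro a b g₁ g₂ g h x y hx hy g' k k'
    subst h k
    rw [Der.map_circ _ rfl rfl rfl rfl (add_right_comm _ _ _) (add_assoc _ _ _).symm, map_add,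
      map_smul, adjTCounit_circ _ _ (add_right_comm _ _ _),
      adjTCounit_circ _ _ (add_assoc _ _ _).symm, adjTCounit_circ _ _ rfl,
      Der.map_circ _ rfl rfl rfl rfl (add_right_comm _ _ _) (add_assoc _ _ _).symm,
      hx _ rfl, hy _ rfl]
    rfl

theorem serCirc_zero {D : Type} [AddCommMonoid D] [HasDeg D] (E : GOperad K (D × ℕ)) {a b : ℕ}
    {g g' g'' : D} (h : g + g' = g'') (x : SerObj E (a + 1) g) (y : SerObj E b g') :
    serCirc E h x y 0 = E.circ (g := (g, 0)) (g' := (g', 0)) (g'' := (g'', 0))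
      (Prod.ext h (zero_add 0)) (x 0) (y 0) := by
  rw [serCirc_apply, Finset.Nat.antidiagonal_zero, Finset.sum_singleton,
    GOperad.circN_eq _ _ (zero_add 0)]

theorem hatT.coeff_circ_zero (P : GOperad K ℤ) {a b : ℕ} {i j k : ℤ} (h : i + j = k)
    (x : (hatT P).obj (a + 1) i) (y : (hatT P).obj b j) :
    hatT.coeff ((hatT P).circ h x y) 0 0 = (adjT P).circ (g := ((i, 0), 0)) (g' := ((j, 0), 0))
      (g'' := ((k, 0), 0)) (Prod.ext (Prod.ext h (zero_add 0)) (zero_add 0))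
        (hatT.coeff x 0 0) (hatT.coeff y 0 0) :=
  (congrFun (serCirc_zero (Ser (adjT P)) h x.1 y.1) 0).trans
    (serCirc_zero (adjT P) (Prod.ext h (zero_add 0)) (x.1 0) (y.1 0))

variable [CharZero K]

/-- The morphism `1_P ∨ 0 : P ∨̂ T → P`, which is the identity on `P` and sends `α` and `κ` (and
hence all terms which contain `α` or `κ`) to zero. -/
def counitT (P : DGOp K) : hatTDG P ⟶ P where
  map :=
    { toFun := fun x => adjTCounit P.toGOperad (hatT.coeff x 0 0)
      map_add' := fun x y => map_add (adjTCounit P.toGOperad) (hatT.coeff x 0 0) (hatT.coeff y 0 0)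
      map_smul' := fun c x => map_smul (adjTCounit P.toGOperad) c (hatT.coeff x 0 0) }
  map_act e x := adjTCounit_act P.toGOperad e (hatT.coeff x 0 0)
  map_one := rfl
  map_circ h x y :=
    (congrArg (adjTCounit P.toGOperad) (hatT.coeff_circ_zero P.toGOperad h x y)).trans
      (adjTCounit_circ _ _ _ _ _)
  map_d h x :=
    (congrArg (adjTCounit P.toGOperad) (hatDer_coeff_zero P h x 0)).trans
      (adjTCounit_derP P _ _ _)

end Counit

end CurvOp

set_option linter.unusedSectionVars false

namespace CurvOp

/-! ### Values of block permutations -/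

section Perm

/-! Everything rests on calculus in one nullary variable. In an operad P ∨ [V] every generator v has
a partial derivative, which removes one occurrence of v and leaves a new last input in its place; it
obeys a Leibniz rule (`PDer`, `Adj.pd`). Inserting v into its own derivative multiplies an
expression by its number of v's (Euler, `Adj.fillS_pd`). In characteristic zero an expression
containing v is therefore recovered from its derivative.

Let (Q, d, κ, Q₀) be an object of the category. An element of weight one is y(…, κ) with y in Q₀
unique, so that on Q₀ the differential reads d x = d₀ x + (-1)^|x| (∂x)(…, κ), where ∂ is a right
derivation of degree 0 from arity n to arity n + 1, and dκ = -ℓ₁(κ) with ℓ₁ in Q₀. The weight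
components of d² = 0 say that ∂∂x is symmetric in its last two inputs (κ is odd, so y(…, κ, κ) = 0
forces this symmetry of y), that d₀ and ∂ commute up to a term ∂x ∘ ℓ₁, and that d₀ ℓ₁ = -ℓ₁ ∘ ℓ₁,
with ∂ℓ₁ symmetric (`pd_facts`, `ellOne_facts`). Put ℓ_{n+1} = ∂ℓ_n. Differentiating one relation
gives the next (`ap₀_lieSum`), so the ℓ_n with n ≥ 1 satisfy the relations without curvature for d₀;
the remaining summand -ℓ_{n+1}(…, κ) of the curved relation is precisely the weight one part of
dℓ_n. Conversely that weight one part forces ℓ_{n+1} = ∂ℓ_n, whence uniqueness. This is (a).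

For (b), write ∂_α and ∂_κ for the derivatives on P ∨̂ T. There d = d_P + (-1)^i (insertion of κ)
∂_α in degree i (`hatDer_eq`). The twisted operations ℓ̂_n = ∑ ℓ_{n+k}(…, α, …, α)/k! satisfy ∂_α
ℓ̂_n = ℓ̂_{n+1} and the curved relations for d_P, and the proposed curvature is c = κ + ℓ̂₀.
Replacing κ by c - ℓ̂₀ in the formula for d exhibits its parts of weight 0 and 1 relative to c, and
dc = -ℓ̂₁(c). Since ∂_κ kills P ∨̂ [α] and sends c to the unit, Euler's identity shows that P ∨̂ T
is free on c over P ∨̂ [α] (`toModule_kappaMap_injective`, `mem_iSup_weightPart`). In this object ∂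
is ∂_α and the canonical operations are the ℓ̂_n.

A morphism g in the category commutes with ∂. An element of P ∨̂ [α] is determined by the constant
terms of its iterated ∂_α-derivatives (`hatAlpha_family_eq_zero`), so g is determined on Q₀ by its
composite f with the projection to P: g(x) must be the Taylor series ∑ f(∂^N x)(…, α, …, α)/N!, and
g(κ) = c. Conversely, for every f under cL∞ this formula defines a morphism; compatibility with
sums, composition and differentials is checked by comparing constant terms and derivatives
(`taylor_circ`, `hatP_taylor`, `univGHom_d`). Composition with the projection is thus a bijection of
morphism sets, which is the adjunction with the stated counit. -/

theorem blk_val (a b c : ℕ) (i : Fin (a + b + c)) : ((blk a b c i : Fin (a + c + b)) : ℕ) =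
    if (i : ℕ) < a then (i : ℕ) else if (i : ℕ) < a + b then i + c else i - b := by
  induction i using Fin.addCases with
  | left i =>
    induction i using Fin.addCases with
    | left i => simp [blk]
    | right i =>
      simp [blk]
      omega
  | right i =>
    simp [blk]
    split_ifs <;> omega

theorem sumE_val {a b a' b' : ℕ} (e : Fin a ≃ Fin a') (f : Fin b ≃ Fin b') (i : Fin (a + b)) :
    ((sumE e f i : Fin (a' + b')) : ℕ) =
      if h : (i : ℕ) < a then (e ⟨i, h⟩ : ℕ) else a' + (f ⟨i - a, by omega⟩ : ℕ) := by
  induction i using Fin.addCases with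
  | left i => simp [sumE]
  | right i => simp [sumE]

theorem sumE_trans {a b a' b' a'' b'' : ℕ} (e : Fin a ≃ Fin a') (f : Fin b ≃ Fin b')
    (e' : Fin a' ≃ Fin a'') (f' : Fin b' ≃ Fin b'') :
    (sumE e f).trans (sumE e' f') = sumE (e.trans e') (f.trans f') := by
  ext i
  induction i using Fin.addCases with
  | left i => simp [sumE]
  | right i => simp [sumE]

theorem blk_zero (a b : ℕ) : blk a b 0 = Equiv.refl (Fin (a + b)) := by
  ext i
  rw [blk_val]
  have := i.2
  change _ = (i : ℕ)
  split_ifs <;> omega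

theorem blk_one_one_trans (a : ℕ) : (blk a 1 1).trans (blk a 1 1) = Equiv.refl _ := by
  ext i
  simp only [Equiv.trans_apply, blk_val, Equiv.refl_apply]
  have := i.2
  split_ifs <;> omega

theorem blk_natural {a b c a' b' c' : ℕ} (e : Fin a ≃ Fin a') (f : Fin b ≃ Fin b')
    (t : Fin c ≃ Fin c') :
    (sumE (sumE e f) t).trans (blk a' b' c') = (blk a b c).trans (sumE (sumE e t) f) := by
  ext i
  induction i using Fin.addCases with
  | left i =>
    induction i using Fin.addCases with
    | left i => simp [blk, sumE]
    | right i => simp [blk, sumE]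
  | right i => simp [blk, sumE]

theorem sumE_assoc {a b c a' b' c' : ℕ} (e : Fin a ≃ Fin a') (f : Fin b ≃ Fin b')
    (t : Fin c ≃ Fin c') (i : Fin (a + b + c)) : ((sumE (sumE e f) t i : Fin _) : ℕ) =
      (sumE e (sumE f t) (finCongr (Nat.add_assoc a b c) i) : Fin _) := by
  have ha : a = a' := by simpa using Fintype.card_congr e
  have hb : b = b' := by simpa using Fintype.card_congr f
  simp only [sumE_val, finCongr_apply, Fin.val_cast]
  split_ifs with h1 h2 h3 <;> try omega
  · have : (⟨(i : ℕ) - a - b, by omega⟩ : Fin c) = ⟨(i : ℕ) - (a + b), by omega⟩ :=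
      Fin.ext (by simp; omega)
    rw [this]; omega

/-- Both routes carry the blocks a, 1, c, b to the order a, b, c, 1: the single letter is the
additional input, which ends up last, while the two inserted operations change places. -/
theorem blk_trans_block (a b c : ℕ) :
    ((blk (a + 1) c b).trans (sumE (blk a 1 b) (Equiv.refl (Fin c)))).trans (blk (a + b) 1 c) =
      ((sumE (blk a 1 c) (Equiv.refl (Fin b))).trans (blk (a + c) 1 b)).trans
        (sumE (blk a c b) (Equiv.refl (Fin 1))) := by
  ext i
  have := i.2
  have hi : (i : ℕ) < a ∨ (i : ℕ) = a ∨ (a + 1 ≤ (i : ℕ) ∧ (i : ℕ) < a + 1 + c) ∨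
    a + 1 + c ≤ (i : ℕ) := by omega
  rcases hi with hi | hi | hi | hi <;>
    simp (disch := omega) only [Equiv.trans_apply, blk_val, sumE_val, if_pos, if_neg, dif_pos,
      dif_neg, Equiv.refl_apply] <;> omega

/-- Two single letters may be exchanged before or after they are moved past a block of size b. -/
theorem blk_trans_swap (a b : ℕ) :
    (((sumE (blk a 1 1) (Equiv.refl (Fin b))).trans (blk (a + 1) 1 b)).trans
      (sumE (blk a 1 b) (Equiv.refl (Fin 1)))).trans (blk (a + b) 1 1) =
      (blk (a + 1) 1 b).trans (sumE (blk a 1 b) (Equiv.refl (Fin 1))) := by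
  ext i
  have := i.2
  have hi : (i : ℕ) < a ∨ (i : ℕ) = a ∨ (i : ℕ) = a + 1 ∨ a + 2 ≤ (i : ℕ) := by omega
  rcases hi with hi | hi | hi | hi <;>
    simp (disch := omega) only [Equiv.trans_apply, blk_val, sumE_val, if_pos, if_neg, dif_pos,
      dif_neg, Equiv.refl_apply] <;> omega

/-- A three-cycle of the last three letters has its inverse as square; this is the braid relation in
the form in which `dl_comm_dl` needs it. -/
theorem blk_braid (a : ℕ) :
    ((sumE (blk a 1 1) (Equiv.refl (Fin 1))).trans (blk (a + 1) 1 1)).trans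
      ((sumE (blk a 1 1) (Equiv.refl (Fin 1))).trans (blk (a + 1) 1 1)) =
      (blk (a + 1) 1 1).trans (sumE (blk a 1 1) (Equiv.refl (Fin 1))) := by
  ext i
  have := i.2
  have hi : (i : ℕ) < a ∨ (i : ℕ) = a ∨ (i : ℕ) = a + 1 ∨ (i : ℕ) = a + 2 := by omega
  rcases hi with hi | hi | hi | hi <;>
    simp (disch := omega) only [Equiv.trans_apply, blk_val, sumE_val, if_pos, if_neg, dif_pos,
      dif_neg, Equiv.refl_apply] <;> omega

theorem GOperad.act_congr {K : Type u} [Field K] {D : Type} [AddCommMonoid D] [HasDeg D]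
    (E : GOperad K D) {m n : ℕ} {g : D} {e f : Fin m ≃ Fin n} (x : E.obj m g)
    (h : ∀ i, (e i : ℕ) = f i) : E.act e x = E.act f x := by
  rw [Equiv.ext fun i => Fin.ext (h i)]

end Perm

/-! ### Infinitesimal composition with an additional last input -/

section Shift

variable {K : Type u} [Field K] {D : Type} [AddCommMonoid D] [IsCancelAdd D] [HasDeg D]

/-- Operations with one additional input, which takes away the degree `γ`. -/
abbrev Shift (E : GOperad K D) (γ : D) (n : ℕ) (g : D) : Type u :=
  ∀ p : {p : D // p + γ = g}, E.obj (n + 1) p.1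

variable {E : GOperad K D} {γ : D}

/-- Relabelling of the inputs other than the additional one. -/
def sAct {m n : ℕ} {g : D} (e : Fin m ≃ Fin n) : Shift E γ m g →ₗ[K] Shift E γ n g where
  toFun F p := E.act (sumE e (Equiv.refl (Fin 1))) (F p)
  map_add' F F' := by funext p; exact map_add _ _ _
  map_smul' c F := by funext p; exact map_smul _ _ _

theorem sAct_apply {m n : ℕ} {g : D} (e : Fin m ≃ Fin n) (F : Shift E γ m g)
    (p : {p : D // p + γ = g}) : sAct e F p = E.act (sumE e (Equiv.refl (Fin 1))) (F p) := rfl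

open Classical in
/-- Composition in which the additional input belongs to the outer operation. -/
noncomputable def dl {a b : ℕ} {g₁ g₂ g : D} (h : g₁ + g₂ = g) :
    Shift E γ (a + 1) g₁ →ₗ[K] E.obj b g₂ →ₗ[K] Shift E γ (a + b) g :=
  LinearMap.mk₂ K (fun F y q =>
    if e : ∃ p, p + γ = g₁ then
      -- The inner permutation exchanges the additional input with the one that receives `y`; the
      -- outer one moves it behind the inputs of `y`. The sign is that of moving a constituent of
      -- degree γ past `y`.
      sg K (deg γ * deg g₂) • E.act (blk a 1 b) (E.circ (a := a + 1) (g := e.choose) (g'' := q.1)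
        (add_right_cancel (b := γ) (by rw [q.2, ← h, add_right_comm, e.choose_spec]))
        (E.act (blk a 1 1) (F ⟨e.choose, e.choose_spec⟩)) y)
    else 0)
    (fun F F' y => by funext q; by_cases e : ∃ p, p + γ = g₁ <;> simp [e])
    (fun c F y => by
      funext q; by_cases e : ∃ p, p + γ = g₁ <;> simp [e, smul_comm c])
    (fun F y y' => by funext q; by_cases e : ∃ p, p + γ = g₁ <;> simp [e])
    (fun c F y => by
      funext q; by_cases e : ∃ p, p + γ = g₁ <;> simp [e, smul_comm c])

open Classical in
/-- Composition in which the additional input belongs to the inner operation. -/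
noncomputable def dr {a b : ℕ} {g₁ g₂ g : D} (h : g₁ + g₂ = g) :
    E.obj (a + 1) g₁ →ₗ[K] Shift E γ b g₂ →ₗ[K] Shift E γ (a + b) g :=
  LinearMap.mk₂ K (fun x G q =>
    if e : ∃ p, p + γ = g₂ then
      E.circ (a := a) (b := b + 1) (g' := e.choose) (g'' := q.1)
        (add_right_cancel (b := γ) (by rw [q.2, ← h, add_assoc, e.choose_spec]))
        x (G ⟨e.choose, e.choose_spec⟩)
    else 0)
    (fun F F' y => by funext q; by_cases e : ∃ p, p + γ = g₂ <;> simp [e])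
    (fun c F y => by funext q; by_cases e : ∃ p, p + γ = g₂ <;> simp [e])
    (fun F y y' => by funext q; by_cases e : ∃ p, p + γ = g₂ <;> simp [e])
    (fun c F y => by funext q; by_cases e : ∃ p, p + γ = g₂ <;> simp [e])

/-- Degrees such as those in ℤ × ℕ can be cancelled but not always subtracted. Cancellation makes
the solution p of p + γ = g₁ unique, so the chosen witness in `dl` is any given one. -/
theorem dl_apply {a b : ℕ} {g₁ g₂ g p g' : D} (h : g₁ + g₂ = g) (F : Shift E γ (a + 1) g₁)
    (y : E.obj b g₂) (k : g' + γ = g) (hp : p + γ = g₁) (hk : p + g₂ = g') :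
    dl h F y ⟨g', k⟩ = sg K (deg γ * deg g₂) •
      E.act (blk a 1 b) (E.circ (a := a + 1) hk (E.act (blk a 1 1) (F ⟨p, hp⟩)) y) := by
  have e : ∃ p, p + γ = g₁ := ⟨p, hp⟩
  obtain rfl : p = e.choose := add_right_cancel (hp.trans e.choose_spec.symm)
  exact dif_pos e

theorem dr_apply {a b : ℕ} {g₁ g₂ g p g' : D} (h : g₁ + g₂ = g) (x : E.obj (a + 1) g₁)
    (G : Shift E γ b g₂) (k : g' + γ = g) (hp : p + γ = g₂) (hk : g₁ + p = g') :
    dr h x G ⟨g', k⟩ = E.circ (a := a) (b := b + 1) hk x (G ⟨p, hp⟩) := by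
  have e : ∃ p, p + γ = g₂ := ⟨p, hp⟩
  obtain rfl : p = e.choose := add_right_cancel (hp.trans e.choose_spec.symm)
  exact dif_pos e

/-- If γ cannot be subtracted from g, the family is indexed by the empty type. This agrees with the
default value 0 in `dl` and `dr`, and settles the degenerate case in the lemmas below. -/
theorem Shift.eq_zero {n : ℕ} {g : D} (e : ¬ ∃ p, p + γ = g) (F : Shift E γ n g) : F = 0 := by
  funext q
  exact (e ⟨q.1, q.2⟩).elim

theorem sAct_refl {n : ℕ} {g : D} (F : Shift E γ n g) : sAct (Equiv.refl _) F = F := by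
  funext ⟨g', k⟩
  rw [sAct_apply, sumE_refl, E.act_refl]

theorem sAct_trans {l m n : ℕ} {g : D} (e : Fin l ≃ Fin m) (f : Fin m ≃ Fin n)
    (F : Shift E γ l g) : sAct (e.trans f) F = sAct f (sAct e F) := by
  funext ⟨g', k⟩
  rw [sAct_apply, sAct_apply, sAct_apply, ← E.act_trans, sumE_trans]
  rfl

theorem dl_act {a a' b b' : ℕ} {g₁ g₂ g : D} (h : g₁ + g₂ = g) (e : Fin a ≃ Fin a')
    (f : Fin b ≃ Fin b') (F : Shift E γ (a + 1) g₁) (y : E.obj b g₂) :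
    dl h (sAct (sumE e (Equiv.refl (Fin 1))) F) (E.act f y) = sAct (sumE e f) (dl h F y) := by
  by_cases hp : ∃ p, p + γ = g₁
  · obtain ⟨p, hp⟩ := hp
    funext ⟨g', k⟩
    have hk : p + g₂ = g' := add_right_cancel (b := γ) (by rw [k, ← h, add_right_comm, hp])
    rw [sAct_apply, dl_apply h _ _ k hp hk, dl_apply h _ _ k hp hk, sAct_apply, ← E.act_trans,
      blk_natural, E.act_trans, E.circ_act, ← E.act_trans, blk_natural, E.act_trans, map_smul]
  · rw [Shift.eq_zero hp F]; simp

theorem dr_act {a a' b b' : ℕ} {g₁ g₂ g : D} (h : g₁ + g₂ = g) (e : Fin a ≃ Fin a')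
    (f : Fin b ≃ Fin b') (x : E.obj (a + 1) g₁) (G : Shift E γ b g₂) :
    dr h (E.act (sumE e (Equiv.refl (Fin 1))) x) (sAct f G) = sAct (sumE e f) (dr h x G) := by
  by_cases hp : ∃ p, p + γ = g₂
  · obtain ⟨p, hp⟩ := hp
    funext ⟨g', k⟩
    have hk : g₁ + p = g' := add_right_cancel (b := γ) (by rw [k, ← h, add_assoc, hp])
    rw [sAct_apply, dr_apply h _ _ k hp hk, dr_apply h _ _ k hp hk, sAct_apply, E.circ_act]
    refine E.act_congr _ fun i => ?_
    exact (sumE_assoc e f (Equiv.refl (Fin 1)) i).symm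
  · rw [Shift.eq_zero hp G]; simp

/-- In a composite of three operations the removed constituent lies in the first, the second or the
third. `dl_dl`, `dl_dr` and `dr_dr` are these cases for the sequential axiom; `dl_comm_dl`,
`dl_comm_dr` and `dr_comm_dl` are those for the parallel axiom. -/
theorem dl_dl {a b c : ℕ} {g₁ g₂ g₃ g₁₂ g₂₃ g : D} (h₁₂ : g₁ + g₂ = g₁₂) (h : g₁₂ + g₃ = g)
    (h₂₃ : g₂ + g₃ = g₂₃) (h' : g₁ + g₂₃ = g)
    (F : Shift E γ (a + 1) g₁) (y : E.obj (b + 1) g₂) (z : E.obj c g₃) :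
    dl (a := a + b) h (dl h₁₂ F y) z =
      sAct (finCongr (Nat.add_assoc a b c).symm) (dl h' F (E.circ h₂₃ y z)) := by
  by_cases hp : ∃ p, p + γ = g₁
  · obtain ⟨p, hp⟩ := hp
    funext ⟨g', k⟩
    subst h₁₂ h₂₃
    have hk : p + (g₂ + g₃) = g' :=
      add_right_cancel (b := γ) (by rw [k, ← h', add_right_comm, hp])
    rw [sAct_apply, dl_apply h' _ _ k hp hk, dl_apply h _ _ k (p := p + g₂)
      (by rw [add_right_comm, hp]) (by rw [add_assoc, hk]), dl_apply rfl _ _ _ hp rfl]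
    simp only [map_smul, LinearMap.smul_apply, smul_smul]
    have e1 : (blk a 1 (b + 1)).trans (blk (a + b) 1 1) =
        sumE (blk a 1 b) (Equiv.refl (Fin 1)) := by
      ext i
      simp only [Equiv.trans_apply, blk_val, sumE_val, Equiv.refl_apply]
      have := i.2
      split_ifs <;> omega
    rw [← E.act_trans, e1]
    conv_lhs => rw [← E.act_refl z]
    rw [E.circ_act (a := a + 1 + b) (e := blk a 1 b),
      E.circ_assoc (a := a + 1) _ _ rfl hk, ← E.act_trans, ← E.act_trans, ← E.act_trans]
    congr 1
    · rw [← sg_add, deg_add]; congr 1; ring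
    · refine E.act_congr _ fun i => ?_
      simp only [Equiv.trans_apply, blk_val, sumE_val, Equiv.refl_apply, finCongr_apply,
        Fin.val_cast]
      have := i.2
      split_ifs <;> omega
  · rw [Shift.eq_zero hp F]; simp

theorem dl_dr {a b c : ℕ} {g₁ g₂ g₃ g₁₂ g₂₃ g : D} (h₁₂ : g₁ + g₂ = g₁₂) (h : g₁₂ + g₃ = g)
    (h₂₃ : g₂ + g₃ = g₂₃) (h' : g₁ + g₂₃ = g)
    (x : E.obj (a + 1) g₁) (G : Shift E γ (b + 1) g₂) (z : E.obj c g₃) :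
    dl (a := a + b) h (dr (b := b + 1) h₁₂ x G) z =
      sAct (finCongr (Nat.add_assoc a b c).symm) (dr h' x (dl h₂₃ G z)) := by
  by_cases hp : ∃ p, p + γ = g₂
  · obtain ⟨p, hp⟩ := hp
    funext ⟨g', k⟩
    subst h₁₂ h₂₃
    have hk : g₁ + (p + g₃) = g' :=
      add_right_cancel (b := γ) (by rw [k, ← h', add_assoc, add_right_comm, hp])
    rw [sAct_apply, dr_apply h' _ _ k (p := p + g₃) (by rw [add_right_comm, hp]) hk,
      dl_apply h _ _ k (p := g₁ + p)
      (by rw [add_assoc, hp]) (by rw [add_assoc, hk]), dr_apply rfl _ _ _ hp rfl,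
      dl_apply rfl _ _ _ hp rfl]
    simp only [map_smul]
    congr 1
    have e1 : blk (a + b) 1 1 = sumE (Equiv.refl (Fin a)) (blk b 1 1) := by
      ext i
      simp only [blk_val, sumE_val, Equiv.refl_apply]
      have := i.2
      split_ifs <;> omega
    have e2 := E.circ_act (a := a) rfl (Equiv.refl (Fin a)) (blk b 1 1) x (G ⟨p, hp⟩)
    have e3 := E.circ_act (a := a) hk (Equiv.refl (Fin a)) (blk b 1 c) x
      (E.circ (a := b + 1) rfl (E.act (blk b 1 1) (G ⟨p, hp⟩)) z)
    rw [sumE_refl, E.act_refl] at e2 e3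
    rw [e3]
    refine (congrArg (fun t => E.act (blk (a + b) 1 c) (E.circ _ t z))
      ((congrArg (fun s => E.act s _) e1).trans e2.symm)).trans ?_
    have e4 := E.circ_assoc (a := a) (b := b + 1) (c := c) rfl
      (show g₁ + p + g₃ = g' by rw [add_assoc, hk]) rfl hk x (E.act (blk b 1 1) (G ⟨p, hp⟩)) z
    refine (congrArg (E.act (blk (a + b) 1 c)) e4).trans ?_
    rw [← E.act_trans, ← E.act_trans]
    refine E.act_congr _ fun i => ?_
    simp only [Equiv.trans_apply, blk_val, sumE_val, Equiv.refl_apply, finCongr_apply,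
        Fin.val_cast]
    have := i.2
    split_ifs <;> omega
  · rw [Shift.eq_zero hp G]; simp

theorem dr_dr {a b c : ℕ} {g₁ g₂ g₃ g₁₂ g₂₃ g : D} (h₁₂ : g₁ + g₂ = g₁₂) (h : g₁₂ + g₃ = g)
    (h₂₃ : g₂ + g₃ = g₂₃) (h' : g₁ + g₂₃ = g)
    (x : E.obj (a + 1) g₁) (y : E.obj (b + 1) g₂) (H : Shift E γ c g₃) :
    dr (a := a + b) h (E.circ h₁₂ x y) H =
      sAct (finCongr (Nat.add_assoc a b c).symm) (dr h' x (dr h₂₃ y H)) := by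
  by_cases hp : ∃ p, p + γ = g₃
  · obtain ⟨p, hp⟩ := hp
    funext ⟨g', k⟩
    subst h₁₂ h₂₃
    have hk : g₁ + (g₂ + p) = g' :=
      add_right_cancel (b := γ) (by rw [k, ← h', add_assoc, add_assoc, hp])
    rw [sAct_apply, dr_apply h' _ _ k (p := g₂ + p) (by rw [add_assoc, hp]) hk,
      dr_apply h _ _ k (p := p) hp (by rw [add_assoc, hk]), dr_apply rfl _ _ _ hp rfl]
    refine (E.circ_assoc (c := c + 1) _ _ rfl hk _ _ _).trans ?_
    refine E.act_congr _ fun i => ?_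
    simp only [sumE_val, Equiv.refl_apply, finCongr_apply, Fin.val_cast]
    have := i.2
    split_ifs <;> omega
  · rw [Shift.eq_zero hp H]; simp

theorem dr_one {b : ℕ} {g : D} (h : 0 + g = g) (G : Shift E γ b g) :
    dr (a := 0) h E.one G = sAct (finCongr (Nat.zero_add b).symm) G := by
  by_cases hp : ∃ p, p + γ = g
  · obtain ⟨p, hp⟩ := hp
    funext ⟨g', k⟩
    obtain rfl : p = g' := add_right_cancel (hp.trans k.symm)
    rw [sAct_apply, dr_apply h _ _ k hp (zero_add p)]
    refine (E.one_circ (zero_add p) (G ⟨p, hp⟩)).trans ?_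
    refine E.act_congr _ fun i => ?_
    simp only [sumE_val, Equiv.refl_apply, finCongr_apply, Fin.val_cast]
    have := i.2
    split_ifs <;> omega
  · rw [Shift.eq_zero hp G]; simp

theorem dl_one {a : ℕ} {g : D} (h : g + 0 = g) (F : Shift E γ (a + 1) g) :
    dl h F E.one = F := by
  by_cases hp : ∃ p, p + γ = g
  · obtain ⟨p, hp⟩ := hp
    funext ⟨g', k⟩
    obtain rfl : p = g' := add_right_cancel (hp.trans k.symm)
    rw [dl_apply h _ _ k hp (add_zero p), deg_zero, mul_zero, sg_zero, one_smul,
      E.circ_one (a := a + 1), ← E.act_trans, blk_one_one_trans, E.act_refl]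
  · rw [Shift.eq_zero hp F]; simp

/-- Normal form for the term in which the constituent is removed from the outer operation: the
additional input is placed before both inputs to be filled, where the parallel axiom leaves it
alone. -/
theorem circ_blk_act {a b c : ℕ} {g₁ g₂ g₃ g₁₂ g : D} (h₁₂ : g₁ + g₂ = g₁₂) (h : g₁₂ + g₃ = g)
    (u : E.obj (a + 1 + 1 + 1) g₁) (y : E.obj b g₂) (z : E.obj c g₃) :
    E.circ (a := a + b + 1) h (E.act (blk (a + b) 1 1) (E.act (sumE (blk a 1 b) (Equiv.refl (Fin 1)))
      (E.act (blk (a + 1) 1 b) (E.circ (a := a + 1 + 1) h₁₂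
        (E.act (sumE (blk a 1 1) (Equiv.refl (Fin 1))) u) y)))) z =
      E.act (sumE (blk a 1 b) (Equiv.refl (Fin c)))
        (E.circ (a := a + 1 + b) h (E.act (blk (a + 1) 1 b) (E.circ h₁₂ u y)) z) := by
  have e := E.circ_act h₁₂ (blk a 1 1) (Equiv.refl (Fin b)) u y
  have e' := E.circ_act h (blk a 1 b) (Equiv.refl (Fin c))
    (E.act (blk (a + 1) 1 b) (E.circ h₁₂ u y)) z
  rw [E.act_refl] at e e'
  rw [e, ← e']
  simp only [← E.act_trans]
  rw [← blk_trans_swap]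

theorem dl_comm_dl {a b c : ℕ} {g₁ g₂ g₃ g₁₂ g₁₃ g : D} (h₁₂ : g₁ + g₂ = g₁₂) (h : g₁₂ + g₃ = g)
    (h₁₃ : g₁ + g₃ = g₁₃) (h' : g₁₃ + g₂ = g)
    (F : Shift E γ (a + 1 + 1) g₁) (y : E.obj b g₂) (z : E.obj c g₃) :
    dl h (sAct (blk a 1 b) (dl h₁₂ F y)) z =
      sg K (deg g₂ * deg g₃) •
        sAct (blk a c b) (dl h' (sAct (blk a 1 c) (dl h₁₃ (sAct (blk a 1 1) F) z)) y) := by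
  by_cases hp : ∃ p, p + γ = g₁
  · obtain ⟨p, hp⟩ := hp
    funext ⟨g', k⟩
    subst h₁₂ h₁₃
    have hk : p + g₂ + g₃ = g' :=
      add_right_cancel (b := γ) (by rw [k, ← h, add_right_comm, add_right_comm p, hp])
    have hk' : p + g₃ + g₂ = g' := by rw [add_right_comm, hk]
    rw [Pi.smul_apply, sAct_apply,
      dl_apply h _ _ k (p := p + g₂) (by rw [add_right_comm, hp]) hk, sAct_apply,
      dl_apply rfl _ _ _ hp rfl,
      dl_apply h' _ _ k (p := p + g₃) (by rw [add_right_comm, hp]) hk', sAct_apply,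
      dl_apply rfl _ _ _ hp rfl, sAct_apply]
    -- `u` is the derivative with its additional input moved in front of the two inputs that are
    -- filled by `y` and `z`, so that `circ_comm` applies with a + 1 idle inputs.
    obtain ⟨u, hu⟩ : ∃ u, E.act (blk (a + 1) 1 1) (F ⟨p, hp⟩) =
        E.act (sumE (blk a 1 1) (Equiv.refl (Fin 1))) u :=
      ⟨E.act (sumE (blk a 1 1) (Equiv.refl (Fin 1))) (E.act (blk (a + 1) 1 1) (F ⟨p, hp⟩)), by
        rw [← E.act_trans (sumE (blk a 1 1) (Equiv.refl (Fin 1))), sumE_trans, blk_one_one_trans,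
          Equiv.refl_trans, sumE_refl, E.act_refl]⟩
    have hu' : E.act (blk (a + 1) 1 1) (E.act (sumE (blk a 1 1) (Equiv.refl (Fin 1)))
        (F ⟨p, hp⟩)) =
        E.act (sumE (blk a 1 1) (Equiv.refl (Fin 1))) (E.act (blk (a + 1) 1 1) u) := by
      have : F ⟨p, hp⟩ = E.act (blk (a + 1) 1 1) (E.act (sumE (blk a 1 1) (Equiv.refl (Fin 1))) u) := by
        rw [← hu, ← E.act_trans, blk_one_one_trans, E.act_refl]
      rw [this]
      simp only [← E.act_trans]
      rw [← blk_braid]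
      rfl
    rw [hu, hu']
    simp only [map_smul, LinearMap.smul_apply, smul_smul]
    rw [circ_blk_act, circ_blk_act, E.circ_comm (a := a + 1) _ _ rfl hk', map_smul, map_smul,
      smul_smul]
    simp only [← E.act_trans]
    congr 1
    · ring
    · refine (congrArg (fun s => E.act s _) (blk_trans_block a b c)).trans ?_
      rfl
  · rw [Shift.eq_zero hp F]; simp

theorem dl_comm_dr {a b c : ℕ} {g₁ g₂ g₃ g₁₂ g₁₃ g : D} (h₁₂ : g₁ + g₂ = g₁₂) (h : g₁₂ + g₃ = g)
    (h₁₃ : g₁ + g₃ = g₁₃) (h' : g₁₃ + g₂ = g)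
    (x : E.obj (a + 1 + 1) g₁) (G : Shift E γ b g₂) (z : E.obj c g₃) :
    dl h (sAct (blk a 1 b) (dr h₁₂ x G)) z =
      sg K (deg g₂ * deg g₃) •
        sAct (blk a c b) (dr h' (E.act (blk a 1 c) (E.circ h₁₃ (E.act (blk a 1 1) x) z)) G) := by
  by_cases hp : ∃ p, p + γ = g₂
  · obtain ⟨p, hp⟩ := hp
    funext ⟨g', k⟩
    -- The derivative of the second operation has degree p with p + γ = g₂, so its Koszul sign with
    -- `z` differs from that of the operation itself by the sign built into `dl`.
    have hs : sg K (deg g₂ * deg g₃) = sg K (deg γ * deg g₃) * sg K (deg p * deg g₃) := by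
      rw [← hp, deg_add, ← sg_add]; congr 1; ring
    subst h₁₂ h₁₃
    have hk : g₁ + p + g₃ = g' :=
      add_right_cancel (b := γ) (by rw [k, ← h, add_right_comm, add_assoc g₁ p, hp])
    have hk' : g₁ + g₃ + p = g' := by rw [add_right_comm, hk]
    rw [Pi.smul_apply, sAct_apply,
      dl_apply h _ _ k (p := g₁ + p) (by rw [add_assoc, hp]) hk, sAct_apply,
      dr_apply rfl _ _ _ hp rfl, dr_apply h' _ _ k hp hk', ← E.act_trans]
    have e1 : (sumE (blk a 1 b) (Equiv.refl (Fin 1))).trans (blk (a + b) 1 1) =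
        blk a 1 (b + 1) := by
      ext i
      simp only [Equiv.trans_apply, blk_val, sumE_val, Equiv.refl_apply]
      have := i.2
      split_ifs <;> omega
    rw [e1, hs, ← smul_smul]
    refine congrArg (_ • ·) ((congrArg (E.act (blk (a + b) 1 c))
      (E.circ_comm (b := b + 1) rfl hk rfl hk' x (G ⟨p, hp⟩) z)).trans ?_)
    rw [map_smul, ← E.act_trans]
    refine congrArg (_ • ·) (E.act_congr _ fun i => ?_)
    simp only [Equiv.trans_apply, blk_val, sumE_val, Equiv.refl_apply]
    have := i.2
    split_ifs <;> omega
  · rw [Shift.eq_zero hp G]; simp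

theorem dr_comm_dl {a b c : ℕ} {g₁ g₂ g₃ g₁₂ g₁₃ g : D} (h₁₂ : g₁ + g₂ = g₁₂) (h : g₁₂ + g₃ = g)
    (h₁₃ : g₁ + g₃ = g₁₃) (h' : g₁₃ + g₂ = g)
    (x : E.obj (a + 1 + 1) g₁) (y : E.obj b g₂) (H : Shift E γ c g₃) :
    dr h (E.act (blk a 1 b) (E.circ h₁₂ x y)) H =
      sg K (deg g₂ * deg g₃) •
        sAct (blk a c b) (dl h' (sAct (blk a 1 c) (dr h₁₃ (E.act (blk a 1 1) x) H)) y) := by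
  by_cases hp : ∃ p, p + γ = g₃
  · obtain ⟨p, hp⟩ := hp
    funext ⟨g', k⟩
    have hs : sg K (deg g₂ * deg p) = sg K (deg g₂ * deg g₃) * sg K (deg γ * deg g₂) := by
      have e : deg g₂ * deg g₃ + deg γ * deg g₂ = deg g₂ * deg p + (deg γ * deg g₂ + deg γ * deg g₂) := by
        rw [← hp, deg_add]; ring
      rw [← sg_add, e, sg_add, sg_add, sg_mul_self, mul_one]
    subst h₁₂ h₁₃
    have hk : g₁ + g₂ + p = g' :=
      add_right_cancel (b := γ) (by rw [k, ← h, add_assoc, hp])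
    have hk' : g₁ + p + g₂ = g' := by rw [add_right_comm, hk]
    rw [Pi.smul_apply, sAct_apply, dr_apply h _ _ k hp hk,
      dl_apply h' _ _ k (p := g₁ + p) (by rw [add_assoc, hp]) hk', sAct_apply,
      dr_apply rfl _ _ _ hp rfl, ← E.act_trans]
    have e1 : (sumE (blk a 1 c) (Equiv.refl (Fin 1))).trans (blk (a + c) 1 1) =
        blk a 1 (c + 1) := by
      ext i
      simp only [Equiv.trans_apply, blk_val, sumE_val, Equiv.refl_apply]
      have := i.2
      split_ifs <;> omega
    rw [e1, map_smul, smul_smul, ← hs]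
    refine (E.circ_comm (c := c + 1) rfl hk rfl hk' x y (H ⟨p, hp⟩)).trans (congrArg (_ • ·) ?_)
    refine Eq.trans ?_ (E.act_trans _ _ _)
    refine E.act_congr _ fun i => ?_
    simp only [Equiv.trans_apply, blk_val, sumE_val, Equiv.refl_apply]
    have := i.2
    split_ifs <;> omega
  · rw [Shift.eq_zero hp H]; simp

end Shift

/-! ### Derivations which create an input -/

section PDer

variable {K : Type u} [Field K] {D : Type} [AddCommMonoid D] [IsCancelAdd D] [HasDeg D]

/-- Right derivations of degree `-γ` which replace a constituent of degree `γ` by an additional (last)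
input. -/
structure PDer (E : GOperad K D) (γ : D) where
  map : ∀ {n : ℕ} {g : D}, E.obj n g →ₗ[K] Shift E γ n g
  map_act : ∀ {m n : ℕ} {g : D} (e : Fin m ≃ Fin n) (x : E.obj m g),
    map (E.act e x) = sAct e (map x)
  map_circ : ∀ {a b : ℕ} {g g' g'' : D} (h : g + g' = g'') (x : E.obj (a + 1) g) (y : E.obj b g'),
    map (E.circ h x y) = dl h (map x) y + dr h x (map y)

/-! ### Input-creating derivations of presented operads -/

section Pres

variable {G : ℕ → D → Type u} (R : ∀ ⦃n : ℕ⦄ ⦃g : D⦄, Pre K G n g → Pre K G n g → Prop) (γ : D)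
  (v : ∀ ⦃n : ℕ⦄ ⦃g : D⦄, G n g → Shift (Pres R) γ n g)

/-- The Leibniz rule on formal expressions. -/
noncomputable def pderPre : ∀ {n : ℕ} {g : D}, Pre K G n g → Shift (Pres R) γ n g
  | _, _, .gen x => v x
  | _, _, .one => 0
  | _, _, .zero => 0
  | _, _, .add x y => pderPre x + pderPre y
  | _, _, .smul c x => c • pderPre x
  | _, _, .act e x => sAct e (pderPre x)
  | _, _, .circ h x y => dl h (pderPre x) (Pres.mk R y) + dr h (Pres.mk R x) (pderPre y)

variable {R γ}

/-- Besides the given relations, the congruence contains the operad axioms; the Leibniz rule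
respects the sequential and parallel ones by the three-term identities for `dl` and `dr`, and the
others by equivariance and the unit laws. -/
theorem pderPre_rel
    (hR : ∀ {n : ℕ} {g : D} {x y : Pre K G n g}, R x y → pderPre R γ v x = pderPre R γ v y)
    {n : ℕ} {g : D} {x y : Pre K G n g} (r : Rel R x y) :
    pderPre R γ v x = pderPre R γ v y := by
  induction r with
  | of r => exact hR r
  | refl => rfl
  | symm _ ih => exact ih.symm
  | trans _ _ ih ih' => exact ih.trans ih'
  | add_congr _ _ ih ih' => simp only [pderPre, ih, ih']
  | smul_congr _ _ ih => simp only [pderPre, ih]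
  | act_congr _ _ ih => simp only [pderPre, ih]
  | circ_congr _ r r' ih ih' =>
    simp only [pderPre, ih, ih', Pres.sound R r, Pres.sound R r']
  | add_comm => exact add_comm _ _
  | add_assoc => exact add_assoc _ _ _
  | zero_add => exact zero_add _
  | one_smul => exact one_smul _ _
  | zero_smul => exact zero_smul _ _
  | smul_zero => exact smul_zero _
  | mul_smul => exact mul_smul _ _ _
  | add_smul => exact add_smul _ _ _
  | smul_add => exact smul_add _ _ _
  | act_add => simp only [pderPre, map_add]
  | act_smul => simp only [pderPre, map_smul]
  | circ_add_left _ x x' y =>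
    simp only [pderPre, Pres.mk_add, map_add, LinearMap.add_apply]
    abel
  | circ_smul_left _ c x y =>
    simp only [pderPre, Pres.mk_smul, map_smul, LinearMap.smul_apply, smul_add]
  | circ_add_right _ x y y' =>
    simp only [pderPre, Pres.mk_add, map_add]
    abel
  | circ_smul_right _ c x y =>
    simp only [pderPre, Pres.mk_smul, map_smul, smul_add]
  | act_refl => exact sAct_refl _
  | act_trans => exact sAct_trans _ _ _
  | circ_act k e f x y =>
    simp only [pderPre, Pres.mk_act, map_add]
    exact congrArg₂ (· + ·) (dl_act _ _ _ _ _) (dr_act _ _ _ _ _)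
  | circ_assoc h₁₂ k h₂₃ k' x y z =>
    simp only [pderPre, Pres.mk_circ, map_add, LinearMap.add_apply]
    exact (congrArg₂ (· + ·) (congrArg₂ (· + ·) (dl_dl _ _ _ _ _ _ _) (dl_dr _ _ _ _ _ _ _))
      (dr_dr _ _ _ _ _ _ _)).trans (add_assoc _ _ _)
  | circ_comm h₁₂ k h₁₃ k' x y z =>
    simp only [pderPre, Pres.mk_circ, Pres.mk_act, map_add, LinearMap.add_apply, smul_add]
    refine (congrArg₂ (· + ·) (congrArg₂ (· + ·) (dl_comm_dl _ _ h₁₃ k' _ _ _)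
      (dl_comm_dr _ _ h₁₃ k' _ _ _)) (dr_comm_dl _ _ h₁₃ k' _ _ _)).trans ?_
    exact add_right_comm _ _ _
  | one_circ k y =>
    simp only [pderPre, map_zero, LinearMap.zero_apply, zero_add, Pres.mk_one]
    exact dr_one _ _
  | circ_one k x =>
    simp only [pderPre, map_zero, add_zero, Pres.mk_one]
    exact dl_one _ _

/-- The right derivation of a presented operad which is determined by values of the generators that
are compatible with the relations. -/
noncomputable def Pres.pder
    (hR : ∀ {n : ℕ} {g : D} {x y : Pre K G n g}, R x y → pderPre R γ v x = pderPre R γ v y) :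
    PDer (Pres R) γ where
  map :=
    { toFun := Quot.lift (pderPre R γ v) (fun _ _ r => pderPre_rel v hR r)
      map_add' := fun x y => by
        induction x using Pres.ind; induction y using Pres.ind
        rfl
      map_smul' := fun c x => by
        induction x using Pres.ind
        rfl }
  map_act e x := by
    induction x using Pres.ind
    rfl
  map_circ h x y := by
    induction x using Pres.ind; induction y using Pres.ind
    rfl

end Pres

/-! ### Partial derivatives in P ∨ [V] -/

section Adj

variable (P : GOperad K ℤ) (emb : ℤ →+ D) {V : Type} [DecidableEq V] (gr : V → D) (v : V)

/-- Values of the partial derivative with respect to `v` on the generators. -/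
def adjPdVal : ∀ ⦃n : ℕ⦄ ⦃g : D⦄, AdjGen P emb gr n g → Shift (Adj P emb gr) (gr v) n g
  | _, _, .of _ _ => 0
  | _, _, .var w h => fun p => if e : w = v then (Adj P emb gr).cast
      (add_right_cancel (b := gr v) (by rw [zero_add, p.2, ← h, e])) (Adj P emb gr).one else 0

/-- The partial derivative of `P ∨ [V]` with respect to `v ∈ V`. -/
noncomputable def Adj.pd : PDer (Adj P emb gr) (gr v) :=
  Pres.pder (R := AdjRel P emb gr) (adjPdVal P emb gr v) (by
    intro n g x y r
    cases r with
    | add h x y => exact (add_zero _).symm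
    | smul h c x => exact (smul_zero (A := Shift (Adj P emb gr) (gr v) _ _) c).symm
    | act h e x => exact (map_zero (sAct e)).symm
    | one h => rfl
    | circ h₁ h₂ h₃ h h' x y =>
      change (0 : Shift (Adj P emb gr) (gr v) _ _) = dl h' (0 : Shift (Adj P emb gr) (gr v) _ _)
        (Adj.of P emb gr h₂ y) + dr h' (Adj.of P emb gr h₁ x) (0 : Shift (Adj P emb gr) (gr v) _ _)
      simp only [map_zero, LinearMap.zero_apply]
      exact (add_zero _).symm)

theorem Adj.pd_of {n : ℕ} {i : ℤ} {g : D} (h : emb i = g) (x : P.obj n i) :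
    (Adj.pd P emb gr v).map (Adj.of P emb gr h x) = 0 := rfl

theorem Adj.pd_var_self {p g : D} (h : gr v = g) (k : p + gr v = g) (k' : 0 = p) :
    (Adj.pd P emb gr v).map (Adj.var P emb gr v h) ⟨p, k⟩ =
      (Adj P emb gr).cast k' (Adj P emb gr).one := dif_pos rfl

theorem Adj.pd_var_ne {w : V} {g : D} (h : gr w = g) (hw : w ≠ v) :
    (Adj.pd P emb gr v).map (Adj.var P emb gr w h) = 0 :=
  funext fun _ => dif_neg hw

end Adj

/-! ### Insertion into the additional input -/

section Fill

variable {E : GOperad K D} {γ γ' : D} (w : E.obj 0 γ')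

open Classical in
/-- Insertion of `w` into the additional input. -/
noncomputable def fillS {n : ℕ} {g g' : D} (h : g' + γ = g + γ') :
    Shift E γ n g →ₗ[K] E.obj n g' where
  toFun F := if e : ∃ p, p + γ = g then
      E.circ (a := n) (b := 0) (g := e.choose)
        (add_right_cancel (b := γ) (by rw [h, add_right_comm, e.choose_spec]))
        (F ⟨e.choose, e.choose_spec⟩) w
    else 0
  map_add' F F' := by by_cases e : ∃ p, p + γ = g <;> simp [e]
  map_smul' c F := by by_cases e : ∃ p, p + γ = g <;> simp [e]

theorem fillS_apply {n : ℕ} {g g' p : D} (h : g' + γ = g + γ') (F : Shift E γ n g)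
    (hp : p + γ = g) (hk : p + γ' = g') :
    fillS w h F = E.circ (a := n) (b := 0) hk (F ⟨p, hp⟩) w := by
  have e : ∃ p, p + γ = g := ⟨p, hp⟩
  obtain rfl : p = e.choose := add_right_cancel (hp.trans e.choose_spec.symm)
  exact dif_pos e

theorem fillS_act {m n : ℕ} {g g' : D} (h : g' + γ = g + γ') (e : Fin m ≃ Fin n)
    (F : Shift E γ m g) : fillS w h (sAct e F) = E.act e (fillS w h F) := by
  by_cases hp : ∃ p, p + γ = g
  · obtain ⟨p, hp⟩ := hp
    have hk : p + γ' = g' := add_right_cancel (b := γ) (by rw [h, add_right_comm, hp])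
    rw [fillS_apply w h _ hp hk, fillS_apply w h _ hp hk, sAct_apply]
    have := E.circ_act (b := 0) hk e (Equiv.refl (Fin 0)) (F ⟨p, hp⟩) w
    rw [E.act_refl] at this
    refine this.trans (E.act_congr _ fun i => ?_)
    have hi : (i : ℕ) < m := i.2
    rw [sumE_val, dif_pos hi]
    rfl
  · rw [Shift.eq_zero hp F]; simp

/-- One sign comes from moving the slot past `y`, the other from moving `w` back into place. They
cancel if γ and γ' have the same parity, as in Euler's identity; if α is replaced by κ they leave
the sign of an odd derivation. -/
theorem fillS_dl {a b : ℕ} {g₁ g₂ g g' q : D} (h : g₁ + g₂ = g) (k : g' + γ = g + γ')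
    (k₁ : q + γ = g₁ + γ') (h' : q + g₂ = g')
    (F : Shift E γ (a + 1) g₁) (y : E.obj b g₂) :
    fillS w k (dl h F y) = (sg K (deg γ * deg g₂) * sg K (deg γ' * deg g₂)) •
      E.circ h' (fillS w k₁ F) y := by
  by_cases hp : ∃ p, p + γ = g₁
  · obtain ⟨p, hp⟩ := hp
    subst h
    have hq : p + γ' = q := add_right_cancel (b := γ) (by rw [k₁, add_right_comm, hp])
    have hg : p + g₂ + γ' = g' := by rw [← h', ← hq, add_right_comm]
    rw [fillS_apply w k _ (p := p + g₂) (by rw [add_right_comm, hp]) hg, dl_apply rfl _ _ _ hp rfl,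
      fillS_apply w k₁ _ hp hq, map_smul, LinearMap.smul_apply, ← smul_smul]
    have e := E.circ_comm (a := a) (c := 0) rfl hg hq h' (E.act (blk a 1 1) (F ⟨p, hp⟩)) y w
    refine congrArg (_ • ·) (e.trans ?_)
    rw [← E.act_trans (blk a 1 1), blk_one_one_trans, E.act_refl, mul_comm]
    refine congrArg (_ • ·) ?_
    have e2 : E.act (blk a 1 0) (E.circ (a := a + 1) (b := 0) hq (F ⟨p, hp⟩) w) =
        E.circ (a := a + 1) (b := 0) hq (F ⟨p, hp⟩) w := by
      rw [blk_zero]; exact E.act_refl _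
    rw [e2]
    refine Eq.trans (E.act_congr (f := Equiv.refl (Fin (a + b))) _ fun i => ?_) (E.act_refl _)
    have hi : (i : ℕ) < a + b := i.2
    rw [blk_val]
    change _ = (i : ℕ)
    split_ifs <;> omega
  · rw [Shift.eq_zero hp F]; simp

theorem fillS_dr {a b : ℕ} {g₁ g₂ g g' q : D} (h : g₁ + g₂ = g) (k : g' + γ = g + γ')
    (k₂ : q + γ = g₂ + γ') (h' : g₁ + q = g')
    (x : E.obj (a + 1) g₁) (G : Shift E γ b g₂) :
    fillS w k (dr h x G) = E.circ h' x (fillS w k₂ G) := by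
  by_cases hp : ∃ p, p + γ = g₂
  · obtain ⟨p, hp⟩ := hp
    subst h
    have hq : p + γ' = q := add_right_cancel (b := γ) (by rw [k₂, add_right_comm, hp])
    have hg : g₁ + p + γ' = g' := by rw [← h', ← hq, add_assoc]
    rw [fillS_apply w k _ (p := g₁ + p) (by rw [add_assoc, hp]) hg, dr_apply rfl _ _ _ hp rfl,
      fillS_apply w k₂ _ hp hq]
    have e := E.circ_assoc (a := a) (b := b) (c := 0) rfl hg hq h' x (G ⟨p, hp⟩) w
    refine e.trans ?_
    exact E.act_refl _
  · rw [Shift.eq_zero hp G]; simp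

end Fill

section Euler

variable (P : GOperad K ℤ) (emb : ℤ →+ D) {V : Type} [DecidableEq V] (gr : V → D) (v : V)

/-- Euler's identity: inserting `v` into its partial derivative multiplies an expression by the
number of its occurrences. -/
theorem Adj.fillS_pd (c : D →+ ℤ) (hemb : ∀ i, c (emb i) = 0) (hv : c (gr v) = 1)
    (hw : ∀ w, w ≠ v → c (gr w) = 0) {n : ℕ} {g : D} (x : (Adj P emb gr).obj n g) :
    fillS (Adj.var P emb gr v rfl) rfl ((Adj.pd P emb gr v).map x) = c g • x := by
  refine Adj.induction P emb gr (p := fun {n g} x => fillS (Adj.var P emb gr v rfl) rfl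
    ((Adj.pd P emb gr v).map x) = c g • x) ?_ ?_ ?_ ?_ ?_ ?_ ?_ x
  · intro n i g h x
    subst h
    rw [Adj.pd_of, map_zero, hemb, zero_smul]
  · intro u g h
    by_cases hu : u = v
    · subst hu h
      rw [fillS_apply _ _ _ (zero_add _) (zero_add _), Adj.pd_var_self P emb gr _ _ _ rfl, hv,
        one_smul]
      refine ((Adj P emb gr).one_circ (b := 0) (zero_add _) _).trans ?_
      exact (Adj P emb gr).act_refl _
    · subst h
      rw [Adj.pd_var_ne P emb gr v _ hu, map_zero, hw u hu, zero_smul]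
  · intro n g
    simp only [map_zero, smul_zero]
  · intro n g x y hx hy
    simp only [map_add, smul_add, hx, hy]
  · intro n g r x hx
    simp only [map_smul, hx, smul_comm r]
  · intro m n g e x hx
    rw [PDer.map_act, fillS_act, hx, map_zsmul]
  · intro a b g₁ g₂ g h x y hx hy
    subst h
    rw [PDer.map_circ, map_add, fillS_dl (k₁ := rfl) (h' := rfl), fillS_dr (k₂ := rfl) (h' := rfl),
      hx, hy, sg_mul_self, one_smul, map_add, add_smul, map_zsmul, map_zsmul,
      LinearMap.smul_apply]

end Euler

end PDer

/-! ### Derivations which create an input, on formal series -/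

section Ser

open Finset hiding antidiagonal mem_antidiagonal
open Finset.HasAntidiagonal

variable {K : Type u} [Field K] {D : Type} [AddCommMonoid D] [IsCancelAdd D] [HasDeg D]

theorem dl_eq_zero {E : GOperad K D} {γ : D} {a b : ℕ} {g₁ g₂ g : D} (h : g₁ + g₂ = g)
    (hp : ¬ ∃ p, p + γ = g₁) (F : Shift E γ (a + 1) g₁) (y : E.obj b g₂) : dl h F y = 0 := by
  rw [Shift.eq_zero hp F, map_zero, LinearMap.zero_apply]

theorem dr_eq_zero {E : GOperad K D} {γ : D} {a b : ℕ} {g₁ g₂ g : D} (h : g₁ + g₂ = g)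
    (hp : ¬ ∃ p, p + γ = g₂) (x : E.obj (a + 1) g₁) (G : Shift E γ b g₂) : dr h x G = 0 := by
  rw [Shift.eq_zero hp G, map_zero]

/-- A right derivation which lowers the weight by one acts on series by a shift. -/
noncomputable def PDer.ser₁ {E : GOperad K (D × ℕ)} {γ : D} (d : PDer E (γ, 1)) :
    PDer (Ser E) γ where
  map {n g} :=
    { toFun := fun x q N => d.map (x (N + 1)) ⟨(q.1, N), Prod.ext q.2 rfl⟩
      map_add' := fun x y => by
        funext q N
        exact congrFun (map_add (d.map (n := n) (g := (g, N + 1))) (x (N + 1)) (y (N + 1))) _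
      map_smul' := fun c x => by
        funext q N
        exact congrFun (map_smul (d.map (n := n) (g := (g, N + 1))) c (x (N + 1))) _ }
  map_act e x := by
    funext q N
    exact congrFun (d.map_act e (x (N + 1))) _
  map_circ {a b g₁ g₂ g} h x y := by
    funext ⟨g', k⟩ N
    change d.map (∑ p ∈ antidiagonal (N + 1), E.circN h p.1 p.2 (N + 1) (x p.1) (y p.2)) ⟨(g', N), Prod.ext k rfl⟩ =
      (dl (E := Ser E) h _ y) ⟨g', k⟩ N + (dr (E := Ser E) h x _) ⟨g', k⟩ N
    have hq : (g', N) + (γ, 1) = (g, N + 1) := Prod.ext k rfl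
    rw [map_sum, Finset.sum_apply]
    have e : ∀ p ∈ antidiagonal (N + 1), d.map (E.circN h p.1 p.2 (N + 1) (x p.1) (y p.2))
        ⟨(g', N), Prod.ext k rfl⟩ =
        (if e : p.1 + p.2 = N + 1 then
          dl (g := (g, N + 1)) (Prod.ext h e) (d.map (x p.1)) (y p.2) ⟨(g', N), hq⟩ else 0) +
        (if e : p.1 + p.2 = N + 1 then
          dr (g := (g, N + 1)) (Prod.ext h e) (x p.1) (d.map (y p.2)) ⟨(g', N), hq⟩ else 0) := by
      intro p hp
      rw [mem_antidiagonal] at hp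
      rw [E.circN_eq h hp, d.map_circ, dif_pos hp, dif_pos hp]
      rfl
    rw [sum_congr rfl e, sum_add_distrib]
    congr 1
    · by_cases hp : ∃ p, p + γ = g₁
      · obtain ⟨p, hp⟩ := hp
        have hk : p + g₂ = g' := add_right_cancel (b := γ) (by rw [k, ← h, add_right_comm, hp])
        rw [dl_apply h _ _ k hp hk]
        change _ = sg K (deg γ * deg g₂) • E.act (blk a 1 b) (∑ r ∈ antidiagonal N,
          E.circN (a := a + 1) hk r.1 r.2 N
            (E.act (blk a 1 1) (d.map (x (r.1 + 1)) ⟨(p, r.1), Prod.ext hp rfl⟩)) (y r.2))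
        -- A first factor of weight 0 has no derivative, because weight cannot be lowered below 0;
        -- the other summands are those of weight N after a shift.
        rw [Finset.Nat.sum_antidiagonal_succ, dif_pos (by simp), map_sum, smul_sum,
          Shift.eq_zero (fun ⟨q, hq⟩ => Nat.succ_ne_zero _ (congrArg Prod.snd hq)) (d.map (x 0))]
        simp only [map_zero, LinearMap.zero_apply, Pi.zero_apply, zero_add]
        refine sum_congr rfl fun r hr => ?_
        rw [mem_antidiagonal] at hr
        have hk' : (p, r.1) + (g₂, r.2) = (g', N) := Prod.ext hk hr
        have hp' : (p, r.1) + (γ, 1) = (g₁, r.1 + 1) := Prod.ext hp rfl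
        rw [dif_pos (by omega), dl_apply _ _ _ hq hp' hk', E.circN_eq hk hr]
        rfl
      · rw [dl_eq_zero h hp]
        refine sum_eq_zero fun r hr => ?_
        rw [mem_antidiagonal] at hr
        rw [dif_pos hr, dl_eq_zero _ (fun ⟨q, hq⟩ => hp ⟨q.1, congrArg Prod.fst hq⟩)]
        rfl
    · by_cases hp : ∃ p, p + γ = g₂
      · obtain ⟨p, hp⟩ := hp
        have hk : g₁ + p = g' := add_right_cancel (b := γ) (by rw [k, ← h, add_assoc, hp])
        rw [dr_apply h _ _ k hp hk]
        change _ = ∑ r ∈ antidiagonal N,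
          E.circN (b := b + 1) hk r.1 r.2 N (x r.1) (d.map (y (r.2 + 1)) ⟨(p, r.2), Prod.ext hp rfl⟩)
        rw [Finset.Nat.sum_antidiagonal_succ', dif_pos (by simp),
          Shift.eq_zero (fun ⟨q, hq⟩ => Nat.succ_ne_zero _ (congrArg Prod.snd hq)) (d.map (y 0))]
        simp only [map_zero, Pi.zero_apply, zero_add]
        refine sum_congr rfl fun r hr => ?_
        rw [mem_antidiagonal] at hr
        have hk' : (g₁, r.1) + (p, r.2) = (g', N) := Prod.ext hk hr
        have hp' : (p, r.2) + (γ, 1) = (g₂, r.2 + 1) := Prod.ext hp rfl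
        rw [dif_pos (by omega), dr_apply _ _ _ hq hp' hk', E.circN_eq hk hr]
      · rw [dr_eq_zero h hp]
        refine sum_eq_zero fun r hr => ?_
        rw [mem_antidiagonal] at hr
        rw [dif_pos hr, dr_eq_zero _ (fun ⟨q, hq⟩ => hp ⟨q.1, congrArg Prod.fst hq⟩)]
        rfl

/-- A right derivation which preserves the weight acts on series componentwise. -/
noncomputable def PDer.ser₀ {E : GOperad K (D × ℕ)} {γ : D} (d : PDer E (γ, 0)) :
    PDer (Ser E) γ where
  map {n g} :=
    { toFun := fun x q N => d.map (x N) ⟨(q.1, N), Prod.ext q.2 rfl⟩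
      map_add' := fun x y => by
        funext q N
        exact congrFun (map_add (d.map (n := n) (g := (g, N))) (x N) (y N)) _
      map_smul' := fun c x => by
        funext q N
        exact congrFun (map_smul (d.map (n := n) (g := (g, N))) c (x N)) _ }
  map_act e x := by
    funext q N
    exact congrFun (d.map_act e (x N)) _
  map_circ {a b g₁ g₂ g} h x y := by
    funext ⟨g', k⟩ N
    change d.map (∑ p ∈ antidiagonal N, E.circN h p.1 p.2 N (x p.1) (y p.2)) ⟨(g', N), Prod.ext k rfl⟩ =
      (dl (E := Ser E) h _ y) ⟨g', k⟩ N + (dr (E := Ser E) h x _) ⟨g', k⟩ N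
    have hq : (g', N) + (γ, 0) = (g, N) := Prod.ext k rfl
    rw [map_sum, Finset.sum_apply]
    have e : ∀ p ∈ antidiagonal N, d.map (E.circN h p.1 p.2 N (x p.1) (y p.2))
        ⟨(g', N), Prod.ext k rfl⟩ =
        (if e : p.1 + p.2 = N then
          dl (g := (g, N)) (Prod.ext h e) (d.map (x p.1)) (y p.2) ⟨(g', N), hq⟩ else 0) +
        (if e : p.1 + p.2 = N then
          dr (g := (g, N)) (Prod.ext h e) (x p.1) (d.map (y p.2)) ⟨(g', N), hq⟩ else 0) := by
      intro p hp
      rw [mem_antidiagonal] at hp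
      rw [E.circN_eq h hp, d.map_circ, dif_pos hp, dif_pos hp]
      rfl
    rw [sum_congr rfl e, sum_add_distrib]
    congr 1
    · by_cases hp : ∃ p, p + γ = g₁
      · obtain ⟨p, hp⟩ := hp
        have hk : p + g₂ = g' := add_right_cancel (b := γ) (by rw [k, ← h, add_right_comm, hp])
        rw [dl_apply h _ _ k hp hk]
        change _ = sg K (deg γ * deg g₂) • E.act (blk a 1 b) (∑ r ∈ antidiagonal N,
          E.circN (a := a + 1) hk r.1 r.2 N
            (E.act (blk a 1 1) (d.map (x r.1) ⟨(p, r.1), Prod.ext hp rfl⟩)) (y r.2))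
        rw [map_sum, smul_sum]
        refine sum_congr rfl fun r hr => ?_
        rw [mem_antidiagonal] at hr
        have hk' : (p, r.1) + (g₂, r.2) = (g', N) := Prod.ext hk hr
        have hp' : (p, r.1) + (γ, 0) = (g₁, r.1) := Prod.ext hp rfl
        rw [dif_pos hr, dl_apply _ _ _ hq hp' hk', E.circN_eq hk hr]
        rfl
      · rw [dl_eq_zero h hp]
        refine sum_eq_zero fun r hr => ?_
        rw [mem_antidiagonal] at hr
        rw [dif_pos hr, dl_eq_zero _ (fun ⟨q, hq⟩ => hp ⟨q.1, congrArg Prod.fst hq⟩)]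
        rfl
    · by_cases hp : ∃ p, p + γ = g₂
      · obtain ⟨p, hp⟩ := hp
        have hk : g₁ + p = g' := add_right_cancel (b := γ) (by rw [k, ← h, add_assoc, hp])
        rw [dr_apply h _ _ k hp hk]
        change _ = ∑ r ∈ antidiagonal N,
          E.circN (b := b + 1) hk r.1 r.2 N (x r.1) (d.map (y r.2) ⟨(p, r.2), Prod.ext hp rfl⟩)
        refine sum_congr rfl fun r hr => ?_
        rw [mem_antidiagonal] at hr
        have hk' : (g₁, r.1) + (p, r.2) = (g', N) := Prod.ext hk hr
        have hp' : (p, r.2) + (γ, 0) = (g₂, r.2) := Prod.ext hp rfl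
        rw [dif_pos hr, dr_apply _ _ _ hq hp' hk', E.circN_eq hk hr]
      · rw [dr_eq_zero h hp]
        refine sum_eq_zero fun r hr => ?_
        rw [mem_antidiagonal] at hr
        rw [dif_pos hr, dr_eq_zero _ (fun ⟨q, hq⟩ => hp ⟨q.1, congrArg Prod.fst hq⟩)]
        rfl

/-- The restriction of a right derivation to a sub-operad which it preserves. -/
noncomputable def PDer.restrict {E : GOperad K D} {γ : D} (d : PDer E γ) (S : SubOperad E)
    (hS : ∀ {n : ℕ} {g : D} {x : E.obj n g}, x ∈ S.carrier n g → ∀ q,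
      d.map x q ∈ S.carrier (n + 1) q.1) : PDer S.toGOperad γ where
  map :=
    { toFun := fun x q => ⟨d.map x.1 q, hS x.2 q⟩
      map_add' := fun x y => by
        funext q
        exact Subtype.ext (congrFun (map_add d.map x.1 y.1) q)
      map_smul' := fun c x => by
        funext q
        exact Subtype.ext (congrFun (map_smul d.map c x.1) q) }
  map_act e x := by
    funext q
    exact Subtype.ext (congrFun (d.map_act e x.1) q)
  map_circ {a b g₁ g₂ g} h x y := by
    funext ⟨g', k⟩
    refine Subtype.ext ((congrFun (d.map_circ h x.1 y.1) ⟨g', k⟩).trans ?_)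
    refine congrArg₂ (fun s t : E.obj (a + b + 1) g' => s + t) ?_ ?_
    · by_cases hp : ∃ p, p + γ = g₁
      · obtain ⟨p, hp⟩ := hp
        have hk : p + g₂ = g' := add_right_cancel (b := γ) (by rw [k, ← h, add_right_comm, hp])
        rw [dl_apply h _ _ k hp hk, dl_apply h _ _ k hp hk]
        rfl
      · rw [dl_eq_zero h hp, dl_eq_zero h hp]
        rfl
    · by_cases hp : ∃ p, p + γ = g₂
      · obtain ⟨p, hp⟩ := hp
        have hk : g₁ + p = g' := add_right_cancel (b := γ) (by rw [k, ← h, add_assoc, hp])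
        rw [dr_apply h _ _ k hp hk, dr_apply h _ _ k hp hk]
        rfl
      · rw [dr_eq_zero h hp, dr_eq_zero h hp]
        rfl

end Ser

/-! ### The structure of `Q₀ ∨ [κ]` -/

section PDerApply

variable {K : Type u} [Field K] {D : Type} [AddCommMonoid D] [IsCancelAdd D] [HasDeg D]
  {E : GOperad K D} {γ : D}

/-- The value of a right derivation in a given degree. -/
def PDer.ap (d : PDer E γ) {n : ℕ} {g p : D} (h : p + γ = g) : E.obj n g →ₗ[K] E.obj (n + 1) p where
  toFun x := d.map x ⟨p, h⟩
  map_add' x y := congrFun (map_add d.map x y) _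
  map_smul' c x := congrFun (map_smul d.map c x) _

theorem PDer.ap_apply (d : PDer E γ) {n : ℕ} {g p : D} (h : p + γ = g) (x : E.obj n g) :
    d.ap h x = d.map x ⟨p, h⟩ := rfl

theorem PDer.ap_act (d : PDer E γ) {m n : ℕ} {g p : D} (h : p + γ = g) (e : Fin m ≃ Fin n)
    (x : E.obj m g) : d.ap h (E.act e x) = E.act (sumE e (Equiv.refl (Fin 1))) (d.ap h x) :=
  congrFun (d.map_act e x) _

theorem PDer.ap_circ (d : PDer E γ) {a b : ℕ} {g₁ g₂ g p₁ p₂ p : D} (h : g₁ + g₂ = g)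
    (h₁ : p₁ + γ = g₁) (h₂ : p₂ + γ = g₂) (hp : p + γ = g) (k₁ : p₁ + g₂ = p) (k₂ : g₁ + p₂ = p)
    (x : E.obj (a + 1) g₁) (y : E.obj b g₂) :
    d.ap hp (E.circ h x y) = sg K (deg γ * deg g₂) •
      E.act (blk a 1 b) (E.circ (a := a + 1) k₁ (E.act (blk a 1 1) (d.ap h₁ x)) y) +
      E.circ (a := a) (b := b + 1) k₂ x (d.ap h₂ y) := by
  change d.map (E.circ h x y) ⟨p, hp⟩ = _
  rw [d.map_circ, Pi.add_apply, dl_apply h _ _ hp h₁ k₁, dr_apply h _ _ hp h₂ k₂]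
  rfl

/-- By the Leibniz rule for 1 ∘ 1 = 1 the derivative of the unit equals twice itself. -/
theorem PDer.map_one (d : PDer E γ) : d.map E.one = 0 := by
  have e := d.map_circ (a := 0) (b := 1) (add_zero 0) E.one E.one
  rw [E.circ_one (a := 0), dl_one, dr_one] at e
  have e' : sAct (finCongr (Nat.zero_add 1).symm) (d.map E.one) = d.map E.one := sAct_refl _
  rw [e'] at e
  exact left_eq_add.1 e

theorem PDer.ap_one (d : PDer E γ) {p : D} (h : p + γ = 0) : d.ap h E.one = 0 :=
  congrFun d.map_one _

end PDerApply

section Kappa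

variable {K : Type u} [Field K]

/-- The degree of `κ` in `Q₀ ∨ [κ]`. -/
abbrev grK : Unit → ℤ × ℕ := fun _ => (-1, 1)

variable (Q₀ : GOperad K ℤ)

/-- The inclusion `Q₀ → Q₀ ∨ [κ]`. -/
abbrev ofK {n : ℕ} {i : ℤ} : Q₀.obj n i →ₗ[K] (adjKappa Q₀).obj n (i, 0) :=
  Adj.of Q₀ (AddMonoidHom.inl ℤ ℕ) grK rfl

/-- The generator `κ` of `Q₀ ∨ [κ]`. -/
abbrev varK : (adjKappa Q₀).obj 0 (-1, 1) := Adj.var Q₀ (AddMonoidHom.inl ℤ ℕ) grK () rfl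

/-- The partial derivative of `Q₀ ∨ [κ]` with respect to `κ`. -/
noncomputable abbrev pdK : PDer (adjKappa Q₀) (-1, 1) := Adj.pd Q₀ (AddMonoidHom.inl ℤ ℕ) grK ()

theorem pdK_degree {i : ℤ} {w : ℕ} : ((i + 1, w) : ℤ × ℕ) + (-1, 1) = (i, w + 1) :=
  Prod.ext (by simp) rfl

/-- The weight counts the occurrences of κ and is additive in ℕ, so both factors of a composite of
weight 0 have weight 0 and no κ is ever used. The claim is generalized to arbitrary degrees to allow
the induction. -/
theorem exists_ofK {n : ℕ} {i : ℤ} (z : (adjKappa Q₀).obj n (i, 0)) : ∃ x, ofK Q₀ x = z := by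
  suffices H : ∀ {n : ℕ} {g : ℤ × ℕ} (z : (adjKappa Q₀).obj n g), g.2 = 0 →
      ∃ (i : ℤ) (h : AddMonoidHom.inl ℤ ℕ i = g) (x : Q₀.obj n i),
        Adj.of Q₀ (AddMonoidHom.inl ℤ ℕ) grK h x = z by
    obtain ⟨j, h, x, hx⟩ := H z rfl
    obtain rfl : j = i := congrArg Prod.fst h
    exact ⟨x, hx⟩
  intro n g z
  refine Adj.induction Q₀ (AddMonoidHom.inl ℤ ℕ) grK (p := fun {n g} z => g.2 = 0 →
      ∃ (i : ℤ) (h : AddMonoidHom.inl ℤ ℕ i = g) (x : Q₀.obj n i),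
        Adj.of Q₀ (AddMonoidHom.inl ℤ ℕ) grK h x = z) ?_ ?_ ?_ ?_ ?_ ?_ ?_ z
  · intro n i g h x _
    exact ⟨i, h, x, rfl⟩
  · intro v g h hg
    rw [← h] at hg
    exact absurd hg Nat.one_ne_zero
  · intro n g hg
    exact ⟨g.1, Prod.ext rfl hg.symm, 0, map_zero _⟩
  · intro n g x y hx hy hg
    obtain ⟨i, rfl, x', rfl⟩ := hx hg
    obtain ⟨j, h, y', rfl⟩ := hy hg
    obtain rfl : j = i := congrArg Prod.fst h
    exact ⟨j, rfl, x' + y', map_add _ _ _⟩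
  · intro n g c x hx hg
    obtain ⟨i, h, x', rfl⟩ := hx hg
    exact ⟨i, h, c • x', map_smul _ _ _⟩
  · intro m n g e x hx hg
    obtain ⟨i, h, x', rfl⟩ := hx hg
    exact ⟨i, h, Q₀.act e x', Adj.of_act _ _ _ _ _ _⟩
  · intro a b g g' g'' h x y hx hy hg
    have hs : g.2 + g'.2 = g''.2 := congrArg Prod.snd h
    obtain ⟨i, rfl, x', rfl⟩ := hx (by omega)
    obtain ⟨j, rfl, y', rfl⟩ := hy (by omega)
    have h3 : AddMonoidHom.inl ℤ ℕ (i + j) = g'' := by rw [map_add]; exact h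
    exact ⟨i + j, h3, Q₀.circ rfl x' y', Adj.of_circ _ _ _ _ _ _ _ _ _ _⟩

/-- Euler's identity for `κ`. -/
theorem circ_pdK {n : ℕ} {i : ℤ} {w : ℕ} (z : (adjKappa Q₀).obj n (i, w + 1)) :
    (adjKappa Q₀).circ (a := n) (b := 0) pdK_degree ((pdK Q₀).ap pdK_degree z) (varK Q₀) =
      (w + 1) • z := by
  have e := Adj.fillS_pd Q₀ (AddMonoidHom.inl ℤ ℕ) grK ()
    ((Nat.castAddMonoidHom ℤ).comp (AddMonoidHom.snd ℤ ℕ)) (fun i => rfl) rfl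
    (fun w hw => (hw rfl).elim) z
  rw [fillS_apply _ _ _ pdK_degree pdK_degree] at e
  refine e.trans ?_
  rw [← natCast_zsmul]
  rfl

/-- The derivative kills `x` and turns κ into the unit, so it inverts the insertion of κ into
elements of Q₀. -/
theorem pdK_circ_varK {n : ℕ} {i : ℤ} (x : Q₀.obj (n + 1) (i + 1)) :
    (pdK Q₀).ap pdK_degree
      ((adjKappa Q₀).circ (a := n) (b := 0) (pdK_degree (i := i) (w := 0)) (ofK Q₀ x) (varK Q₀)) =
      ofK Q₀ x := by
  have h0 : (pdK Q₀).map (ofK Q₀ x) = 0 := Adj.pd_of _ _ _ _ _ _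
  have h1 : (pdK Q₀).map (varK Q₀) ⟨0, zero_add _⟩ = (adjKappa Q₀).one :=
    Adj.pd_var_self _ _ _ _ _ _ rfl
  rw [PDer.ap_apply, PDer.map_circ, h0, map_zero, LinearMap.zero_apply, zero_add,
    dr_apply _ _ _ _ (zero_add _) (add_zero _), h1]
  exact (adjKappa Q₀).circ_one _ _

theorem circ_varK_injective {n : ℕ} {i : ℤ} (x : Q₀.obj (n + 1) (i + 1))
    (h : (adjKappa Q₀).circ (a := n) (b := 0) (pdK_degree (i := i) (w := 0)) (ofK Q₀ x)
      (varK Q₀) = 0) : ofK Q₀ x = 0 := by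
  rw [← pdK_circ_varK, h, map_zero]

/-- The derivative of x(…, κ, κ) removes either κ. As κ is odd, the result is x(…, κ) minus the same
expression for x with its last two inputs exchanged; a second derivative cancels the remaining κ. -/
theorem circ_circ_varK_eq_zero {n : ℕ} {i : ℤ} (x : Q₀.obj (n + 1 + 1) (i + 1 + 1))
    (h : (adjKappa Q₀).circ (a := n) (b := 0) (pdK_degree (i := i) (w := 1))
      ((adjKappa Q₀).circ (a := n + 1) (b := 0) (pdK_degree (w := 0)) (ofK Q₀ x) (varK Q₀))
      (varK Q₀) = 0) : ofK Q₀ (Q₀.act (blk n 1 1) x) = ofK Q₀ x := by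
  have e : (pdK Q₀).ap pdK_degree ((adjKappa Q₀).circ (a := n) (b := 0) (pdK_degree (i := i) (w := 1))
      ((adjKappa Q₀).circ (a := n + 1) (b := 0) (pdK_degree (w := 0)) (ofK Q₀ x) (varK Q₀))
      (varK Q₀)) = 0 := by rw [h, map_zero]
  rw [(pdK Q₀).ap_circ (p₁ := (i + 1 + 1, 0)) (p₂ := 0) _ pdK_degree (zero_add _) _ pdK_degree
    (add_zero _), pdK_circ_varK] at e
  have hs : sg K (deg ((-1, 1) : ℤ × ℕ) * deg ((-1, 1) : ℤ × ℕ)) = -1 := by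
    have : deg ((-1, 1) : ℤ × ℕ) * deg ((-1, 1) : ℤ × ℕ) = 1 := rfl
    rw [this]; simp [sg]
  have h1 : (pdK Q₀).ap (zero_add ((-1, 1) : ℤ × ℕ)) (varK Q₀) = (adjKappa Q₀).one :=
    Adj.pd_var_self _ _ _ _ _ _ rfl
  have h2 : (adjKappa Q₀).circ (a := n) (b := 0 + 1) (add_zero ((i + 1, 1) : ℤ × ℕ))
      ((adjKappa Q₀).circ (a := n + 1) (b := 0) (pdK_degree (w := 0)) (ofK Q₀ x) (varK Q₀))
      (adjKappa Q₀).one = (adjKappa Q₀).circ (a := n + 1) (b := 0) (pdK_degree (w := 0)) (ofK Q₀ x)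
        (varK Q₀) := (adjKappa Q₀).circ_one _ _
  rw [h1, h2, hs, blk_zero] at e
  have h3 : ∀ y : (adjKappa Q₀).obj (n + 1) (i + 1, 1),
    (adjKappa Q₀).act (Equiv.refl (Fin (n + 1))) y = y := fun y => (adjKappa Q₀).act_refl y
  have e2 := (congrArg (fun t => (-1 : K) • t + _) (h3 _)).symm.trans e
  rw [neg_one_smul, neg_add_eq_zero] at e2
  have e3 := congrArg ((pdK Q₀).ap pdK_degree) ((congrArg (fun t => (adjKappa Q₀).circ (a := n + 1)
    (b := 0) (pdK_degree (w := 0)) t (varK Q₀)) (Adj.of_act Q₀ (AddMonoidHom.inl ℤ ℕ) grK rfl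
      (blk n 1 1) x)).trans e2)
  exact (pdK_circ_varK Q₀ _).symm.trans (e3.trans (pdK_circ_varK Q₀ _))

section Map

variable (Q : GOperad K ℤ) (κ : Q.obj 0 (-1)) (S : SubOperad Q)

theorem kappaMap_act {m n : ℕ} {g : ℤ × ℕ} (e : Fin m ≃ Fin n) (z : (adjKappa S.toGOperad).obj m g) :
    kappaMap Q κ S n g.1 g.2 ((adjKappa S.toGOperad).act e z) =
      Q.act e (kappaMap Q κ S m g.1 g.2 z) := by
  induction z using Pres.ind
  rfl

theorem kappaMap_circ {a b : ℕ} {g g' g'' : ℤ × ℕ} (h : g + g' = g'') (k : g.1 + g'.1 = g''.1)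
    (x : (adjKappa S.toGOperad).obj (a + 1) g) (y : (adjKappa S.toGOperad).obj b g') :
    kappaMap Q κ S (a + b) g''.1 g''.2 ((adjKappa S.toGOperad).circ h x y) =
      Q.circ k (kappaMap Q κ S (a + 1) g.1 g.2 x) (kappaMap Q κ S b g'.1 g'.2 y) := by
  induction x using Pres.ind; induction y using Pres.ind
  rfl

variable {Q κ S}

/-- A right derivation of `Q` which kills `Q₀` and maps `κ` to the unit is the
partial derivative with respect to `κ`. -/
theorem pder_kappaMap (d : PDer Q (-1)) (hd : ∀ {n : ℕ} {i : ℤ} (x : Q.obj n i), x ∈ S.carrier n i →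
      d.map x = 0) (hκ : d.map κ ⟨0, zero_add _⟩ = Q.one)
    {n : ℕ} {g : ℤ × ℕ} (z : (adjKappa S.toGOperad).obj n g) :
    (g.2 = 0 → d.map (kappaMap Q κ S n g.1 g.2 z) = 0) ∧
    ∀ (q : ℤ × ℕ) (hq : q + (-1, 1) = g) (hp : q.1 + -1 = g.1),
      d.map (kappaMap Q κ S n g.1 g.2 z) ⟨q.1, hp⟩ =
        kappaMap Q κ S (n + 1) q.1 q.2 ((pdK S.toGOperad).map z ⟨q, hq⟩) := by
  -- In weight 0 the derivative on Q₀ ∨ [κ] vanishes for want of a degree, whereas the vanishing of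
  -- `d` there is a genuine claim. Hence the two halves of the statement.
  have hpos : ∀ {g q : ℤ × ℕ}, q + (-1, 1) = g → g.2 ≠ 0 := by
    rintro g q rfl
    exact Nat.succ_ne_zero _
  refine Adj.induction S.toGOperad (AddMonoidHom.inl ℤ ℕ) grK (p := fun {n g} z =>
    (g.2 = 0 → d.map (kappaMap Q κ S n g.1 g.2 z) = 0) ∧
    ∀ (q : ℤ × ℕ) (hq : q + (-1, 1) = g) (hp : q.1 + -1 = g.1),
      d.map (kappaMap Q κ S n g.1 g.2 z) ⟨q.1, hp⟩ =
        kappaMap Q κ S (n + 1) q.1 q.2 ((pdK S.toGOperad).map z ⟨q, hq⟩)) ?_ ?_ ?_ ?_ ?_ ?_ ?_ z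
  · intro n i g h x
    subst h
    exact ⟨fun _ => hd _ x.2, fun q hq => (hpos hq rfl).elim⟩
  · intro v g h
    subst h
    refine ⟨fun h => absurd h Nat.one_ne_zero, fun q hq hp => ?_⟩
    obtain rfl : q = 0 := add_right_cancel (hq.trans (zero_add (-1, 1)).symm)
    rw [Adj.pd_var_self _ _ _ _ _ _ rfl]
    exact hκ
  · intro n g
    refine ⟨fun _ => by rw [map_zero, map_zero], fun q hq hp => ?_⟩
    rw [map_zero, map_zero, map_zero, Pi.zero_apply, Pi.zero_apply, map_zero]
  · intro n g x y hx hy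
    refine ⟨fun h => by rw [map_add, map_add, hx.1 h, hy.1 h, add_zero], fun q hq hp => ?_⟩
    rw [map_add, map_add, map_add, Pi.add_apply, Pi.add_apply, map_add, hx.2 q hq hp, hy.2 q hq hp]
  · intro n g c x hx
    refine ⟨fun h => by rw [map_smul, map_smul, hx.1 h, smul_zero], fun q hq hp => ?_⟩
    rw [map_smul, map_smul, map_smul, Pi.smul_apply, Pi.smul_apply, map_smul, hx.2 q hq hp]
  · intro m n g e x hx
    refine ⟨fun h => by rw [kappaMap_act, d.map_act, hx.1 h, map_zero], fun q hq hp => ?_⟩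
    rw [kappaMap_act, d.map_act, PDer.map_act, sAct_apply, sAct_apply, kappaMap_act, hx.2 q hq hp]
  · intro a b g₁ g₂ g h x y hx hy
    have h' : g₁.1 + g₂.1 = g.1 := congrArg Prod.fst h
    have hw : g₁.2 + g₂.2 = g.2 := congrArg Prod.snd h
    refine ⟨fun hg => ?_, fun q hq hp => ?_⟩
    · rw [kappaMap_circ Q κ S h h', d.map_circ, hx.1 (by omega), hy.1 (by omega), map_zero,
        map_zero, LinearMap.zero_apply, add_zero]
    · rw [kappaMap_circ Q κ S h h', d.map_circ, PDer.map_circ, Pi.add_apply, Pi.add_apply, map_add]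
      have hq1 : q.1 + -1 = g.1 := congrArg Prod.fst hq
      have hq2 : q.2 + 1 = g.2 := congrArg Prod.snd hq
      congr 1
      · by_cases hg : g₁.2 = 0
        · rw [hx.1 hg, dl_eq_zero h (fun ⟨r, hr⟩ => hpos hr hg)]
          simp only [map_zero, LinearMap.zero_apply, Pi.zero_apply]
        · have hr : (g₁.1 + 1, g₁.2 - 1) + (-1, 1) = g₁ := Prod.ext (by simp) (by simp; omega)
          have hk : (g₁.1 + 1, g₁.2 - 1) + g₂ = q :=
            Prod.ext (by simp; omega) (by simp; omega)
          rw [dl_apply h _ _ hq hr hk, dl_apply h' _ _ hp (p := g₁.1 + 1) (by simp)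
            (congrArg Prod.fst hk), map_smul, kappaMap_act,
            kappaMap_circ Q κ S hk (congrArg Prod.fst hk), kappaMap_act, hx.2 _ hr]
          rfl
      · by_cases hg : g₂.2 = 0
        · rw [hy.1 hg, dr_eq_zero h (fun ⟨r, hr⟩ => hpos hr hg)]
          simp only [map_zero, Pi.zero_apply]
        · have hr : (g₂.1 + 1, g₂.2 - 1) + (-1, 1) = g₂ := Prod.ext (by simp) (by simp; omega)
          have hk : g₁ + (g₂.1 + 1, g₂.2 - 1) = q :=
            Prod.ext (by simp; omega) (by simp; omega)
          rw [dr_apply h _ _ hq hr hk, dr_apply h' _ _ hp (p := g₂.1 + 1) (by simp)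
            (congrArg Prod.fst hk), hy.2 _ hr]
          exact (kappaMap_circ Q κ S (b := b + 1) hk (congrArg Prod.fst hk) _ _).symm

end Map

end Kappa

/-! ### The derivative of the curved L-infinity relations -/

section LieSumDerivative

open Finset hiding antidiagonal mem_antidiagonal
open Finset.HasAntidiagonal

variable {K : Type u} [Field K]

section AtZero

variable {E : GOperad K ℤ} (d : PDer E 0)

/-- A right derivation of degree zero, as a linear map. -/
def PDer.ap₀ {n : ℕ} {g : ℤ} : E.obj n g →ₗ[K] E.obj (n + 1) g := d.ap (add_zero g)

theorem PDer.ap₀_act {m n : ℕ} {g : ℤ} (e : Fin m ≃ Fin n) (x : E.obj m g) :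
    d.ap₀ (E.act e x) = E.act (sumE e (Equiv.refl (Fin 1))) (d.ap₀ x) := d.ap_act _ e x

theorem PDer.ap₀_circ {a b : ℕ} {g₁ g₂ g : ℤ} (h : g₁ + g₂ = g)
    (x : E.obj (a + 1) g₁) (y : E.obj b g₂) :
    d.ap₀ (E.circ h x y) = E.act (blk a 1 b) (E.circ (a := a + 1) h (E.act (blk a 1 1) (d.ap₀ x)) y) +
      E.circ (a := a) (b := b + 1) h x (d.ap₀ y) := by
  have e := d.ap_circ h (add_zero g₁) (add_zero g₂) (add_zero g) h h x y
  rw [deg_zero, zero_mul, sg_zero, one_smul] at e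
  exact e

theorem PDer.ap₀_one : d.ap₀ E.one = 0 := d.ap_one _

/-- A right derivation of degree zero, from its values. -/
noncomputable def PDer.mk₀ (f : ∀ {n : ℕ} {g : ℤ}, E.obj n g →ₗ[K] E.obj (n + 1) g)
    (f_act : ∀ {m n : ℕ} {g : ℤ} (e : Fin m ≃ Fin n) (x : E.obj m g),
      f (E.act e x) = E.act (sumE e (Equiv.refl (Fin 1))) (f x))
    (f_circ : ∀ {a b : ℕ} {g₁ g₂ g : ℤ} (h : g₁ + g₂ = g) (x : E.obj (a + 1) g₁) (y : E.obj b g₂),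
      f (E.circ h x y) = E.act (blk a 1 b) (E.circ (a := a + 1) h (E.act (blk a 1 1) (f x)) y) +
        E.circ (a := a) (b := b + 1) h x (f y)) : PDer E 0 where
  map {n g} :=
    { toFun := fun x q => E.cast (by simpa using q.2.symm) (f x)
      map_add' := fun x y => by funext q; simp only [map_add]; rfl
      map_smul' := fun c x => by funext q; simp only [map_smul]; rfl }
  map_act e x := by
    funext ⟨g', h⟩
    obtain rfl := (add_zero g').symm.trans h
    exact f_act e x
  map_circ {a b g₁ g₂ g} k x y := by
    funext ⟨g', h⟩
    obtain rfl := (add_zero g').symm.trans h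
    rw [Pi.add_apply, dl_apply _ _ _ _ (add_zero g₁) k, dr_apply _ _ _ _ (add_zero g₂) k, deg_zero,
      zero_mul, sg_zero, one_smul]
    exact f_circ k x y

end AtZero

theorem blockImg_eq_iff {p q n : ℕ} (e : Fin (p + q) ≃ Fin n) (B : Finset (Fin n)) :
    blockImg e = B ↔ ∀ j, e j ∈ B ↔ (j : ℕ) < p := by
  have key : ∀ j, e j ∈ blockImg e ↔ (j : ℕ) < p := by
    intro j
    simp only [blockImg, mem_image, mem_univ, true_and, EmbeddingLike.apply_eq_iff_eq]
    constructor
    · rintro ⟨i, rfl⟩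
      exact i.2
    · intro h
      exact ⟨⟨j, h⟩, rfl⟩
  constructor
  · rintro rfl
    exact key
  · intro h
    ext x
    obtain ⟨j, rfl⟩ := e.surjective x
    rw [key, h]

theorem shuf_mem_iff {n : ℕ} (A : Finset (Fin n)) (j : Fin (#A + #Aᶜ)) :
    shuf A j ∈ A ↔ (j : ℕ) < #A := (blockImg_eq_iff (shuf A) A).1 (blockImg_shuf A) j

section Sym

variable (E : GOperad K ℤ) (ℓ : ∀ n, E.obj n (-1))
  (hℓ : ∀ (n : ℕ) (e : Fin n ≃ Fin n), E.act e (ℓ n) = ℓ n)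
include hℓ

/-- Since the ℓ's are symmetric, a relabelled composite depends only on which labels sit at the
outer operation. This makes it possible to index the terms by subsets and to forget the shuffles. -/
theorem act_lieX_eq {p q p' q' n : ℕ} (e : Fin (p + q) ≃ Fin n) (e' : Fin (p' + q') ≃ Fin n)
    (h : blockImg e = blockImg e') : E.act e (lieX E ℓ p q) = E.act e' (lieX E ℓ p' q') := by
  obtain rfl : p = p' := by rw [← card_blockImg e, h, card_blockImg]
  have h1 : p + q = n := by simpa using Fintype.card_congr e
  have h2 : p + q' = n := by simpa using Fintype.card_congr e'
  obtain rfl : q = q' := by omega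
  obtain ⟨s, t, rfl⟩ := exists_sumE e e' h
  rw [E.act_trans, lieX_act E ℓ hℓ]

/-- The summands of the curved L-infinity relation. -/
def lieTerm {n : ℕ} (A : Finset (Fin n)) : E.obj n (-2) := E.act (shuf A) (lieX E ℓ #A #Aᶜ)

omit hℓ in
theorem lieSum_eq_sum_lieTerm (n : ℕ) : lieSum E ℓ n = - ∑ A : Finset (Fin n), lieTerm E ℓ A := rfl

theorem act_lieX_eq_lieTerm {p q n : ℕ} (e : Fin (p + q) ≃ Fin n) (B : Finset (Fin n))
    (h : ∀ j, e j ∈ B ↔ (j : ℕ) < p) : E.act e (lieX E ℓ p q) = lieTerm E ℓ B :=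
  act_lieX_eq E ℓ hℓ e (shuf B) (by rw [(blockImg_eq_iff e B).2 h, blockImg_shuf])

theorem lieTerm_univ (n : ℕ) : lieTerm E ℓ (univ : Finset (Fin n)) = lieX E ℓ n 0 := by
  rw [← act_lieX_eq_lieTerm E ℓ hℓ (p := n) (q := 0) (Equiv.refl (Fin n)) univ
    (fun j => ⟨fun _ => j.2, fun _ => mem_univ _⟩)]
  exact E.act_refl _

theorem lieTerm_map_univ (n : ℕ) :
    lieTerm E ℓ ((univ : Finset (Fin n)).map Fin.castSuccEmb) = lieX E ℓ n 1 := by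
  rw [← act_lieX_eq_lieTerm E ℓ hℓ (p := n) (q := 1) (Equiv.refl (Fin (n + 1))) _ (fun j => ?_)]
  · exact E.act_refl _
  · simp only [Equiv.refl_apply, mem_map, mem_univ, true_and, Fin.coe_castSuccEmb]
    constructor
    · rintro ⟨i, rfl⟩
      exact i.2
    · intro h
      exact ⟨⟨j, h⟩, rfl⟩

omit hℓ in
theorem sumE_refl_one_mem_iff {m n : ℕ} (s : Fin m ≃ Fin n) (A : Finset (Fin n)) (j : Fin (m + 1)) :
    sumE s (Equiv.refl (Fin 1)) j ∈ A.map Fin.castSuccEmb ↔ ∃ h : (j : ℕ) < m, s ⟨j, h⟩ ∈ A := by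
  have hm : m = n := by simpa using Fintype.card_congr s
  rw [mem_map]
  constructor
  · rintro ⟨a, ha, h⟩
    have h' := congrArg Fin.val h
    rw [sumE_val] at h'
    split_ifs at h' with hj
    · refine ⟨hj, ?_⟩
      have : a = s ⟨j, hj⟩ := Fin.ext h'
      rwa [← this]
    · have := a.2
      simp at h'
      omega
  · rintro ⟨h, hs⟩
    refine ⟨_, hs, Fin.ext ?_⟩
    rw [sumE_val, dif_pos h]
    rfl

/-- The new label n goes either to the outer or to the inner operation. The first case gives the
term of A ∪ {n}; the second is left as it stands, because the inner operation may be ℓ₀, on whose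
derivative nothing is assumed. -/
theorem ap₀_lieTerm (d : PDer E 0) (hd : ∀ n, d.ap₀ (ℓ (n + 1)) = ℓ (n + 2)) {n : ℕ}
    (A : Finset (Fin n)) :
    d.ap₀ (lieTerm E ℓ A) = lieTerm E ℓ (insert (Fin.last n) (A.map Fin.castSuccEmb)) +
      E.act (sumE (shuf A) (Equiv.refl (Fin 1)))
        (E.circ (a := #A) (b := #Aᶜ + 1) (g'' := -2) (by norm_num) (ℓ (#A + 1)) (d.ap₀ (ℓ #Aᶜ))) := by
  rw [lieTerm, d.ap₀_act, lieX, d.ap₀_circ, map_add, hd]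
  congr 1
  have e : E.act (blk (#A) 1 1) (ℓ (#A + 2)) = ℓ (#A + 1 + 1) := hℓ (#A + 2) _
  rw [e]
  refine (E.act_trans _ _ _).symm.trans (act_lieX_eq_lieTerm E ℓ hℓ (p := #A + 1) (q := #Aᶜ) _ _ ?_)
  intro j
  have hc : #A + #Aᶜ = n := by rw [card_add_card_compl, Fintype.card_fin]
  rw [mem_insert, Equiv.trans_apply, sumE_refl_one_mem_iff]
  have hl : sumE (shuf A) (Equiv.refl (Fin 1)) (blk (#A) 1 (#Aᶜ) j) = Fin.last n ↔
      (j : ℕ) = #A := by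
    rw [Fin.ext_iff, sumE_val]
    have hb := blk_val (#A) 1 (#Aᶜ) j
    have hj := j.2
    simp only [Equiv.refl_apply]
    split_ifs with h
    · have := (shuf A ⟨_, h⟩).2
      have hn : ¬ ((j : ℕ) = #A) := by
        intro h'
        rw [h'] at hb
        simp at hb
        omega
      simp only [hn, iff_false, Fin.val_last]
      omega
    · simp only [Fin.val_last]
      split_ifs at hb <;> omega
  rw [hl]
  simp only [shuf_mem_iff]
  have hb := blk_val (#A) 1 (#Aᶜ) j
  have hj := j.2
  constructor
  · rintro (h | ⟨h, h'⟩)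
    · omega
    · split_ifs at hb <;> omega
  · intro h
    by_cases hn : (j : ℕ) = #A
    · exact Or.inl hn
    · have : (j : ℕ) < #A := by omega
      rw [if_pos this] at hb
      exact Or.inr ⟨by omega, by omega⟩

omit hℓ in
theorem sum_finset_fin_succ {M : Type*} [AddCommMonoid M] (n : ℕ) (f : Finset (Fin (n + 1)) → M) :
    ∑ B, f B = ∑ A : Finset (Fin n), f (insert (Fin.last n) (A.map Fin.castSuccEmb)) +
      ∑ A : Finset (Fin n), f (A.map Fin.castSuccEmb) := by
  have hl : ∀ A : Finset (Fin n), Fin.last n ∉ A.map Fin.castSuccEmb := by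
    intro A h
    rw [mem_map] at h
    obtain ⟨a, -, h⟩ := h
    exact (Fin.castSucc_lt_last a).ne h
  rw [← sum_filter_add_sum_filter_not univ (fun B : Finset (Fin (n + 1)) => Fin.last n ∈ B)]
  congr 1
  · symm
    refine sum_bij (fun A _ => insert (Fin.last n) (A.map Fin.castSuccEmb)) ?_ ?_ ?_ ?_
    · intro A _
      simp
    · intro A _ A' _ h
      have := congrArg (fun s => s.erase (Fin.last n)) h
      simp only [erase_insert (hl _)] at this
      exact map_injective _ this
    · intro B hB
      rw [mem_filter] at hB
      refine ⟨univ.filter fun a => Fin.castSucc a ∈ B, mem_univ _, ?_⟩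
      ext x
      refine Fin.lastCases ?_ (fun i => ?_) x
      · simp [hB.2]
      · simp [(Fin.castSucc_lt_last i).ne]
    · intro A _
      rfl
  · symm
    refine sum_bij (fun A _ => A.map Fin.castSuccEmb) ?_ ?_ ?_ ?_
    · intro A _
      rw [mem_filter]
      exact ⟨mem_univ _, hl A⟩
    · intro A _ A' _ h
      exact map_injective _ h
    · intro B hB
      rw [mem_filter] at hB
      refine ⟨univ.filter fun a => Fin.castSucc a ∈ B, mem_univ _, ?_⟩
      ext x
      refine Fin.lastCases ?_ (fun i => ?_) x
      · simp [hB.2, (Fin.castSucc_lt_last _).ne]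
      · simp
    · intro A _
      rfl

/-- The derivative of a curved L-infinity relation is the next one, up to the terms that
involve the derivative of `ℓ₀`. -/
theorem ap₀_lieSum (d : PDer E 0) (hd : ∀ n, d.ap₀ (ℓ (n + 1)) = ℓ (n + 2)) (n : ℕ) :
    d.ap₀ (lieSum E ℓ n) = lieSum E ℓ (n + 1) +
      E.circ (a := n) (b := 1) (g'' := -2) (by norm_num) (ℓ (n + 1)) (ℓ 1 - d.ap₀ (ℓ 0)) := by
  have key : ∑ A : Finset (Fin n), E.act (sumE (shuf A) (Equiv.refl (Fin 1)))
      (E.circ (a := #A) (b := #Aᶜ + 1) (g'' := -2) (by norm_num) (ℓ (#A + 1)) (d.ap₀ (ℓ #Aᶜ))) =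
      ∑ A : Finset (Fin n), lieTerm E ℓ (A.map Fin.castSuccEmb) -
        E.circ (a := n) (b := 1) (g'' := -2) (by norm_num) (ℓ (n + 1)) (ℓ 1 - d.ap₀ (ℓ 0)) := by
    -- The full set A is the only one with inner operation ℓ₀. Its summand is split off and produces
    -- the correction ℓ₁ - ∂ℓ₀.
    rw [← sum_erase_add _ _ (mem_univ (univ : Finset (Fin n))),
      ← sum_erase_add univ (fun A : Finset (Fin n) => lieTerm E ℓ (A.map Fin.castSuccEmb))
        (mem_univ (univ : Finset (Fin n))), add_sub_assoc]
    congr 1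
    · refine sum_congr rfl fun A hA => ?_
      have hne : #Aᶜ ≠ 0 := by
        rw [mem_erase] at hA
        intro h
        exact hA.1 (by rwa [card_eq_zero, compl_eq_empty_iff] at h)
      have hq : d.ap₀ (ℓ #Aᶜ) = ℓ (#Aᶜ + 1) := by
        obtain ⟨q, hq⟩ := Nat.exists_eq_succ_of_ne_zero hne
        rw [hq]
        exact hd q
      rw [hq]
      refine act_lieX_eq_lieTerm E ℓ hℓ (p := #A) (q := #Aᶜ + 1) _ _ ?_
      intro j
      refine (sumE_refl_one_mem_iff (shuf A) A j).trans ?_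
      simp only [shuf_mem_iff]
      exact ⟨fun ⟨_, h⟩ => h, fun h => ⟨by omega, h⟩⟩
    · rw [lieTerm_map_univ E ℓ hℓ, map_sub, lieX]
      have : ∀ (A : Finset (Fin n)) (hA : A = univ) (y : ∀ m, E.obj (m + 1) (-1)),
          E.act (sumE (shuf A) (Equiv.refl (Fin 1)))
            (E.circ (a := #A) (b := #Aᶜ + 1) (g'' := -2) (by norm_num) (ℓ (#A + 1)) (y #Aᶜ)) =
          E.circ (a := n) (b := 1) (g'' := -2) (by norm_num) (ℓ (n + 1)) (y 0) := by
        intro A hA y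
        have h1 : #A = n := by rw [hA, card_univ, Fintype.card_fin]
        have h2 : #Aᶜ = 0 := by rw [hA, compl_univ, card_empty]
        -- The cardinalities of A and of its complement are only provably n and 0, so they are
        -- replaced by variables before being substituted.
        have h3 : ∀ (p q : ℕ) (s : Fin (p + q) ≃ Fin n) (hp : p = n) (hq : q = 0),
            E.act (sumE s (Equiv.refl (Fin 1)))
            (E.circ (a := p) (b := q + 1) (g'' := -2) (by norm_num) (ℓ (p + 1)) (y q)) =
          E.circ (a := n) (b := 1) (g'' := -2) (by norm_num) (ℓ (n + 1)) (y 0) := by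
          rintro p q s rfl rfl
          have h4 := E.circ_act (a := p) (b := 1) (g'' := -2) (by norm_num) (s : Fin p ≃ Fin p)
            (Equiv.refl (Fin 1)) (ℓ (p + 1)) (y 0)
          rw [hℓ, E.act_refl] at h4
          exact h4.symm
        exact h3 _ _ _ h1 h2
      rw [this univ rfl fun m => d.ap₀ (ℓ m)]
      abel
  rw [lieSum_eq_sum_lieTerm, map_neg, map_sum, sum_congr rfl fun A _ => ap₀_lieTerm E ℓ hℓ d hd A,
    sum_add_distrib, key, lieSum_eq_sum_lieTerm, sum_finset_fin_succ]
  abel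

end Sym

end LieSumDerivative

/-! ### The structure of the objects of `Curv^Σ` -/

section Ins

variable {K : Type u} [Field K] (Q : GOperad K ℤ) (κ : Q.obj 0 (-1))

/-- Insertion of `κ` into the last input. -/
def insK {n : ℕ} {i j : ℤ} (h : i + -1 = j) : Q.obj (n + 1) i →ₗ[K] Q.obj n j :=
  (Q.circ (a := n) (b := 0) h).flip κ

theorem insK_apply {n : ℕ} {i j : ℤ} (h : i + -1 = j) (x : Q.obj (n + 1) i) :
    insK Q κ h x = Q.circ (a := n) (b := 0) h x κ := rfl

theorem insK_act {m n : ℕ} {i j : ℤ} (h : i + -1 = j) (e : Fin m ≃ Fin n) (x : Q.obj (m + 1) i) :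
    insK Q κ h (Q.act (sumE e (Equiv.refl (Fin 1))) x) = Q.act e (insK Q κ h x) := by
  have := Q.circ_act (b := 0) h e (Equiv.refl (Fin 0)) x κ
  rw [Q.act_refl] at this
  refine this.trans (Q.act_congr _ fun i => ?_)
  have hi : (i : ℕ) < m := i.2
  rw [sumE_val, dif_pos hi]
  rfl

theorem circ_insK {a b : ℕ} {i j j' k k' : ℤ} (h : j + -1 = j') (h₁ : i + j' = k') (h₂ : i + j = k)
    (h' : k + -1 = k') (x : Q.obj (a + 1) i) (y : Q.obj (b + 1) j) :
    Q.circ h₁ x (insK Q κ h y) = insK Q κ h' (Q.circ (a := a) (b := b + 1) h₂ x y) := by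
  have e := Q.circ_assoc (a := a) (b := b) (c := 0) h₂ h' h h₁ x y κ
  exact (e.trans (Q.act_refl _)).symm

/-- This is the parallel axiom with κ as the nullary factor; since κ has degree -1, the exchange
with `y` costs the sign of the degree of `y`. -/
theorem insK_circ {a b : ℕ} {i i' j k k' : ℤ} (h : i + -1 = i') (h₁ : i' + j = k') (h₂ : i + j = k)
    (h' : k + -1 = k') (x : Q.obj (a + 1 + 1) i) (y : Q.obj b j) :
    Q.circ h₁ (insK Q κ h x) y = sg K j • insK Q κ h' (Q.act (blk a 1 b)
      (Q.circ (a := a + 1) h₂ (Q.act (blk a 1 1) x) y)) := by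
  have e := Q.circ_comm (a := a) (c := 0) h₂ h' h h₁ (Q.act (blk a 1 1) x) y κ
  rw [← Q.act_trans (blk a 1 1), blk_one_one_trans, Q.act_refl] at e
  have e2 : Q.act (blk a 1 0) (Q.circ (a := a + 1) (b := 0) h x κ) = insK Q κ h x := by
    rw [blk_zero]; exact Q.act_refl _
  rw [e2] at e
  have e3 : insK Q κ h' (Q.act (blk a 1 b) (Q.circ (a := a + 1) h₂ (Q.act (blk a 1 1) x) y)) =
      sg K j • Q.circ h₁ (insK Q κ h x) y := by
    refine e.trans ?_
    have hs : sg K (deg j * deg (-1 : ℤ)) = sg K j := by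
      have : deg j * deg (-1 : ℤ) = -j := by
        change j * -1 = -j
        ring
      rw [this, sg_neg]
    rw [hs]
    refine congrArg (_ • ·) ?_
    refine Eq.trans (Q.act_congr (f := Equiv.refl (Fin (a + b))) _ fun i => ?_) (Q.act_refl _)
    have hi : (i : ℕ) < a + b := i.2
    rw [blk_val]
    change _ = (i : ℕ)
    split_ifs <;> omega
  rw [e3, smul_smul, sg_mul_self, one_smul]

theorem kappaMap_insK (S : SubOperad Q) {n : ℕ} {i j : ℤ} {w : ℕ} (h : i + -1 = j)
    (h' : ((i, w) : ℤ × ℕ) + (-1, 1) = (j, w + 1)) (z : (adjKappa S.toGOperad).obj (n + 1) (i, w)) :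
    kappaMap Q κ S n j (w + 1)
      ((adjKappa S.toGOperad).circ (a := n) (b := 0) h' z (varK S.toGOperad)) =
      insK Q κ h (kappaMap Q κ S (n + 1) i w z) :=
  kappaMap_circ Q κ S (a := n) (b := 0) h' h z (varK S.toGOperad)

theorem mem_weightPart_zero (S : SubOperad Q) {n : ℕ} {i : ℤ} {x : Q.obj n i} :
    x ∈ weightPart Q κ S 0 n i ↔ x ∈ S.carrier n i := by
  constructor
  · rintro ⟨z, rfl⟩
    obtain ⟨y, rfl⟩ := exists_ofK _ z
    exact y.2
  · intro h
    exact ⟨ofK S.toGOperad ⟨x, h⟩, rfl⟩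

/-- By Euler's identity an expression with a single κ is its own κ-derivative with κ inserted; the
multiplicity is 1, so nothing has to be inverted. The derivative has weight 0 and thus comes from
Q₀. -/
theorem mem_weightPart_one (S : SubOperad Q) {n : ℕ} {i j : ℤ} (h : i + -1 = j) {x : Q.obj n j} :
    x ∈ weightPart Q κ S 1 n j ↔ ∃ y ∈ S.carrier (n + 1) i, insK Q κ h y = x := by
  obtain rfl : i = j + 1 := by omega
  constructor
  · rintro ⟨z, rfl⟩
    have e := circ_pdK S.toGOperad (w := 0) z
    obtain ⟨y, hy⟩ := exists_ofK _ ((pdK S.toGOperad).ap pdK_degree z)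
    refine ⟨y.1, y.2, ?_⟩
    rw [← hy] at e
    have e' := (kappaMap_insK Q κ S h pdK_degree (ofK S.toGOperad y)).symm.trans (congrArg _ e)
    refine e'.trans (congrArg (kappaMap Q κ S n j 1) ?_)
    exact one_smul ℕ z
  · rintro ⟨y, hy, rfl⟩
    exact ⟨_, kappaMap_insK Q κ S h pdK_degree (ofK S.toGOperad ⟨y, hy⟩)⟩

theorem weightPart_circ_mem (S : SubOperad Q) {a b : ℕ} {i j k : ℤ} {w w' w'' : ℕ} (h : i + j = k)
    (hw : w + w' = w'') {x : Q.obj (a + 1) i} {y : Q.obj b j} (hx : x ∈ weightPart Q κ S w (a + 1) i)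
    (hy : y ∈ weightPart Q κ S w' b j) : Q.circ h x y ∈ weightPart Q κ S w'' (a + b) k := by
  obtain ⟨z, rfl⟩ := hx
  obtain ⟨z', rfl⟩ := hy
  have hh : ((i, w) : ℤ × ℕ) + (j, w') = (k, w'') := Prod.ext h hw
  exact ⟨_, kappaMap_circ Q κ S hh h z z'⟩

theorem weightPart_act_mem (S : SubOperad Q) {m n : ℕ} {i : ℤ} {w : ℕ} (e : Fin m ≃ Fin n)
    {x : Q.obj m i} (hx : x ∈ weightPart Q κ S w m i) : Q.act e x ∈ weightPart Q κ S w n i := by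
  obtain ⟨z, rfl⟩ := hx
  exact ⟨_, kappaMap_act Q κ S (g := (i, w)) e z⟩

end Ins

/-! ### The weight decomposition of the differential -/

section Decomp

variable {K : Type u} [Field K] {C : CurvData K} (hC : C.IsCurv)
include hC

/-- The summands have weights 0, 1 and 2, so freeness makes each vanish already in Q₀ ∨ [κ].
Insertion of one κ is injective on Q₀, while insertion of two odd κ's only yields symmetry. Every
consequence of d² = 0 is read off from this lemma. -/
theorem CurvData.IsCurv.eq_zero {n : ℕ} {i j k : ℤ} (h : i + -1 = j) (h' : j + -1 = k)
    (a : C.Q₀.toGOperad.obj n k) (b : C.Q₀.toGOperad.obj (n + 1) j)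
    (c : C.Q₀.toGOperad.obj (n + 1 + 1) i)
    (e : a.1 + insK C.Q.toGOperad C.κ h' b.1 +
      insK C.Q.toGOperad C.κ h' (insK C.Q.toGOperad C.κ h c.1) = 0) :
    a = 0 ∧ b = 0 ∧ C.Q₀.toGOperad.act (blk n 1 1) c = c := by
  obtain rfl : j = k + 1 := by omega
  obtain rfl : i = k + 1 + 1 := by omega
  let za : (adjKappa C.Q₀.toGOperad).obj n (k, 0) := ofK C.Q₀.toGOperad a
  let zb : (adjKappa C.Q₀.toGOperad).obj n (k, 1) := (adjKappa C.Q₀.toGOperad).circ (a := n) (b := 0) pdK_degree (ofK C.Q₀.toGOperad b)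
    (varK C.Q₀.toGOperad)
  let zc : (adjKappa C.Q₀.toGOperad).obj n (k, 2) := (adjKappa C.Q₀.toGOperad).circ (a := n) (b := 0) (pdK_degree (w := 1))
    ((adjKappa C.Q₀.toGOperad).circ (a := n + 1) (b := 0) (pdK_degree (w := 0)) (ofK C.Q₀.toGOperad c)
      (varK C.Q₀.toGOperad)) (varK C.Q₀.toGOperad)
  let f : ∀ w, (adjKappa C.Q₀.toGOperad).obj n (k, w) →ₗ[K] DirectSum ℕ fun w => (adjKappa C.Q₀.toGOperad).obj n (k, w) :=
    fun w => DirectSum.lof K ℕ (fun w => (adjKappa C.Q₀.toGOperad).obj n (k, w)) w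
  have hz : f 0 za + f 1 zb + f 2 zc = 0 := by
    apply (hC.free n k).1
    rw [map_zero, map_add, map_add]
    have t : ∀ w z, DirectSum.toModule K ℕ (C.Q.obj n k)
        (kappaMap C.Q.toGOperad C.κ C.Q₀ n k) (f w z) = kappaMap C.Q.toGOperad C.κ C.Q₀ n k w z :=
      fun w z => DirectSum.toModule_lof K (φ := kappaMap C.Q.toGOperad C.κ C.Q₀ n k) w z
    rw [t, t, t, ← e]
    rfl
  have comp : ∀ w, (f 0 za + f 1 zb + f 2 zc) w = 0 := fun w => by rw [hz]; rfl
  have h0 : za = 0 := by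
    have := comp 0
    rw [DirectSum.add_apply, DirectSum.add_apply] at this
    simp only [f, DirectSum.lof_eq_of, DirectSum.of_eq_same] at this
    rw [DirectSum.of_eq_of_ne _ _ _ (by decide), DirectSum.of_eq_of_ne _ _ _ (by decide), add_zero,
      add_zero] at this
    exact this
  have h1 : zb = 0 := by
    have := comp 1
    rw [DirectSum.add_apply, DirectSum.add_apply] at this
    simp only [f, DirectSum.lof_eq_of, DirectSum.of_eq_same] at this
    rw [DirectSum.of_eq_of_ne _ _ _ (by decide), DirectSum.of_eq_of_ne _ _ _ (by decide), add_zero,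
      zero_add] at this
    exact this
  have h2 : zc = 0 := by
    have := comp 2
    rw [DirectSum.add_apply, DirectSum.add_apply] at this
    simp only [f, DirectSum.lof_eq_of, DirectSum.of_eq_same] at this
    rw [DirectSum.of_eq_of_ne _ _ _ (by decide), DirectSum.of_eq_of_ne _ _ _ (by decide), zero_add,
      zero_add] at this
    exact this
  have inj : ∀ {m : ℕ} {l : ℤ} {x y : C.Q₀.toGOperad.obj m l},
      ofK C.Q₀.toGOperad x = ofK C.Q₀.toGOperad y → x = y := fun {m l x y} hxy =>
    Subtype.ext (congrArg (kappaMap C.Q.toGOperad C.κ C.Q₀ m l 0) hxy)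
  refine ⟨inj (h0.trans (map_zero _).symm), inj ?_, inj ?_⟩
  · rw [map_zero]
    exact circ_varK_injective _ b h1
  · exact circ_circ_varK_eq_zero _ c h2

theorem CurvData.IsCurv.insK_injective {n : ℕ} {j k : ℤ} (h' : j + -1 = k)
    {b b' : C.Q₀.toGOperad.obj (n + 1) j}
    (e : insK C.Q.toGOperad C.κ h' b.1 = insK C.Q.toGOperad C.κ h' b'.1) : b = b' := by
  have := (hC.eq_zero (i := j + 1) (by ring) h' 0 (b - b') 0 (by
    change (0 : C.Q.obj n k) + insK C.Q.toGOperad C.κ h' (b.1 - b'.1) +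
      insK C.Q.toGOperad C.κ h' (insK C.Q.toGOperad C.κ _ 0) = 0
    rw [map_sub, e, sub_self, map_zero, map_zero, add_zero, add_zero])).2.1
  exact sub_eq_zero.1 this

theorem CurvData.IsCurv.exists_d {n : ℕ} {i j : ℤ} (h : i + -1 = j) (x : C.Q₀.toGOperad.obj n i) :
    ∃ (a : C.Q₀.toGOperad.obj n j) (b : C.Q₀.toGOperad.obj (n + 1) i),
      C.Q.d.map h x.1 = a.1 + sg K i • insK C.Q.toGOperad C.κ h b.1 := by
  have := hC.strict_mixed 0 n i j h x.1 ((mem_weightPart_zero _ _ _).2 x.2)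
  obtain ⟨y, hy, z, hz, e⟩ := Submodule.mem_sup.1 this
  obtain ⟨b, hb, rfl⟩ := (mem_weightPart_one _ _ _ h).1 hz
  -- The sign is absorbed into the operation that receives κ. With this choice ∂ satisfies the
  -- Leibniz rule of a right derivation of degree 0, without further signs.
  refine ⟨⟨y, (mem_weightPart_zero _ _ _).1 hy⟩, sg K i • ⟨b, hb⟩, ?_⟩
  rw [← e]
  change y + _ = y + sg K i • insK C.Q.toGOperad C.κ h (sg K i • b)
  rw [map_smul, smul_smul, sg_mul_self, one_smul]

/-- The component `d₀` of the differential, on `Q₀`. -/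
noncomputable def CurvData.IsCurv.d₀ {n : ℕ} {i j : ℤ} (h : i + -1 = j)
    (x : C.Q₀.toGOperad.obj n i) : C.Q₀.toGOperad.obj n j := (hC.exists_d h x).choose

/-- The derivative `∂` on `Q₀`, which describes the component `d₁` of the
differential: `d₁ x = ± ∂x(..., κ)`. -/
noncomputable def CurvData.IsCurv.pdFun {n : ℕ} {i : ℤ} (x : C.Q₀.toGOperad.obj n i) :
    C.Q₀.toGOperad.obj (n + 1) i := (hC.exists_d rfl x).choose_spec.choose

theorem CurvData.IsCurv.d_unique {n : ℕ} {i j : ℤ} (h : i + -1 = j)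
    {a a' : C.Q₀.toGOperad.obj n j} {b b' : C.Q₀.toGOperad.obj (n + 1) i}
    (e : a.1 + sg K i • insK C.Q.toGOperad C.κ h b.1 =
      a'.1 + sg K i • insK C.Q.toGOperad C.κ h b'.1) : a = a' ∧ b = b' := by
  have hs : sg K i ≠ 0 := fun h0 => by simpa [h0] using sg_mul_self K i
  have := hC.eq_zero (i := i + 1) (by ring) h (a - a') (sg K i • (b - b')) 0 (by
    change (a.1 - a'.1) + insK C.Q.toGOperad C.κ h (sg K i • (b.1 - b'.1)) +
      insK C.Q.toGOperad C.κ h (insK C.Q.toGOperad C.κ _ 0) = 0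
    rw [map_smul, map_sub, map_zero, map_zero, add_zero, smul_sub, ← sub_eq_zero.2 e]
    abel)
  exact ⟨sub_eq_zero.1 this.1, sub_eq_zero.1 ((smul_eq_zero.1 this.2.1).resolve_left hs)⟩

theorem CurvData.IsCurv.d_eq {n : ℕ} {i j : ℤ} (h : i + -1 = j) (x : C.Q₀.toGOperad.obj n i) :
    C.Q.d.map h x.1 = (hC.d₀ h x).1 + sg K i • insK C.Q.toGOperad C.κ h (hC.pdFun x).1 := by
  subst h
  have e := (hC.exists_d rfl x).choose_spec.choose_spec
  exact e

theorem CurvData.IsCurv.eq_of_d_eq {n : ℕ} {i j : ℤ} (h : i + -1 = j) {x : C.Q₀.toGOperad.obj n i}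
    {a : C.Q₀.toGOperad.obj n j} {b : C.Q₀.toGOperad.obj (n + 1) i}
    (e : C.Q.d.map h x.1 = a.1 + sg K i • insK C.Q.toGOperad C.κ h b.1) :
    hC.d₀ h x = a ∧ hC.pdFun x = b := hC.d_unique h ((hC.d_eq h x).symm.trans e)

/-- The derivative `∂` on `Q₀`. -/
noncomputable def CurvData.IsCurv.pd : PDer C.Q₀.toGOperad 0 :=
  PDer.mk₀ (fun {n g} =>
    { toFun := hC.pdFun
      map_add' := fun x y => (hC.eq_of_d_eq rfl (a := hC.d₀ rfl x + hC.d₀ rfl y) (by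
        change C.Q.d.map rfl (x.1 + y.1) = ((hC.d₀ rfl x).1 + (hC.d₀ rfl y).1) + sg K g •
          insK C.Q.toGOperad C.κ rfl ((hC.pdFun x).1 + (hC.pdFun y).1)
        rw [map_add, hC.d_eq, hC.d_eq, map_add, smul_add]
        abel)).2
      map_smul' := fun c x => (hC.eq_of_d_eq rfl (a := c • hC.d₀ rfl x) (by
        change C.Q.d.map rfl (c • x.1) = c • (hC.d₀ rfl x).1 + sg K g •
          insK C.Q.toGOperad C.κ rfl (c • (hC.pdFun x).1)
        rw [map_smul, hC.d_eq, map_smul, smul_add, smul_comm c])).2 })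
    (fun {m n g} e x => (hC.eq_of_d_eq rfl (a := C.Q₀.toGOperad.act e (hC.d₀ rfl x)) (by
      change C.Q.d.map rfl (C.Q.act e x.1) = C.Q.act e (hC.d₀ rfl x).1 + sg K g •
        insK C.Q.toGOperad C.κ rfl (C.Q.act (sumE e (Equiv.refl (Fin 1))) (hC.pdFun x).1)
      rw [Der.map_act, hC.d_eq, map_add, map_smul, insK_act])).2)
    -- Leibniz for d on a composite is sorted into weight 0, which is the candidate for d₀, and
    -- weight 1, from which the rule for ∂ follows by uniqueness.
    (fun {a b g₁ g₂ g} h x y => (hC.eq_of_d_eq rfl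
      (a := C.Q₀.toGOperad.circ (g := g₁ + -1) (by rw [← h]; ring) (hC.d₀ rfl x) y +
        sg K g₁ • C.Q₀.toGOperad.circ (g' := g₂ + -1) (by rw [← h]; ring) x (hC.d₀ rfl y)) (by
      change C.Q.d.map rfl (C.Q.circ h x.1 y.1) =
        (C.Q.circ _ (hC.d₀ rfl x).1 y.1 + sg K g₁ • C.Q.circ _ x.1 (hC.d₀ rfl y).1) + sg K g •
        insK C.Q.toGOperad C.κ rfl (C.Q.act (blk a 1 b)
          (C.Q.circ (a := a + 1) h (C.Q.act (blk a 1 1) (hC.pdFun x).1) y.1) +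
          C.Q.circ (a := a) (b := b + 1) h x.1 (hC.pdFun y).1)
      rw [C.Q.d.map_circ h rfl rfl rfl (by rw [← h]; ring) (by rw [← h]; ring), hC.d_eq, hC.d_eq,
        map_add, map_add, map_add, LinearMap.add_apply, map_smul, map_smul, LinearMap.smul_apply,
        insK_circ C.Q.toGOperad C.κ rfl _ h rfl, circ_insK C.Q.toGOperad C.κ rfl _ h rfl]
      have hs : sg K g = sg K g₁ * sg K g₂ := by rw [← h, sg_add]
      have hd : deg g₁ = g₁ := rfl
      rw [hs, hd]
      module)).2)

theorem CurvData.IsCurv.d_eq_pd {n : ℕ} {i j : ℤ} (h : i + -1 = j) (x : C.Q₀.toGOperad.obj n i) :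
    C.Q.d.map h x.1 = (hC.d₀ h x).1 + sg K i • insK C.Q.toGOperad C.κ h (hC.pd.ap₀ x).1 :=
  hC.d_eq h x

theorem CurvData.IsCurv.eq_pd_of_d_eq {n : ℕ} {i j : ℤ} (h : i + -1 = j)
    {x : C.Q₀.toGOperad.obj n i} {a : C.Q₀.toGOperad.obj n j} {b : C.Q₀.toGOperad.obj (n + 1) i}
    (e : C.Q.d.map h x.1 = a.1 + sg K i • insK C.Q.toGOperad C.κ h b.1) :
    hC.d₀ h x = a ∧ hC.pd.ap₀ x = b := hC.eq_of_d_eq h e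

theorem CurvData.IsCurv.exists_ellOne : ∃ l : C.Q₀.toGOperad.obj (0 + 1) (-1),
    C.Q.d.map (show (-1 : ℤ) + -1 = -2 by norm_num) C.κ =
      - insK C.Q.toGOperad C.κ (show (-1 : ℤ) + -1 = -2 by norm_num) l.1 := by
  obtain ⟨b, hb, e⟩ := (mem_weightPart_one _ _ _ (show (-1 : ℤ) + -1 = -2 by norm_num)).1 hC.d_kappa
  refine ⟨-⟨b, hb⟩, ?_⟩
  rw [← e]
  change _ = - insK C.Q.toGOperad C.κ _ (-b)
  rw [map_neg, neg_neg]

/-- The operation `ℓ₁`, defined by `dκ = -ℓ₁(κ)`. -/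
noncomputable def CurvData.IsCurv.ellOne : C.Q₀.toGOperad.obj (0 + 1) (-1) := hC.exists_ellOne.choose

theorem CurvData.IsCurv.d_kappa_eq (h : (-1 : ℤ) + -1 = -2) :
    C.Q.d.map h C.κ = - insK C.Q.toGOperad C.κ h hC.ellOne.1 := hC.exists_ellOne.choose_spec

/-- Besides d x there is the term from dκ = -ℓ₁(κ), and x(…, ℓ₁(κ)) is x ∘ ℓ₁ with κ inserted; hence
it joins the weight one part. -/
theorem CurvData.IsCurv.d_insK {n : ℕ} {i j k : ℤ} (h : i + -1 = j) (h' : j + -1 = k)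
    (x : C.Q₀.toGOperad.obj (n + 1) i) :
    C.Q.d.map h' (insK C.Q.toGOperad C.κ h x.1) = insK C.Q.toGOperad C.κ h' ((hC.d₀ h x).1 -
        sg K i • C.Q.circ (a := n) (b := 0 + 1) h x.1 hC.ellOne.1) +
      sg K i • insK C.Q.toGOperad C.κ h' (insK C.Q.toGOperad C.κ h (hC.pd.ap₀ x).1) := by
  refine (C.Q.d.map_circ (a := n) (b := 0) h h (show (-1 : ℤ) + -1 = -2 by norm_num) h' h'
    (by omega) x.1 C.κ).trans ?_
  rw [hC.d_kappa_eq, hC.d_eq_pd, map_neg, smul_neg, circ_insK C.Q.toGOperad C.κ _ _ h h', map_sub,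
    map_smul, map_add, LinearMap.add_apply, map_smul, LinearMap.smul_apply]
  change insK C.Q.toGOperad C.κ h' _ + sg K i • insK C.Q.toGOperad C.κ h' _ + -(sg K i • _) = _
  abel

/-- These are the parts of weight 1 and 2 of d(d x) = 0: the commutation of d₀ and ∂ up to ℓ₁, and
the symmetry of second derivatives. -/
theorem CurvData.IsCurv.pd_facts {n : ℕ} {i j : ℤ} (h : i + -1 = j) (x : C.Q₀.toGOperad.obj n i) :
    hC.d₀ h (hC.pd.ap₀ x) = hC.pd.ap₀ (hC.d₀ h x) +
        sg K i • C.Q₀.toGOperad.circ (a := n) (b := 0 + 1) h (hC.pd.ap₀ x) hC.ellOne ∧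
      C.Q₀.toGOperad.act (blk n 1 1) (hC.pd.ap₀ (hC.pd.ap₀ x)) = hC.pd.ap₀ (hC.pd.ap₀ x) := by
  obtain ⟨k, hk⟩ : ∃ k, j + -1 = k := ⟨_, rfl⟩
  have e := C.Q.d_sq h hk x.1
  have hs : sg K j = - sg K i := by
    rw [← h, sg_add, sg_neg_one]; ring
  have hs2 := sg_mul_self K i
  rw [hC.d_eq_pd, map_add, hC.d_eq_pd, map_smul, hC.d_insK h hk, hs] at e
  have := hC.eq_zero h hk (hC.d₀ hk (hC.d₀ h x)) (- sg K i • hC.pd.ap₀ (hC.d₀ h x) + sg K i •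
    (hC.d₀ h (hC.pd.ap₀ x) - sg K i • C.Q₀.toGOperad.circ (a := n) (b := 0 + 1) h (hC.pd.ap₀ x)
      hC.ellOne)) (hC.pd.ap₀ (hC.pd.ap₀ x)) (by
    change (hC.d₀ hk (hC.d₀ h x)).1 + insK C.Q.toGOperad C.κ hk (- sg K i •
      (hC.pd.ap₀ (hC.d₀ h x)).1 + sg K i • ((hC.d₀ h (hC.pd.ap₀ x)).1 - sg K i •
        C.Q.circ (a := n) (b := 0 + 1) h (hC.pd.ap₀ x).1 hC.ellOne.1)) +
      insK C.Q.toGOperad C.κ hk (insK C.Q.toGOperad C.κ h (hC.pd.ap₀ (hC.pd.ap₀ x)).1) = 0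
    rw [← e, map_add, map_smul, map_smul, smul_add, smul_smul, hs2, one_smul]
    abel)
  refine ⟨?_, this.2.2⟩
  have h2 := congrArg (fun t => sg K i • t) this.2.1
  have h3 : hC.d₀ h (hC.pd.ap₀ x) - (hC.pd.ap₀ (hC.d₀ h x) + sg K i •
      C.Q₀.toGOperad.circ (a := n) (b := 0 + 1) h (hC.pd.ap₀ x) hC.ellOne) = 0 := by
    rw [← h2.trans (smul_zero _), smul_add, smul_smul, smul_smul, mul_neg, hs2, neg_one_smul,
      one_smul]
    abel
  exact sub_eq_zero.1 h3

end Decomp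

/-! ### The curved L-infinity structure of an object of `Curv^Σ` -/

section Generation

variable {K : Type u} [Field K] {D : Type} [AddCommMonoid D] [HasDeg D] (E : GOperad K D)

theorem GOperad.act_eq_of_act_eq {m n : ℕ} {g : D} (e : Fin m ≃ Fin n) {x y : E.obj m g}
    (h : E.act e x = E.act e y) : x = y := by
  have := congrArg (E.act e.symm) h
  rwa [← E.act_trans, ← E.act_trans, Equiv.self_trans_symm, E.act_refl, E.act_refl] at this

/-- The symmetric group is generated by the permutations which fix the last letter and
the last adjacent transposition. -/
theorem GOperad.act_eq_self_of_generators {k : ℕ} {g : D} (x : E.obj (k + 1 + 1) g)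
    (h₁ : ∀ e : Fin (k + 1) ≃ Fin (k + 1), E.act (sumE e (Equiv.refl (Fin 1))) x = x)
    (h₂ : E.act (blk k 1 1) x = x) (e : Fin (k + 1 + 1) ≃ Fin (k + 1 + 1)) : E.act e x = x := by
  by_cases hl : e (Fin.last (k + 1)) = Fin.last (k + 1)
  · obtain ⟨t, rfl⟩ := exists_eq_sumE e hl
    exact h₁ t
  · have hj : (e (Fin.last (k + 1)) : ℕ) < k + 1 := by
      have := (e (Fin.last (k + 1))).2
      have h' : (e (Fin.last (k + 1)) : ℕ) ≠ k + 1 := fun h => hl (Fin.ext h)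
      omega
    -- `t` moves the image of the last letter to the last place but one, and the adjacent
    -- transposition brings it to the end; the composite with `e` then fixes the last letter.
    let t : Fin (k + 1) ≃ Fin (k + 1) := Equiv.swap ⟨_, hj⟩ (Fin.last k)
    have hs : ((sumE t (Equiv.refl (Fin 1)) (e (Fin.last (k + 1))) : Fin _) : ℕ) = k := by
      rw [sumE_val, dif_pos hj, Equiv.swap_apply_left]
      rfl
    obtain ⟨s, hs⟩ := exists_eq_sumE ((e.trans (sumE t (Equiv.refl (Fin 1)))).trans (blk k 1 1)) (by
      rw [Fin.ext_iff, Equiv.trans_apply, Equiv.trans_apply, blk_val, hs]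
      simp)
    have h3 := h₁ s
    rw [← hs, E.act_trans, E.act_trans] at h3
    refine E.act_eq_of_act_eq _ (E.act_eq_of_act_eq _ (h3.trans ?_))
    rw [h₁ t, h₂]

end Generation

/-! ### Morphisms out of cL∞ -/

section Lift

variable {K : Type u} [Field K]

theorem GHom.map_lieSum {P Q : GOperad K ℤ} (f : GHom P Q) (ℓ : ∀ n, P.obj n (-1)) (n : ℕ) :
    f.map (lieSum P ℓ n) = lieSum Q (fun n => f.map (ℓ n)) n := by
  simp only [lieSum, map_neg, map_sum, f.map_act, f.map_circ]

/-- A morphism out of a presented operad commutes with derivations if it does so on the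
generators. -/
theorem GHom.map_der_of_gen {D : Type} [AddCommMonoid D] [HasDeg D] {G : ℕ → D → Type u}
    {R : ∀ ⦃n : ℕ⦄ ⦃g : D⦄, Pre K G n g → Pre K G n g → Prop} {X : GOperad K D} {δ : D}
    (f : GHom (Pres R) X) (d : Der (Pres R) δ) (d' : Der X δ)
    (H : ∀ {n : ℕ} {g g' : D} (h : g + δ = g') (x : G n g),
      f.map (d.map h (Pres.gen R x)) = d'.map h (f.map (Pres.gen R x)))
    {n : ℕ} {g g' : D} (h : g + δ = g') (x : (Pres R).obj n g) :
    f.map (d.map h x) = d'.map h (f.map x) := by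
  induction x using Pres.induction generalizing g' with
  | gen x => exact H h x
  | one => rw [d.map_one, f.map_one, d'.map_one, map_zero]
  | zero => simp only [map_zero]
  | add x y hx hy => simp only [map_add, hx, hy]
  | smul c x hx => simp only [map_smul, hx]
  | act e x hx => rw [d.map_act, f.map_act, f.map_act, d'.map_act, hx]
  | circ k x y hx hy =>
    rename_i a b p q r
    have k₁ : p + δ + q = g' := by rw [← h, ← k, add_right_comm]
    have k₂ : p + (q + δ) = g' := by rw [← h, ← k, add_assoc]
    rw [d.map_circ k rfl rfl h k₁ k₂, f.map_circ, d'.map_circ k rfl rfl h k₁ k₂, map_add, map_smul,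
      f.map_circ, f.map_circ, hx, hy]

variable (X : GOperad K ℤ) (ℓ : ∀ n, X.obj n (-1))

/-- Values of the generators `ℓ_n`. -/
def lVal : ∀ ⦃n : ℕ⦄ ⦃g : ℤ⦄, LGen.{u} n g → X.obj n g
  | _, _, .ell n => ℓ n

/-- The morphism from the free operad on the invariant generators `ℓ_n` with given values. -/
def liftL (hℓ : ∀ (n : ℕ) (e : Fin n ≃ Fin n), X.act e (ℓ n) = ℓ n) : GHom (freeL K) X where
  map {n g} := Pres.lift (R := LRel K) (D' := ℤ) X (AddMonoidHom.id ℤ) (lVal X ℓ) (fun _ => rfl) (by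
    intro n g x y r
    cases r with
    | symm e => exact hℓ n e)
  map_act e x := by
    induction x using Pres.ind
    rfl
  map_one := rfl
  map_circ h x y := by
    induction x using Pres.ind; induction y using Pres.ind
    rfl

variable [CharZero K]

/-- The morphism from `cL∞` determined by operations `ℓ_n` which satisfy the curved
L-infinity relations. -/
def liftCL (X : DGOp K) (ℓ : ∀ n, X.obj n (-1))
    (hℓ : ∀ (n : ℕ) (e : Fin n ≃ Fin n), X.act e (ℓ n) = ℓ n)
    (hd : ∀ (n : ℕ) (h : (-1 : ℤ) + -1 = -2), X.d.map h (ℓ n) = lieSum X.toGOperad ℓ n) :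
    cLinf K ⟶ X :=
  { liftL X.toGOperad ℓ hℓ with
    map_d := fun {n i j} h x => by
      refine GHom.map_der_of_gen (R := LRel K) (liftL X.toGOperad ℓ hℓ) (cLinfDer K) X.d ?_ h x
      rintro n g g' h ⟨n⟩
      obtain rfl : g' = -2 := by omega
      exact ((liftL X.toGOperad ℓ hℓ).map_lieSum (ell K) n).trans (hd n h).symm }

theorem app_liftCL (X : DGOp K) (ℓ : ∀ n, X.obj n (-1)) (hℓ) (hd) (n : ℕ) :
    app (liftCL X ℓ hℓ hd) (ell K n) = ℓ n := rfl

theorem cLinf_hom_ext {X : DGOp K} {φ ψ : cLinf K ⟶ X}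
    (h : ∀ n, app φ (ell K n) = app ψ (ell K n)) : φ = ψ := by
  refine DGHom.ext_app fun {n i} x => ?_
  refine Pres.induction (R := LRel K) (p := fun {n i} x => app φ x = app ψ x) ?_ ?_ ?_ ?_ ?_ ?_ ?_ x
  · rintro n g ⟨n⟩
    exact h n
  · exact (DGHom.toGHom φ).map_one.trans (DGHom.toGHom ψ).map_one.symm
  · intro n g
    exact (map_zero (app φ)).trans (map_zero (app ψ)).symm
  · intro n g x y hx hy
    exact (map_add (app φ) x y).trans ((congrArg₂ (· + ·) hx hy).trans (map_add (app ψ) x y).symm)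
  · intro n g c x hx
    exact (map_smul (app φ) c x).trans ((congrArg (c • ·) hx).trans (map_smul (app ψ) c x).symm)
  · intro m n g e x hx
    exact ((DGHom.toGHom φ).map_act e x).trans ((congrArg (X.act e) hx).trans
      ((DGHom.toGHom ψ).map_act e x).symm)
  · intro a b g g' g'' k x y hx hy
    exact ((DGHom.toGHom φ).map_circ k x y).trans
      ((congrArg₂ (fun s t => X.circ k s t) hx hy).trans ((DGHom.toGHom ψ).map_circ k x y).symm)

end Lift

/-! ### The operations ℓ_n in Q₀ and the curved relations -/

section Structure

open Finset hiding antidiagonal mem_antidiagonal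

/-- In arity 0 the only summand is ℓ₁ ∘ ℓ₀. -/
theorem lieSum_zero_eq_zero {K : Type u} [Field K] (E : GOperad K ℤ) (ℓ : ∀ n, E.obj n (-1))
    (h : ℓ 0 = 0) : lieSum E ℓ 0 = 0 := by
  rw [lieSum, neg_eq_zero]
  refine sum_eq_zero fun A _ => ?_
  have hA : #Aᶜ = 0 := by rw [Subsingleton.elim Aᶜ ∅, card_empty]
  have hq : ∀ q, q = 0 → ℓ q = 0 := by
    rintro q rfl
    exact h
  rw [hq #Aᶜ hA, map_zero, map_zero]

variable {K : Type u} [Field K] {C : CurvData K} (hC : C.IsCurv)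
include hC

/-- The parts of weight 1 and 2 of d(dκ) = 0. They start the inductions over n: `pd_facts` says
nothing about ∂ℓ₁, since ℓ₁ is not itself given as a derivative. -/
theorem CurvData.IsCurv.ellOne_facts :
    hC.d₀ (show (-1 : ℤ) + -1 = -2 by norm_num) hC.ellOne = - C.Q₀.toGOperad.circ (a := 0)
      (b := 0 + 1) (g'' := -2) (by norm_num) hC.ellOne hC.ellOne ∧
    C.Q₀.toGOperad.act (blk 0 1 1) (hC.pd.ap₀ hC.ellOne) = hC.pd.ap₀ hC.ellOne := by
  have h : (-1 : ℤ) + -1 = -2 := by norm_num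
  have h' : (-2 : ℤ) + -1 = -3 := by norm_num
  have e := C.Q.d_sq h h' C.κ
  rw [hC.d_kappa_eq, map_neg, neg_eq_zero, hC.d_insK h h', sg_neg_one] at e
  have := hC.eq_zero h h' 0 (hC.d₀ h hC.ellOne + C.Q₀.toGOperad.circ (a := 0)
      (b := 0 + 1) h hC.ellOne hC.ellOne) (- hC.pd.ap₀ hC.ellOne) (by
    change (0 : C.Q.obj 0 (-3)) + insK C.Q.toGOperad C.κ h' ((hC.d₀ h hC.ellOne).1 +
      C.Q.circ (a := 0) (b := 0 + 1) h hC.ellOne.1 hC.ellOne.1) + insK C.Q.toGOperad C.κ h'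
        (insK C.Q.toGOperad C.κ h (- (hC.pd.ap₀ hC.ellOne).1)) = 0
    rw [map_neg, map_neg, ← sub_eq_add_neg]
    rw [neg_one_smul, neg_one_smul, sub_neg_eq_add, ← sub_eq_add_neg] at e
    exact (congrArg (· - _) (zero_add _)).trans e)
  refine ⟨eq_neg_of_add_eq_zero_left this.2.1, ?_⟩
  have h2 := this.2.2
  rw [map_neg] at h2
  exact neg_injective h2

/-- The operations `ℓ_n`, `n ≥ 1`, of an object of `Curv^Σ` (and zero for `n = 0`). -/
noncomputable def CurvData.IsCurv.ellPos : ∀ n, C.Q₀.toGOperad.obj n (-1)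
  | 0 => 0
  | 1 => hC.ellOne
  | n + 2 => hC.pd.ap₀ (CurvData.IsCurv.ellPos (n + 1))

theorem CurvData.IsCurv.ap₀_ellPos (n : ℕ) : hC.pd.ap₀ (hC.ellPos (n + 1)) = hC.ellPos (n + 2) := rfl

/-- Permutations fixing the last input come from the symmetry of the preceding operation by
equivariance of ∂; the last transposition is the symmetry of a second derivative, or `ellOne_facts`
in arity 2. Together they generate the symmetric group. -/
theorem CurvData.IsCurv.act_ellPos (n : ℕ) (e : Fin n ≃ Fin n) :
    C.Q₀.toGOperad.act e (hC.ellPos n) = hC.ellPos n := by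
  induction n with
  | zero => exact map_zero _
  | succ n ih =>
    cases n with
    | zero =>
      obtain rfl : e = Equiv.refl _ := Equiv.ext fun i => Subsingleton.elim (α := Fin 1) _ _
      exact C.Q₀.toGOperad.act_refl _
    | succ n =>
      refine GOperad.act_eq_self_of_generators _ _ (fun e => ?_) ?_ e
      · rw [← hC.ap₀_ellPos, ← hC.pd.ap₀_act, ih]
      · cases n with
        | zero => exact hC.ellOne_facts.2
        | succ n => exact (hC.pd_facts rfl (hC.ellPos (n + 1))).2

/-- Apply ∂ to the relation for n. Here the zeroth operation is 0, so its derivative is 0 instead of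
ℓ₁ and `ap₀_lieSum` leaves an extra term ℓ_{n+1} ∘ ℓ₁; it cancels against the commutator of d₀ and
∂. -/
theorem CurvData.IsCurv.d₀_ellPos (n : ℕ) (h : (-1 : ℤ) + -1 = -2) :
    hC.d₀ h (hC.ellPos (n + 1)) = lieSum C.Q₀.toGOperad hC.ellPos (n + 1) := by
  have hz : hC.pd.ap₀ (hC.ellPos 0) = 0 := map_zero _
  have key := ap₀_lieSum C.Q₀.toGOperad hC.ellPos hC.act_ellPos hC.pd hC.ap₀_ellPos
  rw [hz, sub_zero] at key
  induction n with
  | zero =>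
    have h0 : lieSum C.Q₀.toGOperad hC.ellPos 0 = 0 := lieSum_zero_eq_zero _ _ rfl
    have k := key 0
    rw [h0, map_zero] at k
    exact hC.ellOne_facts.1.trans (neg_eq_of_add_eq_zero_left k.symm)
  | succ n ih =>
    have e := (hC.pd_facts h (hC.ellPos (n + 1))).1
    rw [ih, key, sg_neg_one, neg_one_smul] at e
    exact e.trans (add_neg_cancel_right _ _)

/-- The curvature enters only as inner operation, in the summand of the full set, which is
ℓ_{n+1}(…, κ). The other summands involve operations of Q₀ only. This splits the curved relation by
weight. -/
theorem CurvData.IsCurv.lieSum_eq {ℓ : ∀ n, C.Q.obj n (-1)}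
    (hℓ : ∀ (n : ℕ) (e : Fin n ≃ Fin n), C.Q.act e (ℓ n) = ℓ n)
    {ℓ' : ∀ n, C.Q₀.toGOperad.obj n (-1)} (h₀ : ℓ' 0 = 0) (h₁ : ∀ n, (ℓ' (n + 1)).1 = ℓ (n + 1))
    (hκ : ℓ 0 = C.κ) (n : ℕ) :
    lieSum C.Q.toGOperad ℓ n = (lieSum C.Q₀.toGOperad ℓ' n).1 -
      insK C.Q.toGOperad C.κ (show (-1 : ℤ) + -1 = -2 by norm_num) (ℓ (n + 1)) := by
  have hq : ∀ q, q ≠ 0 → ℓ q = (ℓ' q).1 := by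
    intro q hq
    obtain ⟨q, rfl⟩ := Nat.exists_eq_succ_of_ne_zero hq
    exact (h₁ q).symm
  have hsum : (lieSum C.Q₀.toGOperad ℓ' n).1 = - ∑ A : Finset (Fin n),
      C.Q.act (shuf A) (C.Q.circ (g'' := -2) (by norm_num) (ℓ' (#A + 1)).1 (ℓ' #Aᶜ).1) := by
    have e := map_sum (C.Q₀.carrier n (-2)).subtype (fun A : Finset (Fin n) =>
      C.Q₀.toGOperad.act (shuf A) (C.Q₀.toGOperad.circ (g'' := -2) (by norm_num) (ℓ' (#A + 1))
        (ℓ' #Aᶜ))) univ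
    exact congrArg (fun t => - t) e
  rw [hsum, lieSum_eq_sum_lieTerm,
    ← sum_erase_add _ _ (mem_univ (univ : Finset (Fin n))),
    ← sum_erase_add univ (fun A : Finset (Fin n) => C.Q.act (shuf A)
      (C.Q.circ (g'' := -2) (by norm_num) (ℓ' (#A + 1)).1 (ℓ' #Aᶜ).1))
        (mem_univ (univ : Finset (Fin n))), lieTerm_univ C.Q.toGOperad ℓ hℓ]
  have e1 : ∑ A ∈ univ.erase (univ : Finset (Fin n)), lieTerm C.Q.toGOperad ℓ A =
      ∑ A ∈ univ.erase (univ : Finset (Fin n)), C.Q.act (shuf A)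
      (C.Q.circ (g'' := -2) (by norm_num) (ℓ' (#A + 1)).1 (ℓ' #Aᶜ).1) := by
    refine sum_congr rfl fun A hA => ?_
    have hne : #Aᶜ ≠ 0 := by
      rw [mem_erase] at hA
      intro h
      exact hA.1 (by rwa [card_eq_zero, compl_eq_empty_iff] at h)
    rw [lieTerm, lieX, hq _ hne, h₁]
  have e2 : (ℓ' #(univ : Finset (Fin n))ᶜ).1 = 0 := by
    have : ∀ q, q = 0 → (ℓ' q).1 = 0 := by
      rintro q rfl
      rw [h₀]
      rfl
    exact this _ (by simp)
  rw [e1, e2, map_zero, map_zero, add_zero, lieX, hκ, insK_apply]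
  abel

/-- The operations `ℓ_n` of an object of `Curv^Σ`. -/
noncomputable def CurvData.IsCurv.ellAll : ∀ n, C.Q.obj n (-1)
  | 0 => C.κ
  | n + 1 => (hC.ellPos (n + 1)).1

theorem CurvData.IsCurv.act_ellAll (n : ℕ) (e : Fin n ≃ Fin n) :
    C.Q.act e (hC.ellAll n) = hC.ellAll n := by
  cases n with
  | zero =>
    obtain rfl : e = Equiv.refl _ := Subsingleton.elim _ _
    exact C.Q.act_refl _
  | succ n => exact congrArg Subtype.val (hC.act_ellPos (n + 1) e)

/-- Compared by weight, the relation consists of `d₀_ellPos` and ∂ℓ_n = ℓ_{n+1}; for n = 0 it is the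
defining equation of ℓ₁. -/
theorem CurvData.IsCurv.d_ellAll (n : ℕ) (h : (-1 : ℤ) + -1 = -2) :
    C.Q.d.map h (hC.ellAll n) = lieSum C.Q.toGOperad hC.ellAll n := by
  rw [hC.lieSum_eq hC.act_ellAll (ℓ' := hC.ellPos) rfl (fun _ => rfl) rfl]
  cases n with
  | zero =>
    have h0 : lieSum C.Q₀.toGOperad hC.ellPos 0 = 0 := lieSum_zero_eq_zero _ _ rfl
    rw [h0]
    exact (hC.d_kappa_eq h).trans (zero_sub _).symm
  | succ n =>
    rw [← hC.d₀_ellPos n h]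
    refine (hC.d_eq_pd h (hC.ellPos (n + 1))).trans ?_
    rw [sg_neg_one, neg_one_smul, hC.ap₀_ellPos, sub_eq_add_neg]
    rfl

/-- The operations of a curved L-infinity structure with `ℓ₀ = κ` and `ℓ_n ∈ Q₀` for
`n ≥ 1` are determined. -/
theorem CurvData.IsCurv.eq_ellPos {ℓ : ∀ n, C.Q.obj n (-1)}
    (hℓ : ∀ (n : ℕ) (e : Fin n ≃ Fin n), C.Q.act e (ℓ n) = ℓ n)
    (hd : ∀ (n : ℕ) (h : (-1 : ℤ) + -1 = -2), C.Q.d.map h (ℓ n) = lieSum C.Q.toGOperad ℓ n)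
    (hκ : ℓ 0 = C.κ) (hmem : ∀ n, ℓ (n + 1) ∈ C.Q₀.carrier (n + 1) (-1)) (n : ℕ) :
    ℓ (n + 1) = (hC.ellPos (n + 1)).1 := by
  have h : (-1 : ℤ) + -1 = -2 := by norm_num
  -- The value 0 in arity 0 removes the curvature, so that `lieSum_eq` separates the weights;
  -- injectivity of the insertion of κ then determines the next operation.
  let ℓ' : ∀ n, C.Q₀.toGOperad.obj n (-1) := fun n => match n with
    | 0 => 0
    | n + 1 => ⟨ℓ (n + 1), hmem n⟩
  have key := hC.lieSum_eq hℓ (ℓ' := ℓ') rfl (fun _ => rfl) hκ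
  suffices H : ℓ' (n + 1) = hC.ellPos (n + 1) from congrArg Subtype.val H
  induction n with
  | zero =>
    refine hC.insK_injective h ?_
    have e := hd 0 h
    rw [hκ, hC.d_kappa_eq, key] at e
    have h0 : lieSum C.Q₀.toGOperad ℓ' 0 = 0 := lieSum_zero_eq_zero _ _ rfl
    rw [h0] at e
    exact (neg_injective (e.trans (zero_sub _))).symm
  | succ n ih =>
    have e := (hC.eq_pd_of_d_eq h (x := ℓ' (n + 1)) (a := lieSum C.Q₀.toGOperad ℓ' (n + 1))
      (b := ℓ' (n + 2)) (by
        rw [sg_neg_one, neg_one_smul, ← sub_eq_add_neg]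
        exact (hd (n + 1) h).trans (key (n + 1)))).2
    rw [← e, ih]
    rfl

end Structure

/-! ### The unique morphism from cL∞ to an object of the category -/

section Main

variable {K : Type u} [Field K] [CharZero K]

theorem IsCurvStructure.app_ell {C : Curv K} {φ : cLinf K ⟶ C.Q} (hφ : IsCurvStructure C φ) (n : ℕ) :
    app φ (ell K (n + 1)) = (C.isCurv.ellPos (n + 1)).1 := by
  refine C.isCurv.eq_ellPos (ℓ := fun n => app φ (ell K n)) (fun n e => ?_) (fun n h => ?_) hφ.1 hφ.2 n
  · refine ((DGHom.toGHom φ).map_act e (ell K n)).symm.trans ?_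
    exact congrArg (app φ) (act_ell K n e)
  · refine (DGHom.map_d φ h (ell K n)).symm.trans ?_
    exact (DGHom.toGHom φ).map_lieSum (ell K) n

theorem existsUnique_isCurvStructure (C : Curv K) :
    ∃! φ : cLinf K ⟶ C.Q, IsCurvStructure C φ := by
  refine ⟨liftCL C.Q C.isCurv.ellAll C.isCurv.act_ellAll C.isCurv.d_ellAll,
    ⟨rfl, fun n => (C.isCurv.ellPos (n + 1)).2⟩, fun ψ hψ => cLinf_hom_ext fun n => ?_⟩
  rw [app_liftCL]
  cases n with
  | zero => exact hψ.1
  | succ n => exact hψ.app_ell n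

end Main

/-! ### Partial derivatives of `P ∨ T` -/

section AdjT

variable {K : Type u} [Field K]

theorem GOperad.circ_act_nullary {D : Type} [AddCommMonoid D] [HasDeg D] (E : GOperad K D) {m n : ℕ}
    {g g' g'' : D} (h : g + g' = g'') (e : Fin m ≃ Fin n) (x : E.obj (m + 1) g) (y : E.obj 0 g') :
    E.circ (a := n) (b := 0) h (E.act (sumE e (Equiv.refl (Fin 1))) x) y =
      E.act e (E.circ (a := m) (b := 0) h x y) := by
  have := E.circ_act (b := 0) h e (Equiv.refl (Fin 0)) x y
  rw [E.act_refl] at this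
  refine this.trans (E.act_congr _ fun i => ?_)
  have hi : (i : ℕ) < m := i.2
  rw [sumE_val, dif_pos hi]
  rfl

noncomputable instance instDecidableEqTGen : DecidableEq TGen := Classical.decEq _

variable (P : GOperad K ℤ)

/-- The partial derivative with respect to `α`. -/
noncomputable def pdA : PDer (adjT P) ((0, 0), 1) := Adj.pd P embT TGen.gr .alpha

/-- The partial derivative with respect to `κ`. -/
noncomputable def pdB : PDer (adjT P) ((-1, 1), 1) := Adj.pd P embT TGen.gr .kappa

/-- The generator `α`. -/
abbrev varA : (adjT P).obj 0 ((0, 0), 1) := Adj.var P embT TGen.gr .alpha TGen.gr_alpha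

/-- The generator `κ`. -/
abbrev varB : (adjT P).obj 0 ((-1, 1), 1) := Adj.var P embT TGen.gr .kappa TGen.gr_kappa

theorem degA (i : ℤ) (w N : ℕ) : ((i, w), N) + ((0, 0), 1) = ((i, w), N + 1) :=
  Prod.ext (Prod.ext (add_zero i) rfl) rfl

theorem sg_degA (K : Type u) [Field K] (z : ℤ) :
    sg K (deg (((0, 0), 1) : (ℤ × ℕ) × ℕ) * z) = 1 := by
  have : deg (((0, 0), 1) : (ℤ × ℕ) × ℕ) = 0 := rfl
  rw [this, zero_mul, sg_zero]

theorem degB {i j : ℤ} (h : i + -1 = j) (w N : ℕ) :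
    ((i, w), N) + ((-1, 1), 1) = ((j, w + 1), N + 1) := Prod.ext (Prod.ext h rfl) rfl

theorem pdA_of {n : ℕ} {i : ℤ} {g : (ℤ × ℕ) × ℕ} (h : embT i = g) (x : P.obj n i) :
    (pdA P).map (Adj.of P embT TGen.gr h x) = 0 := rfl

theorem pdA_varA {g p : (ℤ × ℕ) × ℕ} (h : TGen.gr .alpha = g) (k : p + ((0, 0), 1) = g)
    (k' : 0 = p) : (pdA P).map (Adj.var P embT TGen.gr .alpha h) ⟨p, k⟩ =
      (adjT P).cast k' (adjT P).one := Adj.pd_var_self _ _ _ _ _ _ _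

theorem pdB_varB {g p : (ℤ × ℕ) × ℕ} (h : TGen.gr .kappa = g) (k : p + ((-1, 1), 1) = g)
    (k' : 0 = p) : (pdB P).map (Adj.var P embT TGen.gr .kappa h) ⟨p, k⟩ =
      (adjT P).cast k' (adjT P).one := Adj.pd_var_self _ _ _ _ _ _ _

theorem pdA_varB {g : (ℤ × ℕ) × ℕ} (h : TGen.gr .kappa = g) :
    (pdA P).map (Adj.var P embT TGen.gr .kappa h) = 0 :=
  Adj.pd_var_ne _ _ _ _ _ (fun h => by cases h)

/-- Euler's identity for `α`, in the absence of `κ`. -/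
theorem circ_pdA {n : ℕ} {i : ℤ} {N : ℕ} (z : (adjT P).obj n ((i, 0), N + 1)) :
    (adjT P).circ (a := n) (b := 0) (degA i 0 N) ((pdA P).ap (degA i 0 N) z) (varA P) =
      (N + 1) • z := by
  have e := Adj.fillS_pd P embT TGen.gr .alpha
    -- The number of α's is the total number of variables minus the number of κ's, taken in ℤ so as
    -- to be additive.
    ((Nat.castAddMonoidHom ℤ).comp (AddMonoidHom.snd (ℤ × ℕ) ℕ) -
      ((Nat.castAddMonoidHom ℤ).comp (AddMonoidHom.snd ℤ ℕ)).comp (AddMonoidHom.fst (ℤ × ℕ) ℕ))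
    (fun i => rfl) rfl (fun w hw => by cases w <;> [exact (hw rfl).elim; rfl]) z
  refine (fillS_apply (γ := TGen.gr .alpha) (γ' := TGen.gr .alpha) (Adj.var P embT TGen.gr .alpha rfl)
    rfl ((Adj.pd P embT TGen.gr .alpha).map z) (degA i 0 N) (degA i 0 N)).symm.trans (e.trans ?_)
  rw [← natCast_zsmul]
  congr 1

/-- Euler's identity for `κ`. -/
theorem circ_pdB {n : ℕ} {i j : ℤ} (h : i + -1 = j) {w N : ℕ}
    (z : (adjT P).obj n ((j, w + 1), N + 1)) :
    (adjT P).circ (a := n) (b := 0) (degB h w N) ((pdB P).ap (degB h w N) z) (varB P) =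
      (w + 1) • z := by
  have e := Adj.fillS_pd P embT TGen.gr .kappa
    (((Nat.castAddMonoidHom ℤ).comp (AddMonoidHom.snd ℤ ℕ)).comp (AddMonoidHom.fst (ℤ × ℕ) ℕ))
    (fun i => rfl) rfl (fun w hw => by cases w <;> [rfl; exact (hw rfl).elim]) z
  refine (fillS_apply (γ := TGen.gr .kappa) (γ' := TGen.gr .kappa) (Adj.var P embT TGen.gr .kappa rfl)
    rfl ((Adj.pd P embT TGen.gr .kappa).map z) (degB h w N) (degB h w N)).symm.trans (e.trans ?_)
  rw [← natCast_zsmul]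
  rfl

/-- Such a degree asks for a positive number of κ's among no variables at all. By Euler's identity
for κ, w + 1 times `z` is an insertion into a derivative whose degree does not exist. -/
theorem adjT_eq_zero [CharZero K] {n : ℕ} {j : ℤ} {w : ℕ} (z : (adjT P).obj n ((j, w + 1), 0)) :
    z = 0 := by
  have e := Adj.fillS_pd P embT TGen.gr .kappa
    (((Nat.castAddMonoidHom ℤ).comp (AddMonoidHom.snd ℤ ℕ)).comp (AddMonoidHom.fst (ℤ × ℕ) ℕ))
    (fun i => rfl) rfl (fun w hw => by cases w <;> [rfl; exact (hw rfl).elim]) z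
  rw [Shift.eq_zero (fun ⟨q, hq⟩ => Nat.succ_ne_zero _ (congrArg Prod.snd hq)) (PDer.map _ z),
    map_zero] at e
  have e' : ((w + 1 : ℕ) : K) • z = 0 := by
    rw [Nat.cast_smul_eq_nsmul, ← natCast_zsmul]
    exact e.symm
  exact (smul_eq_zero.1 e').resolve_left (Nat.cast_ne_zero.2 (Nat.succ_ne_zero w))

theorem eq_zero_of_pdA [CharZero K] {n : ℕ} {i : ℤ} {N : ℕ} (z : (adjT P).obj n ((i, 0), N + 1))
    (h : (pdA P).ap (degA i 0 N) z = 0) : z = 0 := by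
  have e := circ_pdA P z
  rw [h, map_zero, LinearMap.zero_apply, ← Nat.cast_smul_eq_nsmul K] at e
  exact (smul_eq_zero.1 e.symm).resolve_left (Nat.cast_ne_zero.2 (Nat.succ_ne_zero N))

/-- Counts of variables are additive and nonnegative, so an expression without variables is built
from P alone. -/
theorem exists_of_adjT {n : ℕ} {i : ℤ} (z : (adjT P).obj n ((i, 0), 0)) :
    ∃ x, Adj.of P embT TGen.gr (embT_apply i) x = z := by
  suffices H : ∀ {n : ℕ} {g : (ℤ × ℕ) × ℕ} (z : (adjT P).obj n g), g.2 = 0 → g.1.2 = 0 →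
      ∃ (i : ℤ) (h : embT i = g) (x : P.obj n i), Adj.of P embT TGen.gr h x = z by
    obtain ⟨j, h, x, hx⟩ := H z rfl rfl
    obtain rfl : j = i := congrArg (fun g => g.1.1) h
    exact ⟨x, hx⟩
  intro n g z
  refine Adj.induction P embT TGen.gr (p := fun {n g} z => g.2 = 0 → g.1.2 = 0 →
      ∃ (i : ℤ) (h : embT i = g) (x : P.obj n i), Adj.of P embT TGen.gr h x = z)
      ?_ ?_ ?_ ?_ ?_ ?_ ?_ z
  · intro n i g h x _ _
    exact ⟨i, h, x, rfl⟩
  · intro v g h hg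
    rw [← h] at hg
    cases v <;> exact absurd hg Nat.one_ne_zero
  · intro n g hg hg'
    exact ⟨g.1.1, Prod.ext (Prod.ext rfl hg'.symm) hg.symm, 0, map_zero _⟩
  · intro n g x y hx hy hg hg'
    obtain ⟨i, rfl, x', rfl⟩ := hx hg hg'
    obtain ⟨j, h, y', rfl⟩ := hy hg hg'
    obtain rfl : j = i := congrArg (fun g => g.1.1) h
    exact ⟨j, rfl, x' + y', map_add _ _ _⟩
  · intro n g c x hx hg hg'
    obtain ⟨i, h, x', rfl⟩ := hx hg hg'
    exact ⟨i, h, c • x', map_smul _ _ _⟩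
  · intro m n g e x hx hg hg'
    obtain ⟨i, h, x', rfl⟩ := hx hg hg'
    exact ⟨i, h, P.act e x', Adj.of_act _ _ _ _ _ _⟩
  · intro a b g g' g'' h x y hx hy hg hg'
    have hs : g.2 + g'.2 = g''.2 := congrArg Prod.snd h
    have hs' : g.1.2 + g'.1.2 = g''.1.2 := congrArg (fun g => g.1.2) h
    obtain ⟨i, rfl, x', rfl⟩ := hx (by omega) (by omega)
    obtain ⟨j, rfl, y', rfl⟩ := hy (by omega) (by omega)
    have h3 : embT (i + j) = g'' := by rw [map_add]; exact h
    exact ⟨i + j, h3, P.circ rfl x' y', Adj.of_circ _ _ _ _ _ _ _ _ _ _⟩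

theorem of_adjTCounit {n : ℕ} {i : ℤ} (z : (adjT P).obj n ((i, 0), 0)) :
    Adj.of P embT TGen.gr (embT_apply i) (adjTCounit P z) = z := by
  obtain ⟨x, rfl⟩ := exists_of_adjT P z
  rfl

/-- d_T turns one α at a time into κ, which is differentiation in α followed by insertion of κ. The
factor converts the right derivation so obtained into a left one: the odd element passes the whole
expression. -/
theorem derT_eq {n : ℕ} {g g' : (ℤ × ℕ) × ℕ} (h : g + ((-1, 1), 0) = g')
    (k : g' + ((0, 0), 1) = g + ((-1, 1), 1)) (z : (adjT P).obj n g) :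
    (derT P).map h z = sg K (deg g) • fillS (varB P) k ((pdA P).map z) := by
  refine Adj.induction P embT TGen.gr (p := fun {n g} z => ∀ {g' : (ℤ × ℕ) × ℕ}
    (h : g + ((-1, 1), 0) = g') (k : g' + ((0, 0), 1) = g + ((-1, 1), 1)),
    (derT P).map h z = sg K (deg g) • fillS (varB P) k ((pdA P).map z)) ?_ ?_ ?_ ?_ ?_ ?_ ?_ z h k
  · intro n i g e x g' h k
    rw [derT_of, pdA_of, map_zero, smul_zero]
  · intro v g e g' h k
    cases v with
    | alpha =>
      obtain rfl : g = ((0, 0), 1) := e.symm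
      obtain rfl : g' = ((-1, 1), 1) := by rw [← h]; rfl
      have hs : sg K (deg (((0, 0), 1) : (ℤ × ℕ) × ℕ)) = 1 := sg_zero K
      rw [derT_alpha P h e TGen.gr_kappa, fillS_apply _ _ _ (zero_add _) (zero_add _),
        pdA_varA P _ _ rfl, hs, one_smul]
      refine Eq.symm (((adjT P).one_circ (b := 0) (zero_add _) _).trans ?_)
      exact (adjT P).act_refl _
    | kappa => rw [derT_kappa, pdA_varB, map_zero, smul_zero]
  · intro n g g' h k
    simp only [map_zero, smul_zero]
  · intro n g x y hx hy g' h k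
    simp only [map_add, smul_add, hx h k, hy h k]
  · intro n g c x hx g' h k
    simp only [map_smul, hx h k, smul_comm c]
  · intro m n g e x hx g' h k
    rw [Der.map_act, PDer.map_act, fillS_act, hx h k, map_smul]
  · intro a b g₁ g₂ g e x y hx hy g' h k
    have k₁ : g₁ + ((-1, 1), 0) + g₂ = g' := by rw [← h, ← e, add_right_comm]
    have k₂ : g₁ + (g₂ + ((-1, 1), 0)) = g' := by rw [← h, ← e, add_assoc]
    have hk : ((-1, 1), 0) + ((0, 0), 1) = (((-1, 1), 1) : (ℤ × ℕ) × ℕ) := rfl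
    have e₁ : g₁ + ((-1, 1), 0) + ((0, 0), 1) = g₁ + ((-1, 1), 1) := by rw [add_assoc, hk]
    have e₂ : g₂ + ((-1, 1), 0) + ((0, 0), 1) = g₂ + ((-1, 1), 1) := by rw [add_assoc, hk]
    rw [Der.map_circ _ e rfl rfl h k₁ k₂, PDer.map_circ, map_add, fillS_dl _ e k e₁ k₁,
      fillS_dr _ e k e₂ k₂, hx rfl e₁, hy rfl e₂, map_smul, map_smul, LinearMap.smul_apply, smul_add,
      smul_smul, smul_smul]
    have s2 : sg K (deg (((-1, 1), 1) : (ℤ × ℕ) × ℕ) * deg g₂) = sg K (deg g₂) := by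
      have : deg (((-1, 1), 1) : (ℤ × ℕ) × ℕ) = -1 := rfl
      rw [this, neg_one_mul, sg_neg]
    rw [sg_degA, s2, one_mul, ← e, deg_add, sg_add, mul_assoc, sg_mul_self, mul_one]

end AdjT

/-! ### The differential of P and the derivative in α -/

section DerP

theorem degA_pred {g : (ℤ × ℕ) × ℕ} (hg : g.2 ≠ 0) : (g.1, g.2 - 1) + ((0, 0), 1) = g :=
  Prod.ext (Prod.ext (add_zero _) (add_zero _)) (by
    change g.2 - 1 + 1 = g.2
    omega)

variable {K : Type u} [Field K] (P : DGOp K)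

/-- d_P changes only the constituents from P and kills α, while the derivative touches α only; as α
has degree 0, no sign arises when they are interchanged. -/
theorem derP_pdA {n : ℕ} {g g' p p' : (ℤ × ℕ) × ℕ} (hp : p + ((0, 0), 1) = g)
    (hg : g + ((-1, 0), 0) = g') (hp' : p' + ((0, 0), 1) = g') (h : p + ((-1, 0), 0) = p')
    (z : (adjT P.toGOperad).obj n g) :
    (derP P).map h ((pdA P.toGOperad).ap hp z) = (pdA P.toGOperad).ap hp' ((derP P).map hg z) := by
  refine Adj.induction P.toGOperad embT TGen.gr (p := fun {n g} z =>
    ∀ {g' p p' : (ℤ × ℕ) × ℕ} (hp : p + ((0, 0), 1) = g)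
    (hg : g + ((-1, 0), 0) = g') (hp' : p' + ((0, 0), 1) = g') (h : p + ((-1, 0), 0) = p'),
    (derP P).map h ((pdA P.toGOperad).ap hp z) = (pdA P.toGOperad).ap hp' ((derP P).map hg z))
    ?_ ?_ ?_ ?_ ?_ ?_ ?_ z hp hg hp' h
  · intro n i g e x g' p p' hp hg hp' h
    subst e
    exact (Nat.succ_ne_zero _ (congrArg Prod.snd hp)).elim
  · intro v g e g' p p' hp hg hp' h
    rw [derP_var, map_zero, PDer.ap_apply]
    cases v with
    | alpha =>
      obtain rfl : p = 0 := add_right_cancel (hp.trans (e.symm.trans (zero_add _).symm))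
      rw [pdA_varA _ _ _ rfl]
      exact (derP P).map_one h
    | kappa => rw [pdA_varB, Pi.zero_apply, map_zero]
  · intro n g g' p p' hp hg hp' h
    simp only [map_zero]
  · intro n g x y hx hy g' p p' hp hg hp' h
    simp only [map_add, hx hp hg hp' h, hy hp hg hp' h]
  · intro n g c x hx g' p p' hp hg hp' h
    simp only [map_smul, hx hp hg hp' h]
  · intro m n g e x hx g' p p' hp hg hp' h
    rw [PDer.ap_act, Der.map_act, Der.map_act, PDer.ap_act, hx hp hg hp' h]
  · intro a b g₁ g₂ g e x y hx hy g' p p' hp hg hp' h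
    have hd : deg (((-1, 0), 0) : (ℤ × ℕ) × ℕ) = -1 := rfl
    have k₁ : g₁ + ((-1, 0), 0) + g₂ = g' := by rw [← hg, ← e, add_right_comm]
    have k₂ : g₁ + (g₂ + ((-1, 0), 0)) = g' := by rw [← hg, ← e, add_assoc]
    have hno : ∀ {r : (ℤ × ℕ) × ℕ}, r.2 = 0 → ¬ ∃ q, q + ((0, 0), 1) = r := by
      rintro r hr ⟨q, rfl⟩
      exact Nat.succ_ne_zero _ hr
    rw [Der.map_circ _ e rfl rfl hg k₁ k₂, map_add, map_smul]
    simp only [PDer.ap_apply]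
    rw [PDer.map_circ, PDer.map_circ, PDer.map_circ, Pi.add_apply, Pi.add_apply, Pi.add_apply, map_add,
      smul_add, add_add_add_comm]
    congr 1
    · by_cases h1 : g₁.2 = 0
      · rw [dl_eq_zero e (hno h1), dl_eq_zero k₁ (hno (r := g₁ + ((-1, 0), 0)) (by exact h1)),
          dl_eq_zero k₂ (hno h1)]
        simp only [Pi.zero_apply, map_zero, smul_zero, add_zero]
      · obtain ⟨q, hq⟩ : ∃ q, q + ((0, 0), 1) = g₁ := ⟨_, degA_pred h1⟩
        have hk : q + g₂ = p := add_right_cancel (b := ((0, 0), 1)) (by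
          rw [hp, ← e, add_right_comm, hq])
        have hq' : q + ((-1, 0), 0) + ((0, 0), 1) = g₁ + ((-1, 0), 0) := by
          rw [add_right_comm, hq]
        have l₁ : q + ((-1, 0), 0) + g₂ = p' := by rw [← h, ← hk, add_right_comm]
        have l₂ : q + (g₂ + ((-1, 0), 0)) = p' := by rw [← h, ← hk, add_assoc]
        have hdeg : deg q = deg g₁ := by
          rw [← hq, deg_add]
          exact (add_zero _).symm
        rw [dl_apply e _ _ hp hq hk, dl_apply k₁ _ _ hp' hq' l₁, dl_apply k₂ _ _ hp' hq l₂,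
          sg_degA, sg_degA, one_smul, one_smul, one_smul, Der.map_act,
          Der.map_circ _ hk rfl rfl h l₁ l₂, map_add, map_smul, Der.map_act, hdeg]
        have := hx hq rfl hq' rfl
        rw [PDer.ap_apply, PDer.ap_apply] at this
        rw [this]
    · by_cases h1 : g₂.2 = 0
      · rw [dr_eq_zero e (hno h1), dr_eq_zero k₁ (hno h1),
          dr_eq_zero k₂ (hno (r := g₂ + ((-1, 0), 0)) (by exact h1))]
        simp only [Pi.zero_apply, map_zero, smul_zero, add_zero]
      · obtain ⟨q, hq⟩ : ∃ q, q + ((0, 0), 1) = g₂ := ⟨_, degA_pred h1⟩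
        have hk : g₁ + q = p := add_right_cancel (b := ((0, 0), 1)) (by
          rw [hp, ← e, add_assoc, hq])
        have hq' : q + ((-1, 0), 0) + ((0, 0), 1) = g₂ + ((-1, 0), 0) := by
          rw [add_right_comm, hq]
        have l₁ : g₁ + ((-1, 0), 0) + q = p' := by rw [← h, ← hk, add_right_comm]
        have l₂ : g₁ + (q + ((-1, 0), 0)) = p' := by rw [← h, ← hk, add_assoc]
        rw [dr_apply e _ _ hp hq hk, dr_apply k₁ _ _ hp' hq l₁, dr_apply k₂ _ _ hp' hq' l₂]
        have := hy hq rfl hq' rfl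
        rw [PDer.ap_apply, PDer.ap_apply] at this
        rw [← this]
        exact Der.map_circ _ (b := b + 1) hk rfl rfl h l₁ l₂ x _

end DerP

/-! ### Derivations of the completed coproduct -/

section SerSingle

open Finset

variable {K : Type u} [Field K] {D : Type} [AddCommMonoid D] [HasDeg D] (E : GOperad K (D × ℕ))

theorem serCirc_single {a b : ℕ} {g g' g'' : D} (h : g + g' = g'') (x : SerObj E (a + 1) g)
    (y : SerObj E b g') (v : ℕ) (hy : ∀ q, q ≠ v → y q = 0) (w : ℕ) :
    serCirc E h x y (w + v) = E.circ (g := (g, w)) (g' := (g', v)) (g'' := (g'', w + v))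
      (Prod.ext h rfl) (x w) (y v) := by
  rw [serCirc_apply, sum_eq_single (w, v)]
  · exact E.circN_eq h rfl _ _
  · rintro ⟨p, q⟩ hp hne
    rw [HasAntidiagonal.mem_antidiagonal] at hp
    have hq : q ≠ v := by
      rintro rfl
      exact hne (Prod.ext (Nat.add_right_cancel hp) rfl)
    rw [hy q hq, map_zero]
  · intro h'
    exact (h' (HasAntidiagonal.mem_antidiagonal.2 rfl)).elim

theorem serCirc_single_of_lt {a b : ℕ} {g g' g'' : D} (h : g + g' = g'') (x : SerObj E (a + 1) g)
    (y : SerObj E b g') (v : ℕ) (hy : ∀ q, q ≠ v → y q = 0) {w : ℕ} (hw : w < v) :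
    serCirc E h x y w = 0 := by
  rw [serCirc_apply]
  refine sum_eq_zero fun p hp => ?_
  rw [HasAntidiagonal.mem_antidiagonal] at hp
  rw [hy p.2 (by omega), map_zero]

end SerSingle

/-! ### Derivatives, coefficients and the constant term on P ∨̂ T -/

section Hat

variable {K : Type u} [Field K] (P : GOperad K ℤ)

/-- The partial derivative with respect to `α` on the completed coproduct. -/
noncomputable def hatA : PDer (hatT P) 0 :=
  -- The inner series index counts all variables and the outer one only the κ's; removing an α
  -- lowers the inner index alone.
  ((pdA P).ser₁ : PDer (Ser (adjT P)) (0, 0)).ser₀.restrict (serFin _) (by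
    rintro n g x ⟨W, hW⟩ q
    refine ⟨W, fun w hw => funext fun N => ?_⟩
    have k : ((q.1, w), N) + (((0, 0), 1) : (ℤ × ℕ) × ℕ) = ((g, w), N + 1) :=
      Prod.ext (Prod.ext q.2 rfl) rfl
    exact (congrArg ((pdA P).ap k) (congrFun (hW w hw) (N + 1))).trans (map_zero ((pdA P).ap k)))

/-- The partial derivative with respect to `κ` on the completed coproduct. -/
noncomputable def hatB : PDer (hatT P) (-1) :=
  ((pdB P).ser₁ : PDer (Ser (adjT P)) (-1, 1)).ser₁.restrict (serFin _) (by
    rintro n g x ⟨W, hW⟩ q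
    refine ⟨W, fun w hw => funext fun N => ?_⟩
    have k : ((q.1, w), N) + (((-1, 1), 1) : (ℤ × ℕ) × ℕ) = ((g, w + 1), N + 1) :=
      Prod.ext (Prod.ext q.2 rfl) rfl
    exact (congrArg ((pdB P).ap k) (congrFun (hW (w + 1) (by omega)) (N + 1))).trans
      (map_zero ((pdB P).ap k)))

theorem coeff_hatA {n : ℕ} {i : ℤ} (x : (hatT P).obj n i) (w N : ℕ) :
    hatT.coeff ((hatA P).ap₀ x) w N = (pdA P).ap (degA i w N) (hatT.coeff x w (N + 1)) := rfl

theorem coeff_hatB {n : ℕ} {i j : ℤ} (h : i + -1 = j) (x : (hatT P).obj n j) (w N : ℕ) :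
    hatT.coeff ((hatB P).ap h x) w N =
      (pdB P).ap (degB h w N) (hatT.coeff x (w + 1) (N + 1)) := rfl

theorem coeff_add {n : ℕ} {i : ℤ} (x y : (hatT P).obj n i) (w N : ℕ) :
    hatT.coeff (x + y) w N = hatT.coeff x w N + hatT.coeff y w N := rfl

theorem coeff_sub {n : ℕ} {i : ℤ} (x y : (hatT P).obj n i) (w N : ℕ) :
    hatT.coeff (x - y) w N = hatT.coeff x w N - hatT.coeff y w N := rfl

theorem coeff_smul {n : ℕ} {i : ℤ} (c : K) (x : (hatT P).obj n i) (w N : ℕ) :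
    hatT.coeff (c • x) w N = c • hatT.coeff x w N := rfl

/-- The components of the generator `κ` of the completed coproduct. -/
def kapCoeff : ∀ w N : ℕ, (adjT P).obj 0 ((-1, w), N)
  | 1, 1 => varB P
  | _, _ => 0

/-- The generator `κ` of the completed coproduct. -/
def kapHat : (hatT P).obj 0 (-1) :=
  ⟨kapCoeff P, 2, fun w hw => by
    obtain ⟨w, rfl⟩ : ∃ v, w = v + 2 := ⟨w - 2, by omega⟩
    rfl⟩

theorem kapCoeff_weight {q : ℕ} (hq : q ≠ 1) : kapCoeff P q = 0 := by
  funext N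
  match q, hq with
  | 0, _ => rfl
  | q + 2, _ => rfl

theorem kapCoeff_one {q : ℕ} (hq : q ≠ 1) : kapCoeff P 1 q = 0 := by
  match q, hq with
  | 0, _ => rfl
  | q + 2, _ => rfl

theorem coeff_insK_kapHat {n : ℕ} {i j : ℤ} (h : i + -1 = j) (x : (hatT P).obj (n + 1) i)
    (w N : ℕ) : hatT.coeff (insK (hatT P) (kapHat P) h x) (w + 1) (N + 1) =
      (adjT P).circ (a := n) (b := 0) (degB h w N) (hatT.coeff x w N) (varB P) := by
  refine (congrFun (serCirc_single (Ser (adjT P)) (a := n) (b := 0) h x.1 (kapCoeff P) 1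
    (fun q hq => kapCoeff_weight P hq) w) (N + 1)).trans ?_
  exact serCirc_single (adjT P) (a := n) (b := 0) (g := (i, w)) (g' := (-1, 1)) (g'' := (j, w + 1))
    (Prod.ext h rfl) (x.1 w) (kapCoeff P 1) 1 (fun q hq => kapCoeff_one P hq) N

theorem coeff_insK_kapHat_zero {n : ℕ} {i j : ℤ} (h : i + -1 = j) (x : (hatT P).obj (n + 1) i)
    (N : ℕ) : hatT.coeff (insK (hatT P) (kapHat P) h x) 0 N = 0 :=
  congrFun (serCirc_single_of_lt (Ser (adjT P)) (a := n) (b := 0) h x.1 (kapCoeff P) 1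
    (fun _ hq => kapCoeff_weight P hq) Nat.zero_lt_one) N

theorem hatT.coeff_circ_hatAlpha {a b : ℕ} {i j k : ℤ} (h : i + j = k)
    (x : (hatT P).obj (a + 1) i) (y : (hatT P).obj b j) (hy : y ∈ (hatAlpha P).carrier b j)
    (w N : ℕ) : hatT.coeff ((hatT P).circ h x y) w N =
      serCirc (adjT P) (g := (i, w)) (g' := (j, 0)) (g'' := (k, w)) (Prod.ext h (add_zero w))
        (x.1 w) (y.1 0) N := by
  refine (congrFun (serCirc_single (Ser (adjT P)) h x.1 y.1 0 (fun q hq => ?_) w) N)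
  obtain ⟨q, rfl⟩ := Nat.exists_eq_succ_of_ne_zero hq
  exact hy q

theorem coeff_circ_eq_zero {a b : ℕ} {i j k : ℤ} (h : i + j = k)
    (x : (hatT P).obj (a + 1) i) (y : (hatT P).obj b j) (hy : y ∈ (hatAlpha P).carrier b j)
    {w : ℕ} (hx : ∀ N, hatT.coeff x w N = 0) (N : ℕ) :
    hatT.coeff ((hatT P).circ h x y) w N = 0 := by
  have h0 : x.1 w = 0 := funext hx
  rw [hatT.coeff_circ_hatAlpha P h x y hy, h0]
  exact congrFun (LinearMap.map_zero₂ (serCirc (adjT P) _) _) N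

/-- The projection to `P` of the completed coproduct. -/
def hatEps : GHom (hatT P) P where
  map :=
    { toFun := fun x => adjTCounit P (hatT.coeff x 0 0)
      map_add' := fun x y => map_add (adjTCounit P) (hatT.coeff x 0 0) (hatT.coeff y 0 0)
      map_smul' := fun c x => map_smul (adjTCounit P) c (hatT.coeff x 0 0) }
  map_act e x := adjTCounit_act P e (hatT.coeff x 0 0)
  map_one := rfl
  map_circ h x y := (congrArg (adjTCounit P) (hatT.coeff_circ_zero P h x y)).trans
      (adjTCounit_circ _ _ _ _ _)

theorem coeff_zero_zero_of_hatEps {n : ℕ} {i : ℤ} (x : (hatT P).obj n i) (h : (hatEps P).map x = 0) :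
    hatT.coeff x 0 0 = 0 := by
  have e := of_adjTCounit P (hatT.coeff x 0 0)
  have h' : adjTCounit P (hatT.coeff x 0 0) = 0 := h
  rw [h', map_zero] at e
  exact e.symm

theorem hatA_mem {n : ℕ} {i : ℤ} {x : (hatT P).obj n i} (hx : x ∈ (hatAlpha P).carrier n i) :
    (hatA P).ap₀ x ∈ (hatAlpha P).carrier (n + 1) i := by
  rw [mem_hatAlpha] at hx ⊢
  intro w N
  rw [coeff_hatA, hx, map_zero]

theorem hatB_eq_zero {n : ℕ} {i : ℤ} {x : (hatT P).obj n i} (hx : x ∈ (hatAlpha P).carrier n i) :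
    (hatB P).map x = 0 := by
  funext ⟨j, h⟩
  refine hatT.ext fun w N => (coeff_hatB P h x w N).trans ?_
  rw [(mem_hatAlpha x).1 hx, map_zero]
  rfl

theorem hatAlpha_eq_zero {n : ℕ} {i : ℤ} {x : (hatT P).obj n i}
    (hx : x ∈ (hatAlpha P).carrier n i) (h : ∀ N, hatT.coeff x 0 N = 0) : x = 0 := by
  refine hatT.ext fun w N => ?_
  cases w with
  | zero => exact h N
  | succ w => exact (mem_hatAlpha x).1 hx w N

variable [CharZero K]

theorem coeff_succ_of_hatA {n : ℕ} {i : ℤ} (x : (hatT P).obj n i) {N : ℕ}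
    (h : hatT.coeff ((hatA P).ap₀ x) 0 N = 0) : hatT.coeff x 0 (N + 1) = 0 :=
  eq_zero_of_pdA P _ h

/-- A family of elements of `P ∨̂ [α]` which is stable under the derivative with respect to
`α` and has vanishing constant terms vanishes. -/
theorem hatAlpha_family_eq_zero {ι : ℕ → Type*} {i : ℤ} (F : ∀ n, ι n → (hatT P).obj n i)
    (sh : ∀ n, ι n → ι (n + 1)) (hmem : ∀ n x, F n x ∈ (hatAlpha P).carrier n i)
    (hA : ∀ n x, (hatA P).ap₀ (F n x) = F (n + 1) (sh n x))
    (h0 : ∀ n x, (hatEps P).map (F n x) = 0) (n : ℕ) (x : ι n) : F n x = 0 := by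
  refine hatAlpha_eq_zero P (hmem n x) fun N => ?_
  -- The coefficient with N + 1 occurrences of α vanishes as soon as its derivative does, and the
  -- latter is the coefficient with N occurrences of the next member of the family, in arity n + 1.
  induction N generalizing n with
  | zero => exact coeff_zero_zero_of_hatEps P _ (h0 n x)
  | succ N ih =>
    refine coeff_succ_of_hatA P _ ?_
    rw [hA]
    exact ih _ _

end Hat

/-! ### The differential of P ∨̂ T through the derivative in α -/

section HatDer

variable {K : Type u} [Field K] (P : DGOp K)

/-- The derivation of the completed coproduct induced by the differential of `P`. -/
def hatP : Der (hatT P.toGOperad) (-1) :=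
  Der.restrict (E := Ser (Ser (adjT P.toGOperad))) (derP P).ser₀.ser₀ (serFin _) (by
    rintro n g g' h x ⟨W, hW⟩
    refine ⟨W, fun w hw => ?_⟩
    change (derP P).ser₀.map (g := (g, w)) (g' := (g', w)) (Prod.ext h rfl) (x w) = 0
    rw [hW w hw, map_zero])

theorem coeff_hatP {n : ℕ} {i j : ℤ} (h : i + -1 = j) (x : (hatT P.toGOperad).obj n i) (w N : ℕ) :
    hatT.coeff ((hatP P).map h x) w N = (derP P).map (g := ((i, w), N)) (g' := ((j, w), N))
      (Prod.ext (Prod.ext h rfl) rfl) (hatT.coeff x w N) := rfl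

theorem hatP_mem {n : ℕ} {i j : ℤ} (h : i + -1 = j) {x : (hatT P.toGOperad).obj n i}
    (hx : x ∈ (hatAlpha P.toGOperad).carrier n i) :
    (hatP P).map h x ∈ (hatAlpha P.toGOperad).carrier n j := by
  rw [mem_hatAlpha] at hx ⊢
  intro w N
  rw [coeff_hatP, hx, map_zero]

theorem hatP_hatA {n : ℕ} {i j : ℤ} (h : i + -1 = j) (x : (hatT P.toGOperad).obj n i) :
    (hatP P).map h ((hatA P.toGOperad).ap₀ x) = (hatA P.toGOperad).ap₀ ((hatP P).map h x) := by
  refine hatT.ext fun w N => ?_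
  rw [coeff_hatP, coeff_hatA, coeff_hatA, coeff_hatP]
  exact derP_pdA P _ _ _ _ _

theorem hatEps_hatP {n : ℕ} {i j : ℤ} (h : i + -1 = j) (x : (hatT P.toGOperad).obj n i) :
    (hatEps P.toGOperad).map ((hatP P).map h x) = P.d.map h ((hatEps P.toGOperad).map x) :=
  adjTCounit_derP P _ _ _

variable [CharZero K]

theorem hatDer_eq {n : ℕ} {i j : ℤ} (h : i + -1 = j) (x : (hatT P.toGOperad).obj n i) :
    (hatDer P).map h x = (hatP P).map h x +
      sg K i • insK (hatT P.toGOperad) (kapHat P.toGOperad) h ((hatA P.toGOperad).ap₀ x) := by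
  refine hatT.ext fun w N => ?_
  rw [coeff_add, coeff_smul]
  cases w with
  | zero => rw [hatDer_coeff_zero, coeff_insK_kapHat_zero, smul_zero, add_zero, coeff_hatP]
  | succ w =>
    cases N with
    -- With some κ but a total count of 0 variables both sides lie in a zero space.
    | zero => exact (adjT_eq_zero _ _).trans (adjT_eq_zero _ _).symm
    | succ N =>
      rw [hatDer_coeff_succ, coeff_insK_kapHat, coeff_hatP, coeff_hatA]
      congr 1
      have k : ((j, w + 1), N + 1) + (((0, 0), 1) : (ℤ × ℕ) × ℕ) =
          ((i, w), N + 1) + ((-1, 1), 1) := by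
        subst h
        exact Prod.ext (Prod.ext (add_zero _) rfl) rfl
      refine (derT_eq P.toGOperad _ k _).trans ?_
      rw [fillS_apply (varB P.toGOperad) k _ (degA i w N) (degB h w N)]
      rfl

end HatDer

/-! ### Taylor series in `α` -/

section Taylor

variable {K : Type u} [Field K]

theorem pdA_circ_varA (P : GOperad K ℤ) {n : ℕ} {i : ℤ} (x : P.obj (n + 1) i) :
    (pdA P).ap (degA i 0 0) ((adjT P).circ (a := n) (b := 0) (degA i 0 0)
      (Adj.of P embT TGen.gr (embT_apply i) x) (varA P)) =
      Adj.of P embT TGen.gr (embT_apply i) x := by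
  have h1 : (pdA P).map (varA P) ⟨0, zero_add _⟩ = (adjT P).one := pdA_varA P _ _ rfl
  rw [PDer.ap_apply]
  refine (congrFun (PDer.map_circ (pdA P) (a := n) (b := 0) _ _ _) _).trans ?_
  rw [pdA_of, map_zero, LinearMap.zero_apply]
  refine (congrFun (zero_add _) _).trans ?_
  rw [dr_apply _ _ _ _ (zero_add _) (add_zero _), h1]
  exact (adjT P).circ_one _ _

/-- Families with the formal properties of the iterated derivatives of a function of `α` with values
in `P`. -/
structure TaylorData (P : GOperad K ℤ) (i : ℤ) where
  M : ℕ → Type u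
  act : ∀ {m n : ℕ}, (Fin m ≃ Fin n) → M m → M n
  sh : ∀ {n : ℕ}, M n → M (n + 1)
  val : ∀ {n : ℕ}, M n → P.obj n i
  sh_act : ∀ {m n : ℕ} (e : Fin m ≃ Fin n) (x : M m),
    sh (act e x) = act (sumE e (Equiv.refl (Fin 1))) (sh x)
  sh_sh : ∀ {n : ℕ} (x : M n), act (blk n 1 1) (sh (sh x)) = sh (sh x)
  val_act : ∀ {m n : ℕ} (e : Fin m ≃ Fin n) (x : M m), val (act e x) = P.act e (val x)

namespace TaylorData

variable {P : GOperad K ℤ} {i : ℤ} (D : TaylorData P i)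

/-- The terms of the Taylor series. -/
noncomputable def term : ∀ (N : ℕ) {n : ℕ}, D.M n → (adjT P).obj n ((i, 0), N)
  | 0, _, x => Adj.of P embT TGen.gr (embT_apply i) (D.val x)
  -- The successive divisions accumulate the factor 1/N! of the Taylor formula.
  | N + 1, n, x => ((N + 1 : ℕ) : K)⁻¹ •
      (adjT P).circ (a := n) (b := 0) (degA i 0 N) (term N (D.sh x)) (varA P)

theorem term_act (N : ℕ) {m n : ℕ} (e : Fin m ≃ Fin n) (x : D.M m) :
    D.term N (D.act e x) = (adjT P).act e (D.term N x) := by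
  induction N generalizing m n with
  | zero => rw [term, D.val_act, Adj.of_act, term]
  | succ N ih =>
    rw [term, D.sh_act, ih, term, map_smul]
    exact congrArg _ (GOperad.circ_act_nullary (adjT P) _ e _ _)

/-- The Taylor series. -/
noncomputable def tay {n : ℕ} (x : D.M n) : (hatT P).obj n i :=
  ⟨fun w N => match w with
    | 0 => D.term N x
    | _ + 1 => 0, 1, fun w hw => by
      obtain ⟨w, rfl⟩ : ∃ v, w = v + 1 := ⟨w - 1, by omega⟩
      rfl⟩

theorem tay_mem {n : ℕ} (x : D.M n) : D.tay x ∈ (hatAlpha P).carrier n i :=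
  (mem_hatAlpha _).2 fun _ _ => rfl

theorem tay_act {m n : ℕ} (e : Fin m ≃ Fin n) (x : D.M m) :
    D.tay (D.act e x) = (hatT P).act e (D.tay x) := by
  refine hatT.ext fun w N => ?_
  cases w with
  | zero => exact D.term_act N e x
  | succ w => exact (map_zero ((adjT P).act e)).symm

variable [CharZero K]

theorem succ_smul_term (N : ℕ) {n : ℕ} (x : D.M n) :
    ((N + 1 : ℕ) : K) • D.term (N + 1) x =
      (adjT P).circ (a := n) (b := 0) (degA i 0 N) (D.term N (D.sh x)) (varA P) := by
  rw [term, smul_smul, mul_inv_cancel₀ (Nat.cast_ne_zero.2 (Nat.succ_ne_zero N)), one_smul]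

/-- Removing the outermost α gives back the inner term. Removing any other one gives, after exchange
of the two last inputs, a term of the same kind, because second derivatives are symmetric. All N + 1
occurrences contribute equally, which cancels the denominator. -/
theorem pdA_term (N : ℕ) {n : ℕ} (x : D.M n) :
    (pdA P).ap (degA i 0 N) (D.term (N + 1) x) = D.term N (D.sh x) := by
  have h1 : (pdA P).ap (zero_add _) (varA P) = (adjT P).one := pdA_varA P _ _ rfl
  induction N generalizing n with
  | zero =>
    have e0 : D.term 1 x = (adjT P).circ (a := n) (b := 0) (degA i 0 0)
        (Adj.of P embT TGen.gr (embT_apply i) (D.val (D.sh x))) (varA P) := by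
      have hc : (((0 + 1 : ℕ) : K))⁻¹ = 1 := by rw [Nat.zero_add, Nat.cast_one, inv_one]
      rw [term, hc, one_smul, term]
    refine (congrArg ((pdA P).ap (degA i 0 0)) e0).trans ?_
    exact pdA_circ_varA P _
  | succ N ih =>
    rw [term, map_smul, PDer.ap_circ (pdA P) (a := n) (b := 0) (degA i 0 (N + 1)) (degA i 0 N)
      (zero_add _) (degA i 0 (N + 1)) (degA i 0 N) (add_zero _), sg_degA, one_smul, h1, ih,
      ← term_act, D.sh_sh, ← succ_smul_term, map_smul]
    have e1 : (adjT P).act (blk n 1 0) (D.term (N + 1) (D.sh x)) = D.term (N + 1) (D.sh x) := by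
      rw [blk_zero]
      exact (adjT P).act_refl _
    have e2 := (adjT P).circ_one (a := n) (add_zero _) (D.term (N + 1) (D.sh x))
    refine (congrArg₂ (fun s t => ((N + 1 + 1 : ℕ) : K)⁻¹ • (((N + 1 : ℕ) : K) • s + t)) e1 e2).trans ?_
    have e3 : ∀ (c : K) (s : (adjT P).obj (n + 1) ((i, 0), N + 1)), c • s + s = (c + 1) • s :=
      fun c s => by rw [add_smul, one_smul]
    rw [e3, ← Nat.cast_succ, smul_smul,
      inv_mul_cancel₀ (Nat.cast_ne_zero.2 (Nat.succ_ne_zero _)), one_smul]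

theorem hatA_tay {n : ℕ} (x : D.M n) : (hatA P).ap₀ (D.tay x) = D.tay (D.sh x) := by
  refine hatT.ext fun w N => (coeff_hatA P _ w N).trans ?_
  cases w with
  | zero => exact D.pdA_term N x
  | succ w => exact map_zero ((pdA P).ap (degA i (w + 1) N))

end TaylorData

theorem SubOperad.lieSum_mem {E : GOperad K ℤ} (S : SubOperad E) {ℓ : ∀ n, E.obj n (-1)}
    (h : ∀ n, ℓ n ∈ S.carrier n (-1)) (n : ℕ) : lieSum E ℓ n ∈ S.carrier n (-2) :=
  Submodule.neg_mem _ (Submodule.sum_mem _ fun _ _ => S.act_mem _ (S.circ_mem _ (h _) (h _)))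

theorem fillAlpha_smul (P : GOperad K ℤ) {i : ℤ} (c : K) (k : ℕ) {N N' : ℕ} (h : N + k = N')
    (x : (adjT P).obj k ((i, 0), N)) : fillAlpha P k h (c • x) = c • fillAlpha P k h x := by
  induction k generalizing N with
  | zero => exact map_smul _ _ _
  | succ k ih =>
    rw [fillAlpha, fillAlpha, map_smul, LinearMap.smul_apply]
    exact ih _ _

/-! ### The operations twisted by α -/

section Ell

variable (P : GOperad K ℤ) (ℓ : ∀ n, P.obj n (-1))
  (hℓ : ∀ (n : ℕ) (e : Fin n ≃ Fin n), P.act e (ℓ n) = ℓ n)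

/-- The sequence `ℓ_n` as a sequence of iterated derivatives. -/
def ellData : TaylorData P (-1) where
  M _ := PUnit
  act _ x := x
  sh x := x
  val {n} _ := ℓ n
  sh_act _ _ := rfl
  sh_sh _ := rfl
  val_act {m n} e _ := by
    obtain rfl : m = n := by simpa using Fintype.card_congr e
    exact (hℓ m e).symm

/-- The twisted operations `∑_k (1/k!) ℓ_{n+k}(…, α, …, α)`. -/
noncomputable def ellHat (n : ℕ) : (hatT P).obj n (-1) := (ellData P ℓ hℓ).tay (n := n) PUnit.unit

theorem ellHat_mem (n : ℕ) : ellHat P ℓ hℓ n ∈ (hatAlpha P).carrier n (-1) :=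
  (ellData P ℓ hℓ).tay_mem (n := n) _

theorem hatEps_ellHat (n : ℕ) : (hatEps P).map (ellHat P ℓ hℓ n) = ℓ n := rfl

theorem act_ellHat (n : ℕ) (e : Fin n ≃ Fin n) : (hatT P).act e (ellHat P ℓ hℓ n) = ellHat P ℓ hℓ n :=
  ((ellData P ℓ hℓ).tay_act e PUnit.unit).symm

variable [CharZero K]

theorem hatA_ellHat (n : ℕ) : (hatA P).ap₀ (ellHat P ℓ hℓ n) = ellHat P ℓ hℓ (n + 1) :=
  (ellData P ℓ hℓ).hatA_tay (n := n) PUnit.unit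

/-- Filling one further input with α raises the order of the Taylor term by one and costs the factor
N + 1 of its normalization; the factorials record these factors. -/
theorem fillAlpha_term (k : ℕ) {N N' : ℕ} (h : N + k = N') :
    (N.factorial : K) • fillAlpha P k h ((ellData P ℓ hℓ).term N (n := k) PUnit.unit) =
      (N'.factorial : K) • (ellData P ℓ hℓ).term N' (n := 0) PUnit.unit := by
  induction k generalizing N with
  | zero =>
    subst h
    rfl
  | succ k ih =>
    have e := (ellData P ℓ hℓ).succ_smul_term N (n := k) PUnit.unit
    have e' := ih (N := N + 1) (by omega)
    rw [fillAlpha, ← e', Nat.factorial_succ, mul_comm, Nat.cast_mul, mul_smul]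
    exact congrArg _ ((congrArg (fillAlpha P k _) e).symm.trans (fillAlpha_smul P _ k _ _))

/-- Splits the curvature into the twisted operation of arity 0, which lies in P ∨̂ [α], and the
generator κ. -/
theorem curvElt_eq : curvElt P ℓ = ellHat P ℓ hℓ 0 + kapHat P := by
  refine hatT.ext fun w N => ?_
  rw [coeff_add]
  match w, N with
  | 0, N =>
    have e := fillAlpha_term P ℓ hℓ N (zero_add N)
    rw [Nat.factorial_zero, Nat.cast_one, one_smul] at e
    refine Eq.trans ?_ (add_zero _).symm
    change (N.factorial : K)⁻¹ • fillAlpha P N (zero_add N)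
      ((ellData P ℓ hℓ).term 0 (n := N) PUnit.unit) = (ellData P ℓ hℓ).term N (n := 0) PUnit.unit
    rw [e, smul_smul, inv_mul_cancel₀ (Nat.cast_ne_zero.2 (Nat.factorial_ne_zero N)), one_smul]
  | 1, 1 => exact (zero_add _).symm
  | 1, 0 => exact (zero_add _).symm
  | 1, N + 2 => exact (zero_add _).symm
  | w + 2, N => exact (zero_add _).symm

/-- The correction term of `ap₀_lieSum` is absent because the twisted operations form one chain of
derivatives that includes arity 0. -/
theorem hatA_lieSum_ellHat (n : ℕ) : (hatA P).ap₀ (lieSum (hatT P) (ellHat P ℓ hℓ) n) =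
    lieSum (hatT P) (ellHat P ℓ hℓ) (n + 1) := by
  rw [ap₀_lieSum (hatT P) _ (act_ellHat P ℓ hℓ) (hatA P) (fun n => hatA_ellHat P ℓ hℓ (n + 1)) n,
    hatA_ellHat, sub_self, map_zero, add_zero]

end Ell

/-- The differences of the two sides form a family stable under the derivative in α, and their
constant terms vanish by the relations in P. -/
theorem hatP_ellHat [CharZero K] (P : DGOp K) (ℓ : ∀ n, P.obj n (-1))
    (hℓ : ∀ (n : ℕ) (e : Fin n ≃ Fin n), P.act e (ℓ n) = ℓ n) (h : (-1 : ℤ) + -1 = -2)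
    (hd : ∀ n, P.d.map h (ℓ n) = lieSum P.toGOperad ℓ n) (n : ℕ) :
    (hatP P).map h (ellHat P.toGOperad ℓ hℓ n) =
      lieSum (hatT P.toGOperad) (ellHat P.toGOperad ℓ hℓ) n := by
  refine sub_eq_zero.1 (hatAlpha_family_eq_zero P.toGOperad (ι := fun _ => Unit)
    (fun n _ => (hatP P).map h (ellHat P.toGOperad ℓ hℓ n) -
      lieSum (hatT P.toGOperad) (ellHat P.toGOperad ℓ hℓ) n) (fun _ x => x) ?_ ?_ ?_ n ())
  · intro n _
    exact Submodule.sub_mem _ (hatP_mem P h (ellHat_mem _ _ _ n))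
      ((hatAlpha P.toGOperad).lieSum_mem (ellHat_mem P.toGOperad ℓ hℓ) n)
  · intro n _
    rw [map_sub, hatA_lieSum_ellHat, ← hatP_hatA, hatA_ellHat]
  · intro n _
    rw [map_sub, hatEps_hatP, GHom.map_lieSum, hatEps_ellHat, hd]
    exact sub_self _

end Taylor

/-! ### The twisted quadruple -/

section InsAdd

variable {K : Type u} [Field K] (Q : GOperad K ℤ)

theorem insK_add (κ κ' : Q.obj 0 (-1)) {n : ℕ} {i j : ℤ} (h : i + -1 = j) (x : Q.obj (n + 1) i) :
    insK Q (κ + κ') h x = insK Q κ h x + insK Q κ' h x :=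
  map_add (Q.circ (a := n) (b := 0) h x) κ κ'

theorem weightPart_sup_circ_mem_left (κ : Q.obj 0 (-1)) (S : SubOperad Q) {a b : ℕ} {i j k : ℤ}
    {w w' w'' : ℕ} (h : i + j = k) (hw : w + w' = w'') {x : Q.obj (a + 1) i} {y : Q.obj b j}
    (hx : x ∈ weightPart Q κ S w (a + 1) i ⊔ weightPart Q κ S (w + 1) (a + 1) i)
    (hy : y ∈ weightPart Q κ S w' b j) :
    Q.circ h x y ∈ weightPart Q κ S w'' (a + b) k ⊔ weightPart Q κ S (w'' + 1) (a + b) k := by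
  obtain ⟨u, hu, v, hv, rfl⟩ := Submodule.mem_sup.1 hx
  rw [map_add, LinearMap.add_apply]
  exact Submodule.add_mem_sup (weightPart_circ_mem Q κ S h hw hu hy)
    (weightPart_circ_mem Q κ S h (by omega) hv hy)

theorem weightPart_sup_circ_mem_right (κ : Q.obj 0 (-1)) (S : SubOperad Q) {a b : ℕ} {i j k : ℤ}
    {w w' w'' : ℕ} (h : i + j = k) (hw : w + w' = w'') {x : Q.obj (a + 1) i} {y : Q.obj b j}
    (hx : x ∈ weightPart Q κ S w (a + 1) i)
    (hy : y ∈ weightPart Q κ S w' b j ⊔ weightPart Q κ S (w' + 1) b j) :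
    Q.circ h x y ∈ weightPart Q κ S w'' (a + b) k ⊔ weightPart Q κ S (w'' + 1) (a + b) k := by
  obtain ⟨u, hu, v, hv, rfl⟩ := Submodule.mem_sup.1 hy
  rw [map_add]
  exact Submodule.add_mem_sup (weightPart_circ_mem Q κ S h hw hx hu)
    (weightPart_circ_mem Q κ S h (by omega) hx hv)

/-- A derivation which behaves well on `Q₀` and `κ` is the sum of a derivation of weight `0` and a
derivation of weight `1`. -/
theorem der_mem_weightPart_sup (κ : Q.obj 0 (-1)) (S : SubOperad Q) (d : Der Q (-1))
    (hS : ∀ {n : ℕ} {i j : ℤ} (h : i + -1 = j) (x : Q.obj n i), x ∈ S.carrier n i →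
      d.map h x ∈ weightPart Q κ S 0 n j ⊔ weightPart Q κ S 1 n j)
    (hκ : ∀ {j : ℤ} (h : -1 + -1 = j), d.map h κ ∈ weightPart Q κ S 1 0 j ⊔ weightPart Q κ S 2 0 j)
    {n : ℕ} {g : ℤ × ℕ} (z : (adjKappa S.toGOperad).obj n g) {j : ℤ} (h : g.1 + -1 = j) :
    d.map h (kappaMap Q κ S n g.1 g.2 z) ∈
      weightPart Q κ S g.2 n j ⊔ weightPart Q κ S (g.2 + 1) n j := by
  refine Adj.induction S.toGOperad (AddMonoidHom.inl ℤ ℕ) grK (p := fun {n g} z =>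
    ∀ {j : ℤ} (h : g.1 + -1 = j), d.map h (kappaMap Q κ S n g.1 g.2 z) ∈
      weightPart Q κ S g.2 n j ⊔ weightPart Q κ S (g.2 + 1) n j) ?_ ?_ ?_ ?_ ?_ ?_ ?_ z h
  · intro n i g e x j h
    subst e
    exact hS h x.1 x.2
  · intro v g e j h
    subst e
    exact hκ h
  · intro n g j h
    rw [map_zero, map_zero]
    exact Submodule.zero_mem _
  · intro n g x y hx hy j h
    rw [map_add, map_add]
    exact Submodule.add_mem _ (hx h) (hy h)
  · intro n g c x hx j h
    rw [map_smul, map_smul]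
    exact Submodule.smul_mem _ _ (hx h)
  · intro m n g e x hx j h
    rw [kappaMap_act, d.map_act]
    obtain ⟨u, hu, v, hv, e'⟩ := Submodule.mem_sup.1 (hx h)
    rw [← e', map_add]
    exact Submodule.add_mem_sup (weightPart_act_mem Q κ S e hu) (weightPart_act_mem Q κ S e hv)
  · intro a b g₁ g₂ g e x y hx hy j h
    have k : g₁.1 + g₂.1 = g.1 := congrArg Prod.fst e
    have hw : g₁.2 + g₂.2 = g.2 := congrArg Prod.snd e
    rw [kappaMap_circ Q κ S e k, d.map_circ k rfl rfl h (by omega) (by omega)]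
    refine Submodule.add_mem _ ?_ (Submodule.smul_mem _ _ ?_)
    · exact weightPart_sup_circ_mem_left Q κ S _ hw (hx rfl) ⟨y, rfl⟩
    · exact weightPart_sup_circ_mem_right Q κ S _ hw ⟨x, rfl⟩ (hy rfl)

end InsAdd

/-! ### Freeness over κ: injectivity -/

section KappaInjective

open Finset

variable {K : Type u} [Field K] [CharZero K] {Q : GOperad K ℤ} {κ : Q.obj 0 (-1)} {S : SubOperad Q}

/-- Apply `d`, which acts as the derivative in κ: weight 0 disappears and the other weights drop by
one, so by induction on the top weight their derivatives vanish, and by Euler's identity the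
components themselves. What is left has weight 0, where the map is the inclusion of Q₀. -/
theorem sum_kappaMap_injective (d : PDer Q (-1))
    (hd : ∀ {n : ℕ} {i : ℤ} (x : Q.obj n i), x ∈ S.carrier n i → d.map x = 0)
    (hκ : d.map κ ⟨0, zero_add _⟩ = Q.one) (W : ℕ) {n : ℕ} {i : ℤ}
    (f : ∀ w, (adjKappa S.toGOperad).obj n (i, w))
    (h : ∑ w ∈ range (W + 1), kappaMap Q κ S n i w (f w) = 0) (w : ℕ) (hw : w ≤ W) : f w = 0 := by
  have base : ∀ {n : ℕ} {i : ℤ} (z : (adjKappa S.toGOperad).obj n (i, 0)),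
      kappaMap Q κ S n i 0 z = 0 → z = 0 := by
    intro n i z hz
    obtain ⟨y, rfl⟩ := exists_ofK _ z
    have : y = 0 := Subtype.ext hz
    rw [this, map_zero]
  induction W generalizing n i w with
  | zero =>
    obtain rfl : w = 0 := by omega
    rw [zero_add, sum_range_one] at h
    exact base _ h
  | succ W ih =>
    have hi : i + 1 + -1 = i := by ring
    have key : ∀ v, d.ap hi (kappaMap Q κ S n i (v + 1) (f (v + 1))) =
        kappaMap Q κ S (n + 1) (i + 1) v ((pdK S.toGOperad).ap pdK_degree (f (v + 1))) := fun v =>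
      (pder_kappaMap d hd hκ (g := (i, v + 1)) (f (v + 1))).2 (i + 1, v) pdK_degree hi
    have key0 : d.ap hi (kappaMap Q κ S n i 0 (f 0)) = 0 :=
      congrFun ((pder_kappaMap d hd hκ (g := (i, 0)) (f 0)).1 rfl) _
    have hsucc : ∀ v, v ≤ W → f (v + 1) = 0 := by
      intro v hv
      have e := congrArg (d.ap hi) h
      rw [map_zero, map_sum, sum_range_succ', key0, add_zero, sum_congr rfl fun v _ => key v] at e
      have e' := ih (fun v => (pdK S.toGOperad).ap pdK_degree (f (v + 1))) e v hv
      have e'' := circ_pdK S.toGOperad (f (v + 1))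
      have e₃ : (pdK S.toGOperad).ap pdK_degree (f (v + 1)) = 0 := e'
      rw [e₃, map_zero, LinearMap.zero_apply, ← Nat.cast_smul_eq_nsmul K] at e''
      exact (smul_eq_zero.1 e''.symm).resolve_left (Nat.cast_ne_zero.2 (Nat.succ_ne_zero v))
    cases w with
    | succ w => exact hsucc w (by omega)
    | zero =>
      rw [sum_range_succ', sum_eq_zero, zero_add] at h
      · exact base _ h
      · intro v hv
        rw [hsucc v (by rw [mem_range] at hv; omega), map_zero]

theorem toModule_kappaMap_injective (d : PDer Q (-1))
    (hd : ∀ {n : ℕ} {i : ℤ} (x : Q.obj n i), x ∈ S.carrier n i → d.map x = 0)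
    (hκ : d.map κ ⟨0, zero_add _⟩ = Q.one) (n : ℕ) (i : ℤ) :
    Function.Injective (DirectSum.toModule K ℕ (Q.obj n i) (kappaMap Q κ S n i)) := by
  classical
  rw [injective_iff_map_eq_zero]
  intro z hz
  obtain ⟨W, hW⟩ : ∃ W, ∀ w, W < w → z w = 0 := by
    refine ⟨(DFinsupp.support z).sup id, fun w hw => ?_⟩
    by_contra h0
    exact absurd (Finset.le_sup (f := id) (DFinsupp.mem_support_iff.2 h0)) (not_le.2 hw)
  have hz' : z = ∑ w ∈ range (W + 1), DirectSum.lof K ℕ _ w (z w) := by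
    refine DFinsupp.ext fun w => ?_
    rw [DFinsupp.finsetSum_apply]
    by_cases hw : w ≤ W
    · rw [sum_eq_single w]
      · exact (DirectSum.of_eq_same (β := fun w => (adjKappa S.toGOperad).obj n (i, w)) w (z w)).symm
      · intro v _ hv
        exact DirectSum.of_eq_of_ne _ _ _ hv.symm
      · intro h
        exact (h (mem_range.2 (by omega))).elim
    · rw [hW w (not_le.1 hw)]
      refine (sum_eq_zero fun v hv => ?_).symm
      rw [mem_range] at hv
      exact DirectSum.of_eq_of_ne _ _ _ (by omega)
  have hs : ∑ w ∈ range (W + 1), kappaMap Q κ S n i w (z w) = 0 := by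
    rw [← hz]
    conv_rhs => rw [hz', map_sum]
    exact sum_congr rfl fun w _ => (DirectSum.toModule_lof (φ := kappaMap Q κ S n i) K w (z w)).symm
  refine DFinsupp.ext fun w => ?_
  by_cases hw : w ≤ W
  · exact sum_kappaMap_injective d hd hκ W (fun w => z w) hs w hw
  · exact hW w (not_le.1 hw)

end KappaInjective

/-! ### The generator κ of P ∨̂ T -/

section KapHat

variable {K : Type u} [Field K] (P : GOperad K ℤ)

/-- The derivative of κ is the unit of P ∨ T, which projects to the unit of P. The condition that P
be nonzero enters here, and through this lemma gives that the curvature is not in P ∨̂ [α]. -/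
theorem varB_ne_zero (hP : P.one ≠ 0) : varB P ≠ 0 := by
  intro h
  have h1 : (pdB P).ap (zero_add _) (varB P) = (adjT P).one := pdB_varB P _ _ rfl
  rw [h, map_zero] at h1
  have h2 : adjTCounit P (adjT P).one = P.one := rfl
  rw [← h1, map_zero] at h2
  exact hP h2.symm

theorem hatA_kapHat : (hatA P).ap₀ (kapHat P) = 0 := by
  refine hatT.ext fun w N => (coeff_hatA P _ w N).trans ?_
  match w, N with
  | 1, 0 => exact congrFun (pdA_varB P TGen.gr_kappa) _
  | 0, N => exact map_zero ((pdA P).ap (degA (-1) 0 N))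
  | 1, N + 1 => exact map_zero ((pdA P).ap (degA (-1) 1 (N + 1)))
  | w + 2, N => exact map_zero ((pdA P).ap (degA (-1) (w + 2) N))

theorem hatB_kapHat : (hatB P).map (kapHat P) ⟨0, zero_add _⟩ = (hatT P).one := by
  refine hatT.ext fun w N => (coeff_hatB P (zero_add _) (kapHat P) w N).trans ?_
  match w, N with
  | 0, 0 => exact pdB_varB P _ _ rfl
  | 0, N + 1 => exact map_zero ((pdB P).ap (degB (zero_add (-1 : ℤ)) 0 (N + 1)))
  | w + 1, N => exact map_zero ((pdB P).ap (degB (zero_add (-1 : ℤ)) (w + 1) N))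

theorem hatP_kapHat (P : DGOp K) (h : (-1 : ℤ) + -1 = -2) : (hatP P).map h (kapHat P.toGOperad) = 0 := by
  refine hatT.ext fun w N => ?_
  rw [coeff_hatP]
  match w, N with
  | 1, 1 => exact derP_var P _ _ _
  | 0, N => exact map_zero _
  | 1, 0 => exact map_zero _
  | 1, N + 2 => exact map_zero _
  | w + 2, N => exact map_zero _

end KapHat

/-! ### The span of the weight parts -/

section Span

variable {K : Type u} [Field K] {Q : GOperad K ℤ} (κ : Q.obj 0 (-1)) (S : SubOperad Q)

theorem insK_mem_iSup_weightPart {n : ℕ} {i j : ℤ} (h : i + -1 = j) {y : Q.obj (n + 1) i}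
    (hy : y ∈ ⨆ w, weightPart Q κ S w (n + 1) i) :
    insK Q κ h y ∈ ⨆ w, weightPart Q κ S w n j := by
  have hκ : κ ∈ weightPart Q κ S 1 0 (-1) := ⟨varK S.toGOperad, rfl⟩
  have hle : (⨆ w, weightPart Q κ S w (n + 1) i) ≤
      (⨆ w, weightPart Q κ S w n j).comap (insK Q κ h) :=
    iSup_le fun w x hx => Submodule.mem_iSup_of_mem (w + 1)
      (weightPart_circ_mem Q κ S (a := n) (b := 0) h rfl hx hκ)
  exact hle hy

theorem iSup_weightPart_le (n : ℕ) (i : ℤ) : (⨆ w, weightPart Q κ S w n i) ≤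
    LinearMap.range (DirectSum.toModule K ℕ (Q.obj n i) (kappaMap Q κ S n i)) := by
  refine iSup_le fun w => ?_
  rintro _ ⟨z, rfl⟩
  exact ⟨DirectSum.lof K ℕ _ w z, DirectSum.toModule_lof (φ := kappaMap Q κ S n i) K w z⟩

end Span

/-! ### The twisted quadruple belongs to the category -/

section Tw

variable {K : Type u} [Field K] [CharZero K] (P : DGOp K) (ℓ : ∀ n, P.obj n (-1))
  (hℓ : ∀ (n : ℕ) (e : Fin n ≃ Fin n), P.act e (ℓ n) = ℓ n)
include hℓ

/-- The differential of the completed coproduct, in terms of the twisted curvature. -/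
theorem hatDer_eq_curvElt {n : ℕ} {i j : ℤ} (h : i + -1 = j) (x : (hatT P.toGOperad).obj n i) :
    (hatDer P).map h x = ((hatP P).map h x - sg K i • insK (hatT P.toGOperad)
        (ellHat P.toGOperad ℓ hℓ 0) h ((hatA P.toGOperad).ap₀ x)) +
      sg K i • insK (hatT P.toGOperad) (curvElt P.toGOperad ℓ) h ((hatA P.toGOperad).ap₀ x) := by
  rw [hatDer_eq, curvElt_eq P.toGOperad ℓ hℓ, insK_add, smul_add]
  abel

theorem hatB_curvElt : (hatB P.toGOperad).map (curvElt P.toGOperad ℓ) ⟨0, zero_add _⟩ =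
    (hatT P.toGOperad).one := by
  rw [curvElt_eq P.toGOperad ℓ hℓ, map_add, hatB_eq_zero _ (ellHat_mem _ _ _ 0)]
  exact (congrFun (zero_add _) _).trans (hatB_kapHat P.toGOperad)

theorem lieSum_ellHat_zero : lieSum (hatT P.toGOperad) (ellHat P.toGOperad ℓ hℓ) 0 =
    - insK (hatT P.toGOperad) (ellHat P.toGOperad ℓ hℓ 0) (show (-1 : ℤ) + -1 = -2 by norm_num)
      (ellHat P.toGOperad ℓ hℓ 1) := by
  rw [lieSum_eq_sum_lieTerm, Fintype.sum_subsingleton _ (Finset.univ : Finset (Fin 0)),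
    lieTerm_univ _ _ (act_ellHat P.toGOperad ℓ hℓ)]
  rfl

/-- Only the twisted operation of arity 0 contributes: d_P gives -ℓ̂₁(ℓ̂₀), the relation of arity 0,
and d_T gives -ℓ̂₁(κ), where ℓ̂ denotes `ellHat`. Their sum is -ℓ̂₁ applied to the whole curvature.
-/
theorem hatDer_curvElt (h : (-1 : ℤ) + -1 = -2)
    (hd : ∀ n, P.d.map h (ℓ n) = lieSum P.toGOperad ℓ n) :
    (hatDer P).map h (curvElt P.toGOperad ℓ) =
      - insK (hatT P.toGOperad) (curvElt P.toGOperad ℓ) h (ellHat P.toGOperad ℓ hℓ 1) := by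
  rw [curvElt_eq P.toGOperad ℓ hℓ, map_add, hatDer_eq, hatDer_eq, hatP_ellHat P ℓ hℓ h hd, hatP_kapHat,
    hatA_kapHat, map_zero, smul_zero, add_zero, add_zero, hatA_ellHat, lieSum_ellHat_zero, sg_neg_one,
    insK_add, neg_one_smul]
  exact (neg_add _ _).symm

/-- Elements of the completed coproduct are sums of elements of fixed weight with respect to the
twisted curvature. -/
theorem mem_iSup_weightPart (W : ℕ) {n : ℕ} {i : ℤ} (x : (hatT P.toGOperad).obj n i)
    (hx : ∀ w N, W + 1 ≤ w → hatT.coeff x w N = 0) :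
    x ∈ ⨆ w, weightPart (hatT P.toGOperad) (curvElt P.toGOperad ℓ) (hatAlpha P.toGOperad) w n i := by
  induction W generalizing n i with
  | zero =>
    refine Submodule.mem_iSup_of_mem 0 ((mem_weightPart_zero _ _ _).2 ((mem_hatAlpha _).2 ?_))
    intro w N
    exact hx _ _ (by omega)
  | succ W ih =>
    have hi : i + 1 + -1 = i := by ring
    have hW : ((W + 1 : ℕ) : K) ≠ 0 := Nat.cast_ne_zero.2 (Nat.succ_ne_zero W)
    -- By Euler's identity, inserting κ into `y` reproduces the part of `x` with W + 1 occurrences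
    -- of κ. The rest of the curvature contains no κ and affects lower weights only, so subtracting
    -- the insertion of the curvature lowers the top weight.
    let y : (hatT P.toGOperad).obj (n + 1) (i + 1) :=
      ((W + 1 : ℕ) : K)⁻¹ • (hatB P.toGOperad).ap hi x
    have hy : ∀ w N, W + 1 ≤ w → hatT.coeff y w N = 0 := by
      intro w N hw
      change ((W + 1 : ℕ) : K)⁻¹ • hatT.coeff ((hatB P.toGOperad).ap hi x) w N = 0
      rw [coeff_hatB, hx _ _ (by omega), map_zero, smul_zero]
    have e : x = (x - insK (hatT P.toGOperad) (curvElt P.toGOperad ℓ) hi y) +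
        insK (hatT P.toGOperad) (curvElt P.toGOperad ℓ) hi y := (sub_add_cancel _ _).symm
    rw [e]
    refine Submodule.add_mem _ (ih _ ?_) (insK_mem_iSup_weightPart _ _ hi (ih y hy))
    intro w N hw
    obtain ⟨w, rfl⟩ : ∃ v, w = v + 1 := ⟨w - 1, by omega⟩
    cases N with
    | zero => exact adjT_eq_zero _ _
    | succ N =>
      have e1 : hatT.coeff (insK (hatT P.toGOperad) (ellHat P.toGOperad ℓ hℓ 0) hi y)
          (w + 1) (N + 1) = 0 :=
        coeff_circ_eq_zero P.toGOperad (a := n) (b := 0) hi y _ (ellHat_mem _ _ _ 0)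
          (fun N => hy _ _ hw) _
      have e2 : hatT.coeff (insK (hatT P.toGOperad) (kapHat P.toGOperad) hi y) (w + 1) (N + 1) =
          (((W + 1 : ℕ) : K)⁻¹ * ((w + 1 : ℕ) : K)) • hatT.coeff x (w + 1) (N + 1) := by
        rw [coeff_insK_kapHat]
        change (adjT P.toGOperad).circ (a := n) (b := 0) (degB hi w N) (((W + 1 : ℕ) : K)⁻¹ •
          (pdB P.toGOperad).ap (degB hi w N) (hatT.coeff x (w + 1) (N + 1))) (varB P.toGOperad) = _
        rw [map_smul, LinearMap.smul_apply, circ_pdB P.toGOperad hi, mul_smul,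
          Nat.cast_smul_eq_nsmul K (w + 1)]
      rw [coeff_sub, curvElt_eq P.toGOperad ℓ hℓ, insK_add, coeff_add, e1, zero_add, e2]
      rcases Nat.lt_or_ge W w with hlt | hle
      · rw [hx (w + 1) (N + 1) (by omega), smul_zero, sub_zero]
      · obtain rfl : w = W := by omega
        rw [inv_mul_cancel₀ hW, one_smul, sub_self]

theorem curvElt_isCurv (hP : P.one ≠ 0) (h : (-1 : ℤ) + -1 = -2)
    (hd : ∀ n, P.d.map h (ℓ n) = lieSum P.toGOperad ℓ n) :
    (CurvData.mk (hatTDG P) (curvElt P.toGOperad ℓ) (hatAlpha P.toGOperad)).IsCurv where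
  -- The coefficient of the curvature with one κ and no α is the generator κ itself.
  kappa_notMem hmem := varB_ne_zero P.toGOperad hP ((mem_hatAlpha _).1 hmem 0 1)
  free n i := by
    refine ⟨toModule_kappaMap_injective (hatB P.toGOperad) (fun x hx => hatB_eq_zero _ hx)
      (hatB_curvElt P ℓ hℓ) n i, fun x => ?_⟩
    obtain ⟨W, hW⟩ := x.2
    exact iSup_weightPart_le _ _ n i (mem_iSup_weightPart P ℓ hℓ W x fun w N hw =>
      congrFun (hW w (by omega)) N)
  strict_mixed w n i j hj x hx := by
    obtain ⟨z, rfl⟩ := hx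
    refine der_mem_weightPart_sup (hatT P.toGOperad) (curvElt P.toGOperad ℓ) (hatAlpha P.toGOperad)
      (hatDer P) ?_ ?_ (g := (i, w)) z hj
    · intro n i j h x hx
      rw [hatDer_eq_curvElt P ℓ hℓ]
      refine Submodule.add_mem_sup ((mem_weightPart_zero _ _ _).2 (Submodule.sub_mem _ (hatP_mem P h hx)
        (Submodule.smul_mem _ _ ((hatAlpha P.toGOperad).circ_mem (a := n) (b := 0) h
          (hatA_mem _ hx) (ellHat_mem _ _ _ 0))))) ?_
      exact Submodule.smul_mem _ _ ((mem_weightPart_one _ _ _ h).2 ⟨_, hatA_mem _ hx, rfl⟩)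
    · intro j h'
      obtain rfl : j = -2 := by omega
      refine Submodule.mem_sup_left ?_
      rw [hatDer_curvElt P ℓ hℓ h' hd]
      exact Submodule.neg_mem _ ((mem_weightPart_one _ _ _ h').2 ⟨_, ellHat_mem _ _ _ 1, rfl⟩)
  d_kappa := by
    change (hatDer P).map _ (curvElt P.toGOperad ℓ) ∈ _
    rw [hatDer_curvElt P ℓ hℓ h hd]
    exact Submodule.neg_mem _ ((mem_weightPart_one _ _ _ h).2 ⟨_, ellHat_mem _ _ _ 1, rfl⟩)

end Tw

/-! ### The derivative and the operations of the twisted quadruple -/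

section TwData

variable {K : Type u} [Field K] [CharZero K] (P : UnderCL K)

theorem act_ellOf (n : ℕ) (e : Fin n ≃ Fin n) : P.obj.right.act e (ellOf P n) = ellOf P n :=
  ((DGHom.toGHom P.obj.hom).map_act e (ell K n)).symm.trans
    (congrArg (app P.obj.hom) (act_ell K n e))

theorem d_ellOf (h : (-1 : ℤ) + -1 = -2) (n : ℕ) :
    P.obj.right.d.map h (ellOf P n) = lieSum P.obj.right.toGOperad (ellOf P) n :=
  (DGHom.map_d P.obj.hom h (ell K n)).symm.trans
    ((DGHom.toGHom P.obj.hom).map_lieSum (ell K) n)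

theorem twData_isCurv : (twData P).IsCurv :=
  curvElt_isCurv P.obj.right (ellOf P) (act_ellOf P) P.property (by norm_num) (d_ellOf P _)

/-- The operations `ℓ_n` of `P`, twisted by `α`. -/
noncomputable abbrev ellTw (n : ℕ) : (hatT P.obj.right.toGOperad).obj n (-1) :=
  ellHat P.obj.right.toGOperad (ellOf P) (act_ellOf P) n

/-- `hatDer_eq_curvElt` already displays the differential as a sum of weights 0 and 1, and such a
decomposition is unique; hence the abstract derivative is the one in α. -/
theorem twData_pd {n : ℕ} {i j : ℤ} (h : i + -1 = j) (x : (twData P).Q₀.toGOperad.obj n i) :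
    ((twData_isCurv P).d₀ h x).1 = (hatP P.obj.right).map h x.1 - sg K i •
      insK (hatT P.obj.right.toGOperad) (ellTw P 0) h ((hatA P.obj.right.toGOperad).ap₀ x.1) ∧
    ((twData_isCurv P).pd.ap₀ x).1 = (hatA P.obj.right.toGOperad).ap₀ x.1 := by
  have key := (twData_isCurv P).eq_pd_of_d_eq h (x := x)
    (a := ⟨(hatP P.obj.right).map h x.1 - sg K i • insK (hatT P.obj.right.toGOperad) (ellTw P 0) h
      ((hatA P.obj.right.toGOperad).ap₀ x.1), Submodule.sub_mem _ (hatP_mem _ h x.2)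
        (Submodule.smul_mem _ _ ((hatAlpha P.obj.right.toGOperad).circ_mem (a := n) (b := 0) h
          (hatA_mem _ x.2) (ellHat_mem _ _ _ 0)))⟩)
    (b := ⟨(hatA P.obj.right.toGOperad).ap₀ x.1, hatA_mem _ x.2⟩)
    (hatDer_eq_curvElt P.obj.right (ellOf P) (act_ellOf P) h x.1)
  exact ⟨congrArg Subtype.val key.1, congrArg Subtype.val key.2⟩

/-- The first operation is determined by the differential of the curvature, the others by iterated
differentiation in α. This identifies the canonical morphism from cL∞ and is what makes the
projection to P a morphism under cL∞. -/
theorem twData_ellPos (n : ℕ) : (twData_isCurv P).ellPos (n + 1) =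
    ⟨ellTw P (n + 1), ellHat_mem _ _ _ (n + 1)⟩ := by
  induction n with
  | zero =>
    have h : (-1 : ℤ) + -1 = -2 := by norm_num
    refine (twData_isCurv P).insK_injective (n := 0) h (neg_injective ?_)
    exact ((twData_isCurv P).d_kappa_eq h).symm.trans
      (hatDer_curvElt P.obj.right (ellOf P) (act_ellOf P) h (d_ellOf P h))
  | succ n ih =>
    refine Subtype.ext (((twData_pd P rfl _).2).trans ?_)
    rw [ih]
    exact hatA_ellHat _ _ _ (n + 1)

end TwData

/-! ### Morphisms out of an object of `Curv^Σ` -/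

section Extend

variable {K : Type u} [Field K]

/-- The natural morphism from `Q₀ ∨ [κ]` given by a morphism from `Q₀` and a value of `κ`. -/
def kappaLift {Q₀ X : GOperad K ℤ} (φ : GHom Q₀ X) (y : X.obj 0 (-1)) {n : ℕ} {g : ℤ × ℕ} :
    (adjKappa Q₀).obj n g →ₗ[K] X.obj n g.1 :=
  Adj.lift Q₀ (AddMonoidHom.inl ℤ ℕ) (fun _ : Unit => ((-1 : ℤ), 1)) X
    (AddMonoidHom.fst ℤ ℕ) (fun _ => rfl)
    (fun _ _ _ h => (X.cast (by rw [← h]; rfl)).comp φ.map)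
    (fun _ _ h => X.cast (by rw [← h]; rfl) y)
    (fun h e x => by
      simp only [LinearMap.comp_apply, φ.map_act]
      exact X.cast_act _ _ _) (fun _ => φ.map_one)
    (fun _ _ _ _ _ x y => by
      simp only [LinearMap.comp_apply, φ.map_circ]
      exact X.cast_circ _ _ _ _ _ _ _)

theorem kappaLift_act {Q₀ X : GOperad K ℤ} (φ : GHom Q₀ X) (y : X.obj 0 (-1)) {m n : ℕ} {g : ℤ × ℕ}
    (e : Fin m ≃ Fin n) (z : (adjKappa Q₀).obj m g) :
    kappaLift φ y ((adjKappa Q₀).act e z) = X.act e (kappaLift φ y z) := by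
  induction z using Pres.ind
  rfl

theorem kappaLift_circ {Q₀ X : GOperad K ℤ} (φ : GHom Q₀ X) (y : X.obj 0 (-1)) {a b : ℕ}
    {g g' g'' : ℤ × ℕ} (h : g + g' = g'') (k : g.1 + g'.1 = g''.1) (x : (adjKappa Q₀).obj (a + 1) g)
    (z : (adjKappa Q₀).obj b g') :
    kappaLift φ y ((adjKappa Q₀).circ h x z) = X.circ k (kappaLift φ y x) (kappaLift φ y z) := by
  induction x using Pres.ind; induction z using Pres.ind
  rfl

variable {C : CurvData K} (hC : C.IsCurv)
include hC

/-- Surjectivity of Q₀ ∨ [κ] → Q reduces a claim stable under sums to elements of fixed weight. -/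
theorem CurvData.IsCurv.kappaMap_induction {n : ℕ} {i : ℤ} {p : C.Q.obj n i → Prop}
    (h : ∀ w z, p (kappaMap C.Q.toGOperad C.κ C.Q₀ n i w z)) (hadd : ∀ x y, p x → p y → p (x + y))
    (x : C.Q.obj n i) : p x := by
  obtain ⟨z, rfl⟩ := (hC.free n i).2 x
  induction z using DirectSum.induction_on with
  | zero =>
    have := h 0 0
    rwa [map_zero] at this ⊢
  | of w z =>
    have e : DirectSum.toModule K ℕ (C.Q.obj n i) (kappaMap C.Q.toGOperad C.κ C.Q₀ n i)
        (DirectSum.of _ w z) = kappaMap C.Q.toGOperad C.κ C.Q₀ n i w z :=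
      DirectSum.toModule_lof (φ := kappaMap C.Q.toGOperad C.κ C.Q₀ n i) K w z
    rw [e]
    exact h w z
  | add x y hx hy =>
    rw [map_add]
    exact hadd _ _ hx hy

/-- An object of `Curv^Σ` is generated by `Q₀` and `κ`. -/
theorem CurvData.IsCurv.induction {p : ∀ {n : ℕ} {i : ℤ}, C.Q.obj n i → Prop}
    (of : ∀ {n : ℕ} {i : ℤ} (x : C.Q₀.toGOperad.obj n i), p x.1) (kappa : p C.κ)
    (add : ∀ {n : ℕ} {i : ℤ} (x y : C.Q.obj n i), p x → p y → p (x + y))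
    (smul : ∀ {n : ℕ} {i : ℤ} (c : K) (x : C.Q.obj n i), p x → p (c • x))
    (act : ∀ {m n : ℕ} {i : ℤ} (e : Fin m ≃ Fin n) (x : C.Q.obj m i), p x → p (C.Q.act e x))
    (circ : ∀ {a b : ℕ} {i j k : ℤ} (h : i + j = k) (x : C.Q.obj (a + 1) i) (y : C.Q.obj b j),
      p x → p y → p (C.Q.circ h x y)) {n : ℕ} {i : ℤ} (x : C.Q.obj n i) : p x := by
  refine hC.kappaMap_induction (fun w z => ?_) add x
  refine Adj.induction C.Q₀.toGOperad (AddMonoidHom.inl ℤ ℕ) grK (p := fun {n g} z =>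
    p (kappaMap C.Q.toGOperad C.κ C.Q₀ n g.1 g.2 z)) ?_ ?_ ?_ ?_ ?_ ?_ ?_ (g := (i, w)) z
  · intro n i g e x
    subst e
    exact of x
  · intro v g e
    subst e
    exact kappa
  · intro n g
    rw [map_zero]
    exact of 0
  · intro n g x y hx hy
    rw [map_add]
    exact add _ _ hx hy
  · intro n g c x hx
    rw [map_smul]
    exact smul _ _ hx
  · intro m n g e x hx
    rw [kappaMap_act]
    exact act _ _ hx
  · intro a b g g' g'' h x y hx hy
    rw [kappaMap_circ _ _ _ h (congrArg Prod.fst h)]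
    exact circ _ _ _ hx hy

variable {X : GOperad K ℤ} (φ : GHom C.Q₀.toGOperad X) (y : X.obj 0 (-1))

/-- The linear map underlying the extension of a morphism from `Q₀` to `Q`. -/
noncomputable def CurvData.IsCurv.extendMap (n : ℕ) (i : ℤ) : C.Q.obj n i →ₗ[K] X.obj n i :=
  (DirectSum.toModule K ℕ (X.obj n i) (fun w => kappaLift φ y (n := n) (g := (i, w)))).comp
    (LinearEquiv.ofBijective _ (hC.free n i)).symm.toLinearMap

theorem CurvData.IsCurv.extendMap_kappaMap {n : ℕ} {i : ℤ} {w : ℕ}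
    (z : (adjKappa C.Q₀.toGOperad).obj n (i, w)) :
    hC.extendMap φ y n i (kappaMap C.Q.toGOperad C.κ C.Q₀ n i w z) =
      kappaLift φ y (g := (i, w)) z := by
  have e : (LinearEquiv.ofBijective _ (hC.free n i)).symm
      (kappaMap C.Q.toGOperad C.κ C.Q₀ n i w z) = DirectSum.lof K ℕ _ w z := by
    rw [LinearEquiv.symm_apply_eq]
    exact (DirectSum.toModule_lof (φ := kappaMap C.Q.toGOperad C.κ C.Q₀ n i) K w z).symm
  have e' := DirectSum.toModule_lof (N := X.obj n i)
    (φ := fun w => kappaLift φ y (n := n) (g := (i, w))) K w z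
  rw [CurvData.IsCurv.extendMap, LinearMap.comp_apply]
  exact (congrArg _ e).trans e'

/-- The extension of a morphism from `Q₀` to `Q` with a given value of `κ`. -/
noncomputable def CurvData.IsCurv.extend : GHom C.Q.toGOperad X where
  map {n i} := hC.extendMap φ y n i
  map_act {m n i} e x := by
    refine hC.kappaMap_induction (p := fun x => hC.extendMap φ y n i (C.Q.act e x) =
      X.act e (hC.extendMap φ y m i x)) (fun w z => ?_) (fun x y hx hy => ?_) x
    · refine (congrArg (hC.extendMap φ y n i) (kappaMap_act _ _ _ (g := (i, w)) e z).symm).trans ?_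
      refine (hC.extendMap_kappaMap φ y ((adjKappa C.Q₀.toGOperad).act e z)).trans ?_
      exact (kappaLift_act φ y e z).trans (congrArg (X.act e) (hC.extendMap_kappaMap φ y z).symm)
    · simp only [map_add, hx, hy]
  map_one := hC.extendMap_kappaMap φ y (adjKappa C.Q₀.toGOperad).one
  map_circ {a b i j k} h x x' := by
    refine hC.kappaMap_induction (p := fun x => hC.extendMap φ y (a + b) k (C.Q.circ h x x') =
      X.circ h (hC.extendMap φ y (a + 1) i x) (hC.extendMap φ y b j x'))
      (fun w z => ?_) (fun x y hx hy => ?_) x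
    · refine hC.kappaMap_induction (p := fun x' => hC.extendMap φ y (a + b) k (C.Q.circ h
        (kappaMap C.Q.toGOperad C.κ C.Q₀ (a + 1) i w z) x') =
        X.circ h (hC.extendMap φ y (a + 1) i (kappaMap C.Q.toGOperad C.κ C.Q₀ (a + 1) i w z))
          (hC.extendMap φ y b j x')) (fun w' z' => ?_) (fun x y hx hy => ?_) x'
      · have hh : ((i, w) : ℤ × ℕ) + (j, w') = (k, w + w') := Prod.ext h rfl
        refine (congrArg (hC.extendMap φ y (a + b) k) (kappaMap_circ _ _ _ hh h z z').symm).trans ?_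
        refine (hC.extendMap_kappaMap φ y ((adjKappa C.Q₀.toGOperad).circ hh z z')).trans ?_
        rw [hC.extendMap_kappaMap, hC.extendMap_kappaMap]
        exact kappaLift_circ φ y hh h z z'
      · simp only [map_add, hx, hy]
    · simp only [map_add, LinearMap.add_apply, hx, hy]

theorem CurvData.IsCurv.extend_of {n : ℕ} {i : ℤ} (x : C.Q₀.toGOperad.obj n i) :
    (hC.extend φ y).map x.1 = φ.map x :=
  hC.extendMap_kappaMap φ y (ofK C.Q₀.toGOperad x)

theorem CurvData.IsCurv.extend_kappa : (hC.extend φ y).map C.κ = y :=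
  hC.extendMap_kappaMap φ y (varK C.Q₀.toGOperad)

end Extend

/-! ### The universal property of the twisted quadruple -/

section HatExt

variable {K : Type u} [Field K] [CharZero K] (P : GOperad K ℤ)

theorem hatAlpha_ext {n : ℕ} {i : ℤ} {x y : (hatT P).obj n i} (hx : x ∈ (hatAlpha P).carrier n i)
    (hy : y ∈ (hatAlpha P).carrier n i) (hA : (hatA P).ap₀ x = (hatA P).ap₀ y)
    (hE : (hatEps P).map x = (hatEps P).map y) : x = y := by
  refine sub_eq_zero.1 (hatAlpha_eq_zero P (Submodule.sub_mem _ hx hy) fun N => ?_)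
  cases N with
  | zero => exact coeff_zero_zero_of_hatEps P _ (by rw [map_sub, hE, sub_self])
  | succ N => exact coeff_succ_of_hatA P _ (by rw [map_sub, hA, sub_self]; rfl)

/-- Leibniz for x(…, c). The slot created in `x` comes after the one filled by `c`; the symmetry of
the derivative of `x` makes their order irrelevant. -/
theorem hatA_insK (c : (hatT P).obj 0 (-1)) {n : ℕ} {i j : ℤ} (h : i + -1 = j)
    (x : (hatT P).obj (n + 1) i) (hx : (hatT P).act (blk n 1 1) ((hatA P).ap₀ x) = (hatA P).ap₀ x) :
    (hatA P).ap₀ (insK (hatT P) c h x) = insK (hatT P) c h ((hatA P).ap₀ x) +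
      (hatT P).circ (a := n) (b := 1) h x ((hatA P).ap₀ c) := by
  refine ((hatA P).ap₀_circ (a := n) (b := 0) h x c).trans ?_
  rw [hx, blk_zero]
  exact congrArg₂ (· + ·) ((hatT P).act_refl _) rfl

end HatExt

/-! ### Taylor series of the elements of Q₀ -/

section Taylor

variable {K : Type u} [Field K] {C : CurvData K} (hC : C.IsCurv) {X : DGOp K} (f : C.Q ⟶ X)

/-- The iterated derivatives of the elements of `Q₀`, mapped by `f`. -/
noncomputable def taylorData (i : ℤ) : TaylorData X.toGOperad i where
  M n := C.Q₀.toGOperad.obj n i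
  act e x := C.Q₀.toGOperad.act e x
  sh x := hC.pd.ap₀ x
  val x := app f x.1
  sh_act e x := hC.pd.ap₀_act e x
  sh_sh x := (hC.pd_facts rfl x).2
  val_act e x := (DGHom.toGHom f).map_act e x.1

/-- The Taylor series of an element of `Q₀`. -/
noncomputable def taylor {n : ℕ} {i : ℤ} (x : C.Q₀.toGOperad.obj n i) : (hatT X.toGOperad).obj n i :=
  (taylorData hC f i).tay x

theorem taylor_mem {n : ℕ} {i : ℤ} (x : C.Q₀.toGOperad.obj n i) :
    taylor hC f x ∈ (hatAlpha X.toGOperad).carrier n i := (taylorData hC f i).tay_mem x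

theorem hatEps_taylor {n : ℕ} {i : ℤ} (x : C.Q₀.toGOperad.obj n i) :
    (hatEps X.toGOperad).map (taylor hC f x) = app f x.1 := rfl

theorem taylor_act {m n : ℕ} {i : ℤ} (e : Fin m ≃ Fin n) (x : C.Q₀.toGOperad.obj m i) :
    taylor hC f (C.Q₀.toGOperad.act e x) = (hatT X.toGOperad).act e (taylor hC f x) :=
  (taylorData hC f i).tay_act e x

variable [CharZero K]

theorem hatA_taylor {n : ℕ} {i : ℤ} (x : C.Q₀.toGOperad.obj n i) :
    (hatA X.toGOperad).ap₀ (taylor hC f x) = taylor hC f (hC.pd.ap₀ x) :=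
  (taylorData hC f i).hatA_tay x

/-- The Taylor construction assumes no linear structure, so additivity is obtained by comparing
derivatives and constant terms; the family consists of pairs, differentiated componentwise. -/
theorem taylor_add {n : ℕ} {i : ℤ} (x y : C.Q₀.toGOperad.obj n i) :
    taylor hC f (x + y) = taylor hC f x + taylor hC f y := by
  refine sub_eq_zero.1 (hatAlpha_family_eq_zero X.toGOperad
    (ι := fun n => C.Q₀.toGOperad.obj n i × C.Q₀.toGOperad.obj n i)
    (fun n x => taylor hC f (x.1 + x.2) - (taylor hC f x.1 + taylor hC f x.2))
    (fun n x => (hC.pd.ap₀ x.1, hC.pd.ap₀ x.2)) ?_ ?_ ?_ n (x, y))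
  · intro n x
    exact Submodule.sub_mem _ (taylor_mem _ _ _)
      (Submodule.add_mem _ (taylor_mem _ _ _) (taylor_mem _ _ _))
  · intro n x
    rw [map_sub, map_add, hatA_taylor, hatA_taylor, hatA_taylor, map_add]
  · intro n x
    rw [map_sub, map_add, hatEps_taylor, hatEps_taylor, hatEps_taylor, sub_eq_zero]
    exact map_add (app f) _ _

theorem taylor_smul {n : ℕ} {i : ℤ} (c : K) (x : C.Q₀.toGOperad.obj n i) :
    taylor hC f (c • x) = c • taylor hC f x := by
  refine sub_eq_zero.1 (hatAlpha_family_eq_zero X.toGOperad (ι := fun n => C.Q₀.toGOperad.obj n i)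
    (fun n x => taylor hC f (c • x) - c • taylor hC f x) (fun n x => hC.pd.ap₀ x) ?_ ?_ ?_ n x)
  · intro n x
    exact Submodule.sub_mem _ (taylor_mem _ _ _) (Submodule.smul_mem _ _ (taylor_mem _ _ _))
  · intro n x
    rw [map_sub, map_smul, hatA_taylor, hatA_taylor, map_smul]
  · intro n x
    rw [map_sub, map_smul, hatEps_taylor, hatEps_taylor, sub_eq_zero]
    exact map_smul (app f) _ _

/-- The Taylor series, as a linear map. -/
noncomputable def taylorLin (n : ℕ) (i : ℤ) :
    C.Q₀.toGOperad.obj n i →ₗ[K] (hatT X.toGOperad).obj n i where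
  toFun := taylor hC f
  map_add' := taylor_add hC f
  map_smul' := taylor_smul hC f

theorem taylor_zero {n : ℕ} {i : ℤ} : taylor hC f (0 : C.Q₀.toGOperad.obj n i) = 0 :=
  map_zero (taylorLin hC f n i)

theorem taylor_one : taylor hC f C.Q₀.toGOperad.one = (hatT X.toGOperad).one := by
  refine hatAlpha_ext X.toGOperad (taylor_mem _ _ _) (hatAlpha X.toGOperad).one_mem ?_ ?_
  · rw [hatA_taylor, hC.pd.ap₀_one, PDer.ap₀_one, taylor_zero]
  · exact (DGHom.toGHom f).map_one.trans (hatEps X.toGOperad).map_one.symm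

/-- Both sides obey the same Leibniz rule and have the same constant term. The derivative is a sum
of two composites of different shapes, so the vanishing is proved by induction on the number of α's
with both arities varying. -/
theorem taylor_circ {a b : ℕ} {i j k : ℤ} (h : i + j = k) (x : C.Q₀.toGOperad.obj (a + 1) i)
    (y : C.Q₀.toGOperad.obj b j) : taylor hC f (C.Q₀.toGOperad.circ h x y) =
      (hatT X.toGOperad).circ h (taylor hC f x) (taylor hC f y) := by
  refine sub_eq_zero.1 (hatAlpha_eq_zero X.toGOperad (Submodule.sub_mem _ (taylor_mem _ _ _)
    ((hatAlpha X.toGOperad).circ_mem h (taylor_mem _ _ _) (taylor_mem _ _ _))) fun N => ?_)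
  induction N generalizing a b with
  | zero =>
    refine coeff_zero_zero_of_hatEps X.toGOperad _ ?_
    rw [map_sub, GHom.map_circ, hatEps_taylor, hatEps_taylor, hatEps_taylor, sub_eq_zero]
    exact (DGHom.toGHom f).map_circ h x.1 y.1
  | succ N ih =>
    refine coeff_succ_of_hatA X.toGOperad _ ?_
    rw [map_sub, hatA_taylor, PDer.ap₀_circ, PDer.ap₀_circ, hatA_taylor, hatA_taylor, taylor_add,
      taylor_act, ← taylor_act hC f (blk a 1 1), add_sub_add_comm, ← map_sub, coeff_add]
    refine (congrArg₂ (· + ·) ((congrArg ((adjT X.toGOperad).act (blk a 1 b))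
      (ih (a := a + 1) (b := b) (C.Q₀.toGOperad.act (blk a 1 1) (hC.pd.ap₀ x)) y)).trans
        (map_zero _)) (ih (a := a) (b := b + 1) x (hC.pd.ap₀ y))).trans (add_zero _)

/-- The morphism from `Q₀` given by the Taylor series. -/
noncomputable def taylorHom : GHom C.Q₀.toGOperad (hatT X.toGOperad) where
  map {n i} := taylorLin hC f n i
  map_act e x := taylor_act hC f e x
  map_one := taylor_one hC f
  map_circ h x y := taylor_circ hC f h x y

end Taylor

/-! ### The universal morphism and its uniqueness -/

section Universal

variable {K : Type u} [Field K] [CharZero K] {C : CurvData K} (hC : C.IsCurv) (P : UnderCL K)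
  (f : C.Q ⟶ P.obj.right) (hf₀ : app f C.κ = ellOf P 0)
  (hf : ∀ n, app f (hC.ellPos (n + 1)).1 = ellOf P (n + 1))

include hf in
theorem taylor_ellPos (n : ℕ) : taylor hC f (hC.ellPos (n + 1)) = ellTw P (n + 1) := by
  -- Arity 0 is excluded by the index type, since `ellPos` has the conventional value 0 there;
  -- differentiation stays within positive arity.
  refine sub_eq_zero.1 (hatAlpha_family_eq_zero P.obj.right.toGOperad (ι := fun n => PLift (0 < n))
    (fun n _ => taylor hC f (hC.ellPos n) - ellTw P n) (fun n _ => ⟨Nat.succ_pos n⟩) ?_ ?_ ?_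
    (n + 1) ⟨Nat.succ_pos n⟩)
  · intro n _
    exact Submodule.sub_mem _ (taylor_mem _ _ _) (ellHat_mem _ _ _ n)
  · rintro n ⟨hn⟩
    obtain ⟨n, rfl⟩ := Nat.exists_eq_succ_of_ne_zero hn.ne'
    rw [map_sub, hatA_taylor]
    exact congrArg₂ (· - ·) rfl (hatA_ellHat _ _ _ _)
  · rintro n ⟨hn⟩
    obtain ⟨n, rfl⟩ := Nat.exists_eq_succ_of_ne_zero hn.ne'
    rw [map_sub, hatEps_taylor, sub_eq_zero]
    exact hf n

include hf₀ hf in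
-- The constant terms agree because f commutes with the differentials and sends κ to ℓ₀. Under the
-- derivative in α, the term in which the twisted ℓ₀ becomes the twisted ℓ₁ matches the commutator
-- of d₀ and ∂ in `pd_facts`, so the identity for x passes to the one for ∂x.
theorem hatP_taylor {n : ℕ} {i j : ℤ} (h : i + -1 = j) (x : C.Q₀.toGOperad.obj n i) :
    (hatP P.obj.right).map h (taylor hC f x) = taylor hC f (hC.d₀ h x) +
      sg K i • insK (hatT P.obj.right.toGOperad) (ellTw P 0) h (taylor hC f (hC.pd.ap₀ x)) := by
  refine sub_eq_zero.1 (hatAlpha_family_eq_zero P.obj.right.toGOperad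
    (ι := fun n => C.Q₀.toGOperad.obj n i)
    (fun n x => (hatP P.obj.right).map h (taylor hC f x) - (taylor hC f (hC.d₀ h x) +
      sg K i • insK (hatT P.obj.right.toGOperad) (ellTw P 0) h (taylor hC f (hC.pd.ap₀ x))))
    (fun n x => hC.pd.ap₀ x) ?_ ?_ ?_ n x)
  · intro n x
    exact Submodule.sub_mem _ (hatP_mem _ _ (taylor_mem _ _ _)) (Submodule.add_mem _
      (taylor_mem _ _ _) (Submodule.smul_mem _ _ ((hatAlpha P.obj.right.toGOperad).circ_mem
        (a := n) (b := 0) h (taylor_mem _ _ _) (ellHat_mem _ _ _ 0))))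
  · intro n x
    have e1 : taylor hC f (hC.d₀ h (hC.pd.ap₀ x)) = taylor hC f (hC.pd.ap₀ (hC.d₀ h x)) +
        sg K i • (hatT P.obj.right.toGOperad).circ (a := n) (b := 0 + 1) h
          (taylor hC f (hC.pd.ap₀ x)) (ellTw P 1) := by
      rw [(hC.pd_facts h x).1, taylor_add, taylor_smul, taylor_circ]
      exact congrArg (fun z => _ + sg K i • (hatT P.obj.right.toGOperad).circ (a := n) (b := 0 + 1) h
        _ z) (taylor_ellPos hC P f hf 0)
    have e2 : (hatA P.obj.right.toGOperad).ap₀ (ellTw P 0) = ellTw P 1 := hatA_ellHat _ _ _ 0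
    rw [map_sub, map_add, map_smul, ← hatP_hatA, hatA_insK, hatA_taylor, hatA_taylor, hatA_taylor, e1,
      e2]
    · have e3 : ∀ a b c : (hatT P.obj.right.toGOperad).obj (n + 1) j, a + (b + c) = a + c + b :=
        fun a b c => by abel
      rw [smul_add]
      exact congrArg _ (e3 _ _ _)
    · rw [hatA_taylor, ← taylor_act, (hC.pd_facts h x).2]
  · intro n x
    rw [map_sub, map_add, map_smul, hatEps_hatP, hatEps_taylor, hatEps_taylor, sub_eq_zero]
    refine (DGHom.map_d f h x.1).symm.trans ?_
    refine (congrArg (app f) (hC.d_eq_pd h x)).trans ?_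
    rw [map_add, map_smul]
    refine congrArg (fun z => app f (hC.d₀ h x).1 + sg K i • z) ?_
    refine ((DGHom.toGHom f).map_circ (a := n) (b := 0) h _ _).trans ?_
    refine Eq.trans ?_ ((hatEps P.obj.right.toGOperad).map_circ (a := n) (b := 0) h _ _).symm
    exact congrArg (P.obj.right.circ (a := n) (b := 0) h _) hf₀

/-- The morphism of graded operads underlying the universal morphism. -/
noncomputable def univGHom : GHom C.Q.toGOperad (hatT P.obj.right.toGOperad) :=
  hC.extend (taylorHom hC f) (twData P).κ

theorem univGHom_of {n : ℕ} {i : ℤ} (x : C.Q₀.toGOperad.obj n i) :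
    (univGHom hC P f).map x.1 = taylor hC f x := hC.extend_of _ _ x

theorem univGHom_kappa : (univGHom hC P f).map C.κ = (twData P).κ := hC.extend_kappa _ _

theorem univGHom_insK {n : ℕ} {i j : ℤ} (h : i + -1 = j) (x : C.Q₀.toGOperad.obj (n + 1) i) :
    (univGHom hC P f).map (insK C.Q.toGOperad C.κ h x.1) =
      insK (hatT P.obj.right.toGOperad) (twData P).κ h (taylor hC f x) := by
  refine ((univGHom hC P f).map_circ (a := n) (b := 0) h x.1 C.κ).trans ?_
  rw [univGHom_of, univGHom_kappa]
  rfl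

include hf₀ hf in
-- Q₀ and κ generate Q. On Q₀ the insertion of the twisted ℓ₀ in `hatP_taylor` cancels the one in
-- `hatDer_eq_curvElt`; on κ both differentials are minus the first operation applied to the
-- curvature.
theorem univGHom_d {n : ℕ} {i j : ℤ} (h : i + -1 = j) (x : C.Q.obj n i) :
    (univGHom hC P f).map (C.Q.d.map h x) = (hatDer P.obj.right).map h ((univGHom hC P f).map x) := by
  refine hC.induction (p := fun {n i} x => ∀ {j : ℤ} (h : i + -1 = j),
    (univGHom hC P f).map (C.Q.d.map h x) = (hatDer P.obj.right).map h ((univGHom hC P f).map x))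
    ?_ ?_ ?_ ?_ ?_ ?_ x h
  · intro n i x j h
    rw [hC.d_eq_pd, map_add, map_smul, univGHom_insK, univGHom_of, univGHom_of,
      hatDer_eq_curvElt P.obj.right (ellOf P) (act_ellOf P), hatA_taylor, hatP_taylor hC P f hf₀ hf,
      add_sub_cancel_right]
    rfl
  · intro j h
    obtain rfl : j = -2 := by omega
    rw [hC.d_kappa_eq, map_neg, univGHom_insK, univGHom_kappa]
    refine Eq.trans ?_ (hatDer_curvElt P.obj.right (ellOf P) (act_ellOf P) h (d_ellOf P h)).symm
    exact congrArg (fun z => - insK (hatT P.obj.right.toGOperad) (twData P).κ h z)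
      (taylor_ellPos hC P f hf 0)
  · intro n i x y hx hy j h
    simp only [map_add, hx, hy]
  · intro n i c x hx j h
    simp only [map_smul, hx]
  · intro m n i e x hx j h
    rw [Der.map_act, GHom.map_act, GHom.map_act, Der.map_act, hx]
  · intro a b i₁ i₂ i e x y hx hy j h
    have k₁ : i₁ + -1 + i₂ = j := by omega
    have k₂ : i₁ + (i₂ + -1) = j := by omega
    rw [Der.map_circ _ e rfl rfl h k₁ k₂, GHom.map_circ, Der.map_circ _ e rfl rfl h k₁ k₂, map_add,
      map_smul, GHom.map_circ, GHom.map_circ, hx, hy]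

/-- The universal morphism. -/
noncomputable def univHom : CurvHom C (twData P) where
  hom := { univGHom hC P f with map_d := fun h x => univGHom_d hC P f hf₀ hf h x }
  map_kappa := univGHom_kappa hC P f
  map_mem x hx := by
    have e : (univGHom hC P f).map x = taylor hC f ⟨x, hx⟩ := univGHom_of hC P f ⟨x, hx⟩
    change (univGHom hC P f).map x ∈ _
    rw [e]
    exact taylor_mem hC f _

theorem hatEps_curvElt : (hatEps P.obj.right.toGOperad).map (twData P).κ = ellOf P 0 := by
  refine (congrArg (hatEps P.obj.right.toGOperad).map
    (curvElt_eq P.obj.right.toGOperad (ellOf P) (act_ellOf P))).trans ?_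
  rw [map_add]
  exact add_zero _

/-- The constant term of the Taylor series of x is f(x), and that of the curvature is ℓ₀, the image
of κ under f. -/
theorem univHom_counitT : (univHom hC P f hf₀ hf).hom ≫ counitT P.obj.right = f := by
  refine DGHom.ext_app fun x => ?_
  refine hC.induction (p := fun x => (hatEps P.obj.right.toGOperad).map ((univGHom hC P f).map x) =
    app f x) ?_ ?_ ?_ ?_ ?_ ?_ x
  · intro n i x
    rw [univGHom_of, hatEps_taylor]
  · rw [univGHom_kappa, hatEps_curvElt, hf₀]
  · intro n i x y hx hy
    simp only [map_add, hx, hy]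
  · intro n i c x hx
    simp only [map_smul, hx]
  · intro m n i e x hx
    rw [GHom.map_act, GHom.map_act, hx]
    exact ((DGHom.toGHom f).map_act e x).symm
  · intro a b i j k h x y hx hy
    rw [GHom.map_circ, GHom.map_circ, hx, hy]
    exact ((DGHom.toGHom f).map_circ h x y).symm

/-- Morphisms in `Curv^Σ` commute with the derivatives. -/
theorem CurvHom.map_pd {C' : CurvData K} (hC' : C'.IsCurv) (g : CurvHom C C') {n : ℕ} {i : ℤ}
    (x : C.Q₀.toGOperad.obj n i) :
    app g.hom (hC.pd.ap₀ x).1 = (hC'.pd.ap₀ ⟨app g.hom x.1, g.map_mem _ x.2⟩).1 := by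
  refine (congrArg Subtype.val (hC'.eq_pd_of_d_eq rfl (x := ⟨app g.hom x.1, g.map_mem _ x.2⟩)
    (a := ⟨app g.hom (hC.d₀ rfl x).1, g.map_mem _ (hC.d₀ rfl x).2⟩)
    (b := ⟨app g.hom (hC.pd.ap₀ x).1, g.map_mem _ (hC.pd.ap₀ x).2⟩) ?_).2).symm
  refine (DGHom.map_d g.hom rfl x.1).symm.trans ?_
  refine (congrArg (app g.hom) (hC.d_eq_pd rfl x)).trans ?_
  rw [map_add, map_smul]
  refine congrArg (fun z => app g.hom (hC.d₀ rfl x).1 + sg K i • z) ?_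
  refine ((DGHom.toGHom g.hom).map_circ (a := n) (b := 0) rfl _ _).trans ?_
  exact congrArg (C'.Q.circ (a := n) (b := 0) rfl _) g.map_kappa

include hC in
-- Morphisms carry the derivative ∂ of Q₀ to the derivative in α. The differences of the values of
-- `g` and `g'` on Q₀ are thus a family stable under the latter, with constant terms zero by
-- assumption; and both send κ to the curvature.
theorem CurvHom.ext_counitT {g g' : CurvHom C (twData P)}
    (h : g.hom ≫ counitT P.obj.right = g'.hom ≫ counitT P.obj.right) : g = g' := by
  have hA : ∀ (g : CurvHom C (twData P)) {n : ℕ} {i : ℤ} (x : C.Q₀.toGOperad.obj n i),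
      (hatA P.obj.right.toGOperad).ap₀ (app g.hom x.1) = app g.hom (hC.pd.ap₀ x).1 := fun g n i x =>
    ((g.map_pd hC (twData_isCurv P) x).trans (twData_pd P rfl _).2).symm
  have key : ∀ {n : ℕ} {i : ℤ} (x : C.Q₀.toGOperad.obj n i), app g.hom x.1 = app g'.hom x.1 := by
    intro n i x
    refine sub_eq_zero.1 (hatAlpha_family_eq_zero P.obj.right.toGOperad
      (ι := fun n => C.Q₀.toGOperad.obj n i) (fun n x => app g.hom x.1 - app g'.hom x.1)
      (fun n x => hC.pd.ap₀ x) ?_ ?_ ?_ n x)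
    · intro n x
      exact Submodule.sub_mem _ (g.map_mem _ x.2) (g'.map_mem _ x.2)
    · intro n x
      exact (map_sub _ _ _).trans (congrArg₂ (· - ·) (hA g x) (hA g' x))
    · intro n x
      refine (map_sub _ _ _).trans (sub_eq_zero.2 ?_)
      exact congrArg (fun φ : C.Q ⟶ P.obj.right => app φ x.1) h
  refine CurvHom.ext (DGHom.ext_app fun x => ?_)
  refine hC.induction (p := fun x => app g.hom x = app g'.hom x) key ?_ ?_ ?_ ?_ ?_ x
  · rw [g.map_kappa, g'.map_kappa]
  · intro n i x y hx hy
    simp only [map_add, hx, hy]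
  · intro n i c x hx
    simp only [map_smul, hx]
  · intro m n i e x hx
    refine ((DGHom.toGHom g.hom).map_act e x).trans (Eq.trans ?_ ((DGHom.toGHom g'.hom).map_act e x).symm)
    exact congrArg _ hx
  · intro a b i j k h x y hx hy
    refine ((DGHom.toGHom g.hom).map_circ h x y).trans
      (Eq.trans ?_ ((DGHom.toGHom g'.hom).map_circ h x y).symm)
    exact congrArg₂ (fun s t => (twData P).Q.circ h s t) hx hy

end Universal

/-! ### The adjunction -/

section Adjunction

variable (K : Type u) [Field K] [CharZero K]

variable {K} in
/-- The counit of the adjunction. -/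
noncomputable def twistCounit (P : UnderCL K) :
    (forgetL existsUnique_isCurvStructure).obj ((twist twData_isCurv).obj P) ⟶ P :=
  ObjectProperty.homMk (Under.homMk (counitT P.obj.right) (by
    have hφ := (existsUnique_isCurvStructure ((twist twData_isCurv).obj P)).choose_spec.1
    -- It suffices to compare generators: the canonical operations of the twisted quadruple are the
    -- twisted ones, whose constant terms are the ℓ_n of P.
    refine cLinf_hom_ext fun n => ?_
    cases n with
    | zero => exact (congrArg (app (counitT P.obj.right)) hφ.1).trans (hatEps_curvElt P)
    | succ n =>
      refine (congrArg (app (counitT P.obj.right)) ((hφ.app_ell n).trans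
        (congrArg Subtype.val (twData_ellPos P n)))).trans ?_
      exact hatEps_ellHat P.obj.right.toGOperad (ellOf P) (act_ellOf P) (n + 1)))

variable {K} in
theorem twistCounit_naturality {P P' : UnderCL K} (f : P ⟶ P') :
    (forgetL existsUnique_isCurvStructure).map ((twist twData_isCurv).map f) ≫ twistCounit P' =
      twistCounit P ≫ f := by
  refine ObjectProperty.hom_ext _ (Under.UnderMorphism.ext ?_)
  refine DGHom.ext_app fun {n i} x => ?_
  change adjTCounit P'.obj.right.toGOperad ((adjTMap (DGHom.toGHom f.hom.right)).map
    (hatT.coeff x 0 0)) = app f.hom.right (adjTCounit P.obj.right.toGOperad (hatT.coeff x 0 0))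
  -- Only the component without α and κ matters, and it comes from an element of P.
  obtain ⟨y, hy⟩ := exists_of_adjT P.obj.right.toGOperad (hatT.coeff x 0 0)
  rw [← hy]
  rfl

variable {K} in
-- Injectivity is `CurvHom.ext_counitT`. For surjectivity, a morphism under cL∞ sends κ and the
-- canonical operations of C to the ℓ_n of P, which is what the construction of `univHom` requires.
theorem comp_twistCounit_bijective (C : Curv K) (P : UnderCL K) :
    Function.Bijective fun g : C ⟶ (twist twData_isCurv).obj P =>
      (forgetL existsUnique_isCurvStructure).map g ≫ twistCounit P := by
  constructor
  · intro g g' h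
    exact CurvHom.ext_counitT C.isCurv P
      (congrArg (fun φ : (forgetL existsUnique_isCurvStructure).obj C ⟶ P => φ.hom.right) h)
  · intro f
    have hφ := (existsUnique_isCurvStructure C).choose_spec.1
    have hw : ∀ n, app f.hom.right (app (existsUnique_isCurvStructure C).choose (ell K n)) =
        ellOf P n := fun n =>
      congrArg (fun φ : cLinf K ⟶ P.obj.right => app φ (ell K n)) (Under.w f.hom)
    have hf₀ : app f.hom.right C.κ = ellOf P 0 := (congrArg (app f.hom.right) hφ.1.symm).trans (hw 0)
    have hf : ∀ n, app f.hom.right (C.isCurv.ellPos (n + 1)).1 = ellOf P (n + 1) := fun n =>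
      (congrArg (app f.hom.right) (hφ.app_ell n).symm).trans (hw (n + 1))
    refine ⟨univHom C.isCurv P f.hom.right hf₀ hf, ?_⟩
    refine ObjectProperty.hom_ext _ (Under.UnderMorphism.ext ?_)
    exact univHom_counitT C.isCurv P f.hom.right hf₀ hf

/-- The functor `P ↦ P ∨̂ T` is right adjoint to the forgetful functor. -/
noncomputable def twistAdjunction :
    forgetL (K := K) existsUnique_isCurvStructure ⊣ twist twData_isCurv :=
  Adjunction.mkOfHomEquiv
    { homEquiv := fun C P => (Equiv.ofBijective _ (comp_twistCounit_bijective C P)).symm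
      homEquiv_naturality_left_symm := fun {C C' P} f g => by
        change (forgetL existsUnique_isCurvStructure).map (f ≫ g) ≫ twistCounit P =
          (forgetL existsUnique_isCurvStructure).map f ≫
            (forgetL existsUnique_isCurvStructure).map g ≫ twistCounit P
        rw [Functor.map_comp, Category.assoc]
      homEquiv_naturality_right := fun {C P P'} f g => by
        rw [Equiv.symm_apply_eq]
        change _ = (forgetL existsUnique_isCurvStructure).map
          ((Equiv.ofBijective _ (comp_twistCounit_bijective C P)).symm f ≫
            (twist twData_isCurv).map g) ≫ twistCounit P'
        rw [Functor.map_comp, Category.assoc, twistCounit_naturality, ← Category.assoc]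
        exact congrArg (· ≫ g)
          ((Equiv.ofBijective _ (comp_twistCounit_bijective C P)).apply_symm_apply f).symm }

variable {K} in
theorem twistAdjunction_counit_app (P : UnderCL K) :
    (twistAdjunction K).counit.app P = twistCounit P := by
  rw [twistAdjunction, Adjunction.mkOfHomEquiv_counit_app]
  change (forgetL existsUnique_isCurvStructure).map (𝟙 _) ≫ twistCounit P = _
  rw [CategoryTheory.Functor.map_id, Category.id_comp]

end Adjunction

end CurvOp

theorem theorem1p6 (K : Type u) [Field K] [CharZero K] :
    ∃ (hL : ∀ C : CurvOp.Curv K, ∃! φ : CurvOp.cLinf K ⟶ C.Q, CurvOp.IsCurvStructure C φ)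
      (hR : ∀ P : CurvOp.UnderCL K, (CurvOp.twData P).IsCurv)
      (adj : CurvOp.forgetL hL ⊣ CurvOp.twist hR),
      ∀ P : CurvOp.UnderCL K, (adj.counit.app P).hom.right = CurvOp.counitT P.obj.right :=
  ⟨CurvOp.existsUnique_isCurvStructure, CurvOp.twData_isCurv, CurvOp.twistAdjunction K, fun P =>
    congrArg (fun φ => φ.hom.right) (CurvOp.twistAdjunction_counit_app P)⟩
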